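/- **Setting.** Let $(\alpha(n))_{n\ge 1}$ be a sequence of non-negative real numbers and set $$\mathcal A(x)=\sum_{1\le n\le x}\alpha(n),\qquad \mathcal A(x;q,a)=\sum_{\substack{1\le n\le x\\ n\equiv a \bmod q}}\alpha(n).$$ Let $a\neq 0$ be a fixed integer, with the convention $\alpha(a)=0$ if $a<0$. Let $\mathbf h\ge 0$ be a multiplicative function. For a prime $p$ with $p^f\,\|\,a$ ($f\ge 0$) and $e\ge 1$ put $$\mathbf g_a(p^e)=\begin{cases}\mathbf h(p^e)/p^e & e\le f,\\ \frac1{\phi(p^e)}\bigl(\mathbf h(p^f)-\mathbf h(p^{f+1})/p\bigr) & e>f,\end{cases}$$ extend $\mathbf g_a$ multiplicatively to all $q\ge 1$, and set $$\gamma(q)=\prod_{p\mid q}\frac{1-1/p}{1-\mathbf h(p)/p},\qquad \mathbf f_a(q)=\mathbf g_a(q)\,q\,\gamma(q).$$ Let $\mathbf L:[0,\infty)\to[1,\infty)$ be a smooth increasing function tending to infinity. Below, $\delta>0$ is a fixed number that may differ from one line to another, and all estimates are for $x$ large enough. **Hypothesis 1\*.** $$\sum_{q\le 2\mathbf L(x)}\max_{y\le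 x}\Bigl|\mathcal A(y;q,a)-\frac{\mathbf f_a(q)}{q\gamma(q)}\mathcal A(y)\Bigr|\ll\frac{\mathcal A(x)}{\mathbf L(x)^{1+\delta}}.$$ **Hypothesis 2.** Uniformly for $\frac1{2\mathbf L(x)}\le z\le 1+\frac{|a|}x$ we have $\frac{\mathcal A(zx)}{\mathcal A(x)}=z+O\bigl(\mathbf L(x)^{-1-\delta}\bigr)$; moreover $\alpha(n)\ll \mathcal A(x)/\mathbf L(x)^{1+\delta}$ for $n\le x$. **Hypothesis 3.** There is a real number $\mathbf k\ge 0$ such that $\sum_p\frac{\mathbf h(p)-\mathbf k}{p}$ converges and, uniformly in $x$ and in real $t$, $$\mathrm{Re}\sum_{p\le x}\frac{\mathbf h(p)-\mathbf k}{p^{1+it}}\le\Bigl(\frac12-\delta\Bigr)\log(|t|+2)+O(1),\qquad \sum_{p\le x}\frac{(\mathbf h(p)-\mathbf k)\log^n p}{p^{1+it}}\ll_{n,\epsilon}(|t|+2)^{\epsilon}$$ for every integer $n\ge 1$ and every $\epsilon>0$; moreover $\mathbf h(p)<p$ for every prime $p$, and $\mathbf h(d)\ll_\epsilon d^{\epsilon}$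 for every $\epsilon>0$. **The average.** Let $\omega_{\mathbf h}(a)$ be the number of primes $p\mid a$ such that, with $p^f\,\|\,a$, $\mathbf h(p^f)=\mathbf h(p^{f+1})/p$. For $M>1$ define $$\mu_{\mathbf k}(a,M)=-\frac12\,\frac{(\log M)^{1-\mathbf k-\omega_{\mathbf h}(a)}}{\Gamma(2-\mathbf k-\omega_{\mathbf h}(a))}\prod_{\substack{p^f\| a,\ f\ge 0\\ \mathbf h(p^f)=\mathbf h(p^{f+1})/p}}\frac{1+\mathbf h(p)+\dots+\mathbf h(p^f)}{(1-1/p)^{\mathbf k-1}}\log p\prod_{\substack{p^f\| a,\ f\ge 0\\ \mathbf h(p^f)\ne\mathbf h(p^{f+1})/p}}\frac{\mathbf h(p^f)-\mathbf h(p^{f+1})/p}{(1-1/p)^{\mathbf k}},$$ where $1/\Gamma$ is $0$ at the poles of $\Gamma$ and the last product, over the primes in increasing order, is the limit of its partial products. **Theorem.** Assume Hypotheses 1\*, 2 and 3. Then the last product above converges, and for $1<M\le \mathbf L(x)$ and $x\ge x_0$ we have $$\sum_{\frac x{2M}<q\le\frac xM}\Bigl(\mathcal A(x;q,a)-\alpha(a)-\frac{\mathbf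 f_a(q)}{q\gamma(q)}\mathcal A(x)\Bigr)=\frac{\mathcal A(x)}{2M}\Bigl(\mu_{\mathbf k}(a,M)(1+o(1))+O_A\Bigl(\frac1{\log^A M}\Bigr)\Bigr)$$ for every $A>0$. Here $o(1)$ tends to $0$ as $M\to\infty$, uniformly in $x\ge x_0$, and the constant in $O_A$ depends only on $A$ and on the fixed data $(\alpha,\mathbf h,\mathbf L,a)$, not on $x$ or $M$. -/

import Mathlib

open Filter Topology

namespace ArithProg

noncomputable section

/-- `𝒜(x) = ∑_{1 ≤ n ≤ x} α(n)`. -/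
def count (α : ℕ → ℝ) (x : ℝ) : ℝ :=
  ∑ n ∈ Finset.Icc 1 ⌊x⌋₊, α n

/-- `𝒜(x; q, a) = ∑_{1 ≤ n ≤ x, n ≡ a mod q} α(n)`. -/
def countAP (α : ℕ → ℝ) (x : ℝ) (q : ℕ) (a : ℤ) : ℝ :=
  ∑ n ∈ (Finset.Icc 1 ⌊x⌋₊).filter (fun n : ℕ => (n : ℤ) ≡ a [ZMOD (q : ℤ)]), α n

/-- `α(a)` for an integer `a`, with the convention `α(a) = 0` for negative `a`. -/
def firstTerm (α : ℕ → ℝ) (a : ℤ) : ℝ :=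
  if 0 < a then α a.toNat else 0

/-- The exponent `f ≥ 0` such that `p ^ f ∥ a`. -/
def expo (a : ℤ) (p : ℕ) : ℕ := a.natAbs.factorization p

/-- The quantity `h(p^f) - h(p^(f+1)) / p`, where `p ^ f ∥ a`. -/
def localDiff (h : ArithmeticFunction ℝ) (a : ℤ) (p : ℕ) : ℝ :=
  h (p ^ expo a p) - h (p ^ (expo a p + 1)) / (p : ℝ)

/-- The value `g_a(p^e)`, for a prime `p` and `e ≥ 1`. -/
def gLocal (h : ArithmeticFunction ℝ) (a : ℤ) (p e : ℕ) : ℝ :=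
  if e ≤ expo a p then h (p ^ e) / (p : ℝ) ^ e
  else localDiff h a p / (Nat.totient (p ^ e) : ℝ)

/-- The multiplicative function `g_a(q) = ∏_{p^e ∥ q} g_a(p^e)`. -/
def gDens (h : ArithmeticFunction ℝ) (a : ℤ) (q : ℕ) : ℝ :=
  q.factorization.prod (fun p e => gLocal h a p e)

/-- `γ(q) = ∏_{p ∣ q} (1 - 1/p) / (1 - h(p)/p)`. -/
def gammaFun (h : ArithmeticFunction ℝ) (q : ℕ) : ℝ :=
  ∏ p ∈ q.primeFactors, (1 - 1 / (p : ℝ)) / (1 - h p / (p : ℝ))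

/-- `f_a(q) = g_a(q) q γ(q)`. -/
def fDens (h : ArithmeticFunction ℝ) (a : ℤ) (q : ℕ) : ℝ :=
  gDens h a q * (q : ℝ) * gammaFun h q

/-- The expected density `f_a(q) / (q γ(q))` of the class `a mod q`. -/
def density (h : ArithmeticFunction ℝ) (a : ℤ) (q : ℕ) : ℝ :=
  fDens h a q / ((q : ℝ) * gammaFun h q)

/-- The primes `p ≤ N`. -/
def primesUpTo (N : ℕ) : Finset ℕ := (Finset.range (N + 1)).filter Nat.Prime

/-- Equidistribution on average over the moduli `q ≤ 2 L(x)`: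
`∑_{q ≤ 2 L(x)} max_{y ≤ x} |𝒜(y;q,a) - f_a(q)/(q γ(q)) 𝒜(y)| ≪ 𝒜(x) / L(x)^(1+δ)`.
The supremum is a maximum: only finitely many values occur. -/
def LevelHyp (α : ℕ → ℝ) (h : ArithmeticFunction ℝ) (L : ℝ → ℝ) (a : ℤ) : Prop :=
  ∃ δ > (0 : ℝ), ∃ C x₀ : ℝ, ∀ x ≥ x₀,
    ∑ q ∈ Finset.Icc 1 ⌊2 * L x⌋₊,
      (⨆ y : Set.Icc (0 : ℝ) x,
        |countAP α (y : ℝ) q a - density h a q * count α (y : ℝ)|)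
      ≤ C * (count α x / L x ^ (1 + δ))

/-- Regularity of the size of `𝒜(x)`: uniformly for `1/(2 L(x)) ≤ z ≤ 1 + |a|/x` one has
`𝒜(zx)/𝒜(x) = z + O(1/L(x)^(1+δ))`, and `α(n) ≪ 𝒜(x)/L(x)^(1+δ)` for `n ≤ x`. -/
def SizeHyp (α : ℕ → ℝ) (L : ℝ → ℝ) (a : ℤ) : Prop :=
  (∃ δ > (0 : ℝ), ∃ C x₀ : ℝ, ∀ x ≥ x₀, ∀ z : ℝ,
    1 / (2 * L x) ≤ z → z ≤ 1 + |(a : ℝ)| / x →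
      |count α (z * x) / count α x - z| ≤ C / L x ^ (1 + δ)) ∧
  (∃ δ > (0 : ℝ), ∃ C x₀ : ℝ, ∀ x ≥ x₀, ∀ n : ℕ, 1 ≤ n → (n : ℝ) ≤ x →
    α n ≤ C * (count α x / L x ^ (1 + δ)))

/-- The conditions saying that `h` has the constant `k ≥ 0` as its average on the primes
(with no bad primes). -/
structure PrimeHyp (h : ArithmeticFunction ℝ) (k : ℝ) : Prop where
  nonneg : 0 ≤ k
  /-- `∑_p (h(p) - k)/p` converges (the primes being taken in increasing order). -/
  convergent : ∃ S : ℝ, Tendsto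
    (fun N : ℕ => ∑ p ∈ primesUpTo N, (h p - k) / (p : ℝ)) atTop (𝓝 S)
  /-- `∑_{p ≤ x} (h(p) - k)/p^(1+it) ≤ (1/2 - δ) log(|t| + 2) + O(1)`. -/
  bound_zero : ∃ δ > (0 : ℝ), ∃ C : ℝ, ∀ (N : ℕ) (t : ℝ),
    (∑ p ∈ primesUpTo N,
        ((h p - k : ℝ) : ℂ) / (p : ℂ) ^ (1 + (t : ℂ) * Complex.I)).re
      ≤ (1 / 2 - δ) * Real.log (|t| + 2) + C
  /-- `∑_{p ≤ x} (h(p) - k) log^n p / p^(1+it) ≪_{n,ε} (|t| + 2)^ε` for `n ≥ 1`. -/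
  bound_log : ∀ n : ℕ, 1 ≤ n → ∀ ε > (0 : ℝ), ∃ C : ℝ, ∀ (N : ℕ) (t : ℝ),
    ‖∑ p ∈ primesUpTo N,
        (((h p - k) * Real.log p ^ n : ℝ) : ℂ) / (p : ℂ) ^ (1 + (t : ℂ) * Complex.I)‖
      ≤ C * (|t| + 2) ^ ε
  lt_self : ∀ p : ℕ, p.Prime → h p < (p : ℝ)
  growth : ∀ ε > (0 : ℝ), ∃ C : ℝ, ∀ d : ℕ, 1 ≤ d → |h d| ≤ C * (d : ℝ) ^ ε

open Classical in
/-- The primes `p ∣ a` with `h(p^f) = h(p^(f+1))/p`, where `p^f ∥ a`. -/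
def degeneratePrimes (h : ArithmeticFunction ℝ) (a : ℤ) : Finset ℕ :=
  a.natAbs.primeFactors.filter (fun p => h (p ^ expo a p) = h (p ^ (expo a p + 1)) / (p : ℝ))

/-- `ω_h(a)`. -/
def omegaH (h : ArithmeticFunction ℝ) (a : ℤ) : ℕ := (degeneratePrimes h a).card

/-- The product over the degenerate primes. A prime `p ∤ a` (that is, `f = 0`) is never
degenerate when `h(p) < p`. -/
def degenerateProd (h : ArithmeticFunction ℝ) (k : ℝ) (a : ℤ) : ℝ :=
  ∏ p ∈ degeneratePrimes h a,
    (∑ j ∈ Finset.range (expo a p + 1), h (p ^ j)) / (1 - 1 / (p : ℝ)) ^ (k - 1) * Real.log p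

open Classical in
/-- The product over the non-degenerate primes `p ≤ N` (dividing `a` or not). -/
def regularProd (h : ArithmeticFunction ℝ) (k : ℝ) (a : ℤ) (N : ℕ) : ℝ :=
  ∏ p ∈ (primesUpTo N).filter
      (fun p => h (p ^ expo a p) ≠ h (p ^ (expo a p + 1)) / (p : ℝ)),
    localDiff h a p / (1 - 1 / (p : ℝ)) ^ k

/-- The average `μ_k(a, M)`. At the poles of `Γ` the factor `1/Γ` is `0`, which agrees with
`Real.Gamma` being `0` there and division by zero being `0`. -/
def mu (h : ArithmeticFunction ℝ) (k : ℝ) (a : ℤ) (M : ℝ) : ℝ :=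
  -(1 / 2) *
    (Real.log M ^ (1 - k - (omegaH h a : ℝ)) / Real.Gamma (2 - k - (omegaH h a : ℝ))) *
    degenerateProd h k a *
    limUnder atTop (fun N : ℕ => regularProd h k a N)

/-- `∑_{x/(2M) < q ≤ x/M} (𝒜(x;q,a) - α(a) - f_a(q)/(q γ(q)) 𝒜(x))`. -/
def dyadicSum (α : ℕ → ℝ) (h : ArithmeticFunction ℝ) (a : ℤ) (x M : ℝ) : ℝ :=
  ∑ q ∈ Finset.Ioc ⌊x / (2 * M)⌋₊ ⌊x / M⌋₊,
    (countAP α x q a - firstTerm α a - density h a q * count α x)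

end

end ArithProg

/-! Put X = x/(2M). For X < q ≤ 2X the congruence n ≡ a mod q reads n = a + qr, and n ≤ x forces r
to be at most about 2M. Exchanging the two divisors replaces the large moduli q by the small moduli
r, to which Hypothesis 1* applies, while q ∈ (X, 2X] becomes n ∈ (a + rX, a + 2rX]
(`sum_countAP_switch`). By Hypothesis 2 the r-th term is 𝒜(x) g_a(r) (min(1, r/M) - min(1, r/(2M)))
up to an admissible error, so the sum over q is 𝒜(x) (S(2M) - S(M)) with the Cesàro sum S(R) = ∑_{r
≤ R} g_a(r) (1 - r/R) (`EquidistBound.abs_dyadic_sub_le`).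

Write q g_a(q) = ∑_{d ∣ q} b(d). Then S(2M) - S(M) and the expected term ∑_{X < q ≤ 2X} g_a(q) share
the main term c log 2, with c = ∑ b(d)/d, and cancel. What survives is (T(2M) - 2T(M))/(2M), where
T(R) = ∑_d b(d) K(R/d) is `twistAvg` and the kernel K = `stepKernel` tends to 1/2. The error of the
expected term is negligible because X exceeds a constant times M^(1+δ), which Hypothesis 1* itself
implies (`EquidistBound.exists_level_rpow_le`).

The Laplace transform of T(e^y) is F(w) (1/(2w) + regular), F being the Dirichlet series of b
(`PrimeHyp.logMellin_twistAvg`). Since b(p) is close to (1 - h(p))/p, F behaves near 0 like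
ζ(1+w)^(1-k), times one zero at w = 0 for each degenerate prime dividing a. With κ = k + ω the
transform is therefore w^(-(2-κ)) H(w), where H(0+) is half the product of the degenerate and the
regular product (`PrimeHyp.exists_regularProd_limit`). This suggests T(e^u) ~ H(0+) u^(1-κ)/Γ(2-κ),
and T(2M) - 2T(M) ~ -T(M) gives μ. When Γ(2-κ) has a pole, the power of w is a nonnegative integer
power, the transform is not singular at all, and T(e^u) decays faster than any power of u.

The transform need not continue beyond Re w = 0, so contours cannot be moved. Instead, all
derivatives of H on 0 < Re w < 1/2 are bounded by one and the same power of |Im w|. The N-th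
derivative of the transform belongs to y^N T(e^y); dividing by u^N at the end gains arbitrarily
much, while growth in |Im w| costs a fixed power of u, so a large N wins
(`SubexpGrowth.abs_sub_le_of_logMellin`). The common power comes from logarithmic derivatives: if V'
= ℓV and all derivatives of ℓ are O(|Im w|^ε), then differentiating V costs only multiples of ε
(`TameGrowth.of_logDeriv`). For the factor with h(p) - k this slow growth is the bound with log^n p
in Hypothesis 3; for ζ it follows from the 3-4-1 inequality (`slowGrowth_logDeriv_riemannZeta₁`). -/

namespace ArithProg

/-! ### Growth classes of holomorphic functions on a strip -/

/-- The vertical strip `0 < Re w < 1/2`. -/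
def strip : Set ℂ := {w | 0 < w.re ∧ w.re < 1 / 2}

lemma isOpen_strip : IsOpen strip :=
  (isOpen_lt continuous_const Complex.continuous_re).inter
    (isOpen_lt Complex.continuous_re continuous_const)

/-- `f` is holomorphic on the strip and its derivatives up to order `n` are
`O((|Im w| + 2) ^ c)` there. -/
def PolyGrowth (c : ℝ) (n : ℕ) (f : ℂ → ℂ) : Prop :=
  DifferentiableOn ℂ f strip ∧
    ∀ j ≤ n, ∃ C, ∀ w ∈ strip, ‖iteratedDeriv j f w‖ ≤ C * (|w.im| + 2) ^ c

/-- All derivatives of `f` on the strip grow slower than any power. -/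
def SlowGrowth (f : ℂ → ℂ) : Prop := ∀ ε > (0 : ℝ), ∀ n, PolyGrowth ε n f

/-- All derivatives of `f` on the strip grow at most like one fixed power. -/
def TameGrowth (f : ℂ → ℂ) : Prop := ∃ c : ℝ, ∀ n, PolyGrowth c n f

namespace PolyGrowth

variable {c c' : ℝ} {n : ℕ} {f g : ℂ → ℂ}

lemma congr (hf : PolyGrowth c n f) (h : Set.EqOn g f strip) : PolyGrowth c n g := by
  refine ⟨hf.1.congr h, fun j hj => ?_⟩
  obtain ⟨C, hC⟩ := hf.2 j hj
  refine ⟨C, fun w hw => ?_⟩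
  rw [h.iteratedDeriv_of_isOpen isOpen_strip j hw]
  exact hC w hw

lemma mono (hf : PolyGrowth c n f) (h : c ≤ c') {m : ℕ} (hm : m ≤ n) : PolyGrowth c' m f := by
  refine ⟨hf.1, fun j hj => ?_⟩
  obtain ⟨C, hC⟩ := hf.2 j (hj.trans hm)
  refine ⟨|C|, fun w hw => (hC w hw).trans ?_⟩
  have h1 : (1 : ℝ) ≤ |w.im| + 2 := by linarith [abs_nonneg w.im]
  exact mul_le_mul (le_abs_self C) (Real.rpow_le_rpow_of_exponent_le h1 h) (by positivity)
    (abs_nonneg C)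

lemma zero_iff : PolyGrowth c 0 f ↔ DifferentiableOn ℂ f strip ∧
    ∃ C, ∀ w ∈ strip, ‖f w‖ ≤ C * (|w.im| + 2) ^ c := by
  simp [PolyGrowth]

lemma succ_iff : PolyGrowth c (n + 1) f ↔ PolyGrowth c 0 f ∧ PolyGrowth c n (deriv f) := by
  constructor
  · intro h
    refine ⟨h.mono le_rfl (Nat.zero_le _), h.1.deriv isOpen_strip, fun j hj => ?_⟩
    obtain ⟨C, hC⟩ := h.2 (j + 1) (by omega)
    exact ⟨C, fun w hw => by simpa only [iteratedDeriv_succ'] using hC w hw⟩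
  · rintro ⟨h0, h1⟩
    refine ⟨h0.1, fun j hj => ?_⟩
    rcases j with _ | j
    · exact h0.2 0 le_rfl
    · obtain ⟨C, hC⟩ := h1.2 j (by omega)
      exact ⟨C, fun w hw => by simpa only [iteratedDeriv_succ'] using hC w hw⟩

lemma diffAt (hf : PolyGrowth c n f) {w : ℂ} (hw : w ∈ strip) : DifferentiableAt ℂ f w :=
  hf.1.differentiableAt (isOpen_strip.mem_nhds hw)

lemma add (hf : PolyGrowth c n f) (hg : PolyGrowth c n g) :
    PolyGrowth c n (fun w => f w + g w) := by
  induction n generalizing f g with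
  | zero =>
    rw [zero_iff] at *
    obtain ⟨hf, C, hC⟩ := hf
    obtain ⟨hg, C', hC'⟩ := hg
    refine ⟨hf.add hg, C + C', fun w hw => (norm_add_le _ _).trans ?_⟩
    rw [add_mul]
    exact add_le_add (hC w hw) (hC' w hw)
  | succ n ih =>
    have hf' := succ_iff.1 hf
    have hg' := succ_iff.1 hg
    refine succ_iff.2 ⟨?_, (ih hf'.2 hg'.2).congr fun w hw => ?_⟩
    · have h1 := zero_iff.1 hf'.1
      have h2 := zero_iff.1 hg'.1
      obtain ⟨h1, C, hC⟩ := h1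
      obtain ⟨h2, C', hC'⟩ := h2
      refine zero_iff.2 ⟨h1.add h2, C + C', fun w hw => (norm_add_le _ _).trans ?_⟩
      rw [add_mul]
      exact add_le_add (hC w hw) (hC' w hw)
    · exact deriv_fun_add (hf.diffAt hw) (hg.diffAt hw)

lemma mul (hf : PolyGrowth c n f) (hg : PolyGrowth c' n g) :
    PolyGrowth (c + c') n (fun w => f w * g w) := by
  have base : ∀ {f g : ℂ → ℂ}, PolyGrowth c 0 f → PolyGrowth c' 0 g →
      PolyGrowth (c + c') 0 (fun w => f w * g w) := by
    intro f g hf hg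
    obtain ⟨hf, C, hC⟩ := zero_iff.1 hf
    obtain ⟨hg, C', hC'⟩ := zero_iff.1 hg
    refine zero_iff.2 ⟨hf.mul hg, C * C', fun w hw => ?_⟩
    have h2 : (0 : ℝ) < |w.im| + 2 := by positivity
    rw [norm_mul, Real.rpow_add h2]
    calc ‖f w‖ * ‖g w‖ ≤ (C * (|w.im| + 2) ^ c) * (C' * (|w.im| + 2) ^ c') :=
          mul_le_mul (hC w hw) (hC' w hw) (norm_nonneg _) ((norm_nonneg _).trans (hC w hw))
      _ = _ := by ring
  induction n generalizing f g with
  | zero => exact base hf hg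
  | succ n ih =>
    have hf' := succ_iff.1 hf
    have hg' := succ_iff.1 hg
    refine succ_iff.2 ⟨base hf'.1 hg'.1, ?_⟩
    refine ((ih hf'.2 (hg.mono le_rfl n.le_succ)).add
      (ih (hf.mono le_rfl n.le_succ) hg'.2)).congr fun w hw => ?_
    exact deriv_fun_mul (hf.diffAt hw) (hg.diffAt hw)

lemma const (hc : 0 ≤ c) (z : ℂ) : PolyGrowth c n (fun _ => z) := by
  refine ⟨differentiableOn_const _, fun j _ => ⟨‖z‖, fun w _ => ?_⟩⟩
  have h1 : (1 : ℝ) ≤ (|w.im| + 2) ^ c :=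
    Real.one_le_rpow (by linarith [abs_nonneg w.im]) hc
  rw [iteratedDeriv_const]
  split_ifs
  · nlinarith [norm_nonneg z]
  · simp; positivity

/-- Cauchy's estimates. -/
lemma of_bounded {r C : ℝ} (hr : 0 < r) (hc : 0 ≤ c)
    (hd : DifferentiableOn ℂ f {w | -r < w.re ∧ w.re < 1 / 2 + r})
    (hb : ∀ w : ℂ, -r < w.re → w.re < 1 / 2 + r → ‖f w‖ ≤ C * (|w.im| + 2) ^ c) (n : ℕ) :
    PolyGrowth c n f := by
  refine ⟨hd.mono fun w hw => ⟨by linarith [hw.1], by linarith [hw.2]⟩, fun j _ => ?_⟩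
  -- Radius at most r/2 keeps the disc inside the wider strip; radius at most 1 keeps |Im z| + 2
  -- below 2(|Im w| + 2).
  set ρ := min (r / 2) 1 with hρ
  have hρ0 : 0 < ρ := lt_min (by linarith) one_pos
  refine ⟨j.factorial * (|C| * 2 ^ c) / ρ ^ j, fun w hw => ?_⟩
  have hball : ∀ z ∈ Metric.closedBall w ρ, -r < z.re ∧ z.re < 1 / 2 + r ∧
      |z.im| ≤ |w.im| + 1 := by
    intro z hz
    rw [mem_closedBall_iff_norm] at hz
    have h1 := (abs_le.1 ((Complex.abs_re_le_norm (z - w)).trans hz))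
    have h2 := ((Complex.abs_im_le_norm (z - w)).trans hz)
    simp only [Complex.sub_re, Complex.sub_im] at h1 h2
    have h3 : ρ ≤ r / 2 := min_le_left _ _
    have h4 : ρ ≤ 1 := min_le_right _ _
    refine ⟨by linarith [hw.1, h1.1], by linarith [hw.2, h1.2], ?_⟩
    calc |z.im| = |w.im + (z.im - w.im)| := by ring_nf
      _ ≤ _ := (abs_add_le _ _).trans (by linarith)
  have key := Complex.norm_iteratedDeriv_le_of_forall_mem_sphere_norm_le (f := f) (c := w) (R := ρ)
    (C := |C| * 2 ^ c * (|w.im| + 2) ^ c) j hρ0 ?_ ?_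
  · refine key.trans (le_of_eq ?_)
    ring
  · refine DifferentiableOn.diffContOnCl ?_
    rw [closure_ball _ hρ0.ne']
    exact hd.mono fun z hz => ⟨(hball z hz).1, (hball z hz).2.1⟩
  · intro z hz
    obtain ⟨h1, h2, h3⟩ := hball z (Metric.sphere_subset_closedBall hz)
    refine (hb z h1 h2).trans ?_
    rw [mul_assoc, ← Real.mul_rpow (by norm_num) (by positivity)]
    refine mul_le_mul (le_abs_self C) (Real.rpow_le_rpow (by positivity) ?_ hc) (by positivity)
      (abs_nonneg C)
    linarith [abs_nonneg w.im]

/-- A solution of `V' = ℓ V` inherits the growth of `ℓ`. -/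
lemma of_logDeriv {V l : ℂ → ℂ} {ε : ℝ} (hε : 0 ≤ ε) (hV : PolyGrowth c 0 V)
    (hl : PolyGrowth ε n l) (h : ∀ w ∈ strip, deriv V w = l w * V w) :
    PolyGrowth (c + (n + 1) * ε) (n + 1) V := by
  induction n with
  | zero =>
    refine succ_iff.2 ⟨hV.mono (by simpa using hε) le_rfl, ?_⟩
    refine ((hl.mul hV).congr h).mono ?_ le_rfl
    norm_num; linarith
  | succ n ih =>
    have hp : 0 ≤ ((n : ℝ) + 1 + 1) * ε := by positivity
    refine succ_iff.2 ⟨hV.mono (by push_cast; linarith) le_rfl, ?_⟩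
    refine ((hl.mul (ih (hl.mono le_rfl n.le_succ))).congr h).mono (le_of_eq ?_) le_rfl
    push_cast; ring

end PolyGrowth

namespace SlowGrowth

variable {f g : ℂ → ℂ}

lemma congr (hf : SlowGrowth f) (h : Set.EqOn g f strip) : SlowGrowth g :=
  fun ε hε n => (hf ε hε n).congr h

lemma add (hf : SlowGrowth f) (hg : SlowGrowth g) : SlowGrowth (fun w => f w + g w) :=
  fun ε hε n => (hf ε hε n).add (hg ε hε n)

lemma mul (hf : SlowGrowth f) (hg : SlowGrowth g) : SlowGrowth (fun w => f w * g w) :=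
  fun ε hε n => by
    simpa using (hf (ε / 2) (by linarith) n).mul (hg (ε / 2) (by linarith) n)

lemma const (z : ℂ) : SlowGrowth (fun _ => z) := fun _ hε _ => .const hε.le z

lemma neg (hf : SlowGrowth f) : SlowGrowth (fun w => -f w) :=
  ((const (-1)).mul hf).congr fun w _ => by simp

lemma sub (hf : SlowGrowth f) (hg : SlowGrowth g) : SlowGrowth (fun w => f w - g w) :=
  (hf.add hg.neg).congr fun _ _ => sub_eq_add_neg _ _

lemma deriv (hf : SlowGrowth f) : SlowGrowth (deriv f) :=
  fun ε hε n => (PolyGrowth.succ_iff.1 (hf ε hε (n + 1))).2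

/-- Since (1/f)' = -f' (1/f)², a bound for 1/f itself propagates to all derivatives; each of the
three factors is allotted ε/3. -/
lemma inv (hf : SlowGrowth f) (h0 : ∀ w ∈ strip, f w ≠ 0)
    (h : ∀ ε > (0 : ℝ), ∃ C, ∀ w ∈ strip, ‖(f w)⁻¹‖ ≤ C * (|w.im| + 2) ^ ε) :
    SlowGrowth (fun w => (f w)⁻¹) := by
  have hd : DifferentiableOn ℂ (fun w => (f w)⁻¹) strip := (hf 1 one_pos 0).1.inv h0
  suffices H : ∀ n : ℕ, ∀ ε > (0 : ℝ), PolyGrowth ε n (fun w => (f w)⁻¹) from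
    fun ε hε n => H n ε hε
  intro n
  induction n with
  | zero => exact fun ε hε => PolyGrowth.zero_iff.2 ⟨hd, h ε hε⟩
  | succ n ih =>
    intro ε hε
    refine PolyGrowth.succ_iff.2 ⟨PolyGrowth.zero_iff.2 ⟨hd, h ε hε⟩, ?_⟩
    have h1 := ((hf.deriv.neg (ε / 3) (by linarith) n).mul (ih (ε / 3) (by linarith))).mul
      (ih (ε / 3) (by linarith))
    refine (h1.congr fun w hw => ?_).mono (by linarith) le_rfl
    have := ((hf 1 one_pos 0).diffAt hw).hasDerivAt.fun_inv (h0 w hw)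
    rw [this.deriv]
    field_simp

lemma tame (hf : SlowGrowth f) : TameGrowth f := ⟨1, hf 1 one_pos⟩

lemma of_bounded {r C : ℝ} (hr : 0 < r)
    (hd : DifferentiableOn ℂ f {w | -r < w.re ∧ w.re < 1 / 2 + r})
    (hb : ∀ w : ℂ, -r < w.re → w.re < 1 / 2 + r → ‖f w‖ ≤ C) :
    SlowGrowth f := fun ε hε n => by
  refine PolyGrowth.of_bounded (C := |C|) hr hε.le hd (fun w h1 h2 => (hb w h1 h2).trans ?_) n
  have h1 : (1 : ℝ) ≤ (|w.im| + 2) ^ ε :=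
    Real.one_le_rpow (by linarith [abs_nonneg w.im]) hε.le
  exact (le_abs_self C).trans (le_mul_of_one_le_right (abs_nonneg C) h1)

end SlowGrowth

namespace TameGrowth

variable {f g : ℂ → ℂ}

lemma congr (hf : TameGrowth f) (h : Set.EqOn g f strip) : TameGrowth g := by
  obtain ⟨c, hc⟩ := hf
  exact ⟨c, fun n => (hc n).congr h⟩

lemma mul (hf : TameGrowth f) (hg : TameGrowth g) : TameGrowth (fun w => f w * g w) := by
  obtain ⟨c, hc⟩ := hf
  obtain ⟨c', hc'⟩ := hg
  exact ⟨c + c', fun n => (hc n).mul (hc' n)⟩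

/-- n + 1 differentiations cost (n + 1)ε in the exponent. As ε may depend on n, taking ε = 1/(n + 1)
caps the total loss at 1, so a single exponent serves every order. -/
lemma of_logDeriv {V l : ℂ → ℂ} {c : ℝ} (hV : PolyGrowth c 0 V)
    (hl : SlowGrowth l) (h : ∀ w ∈ strip, deriv V w = l w * V w) : TameGrowth V := by
  refine ⟨c + 1, fun n => ?_⟩
  have hn : (0 : ℝ) < 1 / (n + 1) := by positivity
  refine (PolyGrowth.of_logDeriv hn.le hV (hl _ hn n) h).mono (le_of_eq ?_) n.le_succ
  field_simp

end TameGrowth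

end ArithProg

/-! ### Growth of ζ(1 + w) - 1/w near the line Re w = 0 -/

namespace ArithProg

lemma hasDerivAt_ofReal_cpow_neg {u : ℝ} (hu : 0 < u) (w : ℂ) :
    HasDerivAt (fun y : ℝ => (y : ℂ) ^ (-w)) (-w * (u : ℂ) ^ (-w - 1)) u := by
  by_cases hw : w = 0
  · subst hw
    simpa using hasDerivAt_const u (1 : ℂ)
  · exact hasDerivAt_ofReal_cpow_const hu.ne' (by simpa using hw)

lemma norm_cpow_sub_cpow_le {m u : ℝ} (hm : 0 < m) (hmu : m ≤ u) (hu : u ≤ m + 1) {w : ℂ}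
    (hw : -2 ≤ w.re) :
    ‖(u : ℂ) ^ (-w - 1) - (m : ℂ) ^ (-w - 1)‖ ≤ ‖w + 1‖ * m ^ (-w.re - 2) := by
  have h := Convex.norm_image_sub_le_of_norm_hasDerivWithin_le
    (f := fun y : ℝ => (y : ℂ) ^ (-w - 1)) (f' := fun y => -(w + 1) * (y : ℂ) ^ (-(w + 1) - 1))
    (s := Set.Icc m (m + 1)) (C := ‖w + 1‖ * m ^ (-w.re - 2)) (x := m) (y := u) ?_ ?_
    (convex_Icc _ _) ⟨le_rfl, by linarith⟩ ⟨hmu, hu⟩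
  · refine h.trans ?_
    rw [Real.norm_of_nonneg (by linarith)]
    exact mul_le_of_le_one_right (by positivity) (by linarith)
  · intro y hy
    have hy0 : 0 < y := hm.trans_le hy.1
    have := (hasDerivAt_ofReal_cpow_neg hy0 (w + 1)).hasDerivWithinAt (s := Set.Icc m (m + 1))
    refine this.congr_of_eventuallyEq ?_ ?_ <;> simp [sub_eq_add_neg, add_comm]
  · intro y hy
    have hy0 : 0 < y := hm.trans_le hy.1
    rw [norm_mul, norm_neg, Complex.norm_cpow_eq_rpow_re_of_pos hy0]
    refine mul_le_mul_of_nonneg_left ?_ (norm_nonneg _)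
    have : (-(w + 1) - 1).re = -w.re - 2 := by simp; ring
    rw [this]
    exact Real.rpow_le_rpow_of_nonpos hm hy.1 (by linarith)

/-- The terms of the series `w ζ(1 + w) - 1 = ∑ₙ (w n^{-1-w} - n^{-w} + (n+1)^{-w})`. -/
noncomputable def zetaTerm (n : ℕ) (w : ℂ) : ℂ :=
  w * ((n + 1 : ℝ) : ℂ) ^ (-w - 1) - ((n + 1 : ℝ) : ℂ) ^ (-w) + ((n + 1 + 1 : ℝ) : ℂ) ^ (-w)

/-- With m = n + 1, the term is w times the integral over [m, m + 1] of m^(-1-w) - u^(-1-w). The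
integrand has a trivial bound and a mean value bound that gains a factor ‖1 + w‖/m; interpolating
between them gives convergence slightly to the left of Re w = 0 at the price of ‖1 + w‖^(2ε). -/
lemma norm_zetaTerm_le {ε : ℝ} (h0 : 0 < ε) (h1 : ε ≤ 1 / 4) (n : ℕ) {w : ℂ} (hw : -ε < w.re) :
    ‖zetaTerm n w‖ ≤ ‖w‖ * (2 * ‖1 + w‖ ^ (2 * ε) * (n + 1 : ℝ) ^ (-1 - ε)) := by
  set m : ℝ := n + 1 with hm
  have hm0 : 0 < m := by positivity
  have hm1 : 1 ≤ m := by simp [hm]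
  have hb : ∀ u ∈ Set.Icc m (m + 1), ‖(u : ℂ) ^ (-w - 1) - (m : ℂ) ^ (-w - 1)‖ ≤
      2 * ‖1 + w‖ ^ (2 * ε) * m ^ (-1 - ε) := by
    intro u hu
    have hu0 : 0 < u := hm0.trans_le hu.1
    have b1 := norm_cpow_sub_cpow_le hm0 hu.1 hu.2 (w := w) (by linarith)
    have b2 : ‖(u : ℂ) ^ (-w - 1) - (m : ℂ) ^ (-w - 1)‖ ≤ 2 * m ^ (-w.re - 1) := by
      refine (norm_sub_le _ _).trans ?_
      rw [Complex.norm_cpow_eq_rpow_re_of_pos hu0, Complex.norm_cpow_eq_rpow_re_of_pos hm0]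
      have : (-w - 1).re = -w.re - 1 := by simp
      rw [this, two_mul]
      exact add_le_add (Real.rpow_le_rpow_of_nonpos hm0 hu.1 (by linarith)) le_rfl
    -- Both bounds together give min(1, y), which is at most y^(2ε) because 0 < 2ε ≤ 1.
    set y := ‖1 + w‖ / m with hy
    have hy0 : 0 ≤ y := by positivity
    have e1 : ‖w + 1‖ * m ^ (-w.re - 2) = y * m ^ (-w.re - 1) := by
      rw [hy, add_comm w 1, show -w.re - 2 = (-w.re - 1) - 1 by ring, Real.rpow_sub_one hm0.ne']
      ring
    rw [e1] at b1
    have hmp : 0 < m ^ (-w.re - 1) := by positivity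
    have b3 : ‖(u : ℂ) ^ (-w - 1) - (m : ℂ) ^ (-w - 1)‖ ≤ 2 * y ^ (2 * ε) * m ^ (-w.re - 1) := by
      rcases le_total y 1 with hy1 | hy1
      · have : y ≤ y ^ (2 * ε) := by
          rcases hy0.eq_or_lt with h | h
          · rw [← h]; positivity
          · simpa using Real.rpow_le_rpow_of_exponent_ge h hy1 (show 2 * ε ≤ 1 by linarith)
        have h3 : 0 ≤ y ^ (2 * ε) := by positivity
        refine b1.trans (mul_le_mul_of_nonneg_right (by linarith) hmp.le)
      · have : 1 ≤ y ^ (2 * ε) := Real.one_le_rpow hy1 (by linarith)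
        refine b2.trans (mul_le_mul_of_nonneg_right (by linarith) hmp.le)
    refine b3.trans ?_
    have h5 : m ^ (-w.re - 1) ≤ m ^ (ε - 1) :=
      Real.rpow_le_rpow_of_exponent_le hm1 (by linarith)
    calc 2 * y ^ (2 * ε) * m ^ (-w.re - 1) ≤ 2 * y ^ (2 * ε) * m ^ (ε - 1) := by gcongr
      _ = 2 * ‖1 + w‖ ^ (2 * ε) * (m ^ (ε - 1) / m ^ (2 * ε)) := by
        rw [hy, Real.div_rpow (norm_nonneg _) hm0.le]; ring
      _ = _ := by rw [← Real.rpow_sub hm0]; ring_nf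
  -- The increment over [m, m + 1] of y^(-w) + w m^(-w-1) y is exactly the term, and its derivative
  -- is -w times the difference just bounded.
  have h := Convex.norm_image_sub_le_of_norm_hasDerivWithin_le
    (f := fun y : ℝ => (y : ℂ) ^ (-w) + (w * (m : ℂ) ^ (-w - 1)) * y)
    (f' := fun y => -w * (y : ℂ) ^ (-w - 1) + (w * (m : ℂ) ^ (-w - 1)) * 1)
    (s := Set.Icc m (m + 1)) (C := ‖w‖ * (2 * ‖1 + w‖ ^ (2 * ε) * m ^ (-1 - ε)))
    (x := m) (y := m + 1) ?_ ?_
    (convex_Icc _ _) ⟨le_rfl, by linarith⟩ ⟨by linarith, le_rfl⟩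
  · have e : zetaTerm n w = (((m + 1 : ℝ) : ℂ) ^ (-w) + (w * (m : ℂ) ^ (-w - 1)) * ((m + 1 : ℝ) : ℂ))
        - ((m : ℂ) ^ (-w) + (w * (m : ℂ) ^ (-w - 1)) * (m : ℂ)) := by
      rw [zetaTerm]; push_cast [hm]; ring
    rw [e]
    refine h.trans (le_of_eq ?_)
    simp
  · intro y hy
    have hy0 : 0 < y := hm0.trans_le hy.1
    exact ((hasDerivAt_ofReal_cpow_neg hy0 w).add
      ((Complex.ofRealCLM.hasDerivAt (x := y)).const_mul _)).hasDerivWithinAt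
  · intro y hy
    have : -w * (y : ℂ) ^ (-w - 1) + (w * (m : ℂ) ^ (-w - 1)) * 1 =
      -w * ((y : ℂ) ^ (-w - 1) - (m : ℂ) ^ (-w - 1)) := by ring
    rw [this, norm_mul, norm_neg]
    exact mul_le_mul_of_nonneg_left (hb y hy) (norm_nonneg _)

lemma summable_nat_add_one_rpow {ε : ℝ} (h0 : 0 < ε) :
    Summable (fun n : ℕ => (n + 1 : ℝ) ^ (-1 - ε)) := by
  have := (summable_nat_add_iff 1).2 (Real.summable_nat_rpow.2 (show -1 - ε < -1 by linarith))
  simpa using this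

lemma differentiable_zetaTerm (n : ℕ) : Differentiable ℂ (zetaTerm n) := by
  have h1 : ((n + 1 : ℝ) : ℂ) ≠ 0 := by exact_mod_cast (by positivity : (n + 1 : ℝ) ≠ 0)
  have h2 : ((n + 1 + 1 : ℝ) : ℂ) ≠ 0 := by exact_mod_cast (by positivity : (n + 1 + 1 : ℝ) ≠ 0)
  have hd : ∀ c : ℂ, c ≠ 0 → ∀ g : ℂ → ℂ, Differentiable ℂ g →
      Differentiable ℂ (fun w => c ^ (g w)) := fun c hc g hg => hg.const_cpow (Or.inl hc)
  exact ((differentiable_id.mul (hd _ h1 _ (by fun_prop))).sub (hd _ h1 _ (by fun_prop))).add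
    (hd _ h2 _ (by fun_prop))

/-- For Re w > 0 the series splits into wζ(1 + w) and a telescoping series with sum -1; the latter
cancels the pole. -/
lemma tsum_zetaTerm_of_re_pos {w : ℂ} (hw : 0 < w.re) :
    ∑' n, zetaTerm n w = w * riemannZeta₀ (1 + w) := by
  have hw0 : w ≠ 0 := by rintro rfl; simp at hw
  have hs : 1 < (1 + w).re := by simpa using hw
  have hz : HasSum (fun n : ℕ => ((n + 1 : ℝ) : ℂ) ^ (-w - 1)) (riemannZeta (1 + w)) := by
    have h1 := zeta_eq_tsum_one_div_nat_add_one_cpow hs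
    have h2 : Summable (fun n : ℕ => 1 / ((n : ℂ) + 1) ^ (1 + w)) := by
      have := (summable_nat_add_iff 1).2 (Complex.summable_one_div_nat_cpow.2 hs)
      simpa using this
    rw [h1]
    refine h2.hasSum.congr_fun ?_ |> fun h => h
    intro n
    rw [show -w - 1 = -(1 + w) by ring, Complex.cpow_neg]
    push_cast; simp
  have ht : HasSum (fun n : ℕ => ((n + 1 + 1 : ℝ) : ℂ) ^ (-w) - ((n + 1 : ℝ) : ℂ) ^ (-w)) (-1) := by
    have hlim : Tendsto (fun n : ℕ => ((n + 1 : ℝ) : ℂ) ^ (-w)) atTop (𝓝 0) := by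
      rw [tendsto_zero_iff_norm_tendsto_zero]
      have : ∀ n : ℕ, ‖((n + 1 : ℝ) : ℂ) ^ (-w)‖ = (n + 1 : ℝ) ^ (-w.re) := fun n => by
        rw [Complex.norm_cpow_eq_rpow_re_of_pos (by positivity)]; simp
      simp_rw [this]
      exact (tendsto_rpow_neg_atTop hw).comp
        (tendsto_atTop_add_const_right _ 1 tendsto_natCast_atTop_atTop)
    have hsum : Summable (fun n : ℕ => ((n + 1 + 1 : ℝ) : ℂ) ^ (-w) - ((n + 1 : ℝ) : ℂ) ^ (-w)) := by
      have e : ∀ n : ℕ, ((n + 1 + 1 : ℝ) : ℂ) ^ (-w) - ((n + 1 : ℝ) : ℂ) ^ (-w) =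
          zetaTerm n w - w * ((n + 1 : ℝ) : ℂ) ^ (-w - 1) := fun n => by rw [zetaTerm]; ring
      simp_rw [e]
      refine Summable.sub ?_ (hz.summable.mul_left w)
      refine Summable.of_norm_bounded
        (((summable_nat_add_one_rpow (ε := 1 / 4) (by norm_num)).mul_left
          (2 * ‖1 + w‖ ^ (2 * (1 / 4 : ℝ)))).mul_left ‖w‖)
        (fun n => norm_zetaTerm_le (by norm_num) le_rfl n (by linarith))
    refine (hsum.hasSum_iff_tendsto_nat).2 ?_
    have : ∀ n : ℕ, ∑ i ∈ Finset.range n,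
        (((i + 1 + 1 : ℝ) : ℂ) ^ (-w) - ((i + 1 : ℝ) : ℂ) ^ (-w)) = ((n + 1 : ℝ) : ℂ) ^ (-w) - 1 := by
      intro n
      have := Finset.sum_range_sub (fun i : ℕ => ((i + 1 : ℝ) : ℂ) ^ (-w)) n
      simpa using this
    simp_rw [this]
    simpa using hlim.sub_const 1
  have := ((hz.mul_left w).add ht).tsum_eq
  rw [riemannZeta_eq_inv_sub_add (by simpa using hw0)] at this
  have e2 : w * ((1 + w - 1)⁻¹ + riemannZeta₀ (1 + w)) + -1 = w * riemannZeta₀ (1 + w) := by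
    rw [add_sub_cancel_left, mul_add, mul_inv_cancel₀ hw0]; ring
  rw [e2] at this
  rw [← this]
  congr 1; ext n; rw [zetaTerm]; ring

/-- Analytic continuation from Re w > 0. The intersection with a ball makes the bound for the terms
uniform, and convexity supplies connectedness. -/
lemma tsum_zetaTerm {ε : ℝ} (h0 : 0 < ε) (h1 : ε ≤ 1 / 4) {w : ℂ} (hw : -ε < w.re)  :
    ∑' n, zetaTerm n w = w * riemannZeta₀ (1 + w) := by
  set R : ℝ := ‖w‖ + 2
  set U : Set ℂ := {z | -ε < z.re} ∩ Metric.ball 0 R with hU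
  have hUo : IsOpen U := (isOpen_lt continuous_const Complex.continuous_re).inter Metric.isOpen_ball
  have hUc : Convex ℝ U := (convex_halfSpace_re_gt _).inter (convex_ball _ _)
  have hd : DifferentiableOn ℂ (fun z => ∑' n, zetaTerm n z) U := by
    refine Complex.differentiableOn_tsum_of_summable_norm
      (u := fun n : ℕ => R * (2 * (1 + R) ^ (2 * ε) * (n + 1 : ℝ) ^ (-1 - ε))) ?_ ?_ hUo ?_
    · exact ((summable_nat_add_one_rpow h0).mul_left _).mul_left _
    · exact fun n => (differentiable_zetaTerm n).differentiableOn
    · intro n z hz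
      have hz2 : ‖z‖ ≤ R := by have := hz.2; rw [mem_ball_zero_iff] at this; exact this.le
      refine (norm_zetaTerm_le h0 h1 n hz.1).trans ?_
      have : ‖1 + z‖ ≤ 1 + R := (norm_add_le _ _).trans (by simpa using hz2)
      gcongr
  have hd2 : DifferentiableOn ℂ (fun z => z * riemannZeta₀ (1 + z)) U := by
    apply Differentiable.differentiableOn; fun_prop
  have heq := (hd.analyticOnNhd hUo).eqOn_of_preconnected_of_eventuallyEq
    (hd2.analyticOnNhd hUo) hUc.isPreconnected (z₀ := 1)
    ⟨by show -ε < _; simp; linarith, by rw [mem_ball_zero_iff]; simp [R]; linarith [norm_nonneg w]⟩ ?_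
  · refine heq ⟨hw, ?_⟩
    rw [mem_ball_zero_iff]; simp [R]
  · have : {z : ℂ | 0 < z.re} ∈ 𝓝 (1 : ℂ) :=
      (isOpen_lt continuous_const Complex.continuous_re).mem_nhds (by simp)
    filter_upwards [this] with z hz using tsum_zetaTerm_of_re_pos hz

/-- `ζ(1 + w) - 1 / w` grows slowly in a neighbourhood of the line `Re w = 0`. -/
lemma exists_norm_riemannZeta₀_le {ε : ℝ} (h0 : 0 < ε) (h1 : ε ≤ 1 / 4) :
    ∃ C, 0 ≤ C ∧ ∀ w : ℂ, -ε < w.re → w.re < 1 →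
      ‖riemannZeta₀ (1 + w)‖ ≤ C * (|w.im| + 2) ^ (2 * ε) := by
  set S := ∑' n : ℕ, (n + 1 : ℝ) ^ (-1 - ε)
  have hS0 : 0 ≤ S := tsum_nonneg fun n => by positivity
  refine ⟨2 * S + ‖riemannZeta₀ 1‖, by positivity, fun w hw hw1 => ?_⟩
  have ht : (1 : ℝ) ≤ (|w.im| + 2) ^ (2 * ε) :=
    Real.one_le_rpow (by linarith [abs_nonneg w.im]) (by linarith)
  have h1w : ‖1 + w‖ ≤ |w.im| + 2 := by
    refine (Complex.norm_le_abs_re_add_abs_im _).trans ?_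
    have : |(1 + w).re| ≤ 2 := by rw [abs_le]; constructor <;> simp <;> linarith
    simp at this ⊢; linarith
  by_cases hw0 : w = 0
  · subst hw0
    simp only [add_zero]
    nlinarith [norm_nonneg (riemannZeta₀ 1)]
  · have hs := (((summable_nat_add_one_rpow h0).mul_left (2 * ‖1 + w‖ ^ (2 * ε))).mul_left ‖w‖)
    have hle := tsum_of_norm_bounded hs.hasSum (fun n => norm_zetaTerm_le h0 h1 n hw)
    rw [tsum_zetaTerm h0 h1 hw, norm_mul, tsum_mul_left, tsum_mul_left] at hle
    have hle2 := le_of_mul_le_mul_left hle (norm_pos_iff.2 hw0)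
    refine hle2.trans ?_
    have : ‖1 + w‖ ^ (2 * ε) ≤ (|w.im| + 2) ^ (2 * ε) := by gcongr
    calc 2 * ‖1 + w‖ ^ (2 * ε) * S ≤ 2 * (|w.im| + 2) ^ (2 * ε) * S := by gcongr
      _ ≤ _ := by nlinarith [norm_nonneg (riemannZeta₀ 1)]

end ArithProg

/-! ### Lower bounds for ζ and slow growth of its logarithmic derivative -/

namespace ArithProg

/-- `w ζ(1 + w) / (1 + w)`. -/
noncomputable def zetaQuot (w : ℂ) : ℂ := riemannZeta₁ (1 + w) / (1 + w)

/-- The numerator is 1 + w(ζ(1 + w) - 1/w). Dividing by 1 + w neutralizes the factor w, so only the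
growth of ζ(1 + w) - 1/w remains, and its exponent 2r shrinks with the margin r allowed beyond the
strip. -/
lemma slowGrowth_zetaQuot : SlowGrowth zetaQuot := by
  intro ε hε n
  set r := min (ε / 2) (1 / 4) with hr
  have hr0 : 0 < r := lt_min (by linarith) (by norm_num)
  have hr1 : r ≤ 1 / 4 := min_le_right _ _
  have hr2 : r ≤ ε / 2 := min_le_left _ _
  obtain ⟨C, hC0, hC⟩ := exists_norm_riemannZeta₀_le hr0 hr1
  have hne : ∀ w : ℂ, -r < w.re → 1 + w ≠ 0 := by
    intro w hw h
    have := congrArg Complex.re h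
    simp at this; linarith
  refine PolyGrowth.of_bounded (C := 3 * C + 2) hr0 hε.le ?_ ?_ n
  · intro w hw
    refine DifferentiableAt.differentiableWithinAt ?_
    unfold zetaQuot
    exact DifferentiableAt.div (by fun_prop) (by fun_prop) (hne w hw.1)
  · intro w h1 h2
    have hre : 1 / 2 ≤ ‖1 + w‖ := by
      refine le_trans ?_ (Complex.re_le_norm _)
      simp; linarith
    have hw : ‖w‖ ≤ 3 * ‖1 + w‖ := by
      have : ‖w‖ ≤ ‖1 + w‖ + 1 := by simpa using norm_sub_le (1 + w) 1
      linarith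
    have hT : (1 : ℝ) ≤ (|w.im| + 2) ^ ε :=
      Real.one_le_rpow (by linarith [abs_nonneg w.im]) hε.le
    have hz := hC w h1 (by linarith)
    have hz2 : (|w.im| + 2) ^ (2 * r) ≤ (|w.im| + 2) ^ ε :=
      Real.rpow_le_rpow_of_exponent_le (by linarith [abs_nonneg w.im]) (by linarith)
    rw [zetaQuot, norm_div, div_le_iff₀ (by linarith), riemannZeta₁, add_sub_cancel_left]
    calc ‖1 + w * riemannZeta₀ (1 + w)‖ ≤ 1 + ‖w‖ * ‖riemannZeta₀ (1 + w)‖ := by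
          simpa using norm_add_le 1 (w * riemannZeta₀ (1 + w))
      _ ≤ 2 * ‖1 + w‖ + (3 * ‖1 + w‖) * (C * (|w.im| + 2) ^ ε) := by
          refine add_le_add (by linarith) (mul_le_mul hw (hz.trans ?_) (norm_nonneg _) (by positivity))
          gcongr
      _ ≤ _ := by nlinarith [norm_nonneg (1 + w)]

lemma zetaQuot_ne_zero {w : ℂ} (hw : 0 ≤ w.re) : zetaQuot w ≠ 0 := by
  have h1 : 1 + w ≠ 0 := by
    intro h
    have := congrArg Complex.re h
    simp at this; linarith
  refine div_ne_zero ?_ h1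
  by_cases h0 : w = 0
  · subst h0; simp
  · have := riemannZeta_ne_zero_of_one_le_re (s := 1 + w) (by simpa using hw)
    rw [riemannZeta_eq_inv_sub_mul (by simpa using h0)] at this
    exact right_ne_zero_of_mul this

lemma zetaQuot_eq {w : ℂ} (hw : w ≠ 0) : zetaQuot w = riemannZeta (1 + w) * w / (1 + w) := by
  rw [zetaQuot, riemannZeta_eq_inv_sub_mul (by simpa using hw), add_sub_cancel_left]
  field_simp

/-- The `3`-`4`-`1` inequality for `ζ`. -/
lemma one_le_norm_riemannZeta_product {x : ℝ} (hx : 0 < x) (y : ℝ) :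
    1 ≤ ‖riemannZeta (1 + x)‖ ^ 3 * ‖riemannZeta (1 + (x + y * Complex.I))‖ ^ 4 *
      ‖riemannZeta (1 + (x + (2 * y : ℝ) * Complex.I))‖ := by
  have := DirichletCharacter.norm_LFunction_product_ge_one (N := 1) 1 hx y
  unfold DirichletCharacter.LFunctionTrivChar at this
  simp only [DirichletCharacter.LFunction_modOne_eq, norm_mul, norm_pow] at this
  have e1 : (1 : ℂ) + (x + y * Complex.I) = 1 + x + Complex.I * y := by ring
  have e2 : (1 : ℂ) + (x + (2 * y : ℝ) * Complex.I) = 1 + x + 2 * Complex.I * y := by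
    push_cast; ring
  rw [e1, e2]
  exact this

lemma exists_norm_riemannZeta_le {ε : ℝ} (hε : 0 < ε) :
    ∃ C, 0 < C ∧ ∀ w ∈ strip, 1 ≤ |w.im| → ‖riemannZeta (1 + w)‖ ≤ C * (|w.im| + 2) ^ ε := by
  obtain ⟨C, hC⟩ := (slowGrowth_zetaQuot ε hε 0).2 0 le_rfl
  refine ⟨3 * |C| + 1, by positivity, fun w hw h1 => ?_⟩
  have hw0 : w ≠ 0 := by rintro rfl; simp at h1; linarith
  have hn : 1 ≤ ‖w‖ := h1.trans (Complex.abs_im_le_norm w)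
  have h := hC w hw
  rw [iteratedDeriv_zero, zetaQuot_eq hw0, norm_div, norm_mul] at h
  have h1w : ‖1 + w‖ ≤ 3 * ‖w‖ := (norm_add_le _ _).trans (by simp; linarith)
  have h1w0 : 0 < ‖1 + w‖ := by
    rw [norm_pos_iff]; intro h; have := congrArg Complex.re h; simp at this; linarith [hw.1]
  rw [div_le_iff₀ h1w0] at h
  have hT : (0 : ℝ) ≤ (|w.im| + 2) ^ ε := by positivity
  have h3 : ‖riemannZeta (1 + w)‖ * ‖w‖ ≤ (3 * |C| * (|w.im| + 2) ^ ε) * ‖w‖ := by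
    calc _ ≤ C * (|w.im| + 2) ^ ε * ‖1 + w‖ := h
      _ ≤ |C| * (|w.im| + 2) ^ ε * (3 * ‖w‖) := by gcongr; exact le_abs_self C
      _ = _ := by ring
  have := le_of_mul_le_mul_right h3 (by linarith)
  nlinarith

lemma exists_norm_riemannZeta_le_inv :
    ∃ C, 0 < C ∧ ∀ x : ℝ, 0 < x → x < 1 → ‖riemannZeta (1 + x)‖ ≤ C / x := by
  obtain ⟨C, hC0, hC⟩ := exists_norm_riemannZeta₀_le (ε := 1 / 4) (by norm_num) le_rfl
  refine ⟨1 + C * 2 ^ (2 * (1 / 4 : ℝ)), by positivity, fun x h0 h1 => ?_⟩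
  have := hC x (by simp; linarith) (by simpa using h1)
  simp only [Complex.ofReal_im, abs_zero, zero_add] at this
  rw [riemannZeta_eq_inv_sub_add (by simpa using h0.ne'), add_sub_cancel_left]
  refine (norm_add_le _ _).trans ?_
  rw [norm_inv, Complex.norm_real, Real.norm_of_nonneg h0.le, le_div_iff₀ h0, add_mul,
    inv_mul_cancel₀ h0.ne']
  refine add_le_add le_rfl ?_
  nlinarith [norm_nonneg (riemannZeta₀ (1 + x))]

/-- A lower bound for `ζ` near the line `Re s = 1`, with a power of the distance. -/
lemma exists_le_norm_zetaQuot {ε : ℝ} (hε : 0 < ε) :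
    ∃ c, 0 < c ∧ ∀ w ∈ strip, 1 ≤ |w.im| →
      c * w.re ^ (3 / 4 : ℝ) * (|w.im| + 2) ^ (-ε) ≤ ‖zetaQuot w‖ := by
  obtain ⟨C1, hC1, h1⟩ := exists_norm_riemannZeta_le hε
  obtain ⟨C2, hC2, h2⟩ := exists_norm_riemannZeta_le_inv
  set D := C2 ^ 3 * (C1 * 2 ^ ε) with hD
  have hD0 : 0 < D := by positivity
  refine ⟨(1 / 3) * D ^ (-(1 / 4) : ℝ), by positivity, fun w hw him => ?_⟩
  set x := w.re with hx
  have hx0 : 0 < x := hw.1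
  set τ := |w.im| + 2 with hτ
  have hτ1 : 1 ≤ τ := by linarith
  have hwe : w = x + w.im * Complex.I := (Complex.re_add_im w).symm
  have key := one_le_norm_riemannZeta_product hx0 w.im
  rw [← hwe] at key
  have b2 := h2 x hx0 (by linarith [hw.2])
  have b1 := h1 (x + (2 * w.im : ℝ) * Complex.I) (by
    constructor <;> simp
    · exact hx0
    · simpa using hw.2) (by simp; linarith)
  have b1' : ‖riemannZeta (1 + (x + (2 * w.im : ℝ) * Complex.I))‖ ≤ C1 * 2 ^ ε * τ ^ ε := by
    refine b1.trans ?_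
    rw [mul_assoc, ← Real.mul_rpow (by norm_num) (by linarith)]
    have : |(↑x + ((2 * w.im : ℝ) : ℂ) * Complex.I).im| + 2 ≤ 2 * τ := by
      simp [abs_mul]; linarith
    gcongr
  set z := ‖riemannZeta (1 + w)‖ with hz
  have hz0 : 0 ≤ z := norm_nonneg _
  -- The 3-4-1 inequality with ζ(1 + x) ≪ 1/x and ζ ≪ τ^ε at height 2 Im w; the fourth root produces
  -- the exponent 3/4.
  have k2 : x ^ 3 ≤ D * τ ^ ε * z ^ 4 := by
    have : 1 ≤ (C2 / x) ^ 3 * z ^ 4 * (C1 * 2 ^ ε * τ ^ ε) := by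
      refine key.trans ?_
      gcongr
    rw [div_pow, div_mul_eq_mul_div, div_mul_eq_mul_div, le_div_iff₀ (by positivity)] at this
    calc x ^ 3 ≤ _ := by simpa using this
      _ = _ := by rw [hD]; ring
  have k3 : D ^ (-(1 / 4) : ℝ) * x ^ (3 / 4 : ℝ) * τ ^ (-ε) ≤ z := by
    have hzz : (z ^ 4) ^ (1 / 4 : ℝ) = z := by
      rw [← Real.rpow_natCast, ← Real.rpow_mul hz0]; norm_num
    have hxx : (x ^ 3) ^ (1 / 4 : ℝ) = x ^ (3 / 4 : ℝ) := by
      rw [← Real.rpow_natCast, ← Real.rpow_mul hx0.le]; norm_num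
    have := Real.rpow_le_rpow (by positivity) k2 (show (0 : ℝ) ≤ 1 / 4 by norm_num)
    rw [Real.mul_rpow (by positivity) (by positivity), Real.mul_rpow hD0.le (by positivity),
      hzz, hxx, ← Real.rpow_mul (by linarith)] at this
    have e1 : D ^ (-(1 / 4) : ℝ) * D ^ (1 / 4 : ℝ) = 1 := by
      rw [← Real.rpow_add hD0]; norm_num
    have e2 : τ ^ (-ε) * τ ^ (ε * (1 / 4)) ≤ 1 := by
      rw [← Real.rpow_add (by linarith)]
      exact Real.rpow_le_one_of_one_le_of_nonpos hτ1 (by linarith)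
    calc D ^ (-(1 / 4) : ℝ) * x ^ (3 / 4 : ℝ) * τ ^ (-ε)
        ≤ D ^ (-(1 / 4) : ℝ) * (D ^ (1 / 4 : ℝ) * τ ^ (ε * (1 / 4)) * z) * τ ^ (-ε) := by gcongr
      _ = (D ^ (-(1 / 4) : ℝ) * D ^ (1 / 4 : ℝ)) * (τ ^ (-ε) * τ ^ (ε * (1 / 4))) * z := by ring
      _ ≤ 1 * 1 * z := by rw [e1]; gcongr
      _ = z := by ring
  have hw0 : w ≠ 0 := by rintro rfl; simp at hx; linarith
  have hn : 1 ≤ ‖w‖ := him.trans (Complex.abs_im_le_norm w)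
  have h1w : ‖1 + w‖ ≤ 3 * ‖w‖ := (norm_add_le _ _).trans (by simp; linarith)
  have h1w0 : 0 < ‖1 + w‖ := by
    rw [norm_pos_iff]; intro h; have := congrArg Complex.re h; simp at this; linarith [hw.1]
  rw [zetaQuot_eq hw0, norm_div, norm_mul, le_div_iff₀ h1w0]
  calc 1 / 3 * D ^ (-(1 / 4) : ℝ) * x ^ (3 / 4 : ℝ) * τ ^ (-ε) * ‖1 + w‖
      = 1 / 3 * (D ^ (-(1 / 4) : ℝ) * x ^ (3 / 4 : ℝ) * τ ^ (-ε)) * ‖1 + w‖ := by ring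
    _ ≤ 1 / 3 * z * (3 * ‖w‖) := by gcongr
    _ = _ := by ring

lemma convex_strip : Convex ℝ strip :=
  (convex_halfSpace_re_gt _).inter (convex_halfSpace_re_lt _)

/-- The 3-4-1 bound degenerates only like (Re w)^(3/4), with an exponent below 1, whereas moving
horizontally by x₀ changes `zetaQuot` by at most x₀ τ^η. So the lower bound at a suitable abscissa
x₀ survives all the way to Re w = 0. -/
lemma exists_norm_inv_zetaQuot_le_of_one_le {ε : ℝ} (hε : 0 < ε) :
    ∃ C, 0 ≤ C ∧ ∀ w ∈ strip, 1 ≤ |w.im| → ‖(zetaQuot w)⁻¹‖ ≤ C * (|w.im| + 2) ^ ε := by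
  set η := ε / 7 with hη
  have hη0 : 0 < η := by positivity
  obtain ⟨c, hc, hlow⟩ := exists_le_norm_zetaQuot hη0
  obtain ⟨C3', hC3'⟩ := (slowGrowth_zetaQuot η hη0 1).2 1 le_rfl
  set C3 := |C3'| + 1
  have hC30 : 0 < C3 := by positivity
  set q := min (c / (2 * C3)) (1 / 2) with hq
  have hq0 : 0 < q := lt_min (by positivity) (by norm_num)
  have hq1 : q ≤ 1 / 2 := min_le_right _ _
  have hq2 : C3 * q ≤ c / 2 := by
    have : q ≤ c / (2 * C3) := min_le_left _ _
    calc C3 * q ≤ C3 * (c / (2 * C3)) := by gcongr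
      _ = c / 2 := by field_simp
  refine ⟨(c / 2 * q ^ 3)⁻¹, by positivity, fun w hw him => ?_⟩
  set τ := |w.im| + 2 with hτ
  have hτ1 : 1 ≤ τ := by linarith
  have hτ0 : 0 < τ := by linarith
  -- At x₀ the lower bound is c q³ τ^(-7η), and the horizontal variation is at most C3 q · q³
  -- τ^(-7η), at most half of it by the choice of q. Since η = ε/7 the result is τ^(-ε).
  set x₀ := q ^ 4 * τ ^ (-(8 * η)) with hx₀
  have hx₀0 : 0 < x₀ := by positivity
  have hx₀1 : x₀ < 1 / 2 := by
    have h1 : τ ^ (-(8 * η)) ≤ 1 := Real.rpow_le_one_of_one_le_of_nonpos hτ1 (by linarith)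
    have h2 : q ^ 4 ≤ (1 / 2) ^ 4 := by gcongr
    nlinarith [pow_pos hq0 4]
  have hx34 : x₀ ^ (3 / 4 : ℝ) = q ^ 3 * τ ^ (-(6 * η)) := by
    rw [hx₀, Real.mul_rpow (by positivity) (by positivity), ← Real.rpow_natCast,
      ← Real.rpow_mul hq0.le, ← Real.rpow_mul hτ0.le, ← Real.rpow_natCast]
    norm_num; left; ring_nf
  suffices H : c / 2 * q ^ 3 * τ ^ (-ε) ≤ ‖zetaQuot w‖ by
    rw [norm_inv]
    have hp : 0 < c / 2 * q ^ 3 * τ ^ (-ε) := by positivity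
    refine (inv_anti₀ hp H).trans (le_of_eq ?_)
    rw [mul_inv, Real.rpow_neg hτ0.le, inv_inv]
  have hpow : τ ^ (-(6 * η)) * τ ^ (-η) = τ ^ (-ε) := by
    rw [← Real.rpow_add hτ0]; congr 1; rw [hη]; ring
  rcases le_total x₀ w.re with hcase | hcase
  · refine le_trans ?_ (hlow w hw him)
    have : x₀ ^ (3 / 4 : ℝ) ≤ w.re ^ (3 / 4 : ℝ) := by gcongr
    calc c / 2 * q ^ 3 * τ ^ (-ε) = c / 2 * x₀ ^ (3 / 4 : ℝ) * τ ^ (-η) := by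
          rw [hx34, ← hpow]; ring
      _ ≤ c * w.re ^ (3 / 4 : ℝ) * τ ^ (-η) := by
          gcongr; linarith
  · set w₀ : ℂ := x₀ + w.im * Complex.I with hw₀
    have hw₀re : w₀.re = x₀ := by simp [hw₀]
    have hw₀im : w₀.im = w.im := by simp [hw₀]
    have hw₀s : w₀ ∈ strip := ⟨by rw [hw₀re]; exact hx₀0, by rw [hw₀re]; exact hx₀1⟩
    have hl := hlow w₀ hw₀s (by rw [hw₀im]; exact him)
    rw [hw₀re, hw₀im, ← hτ, hx34] at hl
    have hmv := Convex.norm_image_sub_le_of_norm_deriv_le (f := zetaQuot)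
      (s := strip ∩ {z | z.im = w.im}) (C := C3 * τ ^ η) (x := w) (y := w₀)
      (fun z hz => (slowGrowth_zetaQuot 1 one_pos 0).diffAt hz.1) ?_
      (convex_strip.inter (fun a ha b hb s t _ _ hst => by
        simp only [Set.mem_ofPred_eq] at ha hb ⊢
        simp [ha, hb, ← add_mul, hst])) ⟨hw, rfl⟩ ⟨hw₀s, hw₀im⟩
    · have hd : ‖w₀ - w‖ ≤ x₀ := by
        have : w₀ - w = ((x₀ - w.re : ℝ) : ℂ) := by
          apply Complex.ext <;> simp [hw₀]
        rw [this, Complex.norm_real, Real.norm_of_nonneg (by linarith)]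
        linarith [hw.1]
      have h5 : ‖zetaQuot w₀ - zetaQuot w‖ ≤ c / 2 * q ^ 3 * τ ^ (-ε) := by
        refine hmv.trans ?_
        calc C3 * τ ^ η * ‖w₀ - w‖ ≤ C3 * τ ^ η * x₀ := by gcongr
          _ = (C3 * q) * q ^ 3 * (τ ^ η * τ ^ (-(8 * η))) := by rw [hx₀]; ring
          _ = (C3 * q) * q ^ 3 * τ ^ (-ε) := by
            rw [← Real.rpow_add hτ0]; congr 2; rw [hη]; ring
          _ ≤ _ := by gcongr
      have h6 : ‖zetaQuot w₀‖ ≤ ‖zetaQuot w₀ - zetaQuot w‖ + ‖zetaQuot w‖ := by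
        simpa using norm_add_le (zetaQuot w₀ - zetaQuot w) (zetaQuot w)
      have h7 : c * (q ^ 3 * τ ^ (-(6 * η))) * τ ^ (-η) = c * q ^ 3 * τ ^ (-ε) := by
        rw [← hpow]; ring
      rw [h7] at hl
      linarith
    · intro z hz
      have := hC3' z hz.1
      rw [iteratedDeriv_one, hz.2] at this
      refine this.trans ?_
      gcongr
      linarith [le_abs_self C3']

/-- For |Im w| ≤ 1 a compactness argument suffices, as `zetaQuot` has no zero on the closed
half-plane Re w ≥ 0. -/
lemma exists_norm_inv_zetaQuot_le {ε : ℝ} (hε : 0 < ε) :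
    ∃ C, ∀ w ∈ strip, ‖(zetaQuot w)⁻¹‖ ≤ C * (|w.im| + 2) ^ ε := by
  obtain ⟨C, hC0, hC⟩ := exists_norm_inv_zetaQuot_le_of_one_le hε
  have hK : IsCompact (Set.Icc (0 : ℝ) (1 / 2) ×ℂ Set.Icc (-1 : ℝ) 1) :=
    isCompact_Icc.reProdIm isCompact_Icc
  have hcont : ContinuousOn (fun w => (zetaQuot w)⁻¹)
      (Set.Icc (0 : ℝ) (1 / 2) ×ℂ Set.Icc (-1 : ℝ) 1) := by
    refine ContinuousOn.inv₀ (fun w hw => ?_) fun w hw => zetaQuot_ne_zero hw.1.1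
    have h1 : 1 + w ≠ 0 := by
      intro h
      have h2 := congrArg Complex.re h
      have h3 := hw.1.1
      simp at h2 h3; linarith
    refine ContinuousAt.continuousWithinAt ?_
    unfold zetaQuot
    refine ContinuousAt.div ?_ (by fun_prop) h1
    exact (differentiable_riemannZeta₁.continuous.comp (by fun_prop)).continuousAt
  obtain ⟨B, hB⟩ := hK.exists_bound_of_continuousOn hcont
  refine ⟨|B| + C, fun w hw => ?_⟩
  have hT : (1 : ℝ) ≤ (|w.im| + 2) ^ ε :=
    Real.one_le_rpow (by linarith [abs_nonneg w.im]) hε.le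
  rcases le_total 1 |w.im| with h | h
  · refine (hC w hw h).trans ?_
    gcongr; linarith [abs_nonneg B]
  · refine (hB w ⟨⟨hw.1.le, hw.2.le⟩, abs_le.1 h⟩).trans ?_
    nlinarith [le_abs_self B, abs_nonneg B]

/-- The logarithmic derivative equals that of `zetaQuot` plus 1/(1 + w), and both parts grow slowly.
-/
lemma slowGrowth_logDeriv_riemannZeta₁ :
    SlowGrowth (fun w => deriv riemannZeta₁ (1 + w) / riemannZeta₁ (1 + w)) := by
  have h1 := slowGrowth_zetaQuot.inv (fun w hw => zetaQuot_ne_zero hw.1.le)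
    fun ε hε => exists_norm_inv_zetaQuot_le hε
  have h2 : SlowGrowth (fun w : ℂ => (1 + w)⁻¹) := by
    have hne : ∀ w : ℂ, -(1 / 4) < w.re → 1 + w ≠ 0 := by
      intro w hw h
      have := congrArg Complex.re h
      simp at this; linarith
    refine SlowGrowth.of_bounded (r := 1 / 4) (C := 2) (by norm_num) ?_ ?_
    · intro w hw
      refine DifferentiableAt.differentiableWithinAt ?_
      exact DifferentiableAt.inv (by fun_prop) (hne w hw.1)
    · intro w h1 _
      rw [norm_inv]
      refine inv_le_of_inv_le₀ (by norm_num) ((le_trans ?_ (Complex.re_le_norm _)))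
      simp; linarith
  refine ((slowGrowth_zetaQuot.deriv.mul h1).add h2).congr fun w hw => ?_
  have hne : 1 + w ≠ 0 := by
    intro h
    have := congrArg Complex.re h
    simp at this; linarith [hw.1]
  have hz : riemannZeta₁ (1 + w) ≠ 0 := by
    have := zetaQuot_ne_zero hw.1.le
    rw [zetaQuot] at this
    exact fun h => this (by rw [h, zero_div])
  have hd : HasDerivAt (fun w => riemannZeta₁ (1 + w)) (deriv riemannZeta₁ (1 + w)) w := by
    have := (differentiable_riemannZeta₁ (1 + w)).hasDerivAt.comp_const_add 1 w
    exact this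
  have hd2 : HasDerivAt zetaQuot _ w := hd.div ((hasDerivAt_id w).const_add 1) hne
  show _ = deriv zetaQuot w * (zetaQuot w)⁻¹ + (1 + w)⁻¹
  rw [hd2.deriv, zetaQuot]
  field_simp
  ring

end ArithProg

/-! ### Abel summation and Dirichlet series over primes -/

namespace ArithProg

section Abel

lemma sum_range_mul_antitone_eq (c : ℕ → ℂ) (v : ℕ → ℝ) (N : ℕ) :
    ∑ i ∈ Finset.range N, c i * v i = v N * ∑ i ∈ Finset.range N, c i +
      ∑ i ∈ Finset.range N, ((v i - v (i + 1) : ℝ) : ℂ) * ∑ j ∈ Finset.range (i + 1), c j := by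
  induction N with
  | zero => simp
  | succ n ih =>
    rw [Finset.sum_range_succ, ih, Finset.sum_range_succ (fun i => ((v i - v (i + 1) : ℝ) : ℂ) * _),
      Finset.sum_range_succ c n]
    push_cast; ring

lemma norm_sum_range_mul_antitone_le {c : ℕ → ℂ} {v : ℕ → ℝ} {B : ℝ} (hv : Antitone v)
    (hv0 : ∀ i, 0 ≤ v i) (hB : ∀ N, ‖∑ i ∈ Finset.range N, c i‖ ≤ B) (N : ℕ) :
    ‖∑ i ∈ Finset.range N, c i * v i‖ ≤ B * v 0 := by
  rw [sum_range_mul_antitone_eq]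
  have h1 : ‖(v N : ℂ) * ∑ i ∈ Finset.range N, c i‖ ≤ v N * B := by
    rw [norm_mul, Complex.norm_real, Real.norm_of_nonneg (hv0 N)]
    exact mul_le_mul_of_nonneg_left (hB N) (hv0 N)
  have h2 : ‖∑ i ∈ Finset.range N, ((v i - v (i + 1) : ℝ) : ℂ) *
      ∑ j ∈ Finset.range (i + 1), c j‖ ≤ ∑ i ∈ Finset.range N, (v i - v (i + 1)) * B := by
    refine (norm_sum_le _ _).trans (Finset.sum_le_sum fun i _ => ?_)
    have : 0 ≤ v i - v (i + 1) := sub_nonneg.2 (hv i.le_succ)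
    rw [norm_mul, Complex.norm_real, Real.norm_of_nonneg this]
    exact mul_le_mul_of_nonneg_left (hB _) this
  rw [← Finset.sum_mul, Finset.sum_range_sub'] at h2
  refine (norm_add_le _ _).trans ((add_le_add h1 h2).trans (le_of_eq (by ring)))

lemma norm_tsum_mul_antitone_le {c : ℕ → ℂ} {v : ℕ → ℝ} {B : ℝ} (hv : Antitone v)
    (hv0 : ∀ i, 0 ≤ v i) (hB : ∀ N, ‖∑ i ∈ Finset.range N, c i‖ ≤ B)
    (hs : Summable fun i => c i * v i) :
    ‖∑' i, c i * v i‖ ≤ B * v 0 :=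
  le_of_tendsto hs.hasSum.tendsto_sum_nat.norm
    (Eventually.of_forall fun N => norm_sum_range_mul_antitone_le hv hv0 hB N)

/-- The weight `n ^ (-σ)`, with the value `1` at `n = 0`. -/
noncomputable def powWeight (σ : ℝ) (n : ℕ) : ℝ := if n = 0 then 1 else (n : ℝ) ^ (-σ)

lemma powWeight_nonneg (σ : ℝ) (n : ℕ) : 0 ≤ powWeight σ n := by
  unfold powWeight; split_ifs <;> positivity

lemma powWeight_antitone {σ : ℝ} (hσ : 0 ≤ σ) : Antitone (powWeight σ) := by
  refine antitone_nat_of_succ_le fun n => ?_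
  unfold powWeight
  rw [if_neg n.succ_ne_zero]
  split_ifs with h
  · exact Real.rpow_le_one_of_one_le_of_nonpos (by simp) (by linarith)
  · have : (0 : ℝ) < n := by exact_mod_cast Nat.pos_of_ne_zero h
    exact Real.rpow_le_rpow_of_nonpos this (by simp) (by linarith)

lemma term_eq_mul_powWeight (f : ℕ → ℂ) (w : ℂ) (n : ℕ) :
    LSeries.term f w n = LSeries.term f (w.im * Complex.I) n * powWeight w.re n := by
  unfold LSeries.term powWeight
  split_ifs with h
  · simp
  · have hn : (n : ℂ) ≠ 0 := by exact_mod_cast h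
    have e : w = w.re + w.im * Complex.I := (Complex.re_add_im w).symm
    conv_lhs => rw [e, Complex.cpow_add _ _ hn]
    rw [Complex.ofReal_cpow (by positivity), Complex.ofReal_neg, Complex.cpow_neg]
    simp only [Complex.ofReal_natCast]
    field_simp

/-- The weights n^(-Re w) decrease from 1, so by Abel summation bounds for partial sums on the line
Re w = 0 hold for the series to the right of it. This is how the bounds of Hypothesis 3, stated on
the line, enter the strip. -/
lemma norm_LSeries_le_of_partial_sums {f : ℕ → ℂ} {w : ℂ} {B : ℝ} (hw : 0 ≤ w.re)
    (hB : ∀ N, ‖∑ i ∈ Finset.range N, LSeries.term f (w.im * Complex.I) i‖ ≤ B)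
    (hs : LSeriesSummable f w) : ‖LSeries f w‖ ≤ B := by
  have h := norm_tsum_mul_antitone_le (powWeight_antitone hw) (powWeight_nonneg _) hB
    (hs.congr fun n => (term_eq_mul_powWeight f w n))
  rw [LSeries, tsum_congr (term_eq_mul_powWeight f w)]
  simpa [powWeight] using h

end Abel

/-- The coefficients `c(p) / p` on primes. -/
noncomputable def primeCoeff (c : ℕ → ℝ) (n : ℕ) : ℂ := if n.Prime then ((c n / n : ℝ) : ℂ) else 0

lemma abscissa_primeCoeff_le {c : ℕ → ℝ}
    (hc : ∀ ε > (0 : ℝ), ∃ C, ∀ p : ℕ, p.Prime → |c p| ≤ C * (p : ℝ) ^ ε) :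
    LSeries.abscissaOfAbsConv (primeCoeff c) ≤ 0 := by
  refine EReal.le_of_forall_lt_iff_le.1 fun ε hε => ?_
  have hε0 : 0 < ε := by exact_mod_cast hε
  obtain ⟨C, hC⟩ := hc ε hε0
  have := LSeries.abscissaOfAbsConv_le_of_le_const_mul_rpow (f := primeCoeff c) (x := ε - 1)
    ⟨|C|, fun n hn => ?_⟩
  · have e : ((ε - 1 : ℝ) : EReal) + 1 = ε := by
      rw [← EReal.coe_one, ← EReal.coe_add, sub_add_cancel]
    rwa [e] at this
  · have hn0 : (0 : ℝ) < n := by exact_mod_cast Nat.pos_of_ne_zero hn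
    unfold primeCoeff
    split_ifs with hp
    · rw [Complex.norm_real, Real.norm_eq_abs, abs_div, abs_of_pos hn0, Real.rpow_sub_one hn0.ne',
        ← mul_div_assoc]
      gcongr
      exact (hC n hp).trans (by gcongr; exact le_abs_self C)
    · simp; positivity

lemma lseriesSummable_of_abscissa {f : ℕ → ℂ} (hf : LSeries.abscissaOfAbsConv f ≤ 0) {w : ℂ}
    (hw : 0 < w.re) : LSeriesSummable f w :=
  LSeriesSummable_of_abscissaOfAbsConv_lt_re (hf.trans_lt (by exact_mod_cast hw))

lemma logMul_iterate (f : ℕ → ℂ) (m n : ℕ) :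
    (LSeries.logMul^[m] f) n = (Real.log n : ℂ) ^ m * f n := by
  induction m with
  | zero => simp
  | succ m ih =>
    rw [Function.iterate_succ_apply', LSeries.logMul, ih, pow_succ', Complex.natCast_log]
    ring

/-- `∑_p p^{-1-w}`. -/
noncomputable def primeZeta (w : ℂ) : ℂ := LSeries (primeCoeff fun _ => 1) w

/-- `∑_p p^{-1-σ}` for real `σ`. -/
noncomputable def primeZetaReal (σ : ℝ) : ℝ :=
  ∑' n : ℕ, if n.Prime then (n : ℝ) ^ (-1 - σ) else 0

/-- `∑_p (h(p) - k) p^{-1-w}`. -/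
noncomputable def primeDev (h : ArithmeticFunction ℝ) (k : ℝ) (w : ℂ) : ℂ :=
  LSeries (primeCoeff fun n => h n - k) w

section Dev

variable {h : ArithmeticFunction ℝ} {k : ℝ}

lemma PrimeHyp.exists_abs_sub_le (hyp : PrimeHyp h k) {ε : ℝ} (hε : 0 < ε) :
    ∃ C, ∀ p : ℕ, p.Prime → |h p - k| ≤ C * (p : ℝ) ^ ε := by
  obtain ⟨C, hC⟩ := hyp.growth ε hε
  refine ⟨C + |k|, fun p hp => ?_⟩
  have h1 : (1 : ℝ) ≤ (p : ℝ) ^ ε := Real.one_le_rpow (by exact_mod_cast hp.one_le) hε.le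
  calc |h p - k| ≤ |h p| + |k| := abs_sub _ _
    _ ≤ C * (p : ℝ) ^ ε + |k| * (p : ℝ) ^ ε :=
      add_le_add (hC p hp.one_le) (le_mul_of_one_le_right (abs_nonneg k) h1)
    _ = _ := by ring

lemma PrimeHyp.abscissa_le (hyp : PrimeHyp h k) :
    LSeries.abscissaOfAbsConv (primeCoeff fun n => h n - k) ≤ 0 :=
  abscissa_primeCoeff_le fun _ hε => hyp.exists_abs_sub_le hε

lemma sum_range_primeTerm (g : ℕ → ℂ) (N : ℕ) (hg : ∀ n, ¬ n.Prime → g n = 0) :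
    ∑ i ∈ Finset.range (N + 1), g i = ∑ p ∈ primesUpTo N, g p := by
  rw [primesUpTo, Finset.sum_filter]
  exact Finset.sum_congr rfl fun i _ => by split_ifs with hp; exacts [rfl, hg i hp]

/-- Each differentiation of ∑ (h(p) - k) p^(-1-w) brings down a factor log p, so these bounds for n
≥ 1 control all derivatives of its first derivative. -/
lemma PrimeHyp.exists_norm_LSeries_logMul_le (hyp : PrimeHyp h k) {n : ℕ} (hn : 1 ≤ n) {ε : ℝ}
    (hε : 0 < ε) : ∃ C, ∀ w : ℂ, 0 < w.re →
      ‖LSeries (LSeries.logMul^[n] (primeCoeff fun n => h n - k)) w‖ ≤ C * (|w.im| + 2) ^ ε := by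
  obtain ⟨C, hC⟩ := hyp.bound_log n hn ε hε
  refine ⟨|C|, fun w hw => norm_LSeries_le_of_partial_sums hw.le (fun N => ?_) ?_⟩
  · rcases N with _ | N
    · simp; positivity
    · rw [sum_range_primeTerm]
      · refine le_trans (le_of_eq ?_) ((hC N w.im).trans (by gcongr; exact le_abs_self C))
        congr 1
        refine Finset.sum_congr rfl fun p hp => ?_
        have hpp : p.Prime := (Finset.mem_filter.1 hp).2
        have hp0 : (p : ℂ) ≠ 0 := by exact_mod_cast hpp.ne_zero
        rw [LSeries.term_of_ne_zero hpp.ne_zero, logMul_iterate, primeCoeff, if_pos hpp,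
          Complex.cpow_add _ _ hp0, Complex.cpow_one]
        push_cast
        field_simp
      · intro i hi
        simp [LSeries.term, logMul_iterate, primeCoeff, hi]
  · exact lseriesSummable_of_abscissa (by simpa using hyp.abscissa_le) hw

lemma PrimeHyp.differentiableOn_primeDev (hyp : PrimeHyp h k) :
    DifferentiableOn ℂ (primeDev h k) {w | 0 < w.re} :=
  (LSeries_differentiableOn _).mono fun w hw => hyp.abscissa_le.trans_lt (by exact_mod_cast hw)

lemma PrimeHyp.slowGrowth_deriv_primeDev (hyp : PrimeHyp h k) :
    SlowGrowth (deriv (primeDev h k)) := by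
  intro ε hε n
  refine ⟨(hyp.differentiableOn_primeDev.mono fun w hw => hw.1).deriv isOpen_strip,
    fun j _ => ?_⟩
  obtain ⟨C, hC⟩ := hyp.exists_norm_LSeries_logMul_le (n := j + 1) (by omega) hε
  refine ⟨C, fun w hw => ?_⟩
  rw [← iteratedDeriv_succ']
  have : iteratedDeriv (j + 1) (primeDev h k) w = _ :=
    LSeries_iteratedDeriv (j + 1) (hyp.abscissa_le.trans_lt (by exact_mod_cast hw.1))
  rw [this, norm_mul, norm_pow, norm_neg, norm_one, one_pow, one_mul]
  exact hC w hw.1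

/-- `∑_p (h(p) - k) p^{-1-σ}` stays bounded for `σ > 0`. -/
lemma PrimeHyp.exists_norm_primeDev_real_le (hyp : PrimeHyp h k) :
    ∃ C, ∀ σ : ℝ, 0 < σ → ‖primeDev h k σ‖ ≤ C := by
  obtain ⟨S, hS⟩ := hyp.convergent
  obtain ⟨B, hB⟩ := (Metric.isBounded_range_of_tendsto _ hS).exists_norm_le
  refine ⟨|B|, fun σ hσ => norm_LSeries_le_of_partial_sums (by simpa using hσ.le) (fun N => ?_)
    (lseriesSummable_of_abscissa hyp.abscissa_le (by simpa using hσ))⟩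
  rcases N with _ | N
  · simp
  · rw [sum_range_primeTerm]
    · refine le_trans (le_of_eq ?_) ((hB _ ⟨N, rfl⟩).trans (le_abs_self B))
      rw [← Complex.norm_real]
      congr 1
      push_cast
      refine Finset.sum_congr rfl fun p hp => ?_
      have hpp : p.Prime := (Finset.mem_filter.1 hp).2
      rw [LSeries.term_of_ne_zero hpp.ne_zero, primeCoeff, if_pos hpp]
      simp
    · intro i hi
      simp [LSeries.term, primeCoeff, hi]

end Dev

lemma norm_primeCoeff_term (c : ℕ → ℝ) (w : ℂ) (n : ℕ) :
    ‖LSeries.term (primeCoeff c) w n‖ = if n.Prime then |c n| * (n : ℝ) ^ (-1 - w.re) else 0 := by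
  unfold LSeries.term primeCoeff
  by_cases hp : n.Prime
  · have hn0 : (0 : ℝ) < n := by exact_mod_cast hp.pos
    rw [if_neg hp.ne_zero, if_pos hp, if_pos hp, norm_div, Complex.norm_real,
      Complex.norm_natCast_cpow_of_pos hp.pos, Real.norm_eq_abs, abs_div, abs_of_pos hn0,
      Real.rpow_sub hn0, Real.rpow_neg_one]
    field_simp
  · simp [hp]

lemma abscissa_primeOne : LSeries.abscissaOfAbsConv (primeCoeff fun _ => 1) ≤ 0 := by
  refine abscissa_primeCoeff_le fun ε hε => ⟨1, fun p hp => ?_⟩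
  simpa using Real.one_le_rpow (x := p) (by exact_mod_cast hp.one_le) hε.le

lemma summable_prime_rpow {σ : ℝ} (hσ : 0 < σ) :
    Summable fun n : ℕ => if n.Prime then (n : ℝ) ^ (-1 - σ) else 0 := by
  have := (lseriesSummable_of_abscissa abscissa_primeOne (w := σ) (by simpa using hσ)).norm
  refine this.congr fun n => ?_
  rw [norm_primeCoeff_term]; simp

lemma norm_primeZeta_le {w : ℂ} (hw : 0 < w.re) : ‖primeZeta w‖ ≤ primeZetaReal w.re := by
  have := norm_tsum_le_tsum_norm (lseriesSummable_of_abscissa abscissa_primeOne hw).norm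
  refine this.trans (le_of_eq (tsum_congr fun n => ?_))
  rw [norm_primeCoeff_term]; simp

/-- Sums over primes of functions holomorphic slightly beyond the line `Re w = 0`. -/
lemma primeSum_holomorphic {r : ℝ} (hr : 0 < r) {u : ℕ → ℝ} (hu : Summable u) {f : ℕ → ℂ → ℂ}
    (hd : ∀ n, DifferentiableOn ℂ (f n) {w | -r < w.re})
    (hb : ∀ n w, -r < w.re → ‖f n w‖ ≤ u n) :
    DifferentiableOn ℂ (fun w => ∑' n, f n w) {w | -r < w.re} ∧
    (∀ w, -r < w.re → ‖∑' n, f n w‖ ≤ ∑' n, u n) ∧ SlowGrowth (fun w => ∑' n, f n w) := by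
  have h1 : DifferentiableOn ℂ (fun w => ∑' n, f n w) {w | -r < w.re} :=
    Complex.differentiableOn_tsum_of_summable_norm hu hd
      (isOpen_lt continuous_const Complex.continuous_re) hb
  have h2 : ∀ w, -r < w.re → ‖∑' n, f n w‖ ≤ ∑' n, u n := fun w hw =>
    tsum_of_norm_bounded hu.hasSum fun n => hb n w hw
  exact ⟨h1, h2, SlowGrowth.of_bounded hr (h1.mono fun w hw => hw.1) fun w hw _ => h2 w hw⟩

/-- The contribution of the proper prime powers to `log ζ(1 + w)`. -/
noncomputable def primePowTerm (n : ℕ) (w : ℂ) : ℂ :=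
  if n.Prime then -Complex.log (1 - (n : ℂ) ^ (-(1 + w))) - (n : ℂ) ^ (-(1 + w)) else 0

lemma norm_log_one_add_sub_self_le_sq {z : ℂ} (hz : ‖z‖ ≤ 3 / 4) :
    ‖Complex.log (1 + z) - z‖ ≤ 2 * ‖z‖ ^ 2 := by
  refine (Complex.norm_log_one_add_sub_self_le (by linarith)).trans ?_
  have : (1 - ‖z‖)⁻¹ ≤ 4 := inv_le_of_inv_le₀ (by norm_num) (by linarith)
  nlinarith [sq_nonneg ‖z‖]

lemma norm_prime_cpow_le {p : ℕ} (hp : p.Prime) {w : ℂ} (hw : -(1 / 8) < w.re) :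
    ‖(p : ℂ) ^ (-(1 + w))‖ ≤ (p : ℝ) ^ (-(7 / 8) : ℝ) := by
  rw [Complex.norm_natCast_cpow_of_pos hp.pos]
  exact Real.rpow_le_rpow_of_exponent_le (by exact_mod_cast hp.one_le) (by simp; linarith)

/-- Keeps p^(-1-w) at distance from 1 for Re w > -1/8, so that the principal logarithm of 1 -
p^(-1-w) is holomorphic there. -/
lemma prime_rpow_le {p : ℕ} (hp : p.Prime) : (p : ℝ) ^ (-(7 / 8) : ℝ) ≤ 3 / 4 := by
  have h2 : (2 : ℝ) ≤ p := by exact_mod_cast hp.two_le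
  calc (p : ℝ) ^ (-(7 / 8) : ℝ) ≤ 2 ^ (-(7 / 8) : ℝ) :=
        Real.rpow_le_rpow_of_nonpos (by norm_num) h2 (by norm_num)
    _ ≤ 2 ^ (-(1 / 2) : ℝ) := Real.rpow_le_rpow_of_exponent_le (by norm_num) (by norm_num)
    _ ≤ 3 / 4 := by
      rw [Real.rpow_neg (by norm_num), ← Real.sqrt_eq_rpow]
      refine inv_le_of_inv_le₀ (by norm_num) (Real.le_sqrt_of_sq_le (by norm_num))

/-- The difference between -log(1 - z) and z is of second order, and |z|² ≤ n^(-7/4) is summable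
even a little to the left of Re w = 0. -/
lemma primePowTerm_bounds : (∀ n, DifferentiableOn ℂ (primePowTerm n) {w | -(1 / 8) < w.re}) ∧
    ∀ n w, -(1 / 8) < w.re → ‖primePowTerm n w‖ ≤ 2 * (n : ℝ) ^ (-(7 / 4) : ℝ) := by
  constructor
  · intro n
    unfold primePowTerm
    by_cases hp : n.Prime
    · simp only [hp, if_true]
      have hn : (n : ℂ) ≠ 0 := by exact_mod_cast hp.ne_zero
      have hd : Differentiable ℂ fun w : ℂ => (n : ℂ) ^ (-(1 + w)) :=
        Differentiable.const_cpow (by fun_prop) (Or.inl hn)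
      refine DifferentiableOn.sub (DifferentiableOn.neg ?_) hd.differentiableOn
      refine DifferentiableOn.clog (hd.const_sub 1).differentiableOn fun w hw => ?_
      have := (norm_prime_cpow_le hp hw).trans (prime_rpow_le hp)
      refine Or.inl ?_
      have h2 := (Complex.re_le_norm ((n : ℂ) ^ (-(1 + w)))).trans this
      simp only [Complex.sub_re, Complex.one_re]; linarith
    · simp [hp]
  · intro n w hw
    unfold primePowTerm
    split_ifs with hp
    · set z := (n : ℂ) ^ (-(1 + w))
      have h1 := norm_prime_cpow_le hp hw
      have h2 := norm_log_one_add_sub_self_le_sq (z := -z) (by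
        rw [norm_neg]; exact h1.trans (prime_rpow_le hp))
      have e : -Complex.log (1 - z) - z = -(Complex.log (1 + -z) - -z) := by ring_nf
      rw [e, norm_neg]
      refine h2.trans ?_
      rw [norm_neg]
      have : ((n : ℝ) ^ (-(7 / 8) : ℝ)) ^ 2 = (n : ℝ) ^ (-(7 / 4) : ℝ) := by
        rw [← Real.rpow_natCast, ← Real.rpow_mul (by positivity)]; norm_num
      rw [← this]
      gcongr
    · simp; positivity

lemma summable_two_mul_rpow : Summable fun n : ℕ => 2 * (n : ℝ) ^ (-(7 / 4) : ℝ) :=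
  (Real.summable_nat_rpow.2 (by norm_num)).mul_left 2

/-- `∑_p ∑_{m ≥ 2} p^{-m(1+w)} / m`. -/
noncomputable def primePowSum (w : ℂ) : ℂ := ∑' n, primePowTerm n w

lemma primePowSum_holomorphic :
    DifferentiableOn ℂ primePowSum {w | -(1 / 8) < w.re} ∧
    (∀ w, -(1 / 8) < w.re → ‖primePowSum w‖ ≤ ∑' n : ℕ, 2 * (n : ℝ) ^ (-(7 / 4) : ℝ)) ∧
    SlowGrowth primePowSum :=
  primeSum_holomorphic (by norm_num) summable_two_mul_rpow primePowTerm_bounds.1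
    primePowTerm_bounds.2

/-- The Euler product in logarithmic form: `primeZeta` carries the singularity of log ζ(1 + w),
while `primePowSum` is holomorphic beyond the line. -/
lemma exp_primeZeta_add {w : ℂ} (hw : 0 < w.re) :
    Complex.exp (primeZeta w + primePowSum w) = riemannZeta (1 + w) := by
  rw [← riemannZeta_eulerProduct_exp_log (by simpa using hw)]
  congr 1
  have h1 := (lseriesSummable_of_abscissa abscissa_primeOne hw)
  have h2 : Summable fun n => primePowTerm n w :=
    Summable.of_norm_bounded summable_two_mul_rpow
      fun n => primePowTerm_bounds.2 n w (by linarith)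
  rw [primeZeta, primePowSum, LSeries, ← h1.tsum_add h2]
  have := tsum_subtype {p : ℕ | p.Prime} (fun p : ℕ => -Complex.log (1 - (p : ℂ) ^ (-(1 + w))))
  refine Eq.trans (tsum_congr fun n => ?_) this.symm
  by_cases hp : n.Prime
  · have hn : (n : ℂ) ≠ 0 := by exact_mod_cast hp.ne_zero
    rw [Set.indicator_of_mem (show n ∈ {p : ℕ | p.Prime} from hp), primePowTerm, if_pos hp,
      LSeries.term_of_ne_zero hp.ne_zero, primeCoeff, if_pos hp, neg_add, Complex.cpow_add _ _ hn,
      Complex.cpow_neg, Complex.cpow_neg, Complex.cpow_one]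
    push_cast
    field_simp
    ring
  · rw [Set.indicator_of_notMem (show n ∉ {p : ℕ | p.Prime} from hp), primePowTerm, if_neg hp]
    simp [LSeries.term, primeCoeff, hp]

end ArithProg

/-! ### Polynomial growth of the exponential factors and their limits at the origin -/

namespace ArithProg

lemma primeZeta_ofReal {σ : ℝ} : primeZeta σ = (primeZetaReal σ : ℂ) := by
  rw [primeZeta, LSeries, primeZetaReal, Complex.ofReal_tsum]
  refine tsum_congr fun n => ?_
  by_cases hp : n.Prime
  · have hn : (0 : ℝ) < n := by exact_mod_cast hp.pos
    rw [LSeries.term_of_ne_zero hp.ne_zero, primeCoeff, if_pos hp, if_pos hp, Real.rpow_sub hn,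
      Real.rpow_neg_one]
    push_cast [Complex.ofReal_cpow hn.le]
    ring
  · simp [LSeries.term, primeCoeff, hp]

lemma differentiableOn_primeZeta : DifferentiableOn ℂ primeZeta {w | 0 < w.re} :=
  (LSeries_differentiableOn _).mono fun w hw => abscissa_primeOne.trans_lt (by exact_mod_cast hw)

lemma exp_primeZeta_mul {w : ℂ} (hw : 0 < w.re) :
    Complex.exp (primeZeta w + primePowSum w) * w = riemannZeta₁ (1 + w) := by
  have hw0 : w ≠ 0 := by rintro rfl; simp at hw
  rw [exp_primeZeta_add hw, riemannZeta_eq_inv_sub_mul (by simpa using hw0), add_sub_cancel_left]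
  field_simp

/-- Logarithm of ζ(1 + σ) ≪ 1/σ, with the prime powers contributing O(1). -/
lemma exists_primeZetaReal_le :
    ∃ C, 0 ≤ C ∧ ∀ σ : ℝ, 0 < σ → σ < 1 → primeZetaReal σ ≤ Real.log (1 / σ) + C := by
  obtain ⟨C, hC0, hC⟩ := exists_norm_riemannZeta_le_inv
  set B := ∑' n : ℕ, 2 * (n : ℝ) ^ (-(7 / 4) : ℝ)
  refine ⟨|Real.log C| + |B|, by positivity, fun σ h0 h1 => ?_⟩
  have e := exp_primeZeta_add (w := σ) (by simpa using h0)
  have hU := primePowSum_holomorphic.2.1 σ (by simp; linarith)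
  have h2 := hC σ h0 h1
  rw [← e, Complex.norm_exp, primeZeta_ofReal, Complex.add_re, Complex.ofReal_re] at h2
  have h3 := Real.log_le_log (Real.exp_pos _) h2
  rw [Real.log_exp, Real.log_div hC0.ne' h0.ne'] at h3
  have h4 := abs_le.1 ((Complex.abs_re_le_norm _).trans hU)
  rw [one_div, Real.log_inv]
  linarith [le_abs_self (Real.log C), le_abs_self B, h4.1]

/-- Logarithmic differentiation of exp(`primeZeta` + `primePowSum`) · w = `riemannZeta₁` (1 + w);
the summand 1/w removes the pole at the origin. -/
lemma slowGrowth_deriv_primeZeta_add_inv : SlowGrowth (fun w => deriv primeZeta w + w⁻¹) := by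
  refine (slowGrowth_logDeriv_riemannZeta₁.sub primePowSum_holomorphic.2.2.deriv).congr
    fun w hw => ?_
  have hw0 : w ≠ 0 := by rintro rfl; simpa using hw.1
  have hP : HasDerivAt primeZeta (deriv primeZeta w) w :=
    (differentiableOn_primeZeta.differentiableAt
      ((isOpen_lt continuous_const Complex.continuous_re).mem_nhds hw.1)).hasDerivAt
  have hU : HasDerivAt primePowSum (deriv primePowSum w) w :=
    ((primePowSum_holomorphic.2.2 1 one_pos 0).diffAt hw).hasDerivAt
  have h1 := ((hP.add hU).cexp).mul (hasDerivAt_id w)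
  have h2 : HasDerivAt (fun w => riemannZeta₁ (1 + w)) (deriv riemannZeta₁ (1 + w)) w :=
    (differentiable_riemannZeta₁ (1 + w)).hasDerivAt.comp_const_add 1 w
  have heq : (fun w => Complex.exp (primeZeta w + primePowSum w) * w) =ᶠ[𝓝 w]
      fun w => riemannZeta₁ (1 + w) := by
    filter_upwards [(isOpen_lt continuous_const Complex.continuous_re).mem_nhds hw.1] with z hz
    exact exp_primeZeta_mul hz
  have h3 := (h2.congr_of_eventuallyEq heq).unique h1
  dsimp only
  rw [h3, ← exp_primeZeta_mul hw.1]
  have := Complex.exp_ne_zero (primeZeta w + primePowSum w)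
  simp only [Pi.add_apply, id]
  field_simp
  ring

lemma one_le_log_add {t : ℝ} : 0 ≤ Real.log (|t| + 2) :=
  Real.log_nonneg (by linarith [abs_nonneg t])

/-- A function whose derivative has at most linear growth, and which has at most a logarithmic
singularity at the line `Re w = 0`, grows at most logarithmically. -/
lemma exists_norm_le_log {f : ℂ → ℂ} (hd : DifferentiableOn ℂ f strip)
    (hf' : ∃ C, ∀ w ∈ strip, ‖deriv f w‖ ≤ C * (|w.im| + 2))
    (hb : ∃ A B, 0 ≤ B ∧ ∀ w ∈ strip,
      ‖f w‖ ≤ A + B * Real.log (1 / w.re) + B * Real.log (|w.im| + 2)) :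
    ∃ C c, ∀ w ∈ strip, ‖f w‖ ≤ C + c * Real.log (|w.im| + 2) := by
  obtain ⟨C, hC⟩ := hf'
  obtain ⟨A, B, hB, hAB⟩ := hb
  have key : ∀ w ∈ strip, 1 / (2 * (|w.im| + 2)) ≤ w.re →
      ‖f w‖ ≤ A + B * Real.log 2 + 2 * B * Real.log (|w.im| + 2) := by
    intro w hw hre
    refine (hAB w hw).trans ?_
    have hτ : 0 < |w.im| + 2 := by positivity
    have h1 : Real.log (1 / w.re) ≤ Real.log 2 + Real.log (|w.im| + 2) := by
      rw [← Real.log_mul two_ne_zero hτ.ne']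
      refine Real.log_le_log (by have := hw.1; positivity) ?_
      rw [div_le_iff₀ hw.1]
      rw [div_le_iff₀ (by positivity)] at hre
      linarith
    nlinarith
  refine ⟨|A + B * Real.log 2| + |C|, 2 * B, fun w hw => ?_⟩
  set τ := |w.im| + 2 with hτ
  have hτ2 : 2 ≤ τ := by linarith [abs_nonneg w.im]
  rcases le_total (1 / (2 * τ)) w.re with hcase | hcase
  · linarith [key w hw hcase, le_abs_self (A + B * Real.log 2), abs_nonneg C]
  -- At abscissa 1/(2τ) the logarithmic singularity costs only log τ, and from there to w the
  -- function changes by O(1), since the derivative is O(τ) over a length of at most 1/(2τ).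
  · set w₀ : ℂ := (1 / (2 * τ) : ℝ) + w.im * Complex.I with hw₀
    have hre : w₀.re = 1 / (2 * τ) := by rw [hw₀]; simp
    have him : w₀.im = w.im := by simp [hw₀]
    have hs : w₀ ∈ strip := by
      refine ⟨by rw [hre]; positivity, ?_⟩
      rw [hre, div_lt_div_iff₀ (by positivity) (by norm_num)]; linarith
    have h1 := key w₀ hs (by rw [hre, him])
    rw [him] at h1
    have hmv := Convex.norm_image_sub_le_of_norm_deriv_le (f := f)
      (s := strip ∩ {z | z.im = w.im}) (C := |C| * τ) (x := w₀) (y := w)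
      (fun z hz => hd.differentiableAt (isOpen_strip.mem_nhds hz.1)) ?_
      (convex_strip.inter (fun a ha b hb s t _ _ hst => by
        simp only [Set.mem_ofPred_eq] at ha hb ⊢
        simp [ha, hb, ← add_mul, hst])) ⟨hs, him⟩ ⟨hw, rfl⟩
    · have hdist : ‖w - w₀‖ ≤ 1 / (2 * τ) := by
        have : w - w₀ = ((w.re - 1 / (2 * τ) : ℝ) : ℂ) := by
          apply Complex.ext <;> simp [hre, him]
        rw [this, Complex.norm_real, Real.norm_eq_abs, abs_of_nonpos (by linarith)]
        linarith [hw.1]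
      have h5 : ‖f w - f w₀‖ ≤ |C| := by
        refine hmv.trans ?_
        calc |C| * τ * ‖w - w₀‖ ≤ |C| * τ * (1 / (2 * τ)) := by gcongr
          _ = |C| / 2 := by field_simp
          _ ≤ |C| := by linarith [abs_nonneg C]
      have h6 : ‖f w‖ ≤ ‖f w - f w₀‖ + ‖f w₀‖ := by
        simpa using norm_add_le (f w - f w₀) (f w₀)
      linarith [le_abs_self (A + B * Real.log 2)]
    · intro z hz
      refine (hC z hz.1).trans ?_
      rw [hz.2]
      gcongr
      exact le_abs_self C

/-- Logarithmic growth of f makes exp(zf) polynomially bounded, and its logarithmic derivative zf'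
is of slow growth, so all derivatives share one exponent. -/
lemma tameGrowth_exp {f : ℂ → ℂ} (z : ℂ) (hd : DifferentiableOn ℂ f strip)
    (hf' : SlowGrowth (deriv f))
    (hb : ∃ A B, 0 ≤ B ∧ ∀ w ∈ strip,
      ‖f w‖ ≤ A + B * Real.log (1 / w.re) + B * Real.log (|w.im| + 2)) :
    TameGrowth (fun w => Complex.exp (z * f w)) := by
  obtain ⟨C, c, hC⟩ := exists_norm_le_log hd
    (by simpa using (hf' 1 one_pos 0).2 0 le_rfl) hb
  refine TameGrowth.of_logDeriv (c := ‖z‖ * c) (l := fun w => z * deriv f w)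
    (PolyGrowth.zero_iff.2 ⟨(hd.const_mul z).cexp, Real.exp (‖z‖ * C), fun w hw => ?_⟩)
    ((SlowGrowth.const z).mul hf') fun w hw => ?_
  · have hτ : 0 < |w.im| + 2 := by positivity
    rw [Complex.norm_exp, Real.rpow_def_of_pos hτ, ← Real.exp_add, Real.exp_le_exp]
    refine (Complex.re_le_norm _).trans ?_
    rw [norm_mul]
    have := mul_le_mul_of_nonneg_left (hC w hw) (norm_nonneg z)
    linarith
  · have h1 := (hd.differentiableAt (isOpen_strip.mem_nhds hw)).hasDerivAt
    rw [((h1.const_mul z).cexp).deriv]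
    ring

section

variable {h : ArithmeticFunction ℝ} {k : ℝ}

/-- `∑_p |h(p) - k| p^{-1-σ} ≤ 2 k log (1/σ) + O(1)` for nonnegative `h`. -/
lemma PrimeHyp.exists_tsum_abs_le (hyp : PrimeHyp h k) :
    ∃ C, ∀ σ : ℝ, 0 < σ → σ < 1 →
      (∑' n : ℕ, if n.Prime then (h n + k) * (n : ℝ) ^ (-1 - σ) else 0)
        ≤ 2 * k * Real.log (1 / σ) + C := by
  obtain ⟨C1, hC10, hC1⟩ := exists_primeZetaReal_le
  obtain ⟨C2, hC2⟩ := hyp.exists_norm_primeDev_real_le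
  refine ⟨C2 + 2 * k * C1, fun σ h0 h1 => ?_⟩
  have hs1 := summable_prime_rpow h0
  have hs2 : Summable fun n : ℕ => if n.Prime then (h n - k) * (n : ℝ) ^ (-1 - σ) else 0 := by
    have := (lseriesSummable_of_abscissa hyp.abscissa_le (w := σ) (by simpa using h0)).norm
    refine Summable.of_norm (this.congr fun n => ?_)
    rw [norm_primeCoeff_term]
    split_ifs with hp
    · rw [norm_mul, Real.norm_eq_abs, Real.norm_of_nonneg (by positivity)]; simp
    · simp
  have e1 : (primeDev h k σ) = ((∑' n : ℕ, if n.Prime then (h n - k) * (n : ℝ) ^ (-1 - σ) else 0 : ℝ) : ℂ) := by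
    rw [primeDev, LSeries, Complex.ofReal_tsum]
    refine tsum_congr fun n => ?_
    by_cases hp : n.Prime
    · have hn : (0 : ℝ) < n := by exact_mod_cast hp.pos
      rw [LSeries.term_of_ne_zero hp.ne_zero, primeCoeff, if_pos hp, if_pos hp, Real.rpow_sub hn,
        Real.rpow_neg_one]
      push_cast [Complex.ofReal_cpow hn.le]
      ring
    · simp [LSeries.term, primeCoeff, hp]
  have b := hC2 σ h0
  rw [e1, Complex.norm_real] at b
  have b1 := (le_abs_self _).trans b
  have e2 : (∑' n : ℕ, if n.Prime then (h n + k) * (n : ℝ) ^ (-1 - σ) else 0) =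
      (∑' n : ℕ, if n.Prime then (h n - k) * (n : ℝ) ^ (-1 - σ) else 0) + 2 * k * primeZetaReal σ := by
    rw [primeZetaReal, ← tsum_mul_left, ← hs2.tsum_add (hs1.mul_left _)]
    refine tsum_congr fun n => ?_
    split_ifs <;> ring
  rw [e2]
  have := mul_le_mul_of_nonneg_left (hC1 σ h0 h1) (by linarith [hyp.nonneg] : 0 ≤ 2 * k)
  linarith

/-- Since h ≥ 0 and k ≥ 0, |h(p) - k| ≤ h(p) + k, which reduces the bound at w to real σ = Re w. -/
lemma PrimeHyp.norm_primeDev_le (hyp : PrimeHyp h k) (hnonneg : ∀ d, 0 ≤ h d) :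
    ∃ C, ∀ w : ℂ, 0 < w.re → w.re < 1 → ‖primeDev h k w‖ ≤ 2 * k * Real.log (1 / w.re) + C := by
  obtain ⟨C, hC⟩ := hyp.exists_tsum_abs_le
  refine ⟨C, fun w h0 h1 => le_trans ?_ (hC w.re h0 h1)⟩
  have hs := (lseriesSummable_of_abscissa hyp.abscissa_le h0).norm
  refine (norm_tsum_le_tsum_norm hs).trans (hs.tsum_le_tsum (fun n => ?_) ?_)
  · rw [norm_primeCoeff_term]
    split_ifs with hp
    · refine mul_le_mul_of_nonneg_right ?_ (by positivity)
      rw [abs_le]; constructor <;> linarith [hnonneg n, hyp.nonneg]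
    · exact le_rfl
  · have h3 := (summable_prime_rpow h0).mul_left (2 * k)
    refine Summable.of_nonneg_of_le (fun n => ?_) (fun n => ?_) (hs.add h3)
    · split_ifs
      · have := hnonneg n; have := hyp.nonneg; positivity
      · exact le_rfl
    · rw [norm_primeCoeff_term]
      split_ifs with hp
      · rw [← add_mul]
        refine mul_le_mul_of_nonneg_right ?_ (by positivity)
        linarith [le_abs_self (h n - k)]
      · simp

lemma PrimeHyp.tameGrowth_exp_primeDev (hyp : PrimeHyp h k) (hnonneg : ∀ d, 0 ≤ h d) :
    TameGrowth (fun w => Complex.exp (-primeDev h k w)) := by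
  obtain ⟨C, hC⟩ := hyp.norm_primeDev_le hnonneg
  refine (tameGrowth_exp (-1) (hyp.differentiableOn_primeDev.mono fun w hw => hw.1)
    hyp.slowGrowth_deriv_primeDev ⟨C, 2 * k, by linarith [hyp.nonneg], fun w hw => ?_⟩).congr
    fun w _ => by simp
  have h1 := hC w hw.1 (by linarith [hw.2])
  have h2 : 0 ≤ 2 * k * Real.log (|w.im| + 2) := by
    have := hyp.nonneg
    have := one_le_log_add (t := w.im)
    positivity
  linarith

end

lemma differentiableOn_log_strip : DifferentiableOn ℂ Complex.log strip := fun _ hw =>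
  (Complex.differentiableAt_log (Or.inl hw.1)).differentiableWithinAt

/-- Up to the bounded factor from `primePowSum`, this is (wζ(1 + w))^z, defined through a logarithm
that is available because ζ(1 + w) is an exponential for Re w > 0. -/
lemma tameGrowth_exp_primeZeta (z : ℂ) :
    TameGrowth (fun w => Complex.exp (z * (primeZeta w + Complex.log w))) := by
  obtain ⟨C, hC0, hC⟩ := exists_primeZetaReal_le
  have hdP : DifferentiableOn ℂ primeZeta strip := differentiableOn_primeZeta.mono fun w hw => hw.1
  refine tameGrowth_exp z (hdP.add differentiableOn_log_strip)
    (slowGrowth_deriv_primeZeta_add_inv.congr fun w hw => ?_) ⟨C + Real.pi + 1, 2, by norm_num,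
      fun w hw => ?_⟩
  · have h1 := (hdP.differentiableAt (isOpen_strip.mem_nhds hw)).hasDerivAt
    exact (h1.add (Complex.hasDerivAt_log (Or.inl hw.1))).deriv
  · have h1 := (norm_primeZeta_le hw.1).trans (hC w.re hw.1 (by linarith [hw.2]))
    have hτ := one_le_log_add (t := w.im)
    have hre := hw.1
    have hr0 : 0 ≤ Real.log (1 / w.re) :=
      Real.log_nonneg (by rw [le_div_iff₀ hre]; linarith [hw.2])
    have hn0 : 0 < ‖w‖ := hre.trans_le (Complex.re_le_norm w)
    have h2 : ‖Complex.log w‖ ≤ Real.log (1 / w.re) + Real.log (|w.im| + 2) + Real.pi := by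
      refine (Complex.norm_le_abs_re_add_abs_im _).trans ?_
      rw [Complex.log_re, Complex.log_im]
      refine add_le_add ?_ (Complex.abs_arg_le_pi w)
      rw [abs_le]
      constructor
      · have : Real.log w.re ≤ Real.log ‖w‖ := Real.log_le_log hre (Complex.re_le_norm w)
        rw [one_div, Real.log_inv] at *
        linarith
      · have : Real.log ‖w‖ ≤ Real.log (|w.im| + 2) := by
          refine Real.log_le_log hn0 ((Complex.norm_le_abs_re_add_abs_im w).trans ?_)
          rw [abs_of_pos hre]; linarith [hw.2]
        linarith
    refine (norm_add_le _ _).trans ?_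
    linarith

section Limits

/-- Abel's limit theorem for Dirichlet series: the tail of the coefficients beyond N₀ has partial
sums at most ε/4, hence so does the weighted tail, uniformly in σ > 0; the finite head is continuous
in σ. -/
lemma tendsto_tsum_mul_powWeight {c : ℕ → ℂ} {S : ℂ}
    (hc : Tendsto (fun N => ∑ i ∈ Finset.range N, c i) atTop (𝓝 S))
    (hs : ∀ σ > (0 : ℝ), Summable fun i => c i * powWeight σ i) :
    Tendsto (fun σ : ℝ => ∑' i, c i * powWeight σ i) (𝓝[>] 0) (𝓝 S) := by
  rw [Metric.tendsto_nhds]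
  intro ε hε
  have hcau := hc.cauchySeq
  obtain ⟨N₀, hN₀⟩ := Metric.cauchySeq_iff'.1 hcau (ε / 4) (by linarith)
  have hS : ‖∑ i ∈ Finset.range N₀, c i - S‖ ≤ ε / 4 := by
    refine le_of_tendsto ((hc.const_sub _).norm) ?_
    filter_upwards [eventually_ge_atTop N₀] with N hN
    have := hN₀ N hN
    rw [dist_comm, dist_eq_norm] at this
    exact this.le
  set c' : ℕ → ℂ := fun i => if i < N₀ then 0 else c i with hc'
  have hpart : ∀ N, ‖∑ i ∈ Finset.range N, c' i‖ ≤ ε / 4 := by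
    intro N
    rcases le_total N N₀ with h | h
    · rw [Finset.sum_eq_zero]
      · simp; linarith
      · intro i hi
        have := Finset.mem_range.1 hi
        simp [hc', show i < N₀ by omega]
    · have e : ∑ i ∈ Finset.range N, c' i =
          ∑ i ∈ Finset.range N, c i - ∑ i ∈ Finset.range N₀, c i := by
        rw [← Finset.sum_range_add_sum_Ico _ h, ← Finset.sum_range_add_sum_Ico c h,
          add_sub_cancel_left, Finset.sum_eq_zero, zero_add]
        · refine Finset.sum_congr rfl fun i hi => ?_
          have := (Finset.mem_Ico.1 hi).1
          simp [hc', not_lt.2 this]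
        · intro i hi
          simp [hc', Finset.mem_range.1 hi]
      rw [e, ← dist_eq_norm]
      exact (hN₀ N h).le
  have hfin : Tendsto (fun σ : ℝ => ∑ i ∈ Finset.range N₀, c i * powWeight σ i) (𝓝[>] 0)
      (𝓝 (∑ i ∈ Finset.range N₀, c i)) := by
    refine tendsto_finsetSum _ fun i _ => ?_
    have : Tendsto (fun σ : ℝ => (powWeight σ i : ℂ)) (𝓝 0) (𝓝 (1 : ℂ)) := by
      unfold powWeight
      split_ifs with hi
      · simp
      · have hi' : (i : ℝ) ≠ 0 := by exact_mod_cast hi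
        have hcont : Continuous fun σ : ℝ => (((i : ℝ) ^ (-σ) : ℝ) : ℂ) :=
          Complex.continuous_ofReal.comp
            (Real.continuous_const_rpow hi' |>.comp continuous_neg)
        simpa using hcont.tendsto 0
    simpa using (this.mono_left nhdsWithin_le_nhds).const_mul (c i)
  have hev := (Metric.tendsto_nhds.1 hfin) (ε / 4) (by linarith)
  filter_upwards [hev, self_mem_nhdsWithin] with σ h1 h2
  have hσ : (0 : ℝ) < σ := h2
  have hfs : Summable fun i => (if i < N₀ then c i else 0) * (powWeight σ i : ℂ) :=
    summable_of_ne_finset_zero (s := Finset.range N₀) fun i hi => by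
      simp [Finset.mem_range.not.1 hi]
  have hs' : Summable fun i => c' i * (powWeight σ i : ℂ) := by
    refine ((hs σ hσ).sub hfs).congr fun i => ?_
    simp only [hc']
    split_ifs <;> ring
  have hsplit : ∑' i, c i * (powWeight σ i : ℂ) =
      ∑ i ∈ Finset.range N₀, c i * (powWeight σ i : ℂ) + ∑' i, c' i * (powWeight σ i : ℂ) := by
    have e1 : ∑ i ∈ Finset.range N₀, c i * (powWeight σ i : ℂ) =
        ∑' i, (if i < N₀ then c i else 0) * (powWeight σ i : ℂ) := by
      rw [tsum_eq_sum (s := Finset.range N₀) fun i hi => by simp [Finset.mem_range.not.1 hi]]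
      exact Finset.sum_congr rfl fun i hi => by rw [if_pos (Finset.mem_range.1 hi)]
    rw [e1, ← hfs.tsum_add hs']
    refine tsum_congr fun i => ?_
    simp only [hc']
    split_ifs <;> ring
  have htail := norm_tsum_mul_antitone_le (powWeight_antitone hσ.le) (powWeight_nonneg σ) hpart hs'
  have hp0 : powWeight σ 0 = 1 := by simp [powWeight]
  rw [hp0, mul_one] at htail
  rw [dist_eq_norm] at h1 ⊢
  rw [hsplit]
  calc _ = ‖(∑ i ∈ Finset.range N₀, c i * (powWeight σ i : ℂ) - ∑ i ∈ Finset.range N₀, c i) +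
        (∑ i ∈ Finset.range N₀, c i - S) + ∑' i, c' i * (powWeight σ i : ℂ)‖ := by
          congr 1; ring
    _ ≤ _ := norm_add₃_le
    _ < ε := by linarith

lemma PrimeHyp.tendsto_primeDev {h : ArithmeticFunction ℝ} {k S : ℝ} (hyp : PrimeHyp h k)
    (hS : Tendsto (fun N : ℕ => ∑ p ∈ primesUpTo N, (h p - k) / (p : ℝ)) atTop (𝓝 S)) :
    Tendsto (fun σ : ℝ => primeDev h k σ) (𝓝[>] 0) (𝓝 (S : ℂ)) := by
  set c : ℕ → ℂ := fun n => LSeries.term (primeCoeff fun n => h n - k) 0 n with hc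
  have hterm : ∀ (σ : ℝ) n, LSeries.term (primeCoeff fun n => h n - k) σ n =
      c n * powWeight σ n := by
    intro σ n
    rw [term_eq_mul_powWeight]; simp [hc]
  have := tendsto_tsum_mul_powWeight (c := c) (S := S) ?_ ?_
  · refine this.congr fun σ => ?_
    rw [primeDev, LSeries]
    exact tsum_congr fun n => (hterm σ n).symm
  · rw [← tendsto_add_atTop_iff_nat 1]
    refine ((Complex.continuous_ofReal.tendsto S).comp hS).congr fun N => ?_
    rw [sum_range_primeTerm]
    · simp only [Function.comp_apply]
      push_cast
      refine Finset.sum_congr rfl fun p hp => ?_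
      have hpp : p.Prime := (Finset.mem_filter.1 hp).2
      rw [hc]
      simp only
      rw [LSeries.term_of_ne_zero hpp.ne_zero, primeCoeff, if_pos hpp]
      simp
    · intro n hn
      simp [hc, LSeries.term, primeCoeff, hn]
  · intro σ hσ
    exact (lseriesSummable_of_abscissa hyp.abscissa_le (w := σ) (by simpa using hσ)).congr
      fun n => (hterm σ n)

/-- For real σ > 0 the exponent is z times log ‖`riemannZeta₁` (1 + σ)‖ minus `primePowSum` σ, and
`riemannZeta₁` takes the value 1 at 1. -/
lemma tendsto_exp_primeZeta (z : ℝ) :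
    Tendsto (fun σ : ℝ => Complex.exp (z * (primeZeta σ + Complex.log σ))) (𝓝[>] 0)
      (𝓝 ((Real.exp (-z * (primePowSum 0).re) : ℝ) : ℂ)) := by
  have hU : Tendsto (fun σ : ℝ => (primePowSum σ).re) (𝓝[>] 0) (𝓝 (primePowSum 0).re) := by
    have h1 : ContinuousAt primePowSum ((0 : ℝ) : ℂ) :=
      (primePowSum_holomorphic.1.differentiableAt
        ((isOpen_lt continuous_const Complex.continuous_re).mem_nhds (by simp))).continuousAt
    have h2 : ContinuousAt (fun σ : ℝ => (primePowSum σ).re) 0 :=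
      Complex.continuous_re.continuousAt.comp (h1.comp Complex.continuous_ofReal.continuousAt)
    simpa using h2.tendsto.mono_left nhdsWithin_le_nhds
  have hZ : Tendsto (fun σ : ℝ => Real.log ‖riemannZeta₁ (1 + σ)‖) (𝓝[>] 0) (𝓝 0) := by
    have h1 : ContinuousAt (fun σ : ℝ => Real.log ‖riemannZeta₁ (1 + σ)‖) 0 := by
      refine ContinuousAt.log ?_ (by simp)
      exact (continuous_norm.comp (differentiable_riemannZeta₁.continuous.comp
        (continuous_const.add Complex.continuous_ofReal))).continuousAt
    simpa using h1.tendsto.mono_left nhdsWithin_le_nhds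
  have hmain : Tendsto (fun σ : ℝ => z * (Real.log ‖riemannZeta₁ (1 + σ)‖ - (primePowSum σ).re))
      (𝓝[>] 0) (𝓝 (-z * (primePowSum 0).re)) := by
    have := (hZ.sub hU).const_mul z
    refine this.trans (by ring_nf; exact le_rfl)
  refine ((Complex.continuous_ofReal.tendsto _).comp
    ((Real.continuous_exp.tendsto _).comp hmain)).congr' ?_
  filter_upwards [self_mem_nhdsWithin] with σ hσ
  have hσ0 : (0 : ℝ) < σ := hσ
  have e := exp_primeZeta_mul (w := σ) (by simpa using hσ0)
  have e2 : Real.log ‖riemannZeta₁ (1 + σ)‖ =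
      primeZetaReal σ + (primePowSum σ).re + Real.log σ := by
    rw [← e, norm_mul, Complex.norm_exp, Complex.norm_real, Real.norm_of_nonneg hσ0.le,
      Real.log_mul (Real.exp_ne_zero _) hσ0.ne', Real.log_exp, primeZeta_ofReal]
    simp
  simp only [Function.comp_apply]
  rw [e2, primeZeta_ofReal, ← Complex.ofReal_log hσ0.le]
  push_cast
  congr 1; ring

end Limits

end ArithProg

/-! ### The divisor transform of q g_a(q) and its Euler factors -/

namespace ArithProg

/-- The multiplicative function with prescribed values on prime powers. -/
noncomputable def mulExt (φ : ℕ → ℕ → ℝ) : ArithmeticFunction ℝ :=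
  ⟨fun n => if n = 0 then 0 else n.factorization.prod φ, by simp⟩

lemma mulExt_apply {φ : ℕ → ℕ → ℝ} {n : ℕ} (hn : n ≠ 0) : mulExt φ n = n.factorization.prod φ := by
  simp [mulExt, hn]

lemma mulExt_prime_pow {φ : ℕ → ℕ → ℝ} {p e : ℕ} (hp : p.Prime) (he : e ≠ 0) :
    mulExt φ (p ^ e) = φ p e := by
  rw [mulExt_apply (pow_ne_zero _ hp.ne_zero), hp.factorization_pow, Finsupp.prod,
    Finsupp.support_single _ he]
  simp

lemma isMultiplicative_mulExt (φ : ℕ → ℕ → ℝ) : (mulExt φ).IsMultiplicative := by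
  rw [ArithmeticFunction.IsMultiplicative.iff_ne_zero]
  refine ⟨by rw [mulExt_apply one_ne_zero]; simp, fun {m n} hm hn hmn => ?_⟩
  rw [mulExt_apply (mul_ne_zero hm hn), mulExt_apply hm, mulExt_apply hn,
    Nat.factorization_mul hm hn, Finsupp.prod_add_index_of_disjoint]
  simpa using hmn.disjoint_primeFactors

variable (h : ArithmeticFunction ℝ) (a : ℤ)

/-- The Dirichlet inverse transform of `q g_a(q)` at the prime power `p ^ e`, `e ≥ 1`. -/
noncomputable def twistLocal (p e : ℕ) : ℝ :=
  (p : ℝ) ^ e * gLocal h a p e - (p : ℝ) ^ (e - 1) * gLocal h a p (e - 1)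

/-- The multiplicative function `b` with `q g_a(q) = ∑_{d ∣ q} b(d)`. -/
noncomputable def twist : ArithmeticFunction ℝ := mulExt (twistLocal h a)

lemma isMultiplicative_twist : (twist h a).IsMultiplicative := isMultiplicative_mulExt _

variable {h a}

lemma gLocal_zero (hmult : h.IsMultiplicative) (p : ℕ) : gLocal h a p 0 = 1 := by
  simp [gLocal, hmult.map_one]

/-- The local values are successive differences of p^e g_a(p^e), so the sum telescopes. -/
lemma sum_twist_prime_pow (hmult : h.IsMultiplicative) {p : ℕ} (hp : p.Prime) (e : ℕ) :
    ∑ j ∈ Finset.range (e + 1), twist h a (p ^ j) = (p : ℝ) ^ e * gLocal h a p e := by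
  induction e with
  | zero => simp [gLocal_zero hmult, (isMultiplicative_twist h a).map_one]
  | succ e ih =>
    rw [Finset.sum_range_succ, ih, twist, mulExt_prime_pow hp e.succ_ne_zero, twistLocal,
      Nat.succ_sub_one]
    exact add_sub_cancel _ _

lemma mul_gDens_eq_sum (hmult : h.IsMultiplicative) {q : ℕ} (hq : q ≠ 0) :
    (q : ℝ) * gDens h a q = ∑ d ∈ q.divisors, twist h a d := by
  set G := mulExt fun p e => (p : ℝ) ^ e * gLocal h a p e with hG
  have e1 : G q = (q : ℝ) * gDens h a q := by
    rw [hG, mulExt_apply hq, gDens, Finsupp.prod_mul]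
    congr 1
    conv_rhs => rw [← Nat.prod_factorization_pow_eq_self hq]
    rw [Finsupp.prod, Finsupp.prod, Nat.cast_prod]
    simp
  rw [← e1, ← ArithmeticFunction.coe_mul_zeta_apply]
  have hm : (twist h a * (ArithmeticFunction.zeta : ArithmeticFunction ℝ)).IsMultiplicative :=
    (isMultiplicative_twist h a).mul ArithmeticFunction.isMultiplicative_zeta.natCast
  have : G = twist h a * (ArithmeticFunction.zeta : ArithmeticFunction ℝ) := by
    refine (ArithmeticFunction.IsMultiplicative.eq_iff_eq_on_prime_powers _
      (isMultiplicative_mulExt _) _ hm).2 fun p e hp => ?_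
    rw [ArithmeticFunction.coe_mul_zeta_apply, Nat.sum_divisors_prime_pow hp,
      sum_twist_prime_pow hmult hp]
    rcases e with _ | e
    · simp [mulExt_apply, gLocal_zero hmult]
    · rw [mulExt_prime_pow hp e.succ_ne_zero]
  rw [this]

lemma pow_mul_gLocal_of_le {p e : ℕ} (hp : p.Prime) (he : e ≤ expo a p) :
    (p : ℝ) ^ e * gLocal h a p e = h (p ^ e) := by
  have : (p : ℝ) ^ e ≠ 0 := pow_ne_zero _ (by exact_mod_cast hp.ne_zero)
  rw [gLocal, if_pos he]
  field_simp

lemma pow_mul_gLocal_of_lt {p e : ℕ} (hp : p.Prime) (he : expo a p < e) :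
    (p : ℝ) ^ e * gLocal h a p e = localDiff h a p / (1 - 1 / (p : ℝ)) := by
  have hp0 : (p : ℝ) ≠ 0 := by exact_mod_cast hp.ne_zero
  have hp1 : (1 : ℝ) < p := by exact_mod_cast hp.one_lt
  obtain ⟨e, rfl⟩ := Nat.exists_eq_succ_of_ne_zero (show e ≠ 0 by omega)
  rw [gLocal, if_neg (by omega), Nat.totient_prime_pow_succ hp]
  push_cast [Nat.cast_sub hp.one_le]
  have : (p : ℝ) - 1 ≠ 0 := by linarith
  rw [pow_succ]
  field_simp

/-- For e > f the value p^e g_a(p^e) no longer depends on e, so its differences vanish from f + 2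
on. Every Euler factor is thus a polynomial in p^(-w). -/
lemma twist_prime_pow_eq_zero {p e : ℕ} (hp : p.Prime) (he : expo a p + 2 ≤ e) :
    twist h a (p ^ e) = 0 := by
  rw [twist, mulExt_prime_pow hp (by omega), twistLocal, pow_mul_gLocal_of_lt hp (by omega),
    pow_mul_gLocal_of_lt hp (by omega), sub_self]

lemma expo_eq_zero {p : ℕ} (hp : ¬ p ∣ a.natAbs) : expo a p = 0 :=
  Nat.factorization_eq_zero_of_not_dvd hp

lemma localDiff_of_not_dvd (hmult : h.IsMultiplicative) {p : ℕ} (hpa : ¬ p ∣ a.natAbs) :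
    localDiff h a p = 1 - h p / p := by
  rw [localDiff, expo_eq_zero hpa]; simp [hmult.map_one]

lemma twist_prime (hmult : h.IsMultiplicative) {p : ℕ} (hp : p.Prime) (hpa : ¬ p ∣ a.natAbs) :
    twist h a p = (1 - h p) / (p - 1) := by
  have hp0 : (p : ℝ) ≠ 0 := by exact_mod_cast hp.ne_zero
  have hp1 : (1 : ℝ) < p := by exact_mod_cast hp.one_lt
  have hp2 : (p : ℝ) - 1 ≠ 0 := by linarith
  have := mulExt_prime_pow (φ := twistLocal h a) hp one_ne_zero
  rw [pow_one] at this
  rw [twist, this, twistLocal, pow_mul_gLocal_of_lt hp (by simp [expo_eq_zero hpa]),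
    localDiff_of_not_dvd hmult hpa, Nat.sub_self, gLocal_zero hmult]
  field_simp
  ring

/-- The Euler factor at `p` of the Dirichlet series of `twist h a`. -/
noncomputable def eulerFactor (h : ArithmeticFunction ℝ) (a : ℤ) (p : ℕ) (w : ℂ) : ℂ :=
  ∑ e ∈ Finset.range (expo a p + 2), (twist h a (p ^ e) : ℂ) * ((p : ℂ) ^ (-w)) ^ e

lemma eulerFactor_of_not_dvd {p : ℕ}
    (hpa : ¬ p ∣ a.natAbs) (w : ℂ) : eulerFactor h a p w = 1 + (twist h a p : ℂ) * (p : ℂ) ^ (-w) := by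
  rw [eulerFactor, expo_eq_zero hpa]
  simp [Finset.sum_range_succ, (isMultiplicative_twist h a).map_one]

/-- At w = 0 the factor is the telescoped value p^(f+1) g_a(p^(f+1)). It vanishes exactly at
degenerate primes, which is where the zeros counted by `omegaH` come from. -/
lemma eulerFactor_zero (hmult : h.IsMultiplicative) {p : ℕ} (hp : p.Prime) :
    eulerFactor h a p 0 = ((localDiff h a p / (1 - 1 / (p : ℝ)) : ℝ) : ℂ) := by
  rw [← pow_mul_gLocal_of_lt hp (Nat.lt_succ_self (expo a p)), ← sum_twist_prime_pow hmult hp,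
    eulerFactor]
  push_cast
  simp

lemma differentiable_eulerFactor {p : ℕ} (hp : p.Prime) :
    Differentiable ℂ (eulerFactor h a p) := by
  have hp0 : (p : ℂ) ≠ 0 := by exact_mod_cast hp.ne_zero
  unfold eulerFactor
  refine Differentiable.fun_sum fun e _ => (Differentiable.pow ?_ e).const_mul _
  exact Differentiable.const_cpow (by fun_prop) (Or.inl hp0)

lemma exists_norm_eulerFactor_le {p : ℕ} (hp : p.Prime) :
    ∃ B, ∀ w : ℂ, -(1 / 8) < w.re → ‖eulerFactor h a p w‖ ≤ B := by
  refine ⟨∑ e ∈ Finset.range (expo a p + 2), |twist h a (p ^ e)| * ((p : ℝ) ^ (1 / 8 : ℝ)) ^ e,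
    fun w hw => (norm_sum_le _ _).trans (Finset.sum_le_sum fun e _ => ?_)⟩
  rw [norm_mul, norm_pow, Complex.norm_real, Real.norm_eq_abs,
    Complex.norm_natCast_cpow_of_pos hp.pos]
  have : (p : ℝ) ^ (-w).re ≤ (p : ℝ) ^ (1 / 8 : ℝ) :=
    Real.rpow_le_rpow_of_exponent_le (by exact_mod_cast hp.one_le) (by simp; linarith)
  gcongr

lemma sum_succ_mul_sub (c : ℕ → ℝ) (f : ℕ) :
    ∑ e ∈ Finset.range f, ((e : ℝ) + 1) * (c (e + 1) - c e) = f * c f - ∑ e ∈ Finset.range f, c e := by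
  induction f with
  | zero => simp
  | succ f ih => rw [Finset.sum_range_succ, ih, Finset.sum_range_succ]; push_cast; ring

/-- The derivative at 0 is -log p ∑ e b(p^e). Summing by parts, the boundary term is a multiple of
the value at f + 1, which is 0 at a degenerate prime, and what remains is the sum of the h(p^j). -/
lemma deriv_eulerFactor_zero {p : ℕ} (hp : p.Prime)
    (hd : localDiff h a p = 0) :
    HasDerivAt (eulerFactor h a p)
      ((((∑ j ∈ Finset.range (expo a p + 1), h (p ^ j)) * Real.log p : ℝ)) : ℂ) 0 := by
  have hp0 : (p : ℂ) ≠ 0 := by exact_mod_cast hp.ne_zero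
  have h1 : HasDerivAt (fun w : ℂ => (p : ℂ) ^ (-w)) (-Complex.log p) 0 := by
    have := (hasDerivAt_neg (0 : ℂ)).const_cpow (c := (p : ℂ)) (Or.inl hp0)
    simpa using this
  have h2 := HasDerivAt.fun_sum (u := Finset.range (expo a p + 2))
    (A := fun (e : ℕ) (w : ℂ) => (twist h a (p ^ e) : ℂ) * ((p : ℂ) ^ (-w)) ^ e)
    fun e _ => (h1.pow e).const_mul (twist h a (p ^ e) : ℂ)
  refine h2.congr_deriv ?_
  set f := expo a p with hf
  have key : ∑ e ∈ Finset.range (f + 2), (e : ℝ) * twist h a (p ^ e) =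
      -∑ j ∈ Finset.range (f + 1), h (p ^ j) := by
    rw [Finset.sum_range_succ']
    have : ∀ e ∈ Finset.range (f + 1), ((e + 1 : ℕ) : ℝ) * twist h a (p ^ (e + 1)) =
        ((e : ℝ) + 1) * ((fun e => (p : ℝ) ^ e * gLocal h a p e) (e + 1) -
          (fun e => (p : ℝ) ^ e * gLocal h a p e) e) := by
      intro e _
      rw [twist, mulExt_prime_pow hp e.succ_ne_zero, twistLocal, Nat.succ_sub_one]
      push_cast; rfl
    rw [Finset.sum_congr rfl this,
      sum_succ_mul_sub (fun e => (p : ℝ) ^ e * gLocal h a p e)]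
    -- Degeneracy removes the boundary term (f + 1) p^(f+1) g_a(p^(f+1)).
    simp only [pow_mul_gLocal_of_lt hp (show expo a p < f + 1 by omega), hd]
    rw [Finset.sum_congr rfl fun e he =>
      pow_mul_gLocal_of_le (h := h) hp (show e ≤ expo a p by have := Finset.mem_range.1 he; omega)]
    simp
  have key2 := congrArg (fun x : ℝ => (x : ℂ)) key
  push_cast at key2 ⊢
  rw [← neg_eq_iff_eq_neg.2 key2, neg_mul, Finset.sum_mul, ← Finset.sum_neg_distrib]
  refine Finset.sum_congr rfl fun e _ => ?_
  simp
  ring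

/-- Bounded holomorphic functions vanishing at `0`, divided by `w`. -/
lemma slowGrowth_div_self {f : ℂ → ℂ} (hf : Differentiable ℂ f) (h0 : f 0 = 0) {r B : ℝ}
    (hr : 0 < r) (hb : ∀ w : ℂ, -r < w.re → ‖f w‖ ≤ B) :
    SlowGrowth (fun w => f w / w) := by
  have hds : Differentiable ℂ (dslope f 0) := by
    rw [← differentiableOn_univ]
    exact (Complex.differentiableOn_dslope univ_mem).2 hf.differentiableOn
  have heq : ∀ w, w ≠ 0 → dslope f 0 w = f w / w := fun w hw => by
    rw [dslope_of_ne _ hw, slope_def_field, h0, sub_zero, sub_zero]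
  obtain ⟨B', hB'⟩ := (isCompact_closedBall (0 : ℂ) 1).exists_bound_of_continuousOn
    hds.continuous.continuousOn
  refine (SlowGrowth.of_bounded (C := |B| + |B'|) hr hds.differentiableOn
    fun w hw _ => ?_).congr fun w hw => ?_
  · rcases le_total ‖w‖ 1 with h | h
    · refine (hB' w (by simpa using h)).trans ?_
      linarith [le_abs_self B', abs_nonneg B]
    · rw [heq w (by rintro rfl; simp at h; linarith), norm_div]
      refine (div_le_self (norm_nonneg _) h).trans ?_
      linarith [hb w hw, le_abs_self B, abs_nonneg B']
  · exact (heq w (by rintro rfl; simpa using hw.1)).symm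

end ArithProg

/-! ### Large primes: logarithms of Euler factors to second order -/

namespace ArithProg

variable {h : ArithmeticFunction ℝ} {a : ℤ} {k : ℝ}

lemma not_dvd_of_natAbs_lt (ha : a ≠ 0) {p : ℕ} (hp : a.natAbs < p) : ¬ p ∣ a.natAbs :=
  Nat.not_dvd_of_pos_of_lt (Int.natAbs_pos.2 ha) hp

lemma inv_prime_sub_one_le {p : ℕ} (hp : p.Prime) : (1 : ℝ) / (p - 1) ≤ 2 / p := by
  have h2 : (2 : ℝ) ≤ p := by exact_mod_cast hp.two_le
  rw [div_le_div_iff₀ (by linarith) (by linarith)]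
  linarith

/-- From b(p) = (1 - h(p))/(p - 1) and h(p) ≪ p^(1/8). Replacing p - 1 by p gains a further factor
1/p, which leaves room to work to the left of Re w = 0. -/
lemma PrimeHyp.exists_twist_prime_le (hyp : PrimeHyp h k) (hmult : h.IsMultiplicative) (a : ℤ) :
    ∃ C, 0 < C ∧ ∀ p : ℕ, p.Prime → ¬ p ∣ a.natAbs →
      |twist h a p| ≤ C * (p : ℝ) ^ (-(7 / 8) : ℝ) ∧
      |twist h a p - (1 - h p) / p| ≤ C * (p : ℝ) ^ (-(15 / 8) : ℝ) ∧
      |1 - h p| ≤ C * (p : ℝ) ^ (1 / 8 : ℝ) := by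
  obtain ⟨C, hC⟩ := hyp.growth (1 / 8) (by norm_num)
  refine ⟨2 * (1 + |C|), by positivity, fun p hp hpa => ?_⟩
  have h2 : (2 : ℝ) ≤ p := by exact_mod_cast hp.two_le
  have hp0 : (0 : ℝ) < p := by linarith
  have h1 : |1 - h p| ≤ (1 + |C|) * (p : ℝ) ^ (1 / 8 : ℝ) := by
    have h3 : (1 : ℝ) ≤ (p : ℝ) ^ (1 / 8 : ℝ) := Real.one_le_rpow (by linarith) (by norm_num)
    calc |1 - h p| ≤ 1 + |h p| := by simpa using abs_sub 1 (h p)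
      _ ≤ (p : ℝ) ^ (1 / 8 : ℝ) + |C| * (p : ℝ) ^ (1 / 8 : ℝ) :=
        add_le_add h3 ((hC p hp.one_le).trans (by gcongr; exact le_abs_self C))
      _ = _ := by ring
  have hinv : |(1 : ℝ) / (p - 1)| ≤ 2 / p := by
    rw [abs_of_nonneg (by apply div_nonneg <;> linarith)]
    exact inv_prime_sub_one_le hp
  have e1 : (p : ℝ) ^ (1 / 8 : ℝ) * (1 / p) = (p : ℝ) ^ (-(7 / 8) : ℝ) := by
    rw [mul_one_div, ← Real.rpow_sub_one hp0.ne']; norm_num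
  have e2 : (p : ℝ) ^ (-(7 / 8) : ℝ) * (1 / p) = (p : ℝ) ^ (-(15 / 8) : ℝ) := by
    rw [mul_one_div, ← Real.rpow_sub_one hp0.ne']; norm_num
  have hb : |twist h a p| ≤ 2 * (1 + |C|) * (p : ℝ) ^ (-(7 / 8) : ℝ) := by
    rw [twist_prime hmult hp hpa, div_eq_mul_one_div, abs_mul]
    calc |1 - h p| * |1 / ((p : ℝ) - 1)| ≤ ((1 + |C|) * (p : ℝ) ^ (1 / 8 : ℝ)) * (2 / p) := by gcongr
      _ = 2 * (1 + |C|) * ((p : ℝ) ^ (1 / 8 : ℝ) * (1 / p)) := by ring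
      _ = _ := by rw [e1]
  refine ⟨hb, ?_, h1.trans ?_⟩
  · have : twist h a p - (1 - h p) / p = twist h a p * (1 / p) := by
      rw [twist_prime hmult hp hpa]
      have : (p : ℝ) - 1 ≠ 0 := by linarith
      field_simp
      ring
    rw [this, abs_mul, abs_of_nonneg (by positivity : (0 : ℝ) ≤ 1 / p), ← e2, ← mul_assoc]
    gcongr
  · gcongr
    linarith [abs_nonneg C]

/-- Beyond `P` no prime divides `a` and all Euler factors are close to `1`. -/
def IsCutoff (h : ArithmeticFunction ℝ) (a : ℤ) (P : ℕ) : Prop :=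
  a.natAbs ≤ P ∧ ∀ p : ℕ, p.Prime → P < p → ∀ w : ℂ, -(1 / 8) < w.re →
    ‖(twist h a p : ℂ) * (p : ℂ) ^ (-w)‖ ≤ 1 / 2

lemma norm_twist_mul_le {C : ℝ} {p : ℕ} (hp : p.Prime)
    (hb : |twist h a p| ≤ C * (p : ℝ) ^ (-(7 / 8) : ℝ)) {w : ℂ} (hw : -(1 / 8) < w.re) :
    ‖(twist h a p : ℂ) * (p : ℂ) ^ (-w)‖ ≤ C * (p : ℝ) ^ (-(3 / 4) : ℝ) := by
  have hp0 : (0 : ℝ) < p := by exact_mod_cast hp.pos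
  have hp1 : (1 : ℝ) ≤ p := by exact_mod_cast hp.one_le
  rw [norm_mul, Complex.norm_real, Real.norm_eq_abs, Complex.norm_natCast_cpow_of_pos hp.pos]
  have h2 : (p : ℝ) ^ (-w).re ≤ (p : ℝ) ^ (1 / 8 : ℝ) :=
    Real.rpow_le_rpow_of_exponent_le hp1 (by simp; linarith)
  calc |twist h a p| * (p : ℝ) ^ (-w).re ≤ (C * (p : ℝ) ^ (-(7 / 8) : ℝ)) * (p : ℝ) ^ (1 / 8 : ℝ) :=
        mul_le_mul hb h2 (by positivity) ((abs_nonneg _).trans hb)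
    _ = C * ((p : ℝ) ^ (-(7 / 8) : ℝ) * (p : ℝ) ^ (1 / 8 : ℝ)) := by ring
    _ = _ := by rw [← Real.rpow_add hp0]; norm_num

lemma PrimeHyp.exists_isCutoff (hyp : PrimeHyp h k) (hmult : h.IsMultiplicative) (ha : a ≠ 0) :
    ∃ P, IsCutoff h a P := by
  obtain ⟨C, hC0, hC⟩ := hyp.exists_twist_prime_le hmult a
  have hlim : Tendsto (fun n : ℕ => C * (n : ℝ) ^ (-(3 / 4) : ℝ)) atTop (𝓝 0) := by
    simpa using ((tendsto_rpow_neg_atTop (by norm_num : (0 : ℝ) < 3 / 4)).comp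
      tendsto_natCast_atTop_atTop).const_mul C
  obtain ⟨N, hN⟩ := eventually_atTop.1 (hlim.eventually (ge_mem_nhds (by norm_num : (0 : ℝ) < 1 / 2)))
  refine ⟨max a.natAbs N, le_max_left _ _, fun p hp hpP w hw => ?_⟩
  have h1 : a.natAbs < p := (le_max_left _ _).trans_lt hpP
  exact (norm_twist_mul_le hp (hC p hp (not_dvd_of_natAbs_lt ha h1)).1 hw).trans
    (hN p ((le_max_right _ _).trans hpP.le))

/-- The second-order part of `log` of the Euler factor at a prime `n > P`. -/
noncomputable def largeTerm (h : ArithmeticFunction ℝ) (a : ℤ) (P n : ℕ) (w : ℂ) : ℂ :=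
  if n.Prime then (if P < n then Complex.log (1 + (twist h a n : ℂ) * (n : ℂ) ^ (-w)) else 0) -
    ((1 - h n : ℝ) : ℂ) * (n : ℂ) ^ (-(1 + w)) else 0

lemma differentiableOn_largeTerm {P : ℕ} (hP : IsCutoff h a P) (n : ℕ) :
    DifferentiableOn ℂ (largeTerm h a P n) {w | -(1 / 8) < w.re} := by
  unfold largeTerm
  by_cases hp : n.Prime
  · simp only [hp, if_true]
    have hn : (n : ℂ) ≠ 0 := by exact_mod_cast hp.ne_zero
    have hd : Differentiable ℂ fun w : ℂ => (n : ℂ) ^ (-(1 + w)) :=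
      Differentiable.const_cpow (by fun_prop) (Or.inl hn)
    have hd2 : Differentiable ℂ fun w : ℂ => (n : ℂ) ^ (-w) :=
      Differentiable.const_cpow (by fun_prop) (Or.inl hn)
    refine DifferentiableOn.sub ?_ (hd.const_mul _).differentiableOn
    by_cases hPn : P < n
    · simp only [hPn, if_true]
      refine DifferentiableOn.clog ((hd2.const_mul _).const_add 1).differentiableOn fun w hw => ?_
      have := (abs_le.1 ((Complex.abs_re_le_norm _).trans (hP.2 n hp hPn w hw))).1
      refine Or.inl ?_
      simp only [Complex.add_re, Complex.one_re]; linarith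
    · simp [hPn]
  · simp [hp]

/-- Two second-order effects occur beyond P: log(1 + z) - z with |z| ≪ n^(-3/4), and the replacement
of b(n) by (1 - h(n))/n. Up to P there is no logarithm and only the first-order term is present; the
factor P^(3/4) makes it fit the same bound. -/
lemma PrimeHyp.exists_norm_largeTerm_le (hyp : PrimeHyp h k) (hmult : h.IsMultiplicative)
    (ha : a ≠ 0) {P : ℕ} (hP : IsCutoff h a P) :
    ∃ C, ∀ n w, -(1 / 8) < w.re → ‖largeTerm h a P n w‖ ≤ C * (n : ℝ) ^ (-(3 / 2) : ℝ) := by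
  obtain ⟨C, hC0, hC⟩ := hyp.exists_twist_prime_le hmult a
  obtain ⟨C', hC'⟩ := hyp.growth (1 / 8) (by norm_num)
  refine ⟨2 * C ^ 2 + C + (1 + |C'|) * (P : ℝ) ^ (3 / 4 : ℝ), fun n w hw => ?_⟩
  unfold largeTerm
  split_ifs with hp hPn
  · have hpa := not_dvd_of_natAbs_lt ha (hP.1.trans_lt hPn)
    obtain ⟨b1, b2, b3⟩ := hC n hp hpa
    have hn0 : (0 : ℝ) < n := by exact_mod_cast hp.pos
    have hn : (n : ℂ) ≠ 0 := by exact_mod_cast hp.ne_zero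
    set z := (twist h a n : ℂ) * (n : ℂ) ^ (-w) with hz
    have hz1 := hP.2 n hp hPn w hw
    have hz2 := norm_twist_mul_le hp b1 hw
    have e : Complex.log (1 + z) - ((1 - h n : ℝ) : ℂ) * (n : ℂ) ^ (-(1 + w)) =
        (Complex.log (1 + z) - z) +
          ((twist h a n - (1 - h n) / n : ℝ) : ℂ) * (n : ℂ) ^ (-w) := by
      rw [hz, neg_add, Complex.cpow_add _ _ hn, Complex.cpow_neg_one]
      push_cast
      ring
    rw [e]
    have t1 : ‖Complex.log (1 + z) - z‖ ≤ 2 * C ^ 2 * (n : ℝ) ^ (-(3 / 2) : ℝ) := by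
      refine (norm_log_one_add_sub_self_le_sq (by linarith)).trans ?_
      have : ((n : ℝ) ^ (-(3 / 4) : ℝ)) ^ 2 = (n : ℝ) ^ (-(3 / 2) : ℝ) := by
        rw [← Real.rpow_natCast, ← Real.rpow_mul hn0.le]; norm_num
      calc 2 * ‖z‖ ^ 2 ≤ 2 * (C * (n : ℝ) ^ (-(3 / 4) : ℝ)) ^ 2 := by gcongr
        _ = _ := by rw [mul_pow, this]; ring
    have t2 : ‖((twist h a n - (1 - h n) / n : ℝ) : ℂ) * (n : ℂ) ^ (-w)‖ ≤
        C * (n : ℝ) ^ (-(3 / 2) : ℝ) := by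
      rw [norm_mul, Complex.norm_real, Real.norm_eq_abs, Complex.norm_natCast_cpow_of_pos hp.pos]
      have h2 : (n : ℝ) ^ (-w).re ≤ (n : ℝ) ^ (3 / 8 : ℝ) :=
        Real.rpow_le_rpow_of_exponent_le (by exact_mod_cast hp.one_le) (by simp; linarith)
      calc _ ≤ (C * (n : ℝ) ^ (-(15 / 8) : ℝ)) * (n : ℝ) ^ (3 / 8 : ℝ) := by gcongr
        _ = C * ((n : ℝ) ^ (-(15 / 8) : ℝ) * (n : ℝ) ^ (3 / 8 : ℝ)) := by ring
        _ = _ := by rw [← Real.rpow_add hn0]; norm_num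
    refine (norm_add_le _ _).trans ((add_le_add t1 t2).trans ?_)
    rw [← add_mul]
    refine mul_le_mul_of_nonneg_right ?_ (by positivity)
    have : 0 ≤ (1 + |C'|) * (P : ℝ) ^ (3 / 4 : ℝ) := by positivity
    linarith
  · have hn0 : (0 : ℝ) < n := by exact_mod_cast hp.pos
    rw [zero_sub, norm_neg, norm_mul, Complex.norm_real, Real.norm_eq_abs]
    have h1 : |1 - h n| ≤ (1 + |C'|) * (n : ℝ) ^ (1 / 8 : ℝ) := by
      have h3 : (1 : ℝ) ≤ (n : ℝ) ^ (1 / 8 : ℝ) :=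
        Real.one_le_rpow (by exact_mod_cast hp.one_le) (by norm_num)
      calc |1 - h n| ≤ 1 + |h n| := by simpa using abs_sub 1 (h n)
        _ ≤ (n : ℝ) ^ (1 / 8 : ℝ) + |C'| * (n : ℝ) ^ (1 / 8 : ℝ) :=
          add_le_add h3 ((hC' n hp.one_le).trans (by gcongr; exact le_abs_self C'))
        _ = _ := by ring
    have h2 := norm_prime_cpow_le hp hw
    have hnP : (n : ℝ) ^ (3 / 4 : ℝ) ≤ (P : ℝ) ^ (3 / 4 : ℝ) := by
      have : (n : ℝ) ≤ P := by exact_mod_cast not_lt.1 hPn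
      gcongr
    calc |1 - h n| * ‖(n : ℂ) ^ (-(1 + w))‖
        ≤ ((1 + |C'|) * (n : ℝ) ^ (1 / 8 : ℝ)) * (n : ℝ) ^ (-(7 / 8) : ℝ) := by gcongr
      _ = (1 + |C'|) * ((n : ℝ) ^ (3 / 4 : ℝ) * (n : ℝ) ^ (-(3 / 2) : ℝ)) := by
        rw [mul_assoc, ← Real.rpow_add hn0, ← Real.rpow_add hn0]; norm_num
      _ ≤ (1 + |C'|) * ((P : ℝ) ^ (3 / 4 : ℝ) * (n : ℝ) ^ (-(3 / 2) : ℝ)) := by gcongr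
      _ ≤ _ := by
        rw [← mul_assoc]
        refine mul_le_mul_of_nonneg_right ?_ (by positivity)
        nlinarith [sq_nonneg C]
  · simp
    have : 0 ≤ 2 * C ^ 2 + C + (1 + |C'|) * (P : ℝ) ^ (3 / 4 : ℝ) := by positivity
    positivity

/-- The sum of the second-order parts of the logarithms of the Euler factors. -/
noncomputable def largeSum (h : ArithmeticFunction ℝ) (a : ℤ) (P : ℕ) (w : ℂ) : ℂ :=
  ∑' n, largeTerm h a P n w

lemma PrimeHyp.largeSum_holomorphic (hyp : PrimeHyp h k) (hmult : h.IsMultiplicative)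
    (ha : a ≠ 0) {P : ℕ} (hP : IsCutoff h a P) :
    DifferentiableOn ℂ (largeSum h a P) {w | -(1 / 8) < w.re} ∧
    (∃ B, ∀ w, -(1 / 8) < w.re → ‖largeSum h a P w‖ ≤ B) ∧
    (∀ w, -(1 / 8) < w.re → Summable fun n => largeTerm h a P n w) := by
  obtain ⟨C, hC⟩ := hyp.exists_norm_largeTerm_le hmult ha hP
  have hs : Summable fun n : ℕ => C * (n : ℝ) ^ (-(3 / 2) : ℝ) :=
    (Real.summable_nat_rpow.2 (by norm_num)).mul_left C
  obtain ⟨h1, h2, _⟩ := primeSum_holomorphic (r := 1 / 8) (by norm_num) hs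
    (differentiableOn_largeTerm hP) hC
  exact ⟨h1, ⟨_, h2⟩, fun w hw => Summable.of_norm_bounded hs fun n => hC n w hw⟩

/-- The Euler product up to `N`, split at the cutoff. -/
lemma prod_eulerFactor_eq (ha : a ≠ 0) {P : ℕ} (hP : IsCutoff h a P) {w : ℂ}
    (hw : -(1 / 8) < w.re) {N : ℕ} (hN : P ≤ N) :
    ∏ p ∈ primesUpTo N, eulerFactor h a p w = (∏ p ∈ primesUpTo P, eulerFactor h a p w) *
      Complex.exp (∑ p ∈ primesUpTo N,
        (largeTerm h a P p w + ((1 - h p : ℝ) : ℂ) * (p : ℂ) ^ (-(1 + w)))) := by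
  have hsub : primesUpTo P ⊆ primesUpTo N := by
    intro p hp
    simp only [primesUpTo, Finset.mem_filter, Finset.mem_range] at hp ⊢
    exact ⟨by omega, hp.2⟩
  -- Up to P the exponents cancel to 0, since `largeTerm` subtracts the first-order term there too;
  -- beyond P they are the logarithms of the Euler factors.
  rw [Complex.exp_sum, ← Finset.prod_sdiff hsub, mul_comm,
    ← Finset.prod_sdiff hsub (f := fun p => Complex.exp _)]
  congr 1
  have h1 : ∏ p ∈ primesUpTo P,
      Complex.exp (largeTerm h a P p w + ((1 - h p : ℝ) : ℂ) * (p : ℂ) ^ (-(1 + w))) = 1 := by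
    refine Finset.prod_eq_one fun p hp => ?_
    simp only [primesUpTo, Finset.mem_filter, Finset.mem_range] at hp
    rw [largeTerm, if_pos hp.2, if_neg (by omega)]
    simp
  rw [h1, mul_one]
  refine Finset.prod_congr rfl fun p hp => ?_
  simp only [primesUpTo, Finset.mem_sdiff, Finset.mem_filter, Finset.mem_range, not_and] at hp
  have hpp := hp.1.2
  have hPp : P < p := by
    by_contra hc
    exact hp.2 (by omega) hpp
  rw [largeTerm, if_pos hpp, if_pos hPp, sub_add_cancel,
    eulerFactor_of_not_dvd (not_dvd_of_natAbs_lt ha (hP.1.trans_lt hPp)), Complex.exp_log]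
  intro h0
  have := hP.2 p hpp hPp w hw
  rw [eq_neg_of_add_eq_zero_right h0, norm_neg, norm_one] at this
  norm_num at this

end ArithProg

/-! ### Absolute convergence and Euler product of the Dirichlet series of b -/

namespace ArithProg

variable {h : ArithmeticFunction ℝ} {a : ℤ} {k : ℝ}

lemma PrimeHyp.summable_prime_mul (hyp : PrimeHyp h k) (hnonneg : ∀ d, 0 ≤ h d) {σ : ℝ}
    (hσ : 0 < σ) : Summable fun n : ℕ => if n.Prime then (h n + k) * (n : ℝ) ^ (-1 - σ) else 0 := by
  have habs : LSeries.abscissaOfAbsConv (primeCoeff fun n => h n + k) ≤ 0 := by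
    refine abscissa_primeCoeff_le fun ε hε => ?_
    obtain ⟨C, hC⟩ := hyp.exists_abs_sub_le hε
    refine ⟨C + 2 * k, fun p hp => ?_⟩
    have h1 : (1 : ℝ) ≤ (p : ℝ) ^ ε := Real.one_le_rpow (by exact_mod_cast hp.one_le) hε.le
    have h2 := (le_abs_self _).trans (hC p hp)
    have h3 := hyp.nonneg
    rw [abs_of_nonneg (add_nonneg (hnonneg p) h3)]
    nlinarith
  have := (lseriesSummable_of_abscissa habs (w := σ) (by simpa using hσ)).norm
  refine this.congr fun n => ?_
  rw [norm_primeCoeff_term, abs_of_nonneg (add_nonneg (hnonneg n) hyp.nonneg)]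
  simp

lemma natCast_pow_rpow (p e : ℕ) (σ : ℝ) : ((p ^ e : ℕ) : ℝ) ^ σ = ((p : ℝ) ^ σ) ^ e := by
  push_cast
  rw [← Real.rpow_natCast, ← Real.rpow_mul (by positivity), mul_comm, Real.rpow_mul (by positivity),
    Real.rpow_natCast]

lemma tsum_abs_twist_prime_pow {p : ℕ} (hp : p.Prime) (σ : ℝ) :
    (Summable fun e : ℕ => ‖|twist h a (p ^ e)| * ((p ^ e : ℕ) : ℝ) ^ (-σ)‖) ∧
    ∑' e : ℕ, |twist h a (p ^ e)| * ((p ^ e : ℕ) : ℝ) ^ (-σ) =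
      ∑ e ∈ Finset.range (expo a p + 2), |twist h a (p ^ e)| * ((p : ℝ) ^ (-σ)) ^ e := by
  have h0 : ∀ e ∉ Finset.range (expo a p + 2), twist h a (p ^ e) = 0 := fun e he =>
    twist_prime_pow_eq_zero hp (by simpa using he)
  constructor
  · exact summable_of_ne_finset_zero (s := Finset.range (expo a p + 2)) fun e he => by
      rw [h0 e he]; simp
  · rw [tsum_eq_sum (s := Finset.range (expo a p + 2)) fun e he => by rw [h0 e he]; simp]
    exact Finset.sum_congr rfl fun e _ => by rw [natCast_pow_rpow]

/-- `∑_d |b(d)| d^{-σ} = O(σ^{-c})` as `σ → 0`. -/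
lemma PrimeHyp.exists_tsum_abs_twist_le (hyp : PrimeHyp h k) (hmult : h.IsMultiplicative)
    (hnonneg : ∀ d, 0 ≤ h d) (ha : a ≠ 0) :
    ∃ C c : ℝ, 0 < C ∧ 0 ≤ c ∧ ∀ σ : ℝ, 0 < σ → σ < 1 →
      (Summable fun d : ℕ => |twist h a d| * (d : ℝ) ^ (-σ)) ∧
      ∑' d : ℕ, |twist h a d| * (d : ℝ) ^ (-σ) ≤ C * σ ^ (-c) := by
  obtain ⟨C1, hC10, hC1⟩ := exists_primeZetaReal_le
  obtain ⟨C2, hC2⟩ := hyp.exists_tsum_abs_le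
  set A : ℕ → ℝ := fun p => ∑ e ∈ Finset.range (expo a p + 2), |twist h a (p ^ e)| with hA
  have hA0 : ∀ p, 0 ≤ A p := fun p => Finset.sum_nonneg fun e _ => abs_nonneg _
  set A0 := ∑ p ∈ a.natAbs.primeFactors, A p with hA0d
  have hk := hyp.nonneg
  -- Here 2 ∑ (h(p) + k) p^(-1-σ) contributes 4k log(1/σ) + 2 C2, and 2 ∑ p^(-1-σ) contributes 2
  -- log(1/σ) + 2 C1; the primes dividing a account for A0.
  refine ⟨Real.exp (A0 + 2 * C2 + 2 * C1), 4 * k + 2, Real.exp_pos _, by linarith,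
    fun σ h0 h1 => ?_⟩
  set f : ℕ → ℝ := fun d => |twist h a d| * (d : ℝ) ^ (-σ) with hf
  have hf0 : ∀ d, 0 ≤ f d := fun d => by positivity
  have hs1 := hyp.summable_prime_mul hnonneg h0
  have hs2 := summable_prime_rpow h0
  -- Away from a, |b(p)| ≤ 2(1 + h(p))/p and 1 + t ≤ e^t. The finitely many p dividing a only
  -- contribute a bounded factor.
  have hlocal : ∀ p : ℕ, p.Prime → ∑' e : ℕ, f (p ^ e) ≤
      Real.exp ((if p ∣ a.natAbs then A p else 0) + 2 * (1 + h p) * (p : ℝ) ^ (-1 - σ)) := by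
    intro p hp
    have hp0 : (0 : ℝ) < p := by exact_mod_cast hp.pos
    rw [(tsum_abs_twist_prime_pow hp σ).2]
    have hpos : 0 ≤ 2 * (1 + h p) * (p : ℝ) ^ (-1 - σ) := by
      have := hnonneg p; positivity
    split_ifs with hpa
    · have h3 : (p : ℝ) ^ (-σ) ≤ 1 :=
        Real.rpow_le_one_of_one_le_of_nonpos (by exact_mod_cast hp.one_le) (by linarith)
      calc _ ≤ A p := Finset.sum_le_sum fun e _ =>
            mul_le_of_le_one_right (abs_nonneg _) (pow_le_one₀ (by positivity) h3)
        _ ≤ A p + 2 * (1 + h p) * (p : ℝ) ^ (-1 - σ) + 1 := by linarith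
        _ ≤ _ := Real.add_one_le_exp _
    · rw [expo_eq_zero hpa]
      simp only [zero_add, Finset.sum_range_succ, Finset.range_one, Finset.sum_singleton, pow_zero,
        pow_one, (isMultiplicative_twist h a).map_one, abs_one, mul_one]
      have hb : |twist h a p| ≤ (1 + h p) * (2 / p) := by
        rw [twist_prime hmult hp hpa, div_eq_mul_one_div, abs_mul]
        have h2 : (2 : ℝ) ≤ p := by exact_mod_cast hp.two_le
        rw [abs_of_nonneg (show (0 : ℝ) ≤ 1 / (p - 1) by apply div_nonneg <;> linarith)]
        refine mul_le_mul ?_ (inv_prime_sub_one_le hp) (by apply div_nonneg <;> linarith) ?_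
        · rw [abs_le]; constructor <;> linarith [hnonneg p]
        · linarith [hnonneg p]
      refine le_trans ?_ (Real.add_one_le_exp _)
      rw [add_comm]
      refine add_le_add ?_ le_rfl
      calc |twist h a p| * (p : ℝ) ^ (-σ) ≤ (1 + h p) * (2 / p) * (p : ℝ) ^ (-σ) := by gcongr
        _ = _ := by
          rw [Real.rpow_sub hp0, Real.rpow_neg_one, Real.rpow_neg hp0.le]
          field_simp
  -- Every 0 < d < N is N-smooth, so the partial sum is at most the finite Euler product over primes
  -- below N. No convergence has to be known beforehand.
  have hbound : ∀ N : ℕ, ∑ d ∈ Finset.range N, f d ≤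
      Real.exp (A0 + 2 * C2 + 2 * C1) * σ ^ (-(4 * k + 2)) := by
    intro N
    have key := EulerProduct.summable_and_hasSum_smoothNumbers_prod_primesBelow_tsum (f := f)
      (by simp [hf, (isMultiplicative_twist h a).map_one])
      (fun {m n} hmn => by
        simp only [hf]
        rw [(isMultiplicative_twist h a).map_mul_of_coprime hmn, abs_mul, Nat.cast_mul,
          Real.mul_rpow (by positivity) (by positivity)]
        ring)
      (fun {p} hp => (tsum_abs_twist_prime_pow hp σ).1) N
    have hsumm : Summable (Set.indicator (N.smoothNumbers) f) := by
      rw [← summable_subtype_iff_indicator]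
      exact key.2.summable
    have h1' : ∑ d ∈ Finset.range N, f d ≤ ∑' d, Set.indicator (N.smoothNumbers) f d := by
      have : ∑ d ∈ Finset.range N, f d = ∑ d ∈ Finset.range N, Set.indicator (N.smoothNumbers) f d := by
        refine Finset.sum_congr rfl fun d hd => ?_
        rcases Nat.eq_zero_or_pos d with rfl | hd0
        · have hf00 : f 0 = 0 := by simp [hf]
          rw [hf00, Set.indicator_apply, hf00, ite_self]
        · rw [Set.indicator_of_mem (Nat.mem_smoothNumbers_of_lt hd0 (Finset.mem_range.1 hd))]
      rw [this]
      exact hsumm.sum_le_tsum _ fun d _ => Set.indicator_nonneg (fun d _ => hf0 d) d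
    rw [← tsum_subtype, key.2.tsum_eq] at h1'
    refine h1'.trans ((Finset.prod_le_prod (fun p _ => tsum_nonneg fun e => hf0 _) fun p hp =>
      hlocal p (Nat.prime_of_mem_primesBelow hp)).trans ?_)
    rw [← Real.exp_sum, Real.rpow_def_of_pos h0, ← Real.exp_add, Real.exp_le_exp,
      Finset.sum_add_distrib]
    have g1 : ∑ p ∈ N.primesBelow, (if p ∣ a.natAbs then A p else 0) ≤ A0 := by
      rw [← Finset.sum_filter]
      refine Finset.sum_le_sum_of_subset_of_nonneg (fun p hp => ?_) fun p _ _ => hA0 p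
      rw [Finset.mem_filter] at hp
      exact Nat.mem_primeFactors.2 ⟨Nat.prime_of_mem_primesBelow hp.1, hp.2, Int.natAbs_ne_zero.2 ha⟩
    have g2 : ∑ p ∈ N.primesBelow, 2 * (1 + h p) * (p : ℝ) ^ (-1 - σ) ≤
        2 * (2 * k * Real.log (1 / σ) + C2) + 2 * (Real.log (1 / σ) + C1) := by
      have e1 : ∑ p ∈ N.primesBelow, 2 * (1 + h p) * (p : ℝ) ^ (-1 - σ) ≤
          2 * (∑ p ∈ Finset.range N, if p.Prime then (h p + k) * (p : ℝ) ^ (-1 - σ) else 0) +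
          2 * ∑ p ∈ Finset.range N, if p.Prime then (p : ℝ) ^ (-1 - σ) else 0 := by
        rw [← Finset.sum_filter, ← Finset.sum_filter, Finset.mul_sum, Finset.mul_sum,
          ← Finset.sum_add_distrib]
        refine Finset.sum_le_sum fun p _ => ?_
        have : 0 ≤ (p : ℝ) ^ (-1 - σ) := by positivity
        nlinarith
      have e2 := (hs1.sum_le_tsum (Finset.range N) (fun p _ => by
        split_ifs
        · have := hnonneg p; positivity
        · exact le_rfl)).trans (hC2 σ h0 h1)
      have e3 := (hs2.sum_le_tsum (Finset.range N) (fun p _ => by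
        split_ifs <;> positivity)).trans (hC1 σ h0 h1)
      linarith
    have : Real.log (1 / σ) = -Real.log σ := by rw [one_div, Real.log_inv]
    rw [this] at g2
    linarith
  have hsum := summable_of_sum_range_le hf0 hbound
  exact ⟨hsum, hsum.tsum_le_of_sum_range_le hbound⟩

/-- The Dirichlet series of `twist h a`. -/
noncomputable def twistSeries (h : ArithmeticFunction ℝ) (a : ℤ) (w : ℂ) : ℂ :=
  LSeries (fun d => (twist h a d : ℂ)) w

lemma norm_term_twist (w : ℂ) (d : ℕ) :
    ‖LSeries.term (fun d => (twist h a d : ℂ)) w d‖ = |twist h a d| * (d : ℝ) ^ (-w.re) := by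
  rcases Nat.eq_zero_or_pos d with rfl | hd
  · simp
  · rw [LSeries.term_of_ne_zero hd.ne', norm_div, Complex.norm_real, Real.norm_eq_abs,
      Complex.norm_natCast_cpow_of_pos hd, Real.rpow_neg (by positivity), div_eq_mul_inv]

lemma PrimeHyp.summable_abs_twist (hyp : PrimeHyp h k) (hmult : h.IsMultiplicative)
    (hnonneg : ∀ d, 0 ≤ h d) (ha : a ≠ 0) {σ : ℝ} (hσ : 0 < σ) :
    Summable fun d : ℕ => |twist h a d| * (d : ℝ) ^ (-σ) := by
  obtain ⟨C, c, _, _, hC⟩ := hyp.exists_tsum_abs_twist_le hmult hnonneg ha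
  have := (hC (min σ (1 / 2)) (by positivity) (by
    exact (min_le_right _ _).trans_lt (by norm_num))).1
  refine Summable.of_nonneg_of_le (fun d => by positivity) (fun d => ?_) this
  rcases Nat.eq_zero_or_pos d with rfl | hd
  · simp
  · refine mul_le_mul_of_nonneg_left (Real.rpow_le_rpow_of_exponent_le (by exact_mod_cast hd) ?_)
      (abs_nonneg _)
    linarith [min_le_left σ (1 / 2)]

lemma PrimeHyp.lseriesSummable_twist (hyp : PrimeHyp h k) (hmult : h.IsMultiplicative)
    (hnonneg : ∀ d, 0 ≤ h d) (ha : a ≠ 0) {w : ℂ} (hw : 0 < w.re) :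
    LSeriesSummable (fun d => (twist h a d : ℂ)) w :=
  Summable.of_norm ((hyp.summable_abs_twist hmult hnonneg ha hw).congr fun d =>
    (norm_term_twist w d).symm)

lemma natCast_pow_cpow (p e : ℕ) (w : ℂ) : ((p ^ e : ℕ) : ℂ) ^ w = ((p : ℂ) ^ w) ^ e := by
  induction e with
  | zero => simp
  | succ e ih => rw [pow_succ, Nat.cast_mul, Complex.natCast_mul_natCast_cpow, ih, pow_succ]

lemma tsum_term_prime_pow {p : ℕ} (hp : p.Prime) (w : ℂ) :
    ∑' e : ℕ, LSeries.term (fun d => (twist h a d : ℂ)) w (p ^ e) = eulerFactor h a p w := by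
  have h0 : ∀ e ∉ Finset.range (expo a p + 2), twist h a (p ^ e) = 0 := fun e he =>
    twist_prime_pow_eq_zero hp (by simpa using he)
  rw [tsum_eq_sum (s := Finset.range (expo a p + 2)) fun e he => by
    rw [LSeries.term_of_ne_zero (pow_ne_zero _ hp.ne_zero), h0 e he]; simp]
  refine Finset.sum_congr rfl fun e _ => ?_
  rw [LSeries.term_of_ne_zero (pow_ne_zero _ hp.ne_zero), natCast_pow_cpow, Complex.cpow_neg,
    inv_pow, div_eq_mul_inv]

lemma PrimeHyp.tendsto_prod_eulerFactor (hyp : PrimeHyp h k) (hmult : h.IsMultiplicative)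
    (hnonneg : ∀ d, 0 ≤ h d) (ha : a ≠ 0) {w : ℂ} (hw : 0 < w.re) :
    Tendsto (fun N : ℕ => ∏ p ∈ primesUpTo N, eulerFactor h a p w) atTop
      (𝓝 (twistSeries h a w)) := by
  have := EulerProduct.eulerProduct (f := LSeries.term (fun d => (twist h a d : ℂ)) w)
    (by simp [LSeries.term, (isMultiplicative_twist h a).map_one])
    (fun {m n} hmn => by
      rcases Nat.eq_zero_or_pos m with rfl | hm
      · simp
      rcases Nat.eq_zero_or_pos n with rfl | hn
      · simp
      rw [LSeries.term_of_ne_zero hm.ne', LSeries.term_of_ne_zero hn.ne',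
        LSeries.term_of_ne_zero (mul_pos hm hn).ne', (isMultiplicative_twist h a).map_mul_of_coprime hmn,
        Nat.cast_mul, Complex.natCast_mul_natCast_cpow]
      push_cast
      ring)
    (hyp.lseriesSummable_twist hmult hnonneg ha hw).norm (LSeries.term_zero _ _)
  refine (this.comp (tendsto_add_atTop_nat 1)).congr fun N => ?_
  exact Finset.prod_congr rfl fun p hp => tsum_term_prime_pow (Finset.mem_filter.1 hp).2 w

lemma primesUpTo_sum_eq (g : ℕ → ℂ) (N : ℕ) :
    ∑ p ∈ primesUpTo N, g p = ∑ n ∈ Finset.range (N + 1), if n.Prime then g n else 0 := by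
  rw [primesUpTo, Finset.sum_filter]

/-- The Euler product, with the contributions of `ζ` and of `h(p) - k` split off. -/
lemma PrimeHyp.twistSeries_eq (hyp : PrimeHyp h k) (hmult : h.IsMultiplicative)
    (hnonneg : ∀ d, 0 ≤ h d) (ha : a ≠ 0) {P : ℕ} (hP : IsCutoff h a P) {w : ℂ} (hw : 0 < w.re) :
    twistSeries h a w = (∏ p ∈ primesUpTo P, eulerFactor h a p w) *
      Complex.exp (largeSum h a P w - primeDev h k w + (1 - k) * primeZeta w) := by
  have hw' : -(1 / 8) < w.re := by linarith
  refine tendsto_nhds_unique (hyp.tendsto_prod_eulerFactor hmult hnonneg ha hw) ?_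
  have h1 := ((hyp.largeSum_holomorphic hmult ha hP).2.2 w hw').hasSum.tendsto_sum_nat
  have h2 := (lseriesSummable_of_abscissa hyp.abscissa_le hw).hasSum.tendsto_sum_nat
  have h3 := (lseriesSummable_of_abscissa abscissa_primeOne hw).hasSum.tendsto_sum_nat
  have h4 := ((h1.sub h2).add (h3.const_mul (1 - (k : ℂ)))).comp (tendsto_add_atTop_nat 1)
  refine (((Complex.continuous_exp.tendsto _).comp h4).const_mul _).congr' ?_
  filter_upwards [eventually_ge_atTop P] with N hN
  rw [prod_eulerFactor_eq ha hP hw' hN]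
  refine congrArg (fun z => _ * Complex.exp z) ?_
  simp only [Function.comp_apply]
  rw [Finset.mul_sum, ← Finset.sum_sub_distrib, ← Finset.sum_add_distrib, primesUpTo_sum_eq]
  refine Finset.sum_congr rfl fun n _ => ?_
  by_cases hp : n.Prime
  · have hn : (n : ℂ) ≠ 0 := by exact_mod_cast hp.ne_zero
    rw [if_pos hp, LSeries.term_of_ne_zero hp.ne_zero, LSeries.term_of_ne_zero hp.ne_zero,
      primeCoeff, primeCoeff, if_pos hp, if_pos hp, neg_add, Complex.cpow_add _ _ hn,
      Complex.cpow_neg_one, Complex.cpow_neg]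
    push_cast
    field_simp
    ring
  · rw [if_neg hp]
    simp [LSeries.term, primeCoeff, hp, largeTerm]

end ArithProg

/-! ### The regularized Dirichlet series and its value at the origin -/

namespace ArithProg

variable {h : ArithmeticFunction ℝ} {a : ℤ} {k : ℝ}

lemma degenerate_iff {p : ℕ} :
    h (p ^ expo a p) = h (p ^ (expo a p + 1)) / (p : ℝ) ↔ localDiff h a p = 0 := by
  rw [localDiff, sub_eq_zero]

lemma PrimeHyp.localDiff_pos (hyp : PrimeHyp h k) (hmult : h.IsMultiplicative) {p : ℕ}
    (hp : p.Prime) (hpa : ¬ p ∣ a.natAbs) : 0 < localDiff h a p := by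
  have hp0 : (0 : ℝ) < p := by exact_mod_cast hp.pos
  rw [localDiff_of_not_dvd hmult hpa, sub_pos, div_lt_one hp0]
  exact hyp.lt_self p hp

-- If p does not divide a, the local difference is 1 - h(p)/p > 0. Degenerate primes therefore
-- divide a, and all lie below any cutoff P ≥ |a|.
open Classical in
lemma PrimeHyp.degeneratePrimes_eq (hyp : PrimeHyp h k) (hmult : h.IsMultiplicative)
    (ha : a ≠ 0) {P : ℕ} (hP : a.natAbs ≤ P) :
    degeneratePrimes h a = (primesUpTo P).filter fun p => localDiff h a p = 0 := by
  ext p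
  simp only [degeneratePrimes, primesUpTo, Finset.mem_filter, Finset.mem_range, degenerate_iff,
    Nat.mem_primeFactors]
  constructor
  · rintro ⟨⟨hp, hd, _⟩, h0⟩
    exact ⟨⟨Nat.lt_succ_of_le ((Nat.le_of_dvd (Int.natAbs_pos.2 ha) hd).trans hP), hp⟩, h0⟩
  · rintro ⟨⟨_, hp⟩, h0⟩
    refine ⟨⟨hp, ?_, (Int.natAbs_pos.2 ha).ne'⟩, h0⟩
    by_contra hd
    exact (hyp.localDiff_pos hmult hp hd).ne' h0

open Classical in
/-- The Euler factor divided by its zero at the origin, if any. -/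
noncomputable def reducedFactor (h : ArithmeticFunction ℝ) (a : ℤ) (p : ℕ) (w : ℂ) : ℂ :=
  if localDiff h a p = 0 then eulerFactor h a p w / w else eulerFactor h a p w

open Classical in
/-- The value of `reducedFactor` at the origin. -/
noncomputable def reducedValue (h : ArithmeticFunction ℝ) (a : ℤ) (p : ℕ) : ℝ :=
  if localDiff h a p = 0 then (∑ j ∈ Finset.range (expo a p + 1), h (p ^ j)) * Real.log p
  else localDiff h a p / (1 - 1 / (p : ℝ))

lemma slowGrowth_reducedFactor (hmult : h.IsMultiplicative) {p : ℕ} (hp : p.Prime) :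
    SlowGrowth (reducedFactor h a p) := by
  obtain ⟨B, hB⟩ := exists_norm_eulerFactor_le (h := h) (a := a) hp
  unfold reducedFactor
  split_ifs with hd
  · exact slowGrowth_div_self (differentiable_eulerFactor hp) (by
      rw [eulerFactor_zero hmult hp, hd]; simp) (by norm_num : (0 : ℝ) < 1 / 8) hB
  · exact SlowGrowth.of_bounded (by norm_num : (0 : ℝ) < 1 / 8)
      (differentiable_eulerFactor hp).differentiableOn fun w hw _ => hB w hw

lemma tendsto_ofReal_nhdsGT : Tendsto (fun σ : ℝ => (σ : ℂ)) (𝓝[>] 0) (𝓝[≠] 0) := by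
  rw [tendsto_nhdsWithin_iff]
  refine ⟨?_, ?_⟩
  · exact (Complex.continuous_ofReal.tendsto' 0 0 (by simp)).mono_left nhdsWithin_le_nhds
  · filter_upwards [self_mem_nhdsWithin] with σ hσ
    simpa using (ne_of_gt hσ)

lemma tendsto_reducedFactor (hmult : h.IsMultiplicative) {p : ℕ} (hp : p.Prime) :
    Tendsto (fun σ : ℝ => reducedFactor h a p σ) (𝓝[>] 0) (𝓝 (reducedValue h a p : ℂ)) := by
  unfold reducedFactor reducedValue
  split_ifs with hd
  · have := (hasDerivAt_iff_tendsto_slope.1 (deriv_eulerFactor_zero hp hd)).comp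
      tendsto_ofReal_nhdsGT
    refine this.congr fun σ => ?_
    simp [slope_def_field, eulerFactor_zero hmult hp, hd]
  · rw [← eulerFactor_zero hmult hp]
    exact ((differentiable_eulerFactor hp).continuous.tendsto 0).comp
      (tendsto_ofReal_nhdsGT.mono_right nhdsWithin_le_nhds)

lemma SlowGrowth.prod {ι : Type*} (s : Finset ι) {f : ι → ℂ → ℂ}
    (hf : ∀ i ∈ s, SlowGrowth (f i)) : SlowGrowth fun w => ∏ i ∈ s, f i w := by
  classical
  induction s using Finset.induction_on with
  | empty => simpa using SlowGrowth.const 1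
  | insert i s hi ih =>
    simp only [Finset.prod_insert hi]
    exact (hf i (Finset.mem_insert_self _ _)).mul
      (ih fun j hj => hf j (Finset.mem_insert_of_mem hj))

/-- `w ^ (1 - k - ω) F(w)`, which has neither a zero nor a pole at the origin. -/
noncomputable def regularized (h : ArithmeticFunction ℝ) (a : ℤ) (k : ℝ) (w : ℂ) : ℂ :=
  w ^ ((1 - k - omegaH h a : ℝ) : ℂ) * twistSeries h a w

/-- The power w^(-ω) is absorbed by the Euler factors with a zero at the origin, and w^(1-k)
combines with ζ(1 + w)^(1-k) into the exponential of `primeZeta` + log. -/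
lemma PrimeHyp.regularized_eq (hyp : PrimeHyp h k) (hmult : h.IsMultiplicative)
    (hnonneg : ∀ d, 0 ≤ h d) (ha : a ≠ 0) {P : ℕ} (hP : IsCutoff h a P) {w : ℂ} (hw : 0 < w.re) :
    regularized h a k w = (∏ p ∈ primesUpTo P, reducedFactor h a p w) *
      Complex.exp (largeSum h a P w) * Complex.exp (-primeDev h k w) *
      Complex.exp (((1 - k : ℝ) : ℂ) * (primeZeta w + Complex.log w)) := by
  classical
  have hw0 : w ≠ 0 := by rintro rfl; simp at hw
  have e1 : ∏ p ∈ primesUpTo P, eulerFactor h a p w =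
      w ^ omegaH h a * ∏ p ∈ primesUpTo P, reducedFactor h a p w := by
    rw [omegaH, hyp.degeneratePrimes_eq hmult ha hP.1, ← Finset.prod_const, Finset.prod_filter,
      ← Finset.prod_mul_distrib]
    refine Finset.prod_congr rfl fun p _ => ?_
    unfold reducedFactor
    split_ifs
    · field_simp
    · simp
  rw [regularized, hyp.twistSeries_eq hmult hnonneg ha hP hw, e1, Complex.cpow_def_of_ne_zero hw0]
  have e2 : w ^ omegaH h a = Complex.exp (omegaH h a * Complex.log w) := by
    rw [Complex.exp_nat_mul, Complex.exp_log hw0]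
  rw [e2]
  have e3 : ∀ A B C D E F Q : ℂ, A = E + D + F - B - C →
      Complex.exp A = Complex.exp (-B) * Complex.exp (-C) * Complex.exp D * Complex.exp E *
        Complex.exp F := by
    intro A B C D E F Q hh
    rw [hh, ← Complex.exp_add, ← Complex.exp_add, ← Complex.exp_add, ← Complex.exp_add]
    congr 1; ring
  have : Complex.exp (Complex.log w * ((1 - k - omegaH h a : ℝ) : ℂ)) *
      Complex.exp (omegaH h a * Complex.log w) *
      Complex.exp (largeSum h a P w - primeDev h k w + (1 - k) * primeZeta w) =
      Complex.exp (largeSum h a P w) * Complex.exp (-primeDev h k w) *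
      Complex.exp (((1 - k : ℝ) : ℂ) * (primeZeta w + Complex.log w)) := by
    rw [← Complex.exp_add, ← Complex.exp_add, ← Complex.exp_add, ← Complex.exp_add]
    congr 1
    push_cast
    ring
  linear_combination (∏ p ∈ primesUpTo P, reducedFactor h a p w) * this

/-- Each factor of the preceding decomposition is tame: the first two are bounded on a wider strip
or divided by a removable zero, the last two are exponentials with slowly growing logarithmic
derivative. -/
lemma PrimeHyp.tameGrowth_regularized (hyp : PrimeHyp h k) (hmult : h.IsMultiplicative)
    (hnonneg : ∀ d, 0 ≤ h d) (ha : a ≠ 0) : TameGrowth (regularized h a k) := by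
  obtain ⟨P, hP⟩ := hyp.exists_isCutoff hmult ha
  obtain ⟨hd, ⟨B, hB⟩, _⟩ := hyp.largeSum_holomorphic hmult ha hP
  have h1 : SlowGrowth fun w => Complex.exp (largeSum h a P w) :=
    SlowGrowth.of_bounded (C := Real.exp B) (by norm_num : (0 : ℝ) < 1 / 8)
      (hd.cexp.mono fun w hw => hw.1) fun w hw _ => by
        rw [Complex.norm_exp]
        exact Real.exp_le_exp.2 ((Complex.re_le_norm _).trans (hB w hw))
  have h2 : SlowGrowth fun w => ∏ p ∈ primesUpTo P, reducedFactor h a p w :=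
    SlowGrowth.prod _ fun p hp => slowGrowth_reducedFactor hmult (Finset.mem_filter.1 hp).2
  exact (((h2.mul h1).tame.mul (hyp.tameGrowth_exp_primeDev hnonneg)).mul
    (tameGrowth_exp_primeZeta _)).congr fun w hw => hyp.regularized_eq hmult hnonneg ha hP hw.1

lemma primePowTerm_zero {p : ℕ} (hp : p.Prime) :
    primePowTerm p 0 = ((-Real.log (1 - 1 / (p : ℝ)) - 1 / p : ℝ) : ℂ) := by
  have hp1 : (1 : ℝ) < p := by exact_mod_cast hp.one_lt
  have h0 : 0 ≤ 1 - 1 / (p : ℝ) := by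
    rw [sub_nonneg, div_le_one (by linarith)]; exact hp1.le
  have e : (p : ℂ) ^ (-(1 + 0 : ℂ)) = 1 / (p : ℂ) := by
    rw [add_zero, Complex.cpow_neg_one, one_div]
  rw [primePowTerm, if_pos hp, e]
  push_cast [Complex.ofReal_log h0]
  rfl

lemma PrimeHyp.largeTerm_zero (hyp : PrimeHyp h k) (hmult : h.IsMultiplicative) (ha : a ≠ 0)
    {P : ℕ} (hP : IsCutoff h a P) {p : ℕ} (hp : p.Prime) :
    largeTerm h a P p 0 = (((if P < p then Real.log (localDiff h a p / (1 - 1 / (p : ℝ))) else 0) -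
      (1 - h p) / p : ℝ) : ℂ) := by
  have hp1 : (1 : ℝ) < p := by exact_mod_cast hp.one_lt
  have e : (p : ℂ) ^ (-(1 + 0 : ℂ)) = 1 / (p : ℂ) := by
    rw [add_zero, Complex.cpow_neg_one, one_div]
  rw [largeTerm, if_pos hp, e]
  split_ifs with hPp
  · have hpa := not_dvd_of_natAbs_lt ha (hP.1.trans_lt hPp)
    have h0 : 0 ≤ localDiff h a p / (1 - 1 / (p : ℝ)) := by
      have : 0 < 1 - 1 / (p : ℝ) := by
        rw [sub_pos, div_lt_one (by linarith)]; exact hp1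
      exact (div_pos (hyp.localDiff_pos hmult hp hpa) this).le
    have e2 := eulerFactor_zero (a := a) hmult hp
    rw [eulerFactor_of_not_dvd hpa] at e2
    rw [e2, ← Complex.ofReal_log h0]
    push_cast
    ring
  · push_cast; ring

/-- The logarithm of the regularized local factor. -/
noncomputable def logFactor (h : ArithmeticFunction ℝ) (a : ℤ) (k : ℝ) (P n : ℕ) : ℝ :=
  (largeTerm h a P n 0).re - (1 - k) * (primePowTerm n 0).re -
    if n.Prime then (h n - k) / (n : ℝ) else 0

/-- Beyond the cutoff the rational terms in 1/p cancel and exactly the factor of the regular product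
remains; up to the cutoff only the power of 1 - 1/p coming from ζ is left. -/
lemma PrimeHyp.exp_logFactor (hyp : PrimeHyp h k) (hmult : h.IsMultiplicative) (ha : a ≠ 0)
    {P : ℕ} (hP : IsCutoff h a P) {p : ℕ} (hp : p.Prime) :
    Real.exp (logFactor h a k P p) = if P < p then localDiff h a p / (1 - 1 / (p : ℝ)) ^ k
      else (1 - 1 / (p : ℝ)) ^ (1 - k) := by
  have hp1 : (1 : ℝ) < p := by exact_mod_cast hp.one_lt
  have h0 : 0 < 1 - 1 / (p : ℝ) := by
    rw [sub_pos, div_lt_one (by linarith)]; exact hp1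
  rw [logFactor, if_pos hp, hyp.largeTerm_zero hmult ha hP hp, primePowTerm_zero hp,
    Complex.ofReal_re, Complex.ofReal_re]
  split_ifs with hPp
  · have hd := hyp.localDiff_pos hmult hp (not_dvd_of_natAbs_lt ha (hP.1.trans_lt hPp))
    rw [Real.rpow_def_of_pos h0, ← Real.exp_log hd, ← Real.exp_sub, Real.exp_log hd,
      Real.log_div hd.ne' h0.ne']
    congr 1; ring
  · rw [Real.rpow_def_of_pos h0]
    congr 1; ring

/-- The first two parts converge absolutely; the third converges only in the order of increasing
primes, by Hypothesis 3, which is why the product is a limit of partial products. -/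
lemma PrimeHyp.tendsto_sum_logFactor (hyp : PrimeHyp h k) (hmult : h.IsMultiplicative)
    (ha : a ≠ 0) {P : ℕ} (hP : IsCutoff h a P) {S : ℝ}
    (hS : Tendsto (fun N : ℕ => ∑ p ∈ primesUpTo N, (h p - k) / (p : ℝ)) atTop (𝓝 S)) :
    Tendsto (fun N : ℕ => ∑ p ∈ primesUpTo N, logFactor h a k P p) atTop
      (𝓝 ((largeSum h a P 0).re - (1 - k) * (primePowSum 0).re - S)) := by
  have h1 := (Complex.hasSum_re
    ((hyp.largeSum_holomorphic hmult ha hP).2.2 0 (by simp)).hasSum).tendsto_sum_nat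
  have hs : Summable fun n => primePowTerm n 0 :=
    Summable.of_norm_bounded summable_two_mul_rpow
      fun n => primePowTerm_bounds.2 n 0 (by simp)
  have h2 := (Complex.hasSum_re hs.hasSum).tendsto_sum_nat
  refine (((h1.sub (h2.const_mul (1 - k))).comp (tendsto_add_atTop_nat 1)).sub hS).congr fun N => ?_
  simp only [Function.comp_apply, Finset.mul_sum, ← Finset.sum_sub_distrib]
  simp only [primesUpTo, Finset.sum_filter, ← Finset.sum_sub_distrib]
  refine Finset.sum_congr rfl fun n _ => ?_
  by_cases hn : n.Prime
  · simp [logFactor, hn]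
  · simp [hn, largeTerm, primePowTerm]

lemma PrimeHyp.largeSum_zero (hyp : PrimeHyp h k) (hmult : h.IsMultiplicative) (ha : a ≠ 0)
    {P : ℕ} (hP : IsCutoff h a P) : largeSum h a P 0 = ((largeSum h a P 0).re : ℂ) := by
  rw [largeSum, Complex.re_tsum ((hyp.largeSum_holomorphic hmult ha hP).2.2 0 (by simp)),
    Complex.ofReal_tsum]
  refine tsum_congr fun n => ?_
  by_cases hn : n.Prime
  · rw [hyp.largeTerm_zero hmult ha hP hn, Complex.ofReal_re]
  · simp [largeTerm, hn]

-- Beyond P both sides have the same factors; up to P the logarithmic factors multiply to the powers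
-- of 1 - 1/p on the left.
open Classical in
lemma PrimeHyp.regularProd_mul (hyp : PrimeHyp h k) (hmult : h.IsMultiplicative) (ha : a ≠ 0)
    {P : ℕ} (hP : IsCutoff h a P) {N : ℕ} (hN : P ≤ N) :
    regularProd h k a N * (∏ p ∈ primesUpTo P, (1 - 1 / (p : ℝ)) ^ (1 - k)) =
      regularProd h k a P * Real.exp (∑ p ∈ primesUpTo N, logFactor h a k P p) := by
  have hsub : primesUpTo P ⊆ primesUpTo N :=
    Finset.filter_subset_filter _ (Finset.range_mono (by omega))
  have hmem : ∀ p ∈ primesUpTo N \ primesUpTo P, p.Prime ∧ P < p := by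
    intro p hp
    simp only [primesUpTo, Finset.mem_sdiff, Finset.mem_filter, Finset.mem_range] at hp
    exact ⟨hp.1.2, by by_contra hh; exact hp.2 ⟨by omega, hp.1.2⟩⟩
  have e0 : ∀ K, regularProd h k a K = ∏ p ∈ primesUpTo K, if localDiff h a p = 0 then 1 else
      localDiff h a p / (1 - 1 / (p : ℝ)) ^ k := by
    intro K
    rw [regularProd, Finset.prod_filter]
    refine Finset.prod_congr rfl fun p _ => ?_
    simp only [ne_eq, degenerate_iff, ite_not]
  rw [e0, e0, Real.exp_sum, ← Finset.prod_sdiff hsub, ← Finset.prod_sdiff hsub]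
  have e1 : ∏ p ∈ primesUpTo P, Real.exp (logFactor h a k P p) =
      ∏ p ∈ primesUpTo P, (1 - 1 / (p : ℝ)) ^ (1 - k) := by
    refine Finset.prod_congr rfl fun p hp => ?_
    simp only [primesUpTo, Finset.mem_filter, Finset.mem_range] at hp
    rw [hyp.exp_logFactor hmult ha hP hp.2, if_neg (by omega)]
  have e2 : (∏ p ∈ primesUpTo N \ primesUpTo P, if localDiff h a p = 0 then (1 : ℝ) else
      localDiff h a p / (1 - 1 / (p : ℝ)) ^ k) =
      ∏ p ∈ primesUpTo N \ primesUpTo P, Real.exp (logFactor h a k P p) := by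
    refine Finset.prod_congr rfl fun p hp => ?_
    obtain ⟨hp, hPp⟩ := hmem p hp
    rw [hyp.exp_logFactor hmult ha hP hp, if_pos hPp, if_neg
      (hyp.localDiff_pos hmult hp (not_dvd_of_natAbs_lt ha (hP.1.trans_lt hPp))).ne']
  rw [e1, e2]
  ring

-- Compares the finite product in the definition of μ with the values at 0 of the reduced Euler
-- factors: both kinds of primes differ by the same power (1 - 1/p)^(1-k).
open Classical in
lemma PrimeHyp.degenerateProd_mul (hyp : PrimeHyp h k) (hmult : h.IsMultiplicative) (ha : a ≠ 0)
    {P : ℕ} (hP : a.natAbs ≤ P) :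
    degenerateProd h k a * regularProd h k a P =
      (∏ p ∈ primesUpTo P, reducedValue h a p) *
        ∏ p ∈ primesUpTo P, (1 - 1 / (p : ℝ)) ^ (1 - k) := by
  rw [degenerateProd, regularProd, hyp.degeneratePrimes_eq hmult ha hP, Finset.prod_filter,
    Finset.prod_filter, ← Finset.prod_mul_distrib, ← Finset.prod_mul_distrib]
  refine Finset.prod_congr rfl fun p hp => ?_
  have hp := (Finset.mem_filter.1 hp).2
  have hp1 : (1 : ℝ) < p := by exact_mod_cast hp.one_lt
  have h0 : 0 < 1 - 1 / (p : ℝ) := by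
    rw [sub_pos, div_lt_one (by linarith)]; exact hp1
  simp only [ne_eq, degenerate_iff, ite_not, reducedValue]
  split_ifs with hd
  · rw [show k - 1 = -(1 - k) by ring, Real.rpow_neg h0.le]
    simp only [div_eq_mul_inv, inv_inv]
    ring
  · have := (Real.rpow_pos_of_pos h0 k).ne'
    rw [Real.rpow_sub h0, Real.rpow_one]
    generalize 1 - 1 / (p : ℝ) = r at *
    field_simp

/-- The sum of the h(p^j) is at least h(1) = 1 because h ≥ 0. -/
lemma degenerateProd_ne_zero (hmult : h.IsMultiplicative) (hnonneg : ∀ d, 0 ≤ h d) :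
    degenerateProd h k a ≠ 0 := by
  refine Finset.prod_ne_zero_iff.2 fun p hp => ?_
  have hp := Nat.prime_of_mem_primeFactors (Finset.mem_filter.1 hp).1
  have hp1 : (1 : ℝ) < p := by exact_mod_cast hp.one_lt
  have h0 : 0 < 1 - 1 / (p : ℝ) := by
    rw [sub_pos, div_lt_one (by linarith)]; exact hp1
  have h1 : 0 < ∑ j ∈ Finset.range (expo a p + 1), h (p ^ j) := by
    rw [Finset.sum_range_succ']
    have : 0 ≤ ∑ j ∈ Finset.range (expo a p), h (p ^ (j + 1)) :=
      Finset.sum_nonneg fun _ _ => hnonneg _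
    simp only [pow_zero, hmult.map_one]
    linarith
  have h2 : 0 < Real.log p := Real.log_pos hp1
  positivity

/-- The infinite product converges to a non-zero limit, and with it one can express the value at
the origin of the regularized Dirichlet series. -/
theorem PrimeHyp.exists_regularProd_limit (hyp : PrimeHyp h k) (hmult : h.IsMultiplicative)
    (hnonneg : ∀ d, 0 ≤ h d) (ha : a ≠ 0) :
    ∃ Q : ℝ, Q ≠ 0 ∧ Tendsto (fun N => regularProd h k a N) atTop (𝓝 Q) ∧
      Tendsto (fun σ : ℝ => regularized h a k σ) (𝓝[>] 0)
        (𝓝 ((degenerateProd h k a * Q : ℝ) : ℂ)) := by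
  obtain ⟨P, hP⟩ := hyp.exists_isCutoff hmult ha
  obtain ⟨S, hS⟩ := hyp.convergent
  have hlim := hyp.tendsto_sum_logFactor hmult ha hP hS
  set X := (largeSum h a P 0).re - (1 - k) * (primePowSum 0).re - S with hX
  set W := ∏ p ∈ primesUpTo P, (1 - 1 / (p : ℝ)) ^ (1 - k) with hW
  have hW0 : W ≠ 0 := by
    refine Finset.prod_ne_zero_iff.2 fun p hp => ?_
    have hp := (Finset.mem_filter.1 hp).2
    have hp1 : (1 : ℝ) < p := by exact_mod_cast hp.one_lt
    have h0 : 0 < 1 - 1 / (p : ℝ) := by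
      rw [sub_pos, div_lt_one (by linarith)]; exact hp1
    positivity
  have hR0 : regularProd h k a P ≠ 0 := by
    refine Finset.prod_ne_zero_iff.2 fun p hp => ?_
    obtain ⟨hp, hd⟩ := Finset.mem_filter.1 hp
    have hp := (Finset.mem_filter.1 hp).2
    have hp1 : (1 : ℝ) < p := by exact_mod_cast hp.one_lt
    have h0 : 0 < 1 - 1 / (p : ℝ) := by
      rw [sub_pos, div_lt_one (by linarith)]; exact hp1
    rw [ne_eq, degenerate_iff] at hd
    positivity
  refine ⟨regularProd h k a P * Real.exp X / W, by positivity, ?_, ?_⟩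
  · refine ((((Real.continuous_exp.tendsto _).comp hlim).const_mul
      (regularProd h k a P)).div_const W).congr' ?_
    filter_upwards [eventually_ge_atTop P] with N hN
    rw [Function.comp_apply, ← hyp.regularProd_mul hmult ha hP hN]
    exact mul_div_cancel_right₀ _ hW0
  -- The auxiliary product W of powers of 1 - 1/p cancels, leaving the quantity that the four
  -- factors of `regularized` produce in the limit.
  · have e : degenerateProd h k a * (regularProd h k a P * Real.exp X / W) =
        (∏ p ∈ primesUpTo P, reducedValue h a p) * Real.exp X := by
      rw [← mul_div_assoc, ← mul_assoc, hyp.degenerateProd_mul hmult ha hP.1, ← hW]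
      field_simp
    rw [e]
    have h1 : Tendsto (fun σ : ℝ => ∏ p ∈ primesUpTo P, reducedFactor h a p σ) (𝓝[>] 0)
        (𝓝 (∏ p ∈ primesUpTo P, (reducedValue h a p : ℂ))) :=
      tendsto_finsetProd _ fun p hp => tendsto_reducedFactor hmult (Finset.mem_filter.1 hp).2
    have h2 : Tendsto (fun σ : ℝ => Complex.exp (largeSum h a P σ)) (𝓝[>] 0)
        (𝓝 (Complex.exp (largeSum h a P 0))) := by
      have hc : ContinuousAt (largeSum h a P) 0 :=
        ((hyp.largeSum_holomorphic hmult ha hP).1.differentiableAt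
          ((isOpen_lt continuous_const Complex.continuous_re).mem_nhds (by simp))).continuousAt
      exact (Complex.continuous_exp.tendsto _).comp (hc.tendsto.comp
        (tendsto_ofReal_nhdsGT.mono_right nhdsWithin_le_nhds))
    have h3 := (Complex.continuous_exp.tendsto _).comp (hyp.tendsto_primeDev hS).neg
    have h4 := ((h1.mul h2).mul h3).mul (tendsto_exp_primeZeta (1 - k))
    have e2 : (((∏ p ∈ primesUpTo P, reducedValue h a p) * Real.exp X : ℝ) : ℂ) =
        (∏ p ∈ primesUpTo P, (reducedValue h a p : ℂ)) * Complex.exp (largeSum h a P 0) *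
          Complex.exp (-(S : ℂ)) * ((Real.exp (-(1 - k) * (primePowSum 0).re) : ℝ) : ℂ) := by
      rw [hyp.largeSum_zero hmult ha hP, hX]
      push_cast
      rw [mul_assoc, mul_assoc, ← Complex.exp_add, ← Complex.exp_add]
      congr 2
      ring
    rw [e2]
    refine h4.congr' ?_
    filter_upwards [self_mem_nhdsWithin] with σ hσ
    exact (hyp.regularized_eq hmult hnonneg ha hP (by simpa using hσ)).symm

end ArithProg

/-! ### Harmonic sums and the kernel -/

namespace ArithProg

/-- The `n`-th harmonic number. -/
noncomputable def harm (n : ℕ) : ℝ := ∑ m ∈ Finset.Icc 1 n, 1 / (m : ℝ)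

lemma harm_succ (n : ℕ) : harm (n + 1) = harm n + 1 / ((n : ℝ) + 1) := by
  rw [harm, Finset.sum_Icc_succ_top (by omega), harm]; push_cast; rfl

lemma harm_eq_harmonic (n : ℕ) : harm n = (harmonic n : ℝ) := by
  rw [harm, harmonic_eq_sum_Icc]; push_cast; simp

/-- This is t ≤ sinh t at t = log(1 + 1/n). -/
lemma log_one_add_inv_le (n : ℕ) (hn : 1 ≤ n) :
    Real.log ((n : ℝ) + 1) - Real.log n ≤ (1 / n + 1 / ((n : ℝ) + 1)) / 2 := by
  have hn0 : (0 : ℝ) < n := by exact_mod_cast hn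
  have hy : (1 : ℝ) ≤ ((n : ℝ) + 1) / n := by rw [le_div_iff₀ hn0]; linarith
  have h1 := Real.self_le_sinh_iff.2 (Real.log_nonneg hy)
  rw [Real.sinh_log (by positivity), Real.log_div (by positivity) hn0.ne'] at h1
  refine h1.trans (le_of_eq ?_)
  field_simp
  ring

lemma le_log_one_add_inv (n : ℕ) (hn : 1 ≤ n) :
    2 / (2 * (n : ℝ) + 1) ≤ Real.log ((n : ℝ) + 1) - Real.log n := by
  have hn0 : (0 : ℝ) < n := by exact_mod_cast hn
  have h1 := Real.le_log_one_add_of_nonneg (x := 1 / n) (by positivity)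
  rw [show 1 + 1 / (n : ℝ) = ((n : ℝ) + 1) / n by field_simp,
    Real.log_div (by positivity) hn0.ne'] at h1
  refine le_trans (le_of_eq ?_) h1
  field_simp
  ring

/-- The sequence H_n - log n - 1/(2n) increases, and it decreases once 1/(8n²) is added; both
versions tend to Euler's constant, which is thus enclosed between them. -/
lemma abs_harm_sub_le (n : ℕ) (hn : 1 ≤ n) :
    |harm n - Real.log n - Real.eulerMascheroniConstant - 1 / (2 * n)| ≤ 1 / (8 * (n : ℝ) ^ 2) := by
  have hlim : Tendsto (fun n : ℕ => harm n - Real.log n) atTop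
      (𝓝 Real.eulerMascheroniConstant) := by
    simpa only [harm_eq_harmonic] using Real.tendsto_harmonic_sub_log
  have hz1 : Tendsto (fun n : ℕ => 1 / (2 * (n : ℝ))) atTop (𝓝 0) := by
    have := (tendsto_const_div_atTop_nhds_zero_nat (1 / 2 : ℝ))
    refine this.congr fun n => ?_
    rw [div_div]
  have hz2 : Tendsto (fun n : ℕ => 1 / (8 * (n : ℝ) ^ 2)) atTop (𝓝 0) := by
    have := (tendsto_const_div_pow (1 / 8 : ℝ) 2 (by norm_num))
    refine this.congr fun n => ?_
    rw [div_div]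
  have e1 : ∀ m, 1 ≤ m → harm m - Real.log m - 1 / (2 * m) ≤
      harm (m + 1) - Real.log (m + 1 : ℕ) - 1 / (2 * (m + 1 : ℕ)) := by
    intro m hm
    have hm0 : (0 : ℝ) < m := by exact_mod_cast hm
    have := log_one_add_inv_le m hm
    rw [harm_succ]
    push_cast
    have e : (1 / (m : ℝ) + 1 / ((m : ℝ) + 1)) / 2 =
        1 / ((m : ℝ) + 1) - 1 / (2 * (m + 1)) + 1 / (2 * m) := by field_simp; ring
    linarith
  have e2 : ∀ m, 1 ≤ m → harm (m + 1) - Real.log (m + 1 : ℕ) - 1 / (2 * (m + 1 : ℕ)) +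
      1 / (8 * (m + 1 : ℕ) ^ 2) ≤ harm m - Real.log m - 1 / (2 * m) + 1 / (8 * (m : ℝ) ^ 2) := by
    intro m hm
    have hm0 : (0 : ℝ) < m := by exact_mod_cast hm
    have := le_log_one_add_inv m hm
    rw [harm_succ]
    push_cast
    have e : 1 / ((m : ℝ) + 1) - 1 / (2 * (m + 1)) + 1 / (2 * m) + 1 / (8 * ((m : ℝ) + 1) ^ 2) -
        1 / (8 * (m : ℝ) ^ 2) ≤ 2 / (2 * (m : ℝ) + 1) := by
      have : 2 / (2 * (m : ℝ) + 1) - (1 / ((m : ℝ) + 1) - 1 / (2 * (m + 1)) + 1 / (2 * m) +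
        1 / (8 * ((m : ℝ) + 1) ^ 2) - 1 / (8 * (m : ℝ) ^ 2)) =
        1 / (8 * (m : ℝ) ^ 2 * (m + 1) ^ 2 * (2 * m + 1)) := by
        field_simp; ring
      have h2 : 0 ≤ 1 / (8 * (m : ℝ) ^ 2 * (m + 1) ^ 2 * (2 * m + 1)) := by positivity
      linarith
    linarith
  have m1 : ∀ N, n ≤ N → harm n - Real.log n - 1 / (2 * n) ≤
      harm N - Real.log N - 1 / (2 * N) := by
    intro N hN
    induction N, hN using Nat.le_induction with
    | base => exact le_rfl
    | succ N hN ih => exact ih.trans (e1 N (hn.trans hN))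
  have m2 : ∀ N, n ≤ N → harm N - Real.log N - 1 / (2 * N) + 1 / (8 * (N : ℝ) ^ 2) ≤
      harm n - Real.log n - 1 / (2 * n) + 1 / (8 * (n : ℝ) ^ 2) := by
    intro N hN
    induction N, hN using Nat.le_induction with
    | base => exact le_rfl
    | succ N hN ih => exact (e2 N (hn.trans hN)).trans ih
  have l1 := ge_of_tendsto (hlim.sub hz1) (eventually_atTop.2 ⟨n, m1⟩)
  have l2 := le_of_tendsto ((hlim.sub hz1).add hz2) (eventually_atTop.2 ⟨n, m2⟩)
  rw [abs_le]
  have : 0 ≤ 1 / (8 * (n : ℝ) ^ 2) := by positivity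
  constructor <;> linarith

/-- `∑_{m ≤ u} (1/m - 1/u)`. -/
noncomputable def stepSum (u : ℝ) : ℝ := ∑ m ∈ Finset.Icc 1 ⌊u⌋₊, (1 / (m : ℝ) - 1 / u)

/-- `u` times the difference of `stepSum u` and its smooth approximation. -/
noncomputable def stepKernel (u : ℝ) : ℝ :=
  u * (stepSum u - Real.log u - (Real.eulerMascheroniConstant - 1))

lemma stepKernel_eq {u : ℝ} (hu : 0 < u) :
    stepKernel u = u * (harm ⌊u⌋₊ - Real.log u - Real.eulerMascheroniConstant) + (u - ⌊u⌋₊) := by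
  rw [stepKernel, stepSum, Finset.sum_sub_distrib, harm]
  simp
  field_simp
  ring

/-- With t = u - ⌊u⌋ and n = ⌊u⌋, harm n - log u - γ is 1/(2n) - t/n up to O(1/n²), and u(1/(2n) -
t/n) + t - 1/2 = t(1/2 - t)/n: the sawtooth cancels to leading order, so the kernel has the limit
1/2. -/
lemma abs_stepKernel_sub_le {u : ℝ} (hu : 1 ≤ u) : |stepKernel u - 1 / 2| ≤ 6 / u := by
  have hu0 : 0 < u := by linarith
  rw [stepKernel_eq hu0]
  set n := ⌊u⌋₊ with hn
  have hn1 : 1 ≤ n := Nat.le_floor (by simpa using hu)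
  have hn1' : (1 : ℝ) ≤ n := by exact_mod_cast hn1
  have hnu : (n : ℝ) ≤ u := Nat.floor_le hu0.le
  have hnu' : u < n + 1 := Nat.lt_floor_add_one u
  obtain ⟨h1, h2⟩ := abs_le.1 (abs_harm_sub_le n hn1)
  set t := u - n with ht
  have hut : u = n + t := by rw [ht]; ring
  have ht0 : 0 ≤ t := by linarith
  have ht1 : t ≤ 1 := by linarith
  have hlog : Real.log u - Real.log n = Real.log (1 + t / n) := by
    rw [← Real.log_div hu0.ne' (by positivity)]; congr 1; rw [hut]; field_simp
  have hl1 : Real.log (1 + t / n) ≤ t / n := by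
    have := Real.log_le_sub_one_of_pos (show 0 < 1 + t / n by positivity); linarith
  have hl2 : t / n - (t / n) ^ 2 ≤ Real.log (1 + t / n) := by
    have h3 := Real.one_sub_inv_le_log_of_pos (show 0 < 1 + t / n by positivity)
    refine le_trans ?_ h3
    have hx : 0 ≤ t / n := by positivity
    rw [le_sub_iff_add_le, ← le_sub_iff_add_le', inv_le_iff_one_le_mul₀ (by positivity)]
    nlinarith [mul_nonneg hx (sq_nonneg (t / n))]
  set D := harm n - Real.log u - Real.eulerMascheroniConstant with hD
  have hx1 : t / n ≤ 1 / n := by gcongr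
  have hx2 : (t / n) ^ 2 ≤ (1 / n) ^ 2 := by gcongr
  have d1 : D ≤ 1 / (2 * n) - t / n + 9 / 8 * (1 / n) ^ 2 := by
    have : 1 / (8 * (n : ℝ) ^ 2) = 1 / 8 * (1 / n) ^ 2 := by field_simp
    linarith
  have d2 : 1 / (2 * n) - t / n - 9 / 8 * (1 / n) ^ 2 ≤ D := by
    have : 1 / (8 * (n : ℝ) ^ 2) = 1 / 8 * (1 / n) ^ 2 := by field_simp
    have : 0 ≤ (1 / (n : ℝ)) ^ 2 := by positivity
    linarith
  have hsix : 3 / (n : ℝ) ≤ 6 / u := by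
    rw [div_le_div_iff₀ (by positivity) hu0]; linarith
  have hdu : u * (1 / (n : ℝ)) ^ 2 * (9 / 8) ≤ 9 / 4 * (1 / n) := by
    have : u * (1 / (n : ℝ)) ≤ 2 := by
      rw [mul_one_div, div_le_iff₀ (by positivity)]; linarith
    have h0 : 0 ≤ 1 / (n : ℝ) := by positivity
    nlinarith
  have hmid : |u * (1 / (2 * n) - t / n) + t - 1 / 2| ≤ 1 / 2 * (1 / n) := by
    have : u * (1 / (2 * n) - t / n) + t - 1 / 2 = t * (1 / 2 - t) * (1 / n) := by
      rw [hut]; field_simp; ring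
    rw [this, abs_mul, abs_of_nonneg (show 0 ≤ 1 / (n : ℝ) by positivity)]
    gcongr
    rw [abs_le]
    constructor <;> nlinarith
  obtain ⟨k1, k2⟩ := abs_le.1 hmid
  have f1 := mul_le_mul_of_nonneg_left d1 hu0.le
  have f2 := mul_le_mul_of_nonneg_left d2 hu0.le
  have : 3 / (n : ℝ) = 3 * (1 / n) := by ring
  have h0 : 0 ≤ 1 / (n : ℝ) := by positivity
  rw [abs_le]
  constructor <;> nlinarith

/-- Below 1 the sum is empty and the kernel is u(1 - γ - log u); a quarter power of u absorbs the
logarithm. -/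
lemma exists_abs_stepKernel_le_rpow :
    ∃ C, 0 < C ∧ ∀ u : ℝ, 0 < u → u < 1 → |stepKernel u| ≤ C * u ^ (3 / 4 : ℝ) := by
  refine ⟨5 + |Real.eulerMascheroniConstant|, by positivity, fun u h0 h1 => ?_⟩
  have hf : ⌊u⌋₊ = 0 := Nat.floor_eq_zero.2 h1
  rw [stepKernel_eq h0, hf]
  simp only [harm, Nat.cast_zero, sub_zero]
  rw [show Finset.Icc 1 0 = (∅ : Finset ℕ) by simp, Finset.sum_empty]
  have h2 := Real.abs_log_mul_self_rpow_lt u (1 / 4) h0 h1.le (by norm_num)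
  have h3 : u = u ^ (1 / 4 : ℝ) * u ^ (3 / 4 : ℝ) := by
    rw [← Real.rpow_add h0]; norm_num
  have h4 : u ≤ u ^ (3 / 4 : ℝ) := by
    conv_lhs => rw [← Real.rpow_one u]
    exact Real.rpow_le_rpow_of_exponent_ge h0 h1.le (by norm_num)
  have h5 : u * (0 - Real.log u - Real.eulerMascheroniConstant) + u =
      -(Real.log u * u ^ (1 / 4 : ℝ)) * u ^ (3 / 4 : ℝ) +
        u * (1 - Real.eulerMascheroniConstant) := by
    rw [neg_mul, mul_assoc, ← h3]; ring
  rw [h5]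
  refine (abs_add_le _ _).trans ?_
  rw [abs_mul, abs_mul, abs_neg, abs_of_pos h0, abs_of_pos (Real.rpow_pos_of_pos h0 _)]
  have h6 : |1 - Real.eulerMascheroniConstant| ≤ 1 + |Real.eulerMascheroniConstant| := by
    simpa using abs_sub (1 : ℝ) Real.eulerMascheroniConstant
  have h7 : 0 < u ^ (3 / 4 : ℝ) := Real.rpow_pos_of_pos h0 _
  have h8 : |Real.log u * u ^ (1 / 4 : ℝ)| ≤ 4 := by linarith
  calc _ ≤ 4 * u ^ (3 / 4 : ℝ) + u ^ (3 / 4 : ℝ) * (1 + |Real.eulerMascheroniConstant|) := by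
        gcongr
    _ = _ := by ring

/-- The freedom in σ allows sums over d to be weighted by d^(-σ) with σ as small as desired. The
second quantity is the right derivative of the kernel in the variable log u. -/
lemma exists_abs_stepKernel_le : ∃ C, 0 < C ∧ ∀ u : ℝ, 0 < u → ∀ σ : ℝ, 0 ≤ σ → σ ≤ 3 / 4 →
    |stepKernel u| ≤ C * u ^ σ ∧ |stepKernel u - (u - ⌊u⌋₊)| ≤ C * u ^ σ := by
  obtain ⟨C, hC0, hC⟩ := exists_abs_stepKernel_le_rpow
  refine ⟨C + 8, by linarith, fun u hu σ h0 h1 => ?_⟩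
  have hfl : |u - ⌊u⌋₊| ≤ u ^ σ := by
    rw [abs_of_nonneg (by linarith [Nat.floor_le hu.le])]
    rcases lt_or_ge u 1 with h | h
    · rw [Nat.floor_eq_zero.2 h, Nat.cast_zero, sub_zero]
      conv_lhs => rw [← Real.rpow_one u]
      exact Real.rpow_le_rpow_of_exponent_ge hu h.le (by linarith)
    · have := Real.one_le_rpow h h0
      linarith [Nat.lt_floor_add_one u]
  have hk : |stepKernel u| ≤ (C + 7) * u ^ σ := by
    have hpos : 0 < u ^ σ := Real.rpow_pos_of_pos hu _
    rcases lt_or_ge u 1 with h | h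
    · have h2 : u ^ (3 / 4 : ℝ) ≤ u ^ σ := Real.rpow_le_rpow_of_exponent_ge hu h.le h1
      refine (hC u hu h).trans ?_
      nlinarith
    · have h2 := Real.one_le_rpow h h0
      have h3 := abs_stepKernel_sub_le h
      have h4 : 6 / u ≤ 6 := div_le_self (by norm_num) h
      have h5 := abs_sub_abs_le_abs_sub (stepKernel u) (1 / 2)
      rw [abs_of_pos (show (0 : ℝ) < 1 / 2 by norm_num)] at h5
      nlinarith
  refine ⟨hk.trans (by have := Real.rpow_pos_of_pos hu σ; nlinarith), ?_⟩
  refine (abs_sub _ _).trans ?_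
  linarith

/-- The summand 1/m - 1/u vanishes when m enters at u = m. Written with a fixed number of terms, the
sum is visibly continuous. -/
lemma stepSum_eq_sum_max {u : ℝ} (hu : 0 < u) {N : ℕ} (hN : u ≤ N) :
    stepSum u = ∑ m ∈ Finset.Icc 1 N, max (1 / (m : ℝ) - 1 / u) 0 := by
  have hsub : Finset.Icc 1 ⌊u⌋₊ ⊆ Finset.Icc 1 N :=
    Finset.Icc_subset_Icc le_rfl ((Nat.floor_le_floor hN).trans (by simp))
  rw [stepSum, ← Finset.sum_subset hsub]
  · refine Finset.sum_congr rfl fun m hm => (max_eq_left ?_).symm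
    rw [Finset.mem_Icc] at hm
    have hm0 : (0 : ℝ) < m := by exact_mod_cast hm.1
    have : (m : ℝ) ≤ u := (Nat.le_floor_iff hu.le).1 hm.2
    have := one_div_le_one_div_of_le hm0 this
    linarith
  · intro m hm hm'
    rw [Finset.mem_Icc] at hm hm'
    refine max_eq_right ?_
    have : u < m := by
      by_contra hh
      exact hm' ⟨hm.1, (Nat.le_floor_iff hu.le).2 (by linarith)⟩
    have := one_div_le_one_div_of_le hu this.le
    linarith

lemma continuousOn_stepKernel : ContinuousOn stepKernel (Set.Ioi 0) := by
  intro u hu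
  have hu : 0 < u := hu
  refine ContinuousAt.continuousWithinAt ?_
  obtain ⟨N, hN⟩ := exists_nat_gt u
  have h1 : stepSum =ᶠ[𝓝 u] fun v => ∑ m ∈ Finset.Icc 1 N, max (1 / (m : ℝ) - 1 / v) 0 := by
    filter_upwards [Ioo_mem_nhds hu hN] with v hv
    exact stepSum_eq_sum_max hv.1 hv.2.le
  have h2 : ContinuousAt (fun v : ℝ => ∑ m ∈ Finset.Icc 1 N, max (1 / (m : ℝ) - 1 / v) 0) u := by
    refine tendsto_finsetSum _ fun m _ => ?_
    exact ((continuousAt_const.sub (continuousAt_const.div continuousAt_id hu.ne')).max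
      continuousAt_const)
  exact continuousAt_id.mul (((h2.congr h1.symm).sub (Real.continuousAt_log hu.ne')).sub
    continuousAt_const)

lemma hasDerivWithinAt_stepKernel_exp (y : ℝ) :
    HasDerivWithinAt (fun y => stepKernel (Real.exp y))
      (stepKernel (Real.exp y) - (Real.exp y - ⌊Real.exp y⌋₊)) (Set.Ici y) y := by
  set n := ⌊Real.exp y⌋₊ with hn
  have hD : HasDerivAt (fun y => Real.exp y * (harm n - y - Real.eulerMascheroniConstant) +
      (Real.exp y - n)) (stepKernel (Real.exp y) - (Real.exp y - n)) y := by
    have h1 := ((Real.hasDerivAt_exp y).mul (((hasDerivAt_id y).const_sub (harm n)).sub_const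
      Real.eulerMascheroniConstant)).add ((Real.hasDerivAt_exp y).sub_const (n : ℝ))
    refine h1.congr_deriv ?_
    rw [stepKernel_eq (Real.exp_pos y), ← hn, Real.log_exp]
    simp only [id]
    ring
  refine hD.hasDerivWithinAt.congr_of_eventuallyEq ?_ ?_
  · have : ∀ᶠ v in 𝓝[≥] y, Real.exp v < n + 1 :=
      nhdsWithin_le_nhds (Real.continuous_exp.continuousAt.eventually_lt continuousAt_const
        (Nat.lt_floor_add_one _))
    filter_upwards [this, self_mem_nhdsWithin] with v hv hv'
    have hfl : ⌊Real.exp v⌋₊ = n := by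
      rw [Nat.floor_eq_iff (Real.exp_pos v).le]
      exact ⟨(Nat.floor_le (Real.exp_pos y).le).trans (Real.exp_le_exp.2 hv'), hv⟩
    rw [stepKernel_eq (Real.exp_pos v), hfl, Real.log_exp]
  · rw [stepKernel_eq (Real.exp_pos y), ← hn, Real.log_exp]

/-- Right derivatives suffice for the mean value inequality, so the corners at integers do no harm.
The Lipschitz bound is needed later for pointwise Fourier inversion. -/
lemma exists_abs_stepKernel_exp_sub_le : ∃ C, 0 < C ∧ ∀ y₁ y₂ : ℝ, y₁ ≤ y₂ → ∀ σ : ℝ, 0 ≤ σ →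
    σ ≤ 3 / 4 → |stepKernel (Real.exp y₂) - stepKernel (Real.exp y₁)| ≤
      C * Real.exp (σ * y₂) * (y₂ - y₁) := by
  obtain ⟨C, hC0, hC⟩ := exists_abs_stepKernel_le
  refine ⟨C, hC0, fun y₁ y₂ hy σ h0 h1 => ?_⟩
  refine norm_image_sub_le_of_norm_deriv_right_le_segment (f := fun y => stepKernel (Real.exp y))
    (a := y₁) (b := y₂) ?_ (fun y _ => hasDerivWithinAt_stepKernel_exp y) (fun y hy' => ?_) y₂
    (Set.right_mem_Icc.2 hy)
  · exact continuousOn_stepKernel.comp Real.continuous_exp.continuousOn fun y _ => Real.exp_pos y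
  · rw [Real.norm_eq_abs]
    refine (hC _ (Real.exp_pos y) σ h0 h1).2.trans ?_
    rw [← Real.exp_mul]
    have := hy'.2.le
    have : y * σ ≤ σ * y₂ := by nlinarith
    gcongr

/-- The kernel in the variable of the Mellin transform. -/
noncomputable def mellinKernel (t : ℝ) : ℂ := (stepKernel t⁻¹ : ℂ)

lemma continuousOn_mellinKernel : ContinuousOn mellinKernel (Set.Ioi 0) :=
  Complex.continuous_ofReal.comp_continuousOn
    (continuousOn_stepKernel.comp (continuousOn_id.inv₀ fun _ ht => ne_of_gt ht)
      fun _ ht => Set.mem_Ioi.2 (inv_pos.2 ht))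

end ArithProg

/-! ### Mellin transform of the kernel -/

namespace ArithProg

section

open MeasureTheory


/-- The kernel minus half the indicator function of `(0, 1]`. -/
noncomputable def kernelRest (t : ℝ) : ℂ :=
  mellinKernel t - (1 / 2 : ℂ) * (Set.Ioc (0 : ℝ) 1).indicator (fun _ => (1 : ℂ)) t

lemma locallyIntegrableOn_mellinKernel : LocallyIntegrableOn mellinKernel (Set.Ioi 0) :=
  continuousOn_mellinKernel.locallyIntegrableOn measurableSet_Ioi

lemma locallyIntegrableOn_kernelRest : LocallyIntegrableOn kernelRest (Set.Ioi 0) := by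
  refine locallyIntegrableOn_mellinKernel.sub ?_
  have : Integrable (fun t : ℝ => (1 / 2 : ℂ) * (Set.Ioc (0 : ℝ) 1).indicator
      (fun _ => (1 : ℂ)) t) :=
    ((integrable_indicator_iff measurableSet_Ioc).2 (by simp)).const_mul _
  exact this.locallyIntegrable.locallyIntegrableOn _

/-- Removing the limit 1/2 near t = 0 leaves O(t); for t > 1 the bound is that of the kernel below
1. The Mellin transform therefore converges for -1 < Re w < 3/4. -/
lemma exists_norm_kernelRest_le : ∃ C, 0 < C ∧
    (∀ t : ℝ, 0 < t → t ≤ 1 → ‖kernelRest t‖ ≤ C * t) ∧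
    (∀ t : ℝ, 1 < t → ‖kernelRest t‖ ≤ C * t ^ (-(3 / 4) : ℝ)) := by
  obtain ⟨C, hC0, hC⟩ := exists_abs_stepKernel_le_rpow
  refine ⟨C + 6, by linarith, fun t h0 h1 => ?_, fun t h1 => ?_⟩
  · have e : kernelRest t = ((stepKernel t⁻¹ - 1 / 2 : ℝ) : ℂ) := by
      rw [kernelRest, Set.indicator_of_mem (show t ∈ Set.Ioc (0 : ℝ) 1 from ⟨h0, h1⟩),
        mellinKernel]; push_cast; ring
    rw [e, Complex.norm_real, Real.norm_eq_abs]
    refine (abs_stepKernel_sub_le ((one_le_inv₀ h0).2 h1)).trans ?_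
    rw [div_inv_eq_mul]
    nlinarith
  · have h0 : 0 < t := by linarith
    have e : kernelRest t = ((stepKernel t⁻¹ : ℝ) : ℂ) := by
      rw [kernelRest, Set.indicator_of_notMem (fun h => absurd h.2 (by linarith)), mellinKernel]
      ring
    rw [e, Complex.norm_real, Real.norm_eq_abs]
    refine (hC _ (inv_pos.2 h0) (inv_lt_one_of_one_lt₀ h1)).trans ?_
    rw [Real.inv_rpow h0.le, ← Real.rpow_neg h0.le]
    have := Real.rpow_pos_of_pos h0 (-(3 / 4))
    nlinarith

/-- The part of the Mellin transform of the kernel that is regular at the origin. -/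
noncomputable def kernelMellinRest (w : ℂ) : ℂ := mellin kernelRest w

lemma kernelRest_isBigO : kernelRest =O[atTop] (fun t : ℝ => t ^ (-(3 / 4) : ℝ)) ∧
    kernelRest =O[𝓝[>] 0] (fun t : ℝ => t ^ (-(-1) : ℝ)) := by
  obtain ⟨C, hC0, hC1, hC2⟩ := exists_norm_kernelRest_le
  constructor
  · refine Asymptotics.IsBigO.of_bound C ?_
    filter_upwards [eventually_gt_atTop 1] with t ht
    rw [Real.norm_of_nonneg (by positivity)]
    exact hC2 t ht
  · refine Asymptotics.IsBigO.of_bound C ?_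
    filter_upwards [Ioc_mem_nhdsGT one_pos] with t ht
    rw [neg_neg, Real.rpow_one, Real.norm_of_nonneg ht.1.le]
    exact hC1 t ht.1 ht.2

lemma mellin_kernelRest_bounds :
    (∀ w : ℂ, -1 < w.re → w.re < 3 / 4 →
      MellinConvergent kernelRest w ∧ DifferentiableAt ℂ kernelMellinRest w) ∧
    ∃ B, ∀ w : ℂ, -(1 / 8) < w.re → w.re < 5 / 8 → ‖kernelMellinRest w‖ ≤ B := by
  obtain ⟨hb1, hb2⟩ := kernelRest_isBigO
  refine ⟨fun w h1 h2 => ⟨mellinConvergent_of_isBigO_rpow locallyIntegrableOn_kernelRest hb1 h2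
    hb2 h1, mellin_differentiableAt_of_isBigO_rpow locallyIntegrableOn_kernelRest hb1 h2 hb2 h1⟩,
    ?_⟩
  obtain ⟨C, hC0, hC1, hC2⟩ := exists_norm_kernelRest_le
  set B : ℝ → ℝ := fun t => C * (Set.Ioc (0 : ℝ) 1).indicator (fun t => t ^ (-(1 / 8) : ℝ)) t +
    C * (Set.Ioi (1 : ℝ)).indicator (fun t => t ^ (-(9 / 8) : ℝ)) t with hB
  have hBi : Integrable B := by
    refine (Integrable.const_mul ?_ C).add (Integrable.const_mul ?_ C)
    · rw [integrable_indicator_iff measurableSet_Ioc,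
        ← intervalIntegrable_iff_integrableOn_Ioc_of_le zero_le_one]
      exact intervalIntegral.intervalIntegrable_rpow' (by norm_num)
    · rw [integrable_indicator_iff measurableSet_Ioi]
      exact integrableOn_Ioi_rpow_of_lt (by norm_num) one_pos
  refine ⟨∫ t in Set.Ioi (0 : ℝ), B t, fun w h1 h2 => ?_⟩
  rw [kernelMellinRest, mellin]
  refine norm_integral_le_of_norm_le hBi.integrableOn
    ((ae_restrict_iff' measurableSet_Ioi).2 (Eventually.of_forall fun t ht => ?_))
  have ht : 0 < t := ht
  rw [norm_smul, Complex.norm_cpow_eq_rpow_re_of_pos ht, Complex.sub_re, Complex.one_re]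
  rcases le_or_gt t 1 with h | h
  · have hnot : t ∉ Set.Ioi (1 : ℝ) := by simpa using h
    simp only [hB, Set.indicator_of_mem (show t ∈ Set.Ioc (0 : ℝ) 1 from ⟨ht, h⟩),
      Set.indicator_of_notMem hnot, mul_zero, add_zero]
    calc t ^ (w.re - 1) * ‖kernelRest t‖ ≤ t ^ (w.re - 1) * (C * t) := by
          gcongr; exact hC1 t ht h
      _ = C * t ^ w.re := by rw [Real.rpow_sub ht, Real.rpow_one]; field_simp
      _ ≤ C * t ^ (-(1 / 8) : ℝ) := by
          have := Real.rpow_le_rpow_of_exponent_ge ht h h1.le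
          gcongr
  · have hnot : t ∉ Set.Ioc (0 : ℝ) 1 := fun hh => absurd hh.2 (by linarith)
    simp only [hB, Set.indicator_of_mem (show t ∈ Set.Ioi (1 : ℝ) from h),
      Set.indicator_of_notMem hnot, mul_zero, zero_add]
    calc t ^ (w.re - 1) * ‖kernelRest t‖ ≤ t ^ (w.re - 1) * (C * t ^ (-(3 / 4) : ℝ)) := by
          gcongr; exact hC2 t h
      _ = C * t ^ (w.re - 7 / 4) := by
          rw [mul_left_comm, ← Real.rpow_add ht]; congr 2; ring
      _ ≤ C * t ^ (-(9 / 8) : ℝ) := by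
          have := Real.rpow_le_rpow_of_exponent_le h.le (show w.re - 7 / 4 ≤ -(9 / 8) by linarith)
          gcongr

/-- The half indicator contributes 1/(2w), the only singularity at the origin. -/
lemma mellin_mellinKernel {w : ℂ} (h0 : 0 < w.re) (h1 : w.re < 3 / 4) :
    HasMellin mellinKernel w (1 / (2 * w) + kernelMellinRest w) := by
  have hw : w ≠ 0 := by rintro rfl; simp at h0
  have hA : HasMellin (fun t => (1 / 2 : ℂ) * (Set.Ioc (0 : ℝ) 1).indicator (fun _ => (1 : ℂ)) t) w
      ((1 / 2 : ℂ) * (1 / w)) := by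
    obtain ⟨c1, c2⟩ := hasMellin_one_Ioc h0
    refine ⟨c1.const_smul (1 / 2 : ℂ), ?_⟩
    rw [← c2]
    exact mellin_const_smul _ _ (1 / 2 : ℂ)
  have hB : HasMellin kernelRest w (kernelMellinRest w) :=
    ⟨(mellin_kernelRest_bounds.1 w (by linarith) h1).1, rfl⟩
  have := hasMellin_add hA.1 hB.1
  rw [hA.2, hB.2] at this
  convert this using 1
  · ext t; simp [kernelRest]
  · field_simp

/-- `w` times the Mellin transform of the kernel. -/
noncomputable def kernelFactor (w : ℂ) : ℂ := 1 / 2 + w * kernelMellinRest w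

lemma polyGrowth_id (n : ℕ) : PolyGrowth 1 n (fun w => w) := by
  refine PolyGrowth.of_bounded (r := 1) (C := 1) one_pos zero_le_one differentiableOn_id
    (fun w h1 h2 => ?_) n
  rw [Real.rpow_one, one_mul]
  refine (Complex.norm_le_abs_re_add_abs_im w).trans ?_
  have : |w.re| ≤ 2 := abs_le.2 ⟨by linarith, by linarith⟩
  linarith

lemma TameGrowth.add {f g : ℂ → ℂ} (hf : TameGrowth f) (hg : TameGrowth g) :
    TameGrowth (fun w => f w + g w) := by
  obtain ⟨c, hc⟩ := hf
  obtain ⟨c', hc'⟩ := hg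
  exact ⟨max c c', fun n => ((hc n).mono (le_max_left _ _) le_rfl).add
    ((hc' n).mono (le_max_right _ _) le_rfl)⟩

lemma tameGrowth_kernelFactor : TameGrowth kernelFactor := by
  obtain ⟨h1, B, hB⟩ := mellin_kernelRest_bounds
  have : SlowGrowth kernelMellinRest :=
    SlowGrowth.of_bounded (r := 1 / 8) (C := B) (by norm_num)
      (fun w hw => (h1 w (by linarith [hw.1]) (by linarith [hw.2])).2.differentiableWithinAt)
      fun w hw1 hw2 => hB w hw1 (by linarith)
  exact (SlowGrowth.const (1 / 2)).tame.add
    (TameGrowth.mul ⟨1, polyGrowth_id⟩ this.tame)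

lemma tendsto_kernelFactor : Tendsto (fun σ : ℝ => kernelFactor σ) (𝓝[>] 0) (𝓝 (1 / 2)) := by
  have hc : ContinuousAt kernelFactor 0 :=
    continuousAt_const.add (continuousAt_id.mul
      (mellin_kernelRest_bounds.1 0 (by simp) (by simp)).2.continuousAt)
  have := hc.tendsto.comp (tendsto_ofReal_nhdsGT.mono_right nhdsWithin_le_nhds)
  refine (this.congr fun _ => rfl).trans (le_of_eq ?_)
  simp [kernelFactor]

end

end ArithProg

/-! ### Gaussian smoothing and a pointwise bound from the Fourier transform -/

namespace ArithProg

section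

open MeasureTheory FourierTransform


/-- The density of mass one concentrated around `u` at the scale `β`. -/
noncomputable def gaussBump (β u y : ℝ) : ℝ := β⁻¹ * Real.exp (-(Real.pi / β ^ 2) * (y - u) ^ 2)

lemma gaussBump_nonneg {β : ℝ} (hβ : 0 < β) (u y : ℝ) : 0 ≤ gaussBump β u y := by
  unfold gaussBump; positivity

lemma integrable_gaussBump {β : ℝ} (hβ : 0 < β) (u : ℝ) : Integrable (gaussBump β u) := by
  have hb : 0 < Real.pi / β ^ 2 := by have := Real.pi_pos; positivity
  exact ((integrable_exp_neg_mul_sq hb).comp_sub_right u).const_mul β⁻¹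

lemma integral_gaussBump {β : ℝ} (hβ : 0 < β) (u : ℝ) : ∫ y, gaussBump β u y = 1 := by
  unfold gaussBump
  rw [integral_const_mul, integral_sub_right_eq_self (fun y => Real.exp (-(Real.pi / β ^ 2) * y ^ 2)),
    integral_gaussian, div_div_cancel₀ Real.pi_ne_zero, Real.sqrt_sq hβ.le]
  field_simp

lemma fourier_gauss {β : ℝ} (hβ : 0 < β) (u : ℝ) :
    𝓕 (fun x : ℝ => Complex.exp (-Real.pi * ((β ^ 2 : ℝ) : ℂ) * x ^ 2 +
      2 * Real.pi * (Complex.I * u) * x)) = fun y : ℝ => (gaussBump β u y : ℂ) := by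
  have hb : 0 < (((β ^ 2 : ℝ) : ℂ)).re := by rw [Complex.ofReal_re]; positivity
  rw [fourier_gaussian_pi' hb]
  funext y
  have e : (((β ^ 2 : ℝ) : ℂ)) ^ (1 / 2 : ℂ) = β := by
    rw [show (1 / 2 : ℂ) = ((1 / 2 : ℝ) : ℂ) by push_cast; rfl, ← Complex.ofReal_cpow (by positivity),
      ← Real.sqrt_eq_rpow, Real.sqrt_sq hβ.le]
  rw [e, gaussBump]
  push_cast
  rw [one_div]
  congr 2
  have : (y : ℂ) + Complex.I * (Complex.I * u) = y - u := by
    rw [← mul_assoc, Complex.I_mul_I]; ring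
  rw [this]
  ring

lemma integrable_gauss {β : ℝ} (hβ : 0 < β) (u : ℝ) :
    Integrable (fun x : ℝ => Complex.exp (-Real.pi * ((β ^ 2 : ℝ) : ℂ) * x ^ 2 +
      2 * Real.pi * (Complex.I * u) * x)) := by
  have hb : 0 < Real.pi * β ^ 2 := by have := Real.pi_pos; positivity
  refine (integrable_exp_neg_mul_sq hb).mono' (by fun_prop) (Eventually.of_forall fun x => ?_)
  rw [Complex.norm_exp]
  refine le_of_eq (congrArg _ ?_)
  simp [← Complex.ofReal_pow]

lemma norm_gauss (β u x : ℝ) : ‖Complex.exp (-Real.pi * ((β ^ 2 : ℝ) : ℂ) * x ^ 2 +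
      2 * Real.pi * (Complex.I * u) * x)‖ = Real.exp (-(Real.pi * β ^ 2) * x ^ 2) := by
  rw [Complex.norm_exp]
  refine congrArg _ ?_
  simp [← Complex.ofReal_pow]

/-- With x = |y - u|/β, half of the Gaussian exponent absorbs the linear factor through x ≤
exp(πx²/2); the remaining Gaussian has integral √2 β. -/
lemma integral_abs_sub_mul_gaussBump_le {β : ℝ} (hβ : 0 < β) (u : ℝ) :
    Integrable (fun y => |y - u| * gaussBump β u y) ∧
      ∫ y, |y - u| * gaussBump β u y ≤ 2 * β := by
  have hb : 0 < Real.pi / (2 * β ^ 2) := by have := Real.pi_pos; positivity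
  have hi : Integrable fun y => Real.exp (-(Real.pi / (2 * β ^ 2)) * (y - u) ^ 2) :=
    (integrable_exp_neg_mul_sq hb).comp_sub_right u
  have hle : ∀ y, |y - u| * gaussBump β u y ≤
      Real.exp (-(Real.pi / (2 * β ^ 2)) * (y - u) ^ 2) := by
    intro y
    set x := |y - u| / β with hx
    have h1 : |y - u| = β * x := by rw [hx]; field_simp
    have h2 : x ≤ Real.exp (Real.pi / 2 * x ^ 2) := by
      have := Real.add_one_le_exp (Real.pi / 2 * x ^ 2)
      have := Real.pi_gt_three
      nlinarith [sq_nonneg (x - 1), sq_nonneg x]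
    have h3 : (y - u) ^ 2 = β ^ 2 * x ^ 2 := by rw [← sq_abs, h1]; ring
    rw [gaussBump, h3, h1]
    have e1 : -(Real.pi / β ^ 2) * (β ^ 2 * x ^ 2) = -(Real.pi / 2 * x ^ 2) - Real.pi / 2 * x ^ 2 := by
      field_simp; ring
    have e2 : -(Real.pi / (2 * β ^ 2)) * (β ^ 2 * x ^ 2) = -(Real.pi / 2 * x ^ 2) := by
      field_simp
    rw [e1, e2, sub_eq_add_neg, Real.exp_add, Real.exp_neg]
    have h4 := Real.exp_pos (Real.pi / 2 * x ^ 2)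
    rw [show β * x * (β⁻¹ * ((Real.exp (Real.pi / 2 * x ^ 2))⁻¹ * (Real.exp (Real.pi / 2 * x ^ 2))⁻¹)) =
      x * (Real.exp (Real.pi / 2 * x ^ 2))⁻¹ * (Real.exp (Real.pi / 2 * x ^ 2))⁻¹ by field_simp]
    refine mul_le_of_le_one_left (by positivity) ?_
    rw [← div_eq_mul_inv, div_le_one h4]
    exact h2
  have hint : Integrable (fun y => |y - u| * gaussBump β u y) := by
    refine hi.mono' ?_ (Eventually.of_forall fun y => ?_)
    · unfold gaussBump; fun_prop
    · rw [Real.norm_of_nonneg (mul_nonneg (abs_nonneg _) (gaussBump_nonneg hβ u y))]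
      exact hle y
  refine ⟨hint, (integral_mono hint hi hle).trans ?_⟩
  rw [integral_sub_right_eq_self (fun y => Real.exp (-(Real.pi / (2 * β ^ 2)) * y ^ 2)),
    integral_gaussian, div_div_cancel₀ Real.pi_ne_zero]
  refine Real.sqrt_le_iff.2 ⟨by positivity, ?_⟩
  nlinarith [sq_nonneg β]

/-- A pointwise bound for a Lipschitz function in terms of its Fourier transform. -/
lemma norm_le_of_fourier_le {g : ℝ → ℂ} (hg : Integrable g) {Λ u β : ℝ} (hβ : 0 < β)
    (hΛ : ∀ y, ‖g y - g u‖ ≤ Λ * |y - u|) {D : ℝ → ℝ} (hD : ∀ ξ, ‖𝓕 g ξ‖ ≤ D ξ)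
    (hDi : Integrable fun ξ => D ξ * Real.exp (-(Real.pi * β ^ 2) * ξ ^ 2)) :
    ‖g u‖ ≤ Λ * (2 * β) + ∫ ξ, D ξ * Real.exp (-(Real.pi * β ^ 2) * ξ ^ 2) := by
  -- Shifting the Fourier transform onto the modulated Gaussian expresses the local average of g at
  -- u through the transform of g, damped beyond frequency 1/β. The average differs from g(u) by at
  -- most 2βΛ.
  have key := VectorFourier.integral_fourierIntegral_smul_eq_flip (μ := volume) (ν := volume)
    (L := innerₗ ℝ) Real.continuous_fourierChar continuous_inner hg (integrable_gauss hβ u)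
  rw [flip_innerₗ] at key
  change ∫ ξ, (𝓕 g ξ) • _ = ∫ y, g y • (𝓕 (fun x : ℝ => Complex.exp (-Real.pi * ((β ^ 2 : ℝ) : ℂ) *
    x ^ 2 + 2 * Real.pi * (Complex.I * u) * x)) y) at key
  rw [fourier_gauss hβ u] at key
  have hBi := integrable_gaussBump hβ u
  have hBc : Integrable fun y => (gaussBump β u y : ℂ) := hBi.ofReal
  obtain ⟨hA1, hA2⟩ := integral_abs_sub_mul_gaussBump_le hβ u
  have hdiff : Integrable fun y => (g y - g u) • (gaussBump β u y : ℂ) := by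
    refine (hA1.const_mul Λ).mono' ?_ (Eventually.of_forall fun y => ?_)
    · exact (hg.aestronglyMeasurable.sub aestronglyMeasurable_const).smul hBc.aestronglyMeasurable
    · rw [norm_smul, Complex.norm_real, Real.norm_of_nonneg (gaussBump_nonneg hβ u y), ← mul_assoc]
      exact mul_le_mul_of_nonneg_right (hΛ y) (gaussBump_nonneg hβ u y)
  have hc : Integrable fun y => g u • (gaussBump β u y : ℂ) := hBc.smul (g u)
  have e1 : ∫ y, g y • (gaussBump β u y : ℂ) =
      (∫ y, (g y - g u) • (gaussBump β u y : ℂ)) + g u := by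
    have : ∫ y, g u • (gaussBump β u y : ℂ) = g u := by
      rw [integral_smul, integral_complex_ofReal, integral_gaussBump hβ u]
      simp
    have h2 := integral_add hdiff hc
    rw [this] at h2
    rw [← h2]
    refine integral_congr_ae (Eventually.of_forall fun y => ?_)
    simp only [smul_eq_mul]
    ring
  have e2 : g u = (∫ ξ, (𝓕 g ξ) • Complex.exp (-Real.pi * ((β ^ 2 : ℝ) : ℂ) *
    ξ ^ 2 + 2 * Real.pi * (Complex.I * u) * ξ)) - ∫ y, (g y - g u) • (gaussBump β u y : ℂ) := by
    rw [key, e1]; ring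
  have b1 : ‖∫ ξ, (𝓕 g ξ) • Complex.exp (-Real.pi * ((β ^ 2 : ℝ) : ℂ) *
      ξ ^ 2 + 2 * Real.pi * (Complex.I * u) * ξ)‖ ≤
      ∫ ξ, D ξ * Real.exp (-(Real.pi * β ^ 2) * ξ ^ 2) := by
    refine norm_integral_le_of_norm_le hDi (Eventually.of_forall fun ξ => ?_)
    rw [norm_smul, norm_gauss]
    exact mul_le_mul_of_nonneg_right (hD ξ) (Real.exp_pos _).le
  have b2 : ‖∫ y, (g y - g u) • (gaussBump β u y : ℂ)‖ ≤ Λ * (2 * β) := by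
    have hΛ0 : 0 ≤ Λ := by
      have := (norm_nonneg _).trans (hΛ (u + 1))
      simpa using this
    refine (norm_integral_le_of_norm_le (hA1.const_mul Λ) (Eventually.of_forall fun y => ?_)).trans ?_
    · rw [norm_smul, Complex.norm_real, Real.norm_of_nonneg (gaussBump_nonneg hβ u y), ← mul_assoc]
      exact mul_le_mul_of_nonneg_right (hΛ y) (gaussBump_nonneg hβ u y)
    · rw [integral_const_mul]
      exact mul_le_mul_of_nonneg_left hA2 hΛ0
  exact ((congrArg norm e2).le.trans (norm_sub_le _ _)).trans (by linarith)

/-- The contribution of the singularity at the origin. -/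
lemma integral_inv_sq_add_sq {σ : ℝ} (hσ : 0 < σ) :
    Integrable (fun ξ : ℝ => (σ ^ 2 + (2 * Real.pi * ξ) ^ 2)⁻¹) ∧
      ∫ ξ : ℝ, (σ ^ 2 + (2 * Real.pi * ξ) ^ 2)⁻¹ ≤ σ⁻¹ := by
  have hπ := Real.pi_pos
  have e : (fun ξ : ℝ => (σ ^ 2 + (2 * Real.pi * ξ) ^ 2)⁻¹) =
      fun ξ => (σ ^ 2)⁻¹ * (1 + (2 * Real.pi / σ * ξ) ^ 2)⁻¹ := by
    funext ξ
    rw [← mul_inv]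
    congr 1
    field_simp
  have hne : 2 * Real.pi / σ ≠ 0 := by positivity
  rw [e]
  refine ⟨(integrable_inv_one_add_sq.comp_mul_left' hne).const_mul _, ?_⟩
  rw [integral_const_mul, Measure.integral_comp_mul_left (fun x => (1 + x ^ 2)⁻¹),
    integral_univ_inv_one_add_sq, abs_of_pos (by positivity), smul_eq_mul]
  rw [show (σ ^ 2)⁻¹ * ((2 * Real.pi / σ)⁻¹ * Real.pi) = σ⁻¹ * (1 / 2) by field_simp]
  have : 0 < σ⁻¹ := by positivity
  linarith

/-- The contribution of the large ordinates. -/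
lemma exists_integral_rpow_gauss_le {c : ℝ} (hc : 0 ≤ c) : ∃ K, ∀ β : ℝ, 0 < β → β ≤ 1 →
    Integrable (fun ξ : ℝ => (|2 * Real.pi * ξ| + 2) ^ c * Real.exp (-(Real.pi * β ^ 2) * ξ ^ 2)) ∧
    ∫ ξ : ℝ, (|2 * Real.pi * ξ| + 2) ^ c * Real.exp (-(Real.pi * β ^ 2) * ξ ^ 2) ≤
      K * β ^ (-(c + 1)) := by
  have hπ := Real.pi_pos
  have hcont : Continuous fun x : ℝ => (|2 * Real.pi * x| + 2) ^ c := by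
    refine Continuous.rpow_const (by fun_prop) fun x => Or.inl ?_
    positivity
  have hI : Integrable fun x : ℝ => (|2 * Real.pi * x| + 2) ^ c * Real.exp (-Real.pi * x ^ 2) := by
    obtain ⟨C, hC⟩ : ∃ C, ∀ y : ℝ, 0 ≤ y → (y + 2) ^ c ≤ C * Real.exp y := by
      set n := ⌈c⌉₊
      refine ⟨n.factorial * Real.exp 2, fun y hy => ?_⟩
      have h1 : (y + 2) ^ c ≤ (y + 2) ^ (n : ℝ) :=
        Real.rpow_le_rpow_of_exponent_le (by linarith) (Nat.le_ceil c)
      have h2 := Real.pow_div_factorial_le_exp (x := y + 2) (by linarith) n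
      rw [div_le_iff₀ (by positivity)] at h2
      rw [Real.rpow_natCast] at h1
      refine h1.trans (h2.trans (le_of_eq ?_))
      rw [Real.exp_add]; ring
    refine ((integrable_exp_neg_mul_sq (show 0 < Real.pi / 2 by positivity)).const_mul
      (C * Real.exp (2 * Real.pi))).mono' (hcont.mul (by fun_prop)).aestronglyMeasurable
      (Eventually.of_forall fun x => ?_)
    rw [Real.norm_of_nonneg (by positivity)]
    have hC0 : 0 ≤ C := by
      have := hC 0 le_rfl
      rw [Real.exp_zero, mul_one] at this
      exact le_trans (by positivity) this
    calc _ ≤ (C * Real.exp |2 * Real.pi * x|) * Real.exp (-Real.pi * x ^ 2) := by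
          gcongr; exact hC _ (abs_nonneg _)
      _ = C * Real.exp (|2 * Real.pi * x| + -Real.pi * x ^ 2) := by rw [Real.exp_add]; ring
      _ ≤ C * Real.exp (2 * Real.pi + -(Real.pi / 2) * x ^ 2) := by
          refine mul_le_mul_of_nonneg_left (Real.exp_le_exp.2 ?_) hC0
          rw [abs_mul, abs_of_pos (by positivity : 0 < 2 * Real.pi), ← sq_abs x]
          nlinarith [sq_nonneg (|x| - 2)]
      _ = _ := by rw [Real.exp_add]; ring
  refine ⟨∫ x : ℝ, (|2 * Real.pi * x| + 2) ^ c * Real.exp (-Real.pi * x ^ 2), fun β h0 h1 => ?_⟩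
  -- The substitution ξ ↦ βξ costs β^(-c) from the polynomial and β^(-1) from the measure.
  have hI' := hI.comp_mul_left' h0.ne'
  have hle : ∀ ξ : ℝ, (|2 * Real.pi * ξ| + 2) ^ c * Real.exp (-(Real.pi * β ^ 2) * ξ ^ 2) ≤
      β ^ (-c) * ((|2 * Real.pi * (β * ξ)| + 2) ^ c * Real.exp (-Real.pi * (β * ξ) ^ 2)) := by
    intro ξ
    have e1 : -(Real.pi * β ^ 2) * ξ ^ 2 = -Real.pi * (β * ξ) ^ 2 := by ring
    rw [e1, ← mul_assoc]
    refine mul_le_mul_of_nonneg_right ?_ (Real.exp_pos _).le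
    have e2 : |2 * Real.pi * (β * ξ)| = β * |2 * Real.pi * ξ| := by
      rw [show 2 * Real.pi * (β * ξ) = β * (2 * Real.pi * ξ) by ring, abs_mul, abs_of_pos h0]
    have e3 : |2 * Real.pi * ξ| + 2 ≤ β⁻¹ * (|2 * Real.pi * (β * ξ)| + 2) := by
      rw [e2]
      have : 1 ≤ β⁻¹ := (one_le_inv₀ h0).2 h1
      have e4 : β⁻¹ * (β * |2 * Real.pi * ξ| + 2) = |2 * Real.pi * ξ| + β⁻¹ * 2 := by
        field_simp
      rw [e4]; linarith
    refine (Real.rpow_le_rpow (by positivity) e3 hc).trans (le_of_eq ?_)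
    rw [Real.mul_rpow (by positivity) (by positivity), Real.inv_rpow h0.le, Real.rpow_neg h0.le]
  have hint : Integrable (fun ξ : ℝ => (|2 * Real.pi * ξ| + 2) ^ c *
      Real.exp (-(Real.pi * β ^ 2) * ξ ^ 2)) := by
    refine (hI'.const_mul (β ^ (-c))).mono' (hcont.mul (by fun_prop)).aestronglyMeasurable
      (Eventually.of_forall fun ξ => ?_)
    rw [Real.norm_of_nonneg (by positivity)]
    exact hle ξ
  refine ⟨hint, (integral_mono hint (hI'.const_mul _) hle).trans (le_of_eq ?_)⟩
  rw [integral_const_mul, Measure.integral_comp_mul_left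
    (fun x => (|2 * Real.pi * x| + 2) ^ c * Real.exp (-Real.pi * x ^ 2)), smul_eq_mul,
    abs_of_pos (by positivity), neg_add, Real.rpow_add h0, Real.rpow_neg_one]
  ring

end

end ArithProg

/-! ### Laplace transforms of functions of subexponential growth -/

namespace ArithProg

section

open MeasureTheory FourierTransform


/-- `f` and its difference quotients are `O(σ ^ (-c) e ^ (σ y))`, uniformly for small `σ > 0`. -/
def SubexpGrowth (c : ℝ) (f : ℝ → ℝ) : Prop :=
  ∃ C r : ℝ, 0 < C ∧ 0 < r ∧ r ≤ 1 ∧ ∀ σ, 0 < σ → σ < r →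
    (∀ y, |f y| ≤ C * σ ^ (-c) * Real.exp (σ * y)) ∧
    ∀ y₁ y₂, y₁ ≤ y₂ → |f y₂ - f y₁| ≤ C * σ ^ (-c) * Real.exp (σ * y₂) * (y₂ - y₁)

lemma exists_rpow_mul_exp_neg_le {s : ℝ} (hs : 0 ≤ s) : ∃ K, 0 < K ∧ ∀ σ x : ℝ, 0 < σ → 0 ≤ x →
    x ^ s ≤ K * σ ^ (-s) * Real.exp (σ * x) := by
  set n := ⌈s⌉₊
  refine ⟨1 + n.factorial, by positivity, fun σ x hσ hx => ?_⟩
  have h1 : (σ * x) ^ s ≤ (1 + n.factorial) * Real.exp (σ * x) := by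
    have hy : 0 ≤ σ * x := by positivity
    rcases le_or_gt (σ * x) 1 with h | h
    · have h2 := Real.rpow_le_one hy h hs
      have h3 := Real.one_le_exp hy
      have h4 : (1 : ℝ) ≤ 1 + n.factorial := by simp
      nlinarith
    · have h2 : (σ * x) ^ s ≤ (σ * x) ^ (n : ℝ) :=
        Real.rpow_le_rpow_of_exponent_le h.le (Nat.le_ceil s)
      have h3 := Real.pow_div_factorial_le_exp (x := σ * x) hy n
      rw [div_le_iff₀ (by positivity)] at h3
      rw [Real.rpow_natCast] at h2
      have := Real.exp_pos (σ * x)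
      nlinarith
  rw [Real.mul_rpow hσ.le hx] at h1
  rw [Real.rpow_neg hσ.le]
  have := Real.rpow_pos_of_pos hσ s
  rw [mul_right_comm, ← div_eq_mul_inv, le_div_iff₀ this, mul_comm]
  exact h1

namespace SubexpGrowth

variable {c c' : ℝ} {f g : ℝ → ℝ}

lemma mono (hf : SubexpGrowth c f) (h : c ≤ c') : SubexpGrowth c' f := by
  obtain ⟨C, r, hC, hr, hr1, H⟩ := hf
  refine ⟨C, r, hC, hr, hr1, fun σ h0 h1 => ?_⟩
  have : σ ^ (-c) ≤ σ ^ (-c') :=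
    Real.rpow_le_rpow_of_exponent_ge h0 (by linarith) (by linarith)
  obtain ⟨H1, H2⟩ := H σ h0 h1
  refine ⟨fun y => (H1 y).trans (by gcongr), fun y₁ y₂ hy => (H2 y₁ y₂ hy).trans ?_⟩
  have : 0 ≤ y₂ - y₁ := by linarith
  gcongr

/-- A factor |y| is at most a constant times σ^(-1) e^(σ|y|/2). The spare exponential comes from
using the bounds of f with exponent σ/2 for y ≥ 0 and 3σ/2 for y ≤ 0, which also explains halving
the range of σ. -/
lemma id_mul (hf : SubexpGrowth c f) : SubexpGrowth (c + 1) (fun y => y * f y) := by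
  obtain ⟨C, r, hC, hr, hr1, H⟩ := hf
  obtain ⟨K, hK0, hK⟩ := exists_rpow_mul_exp_neg_le zero_le_one
  set T : ℝ := 2 ^ |c|
  have hT : ∀ σ : ℝ, 0 < σ → σ < r / 2 → ∀ σ', (σ' = σ / 2 ∨ σ' = 3 / 2 * σ) →
      0 < σ' ∧ σ' < r ∧ σ' ^ (-c) ≤ T * σ ^ (-c) := by
    intro σ h0 h1 σ' h
    have hσ' : 0 < σ' ∧ σ' < r := by rcases h with h | h <;> (subst h; constructor <;> linarith)
    refine ⟨hσ'.1, hσ'.2, ?_⟩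
    obtain ⟨q, hq, hq1, hq2⟩ : ∃ q : ℝ, σ' = q * σ ∧ 1 / 2 ≤ q ∧ q ≤ 2 := by
      rcases h with h | h
      · exact ⟨1 / 2, by rw [h]; ring, le_rfl, by norm_num⟩
      · exact ⟨3 / 2, h, by norm_num, by norm_num⟩
    have hq0 : 0 < q := by linarith
    rw [hq, Real.mul_rpow hq0.le h0.le]
    refine mul_le_mul_of_nonneg_right ?_ (by positivity)
    rcases le_total 0 c with hc | hc
    · rw [Real.rpow_neg hq0.le, ← Real.inv_rpow hq0.le]
      have : q⁻¹ ≤ 2 := inv_le_of_inv_le₀ two_pos (by linarith)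
      refine (Real.rpow_le_rpow (by positivity) this hc).trans_eq ?_
      simp only [T, abs_of_nonneg hc]
    · refine (Real.rpow_le_rpow (by positivity) hq2 (by linarith)).trans_eq ?_
      simp only [T, abs_of_nonpos hc]
  have hT0 : 0 < T := by positivity
  refine ⟨2 * K * C * T + C, r / 2, by positivity, by linarith, by linarith, fun σ h0 h1 => ?_⟩
  have hσ1 : σ < 1 := by linarith
  have hpow : σ ^ (-(c + 1)) = σ ^ (-c) * σ⁻¹ := by
    rw [neg_add, Real.rpow_add h0, Real.rpow_neg_one]
  have hσc := Real.rpow_pos_of_pos h0 (-c)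
  have key : ∀ y, ∃ σ', 0 < σ' ∧ σ' < r ∧ σ' ^ (-c) ≤ T * σ ^ (-c) ∧
      |y| * Real.exp (σ' * y) ≤ 2 * K * σ⁻¹ * Real.exp (σ * y) := by
    intro y
    have hy := hK (σ / 2) |y| (by linarith) (abs_nonneg y)
    rw [Real.rpow_one, Real.rpow_neg_one, inv_div] at hy
    rcases le_total 0 y with h | h
    · obtain ⟨a1, a2, a3⟩ := hT σ h0 h1 (σ / 2) (Or.inl rfl)
      refine ⟨σ / 2, a1, a2, a3, ?_⟩
      rw [abs_of_nonneg h] at hy ⊢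
      calc y * Real.exp (σ / 2 * y) ≤ K * (2 / σ) * Real.exp (σ / 2 * y) * Real.exp (σ / 2 * y) := by
            gcongr
        _ = 2 * K * σ⁻¹ * Real.exp (σ * y) := by
            rw [mul_assoc, ← Real.exp_add, div_eq_mul_inv]; ring_nf
    · obtain ⟨a1, a2, a3⟩ := hT σ h0 h1 (3 / 2 * σ) (Or.inr rfl)
      refine ⟨3 / 2 * σ, a1, a2, a3, ?_⟩
      rw [abs_of_nonpos h] at hy ⊢
      calc -y * Real.exp (3 / 2 * σ * y) ≤
            K * (2 / σ) * Real.exp (σ / 2 * -y) * Real.exp (3 / 2 * σ * y) := by gcongr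
        _ = 2 * K * σ⁻¹ * Real.exp (σ * y) := by
            rw [mul_assoc, ← Real.exp_add, div_eq_mul_inv]; ring_nf
  refine ⟨fun y => ?_, fun y₁ y₂ hy => ?_⟩
  · obtain ⟨σ', a1, a2, a3, a4⟩ := key y
    rw [abs_mul]
    calc |y| * |f y| ≤ |y| * (C * (T * σ ^ (-c)) * Real.exp (σ' * y)) := by
          refine mul_le_mul_of_nonneg_left (((H σ' a1 a2).1 y).trans ?_) (abs_nonneg y)
          gcongr
      _ = C * (T * σ ^ (-c)) * (|y| * Real.exp (σ' * y)) := by ring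
      _ ≤ C * (T * σ ^ (-c)) * (2 * K * σ⁻¹ * Real.exp (σ * y)) := by gcongr
      _ = 2 * K * C * T * (σ ^ (-c) * σ⁻¹) * Real.exp (σ * y) := by ring
      _ ≤ (2 * K * C * T + C) * (σ ^ (-c) * σ⁻¹) * Real.exp (σ * y) := by gcongr; linarith
      _ = _ := by rw [hpow]
  · obtain ⟨σ', a1, a2, a3, a4⟩ := key y₂
    have hy' : 0 ≤ y₂ - y₁ := by linarith
    rw [show y₂ * f y₂ - y₁ * f y₁ = y₂ * (f y₂ - f y₁) + f y₁ * (y₂ - y₁) by ring]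
    refine (abs_add_le _ _).trans ?_
    rw [abs_mul, abs_mul, abs_of_nonneg hy']
    have b1 : |y₂| * |f y₂ - f y₁| ≤
        2 * K * C * T * (σ ^ (-c) * σ⁻¹) * Real.exp (σ * y₂) * (y₂ - y₁) := by
      calc |y₂| * |f y₂ - f y₁| ≤
            |y₂| * (C * (T * σ ^ (-c)) * Real.exp (σ' * y₂) * (y₂ - y₁)) := by
            refine mul_le_mul_of_nonneg_left (((H σ' a1 a2).2 y₁ y₂ hy).trans ?_) (abs_nonneg _)
            gcongr
        _ = C * (T * σ ^ (-c)) * (y₂ - y₁) * (|y₂| * Real.exp (σ' * y₂)) := by ring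
        _ ≤ C * (T * σ ^ (-c)) * (y₂ - y₁) * (2 * K * σ⁻¹ * Real.exp (σ * y₂)) := by gcongr
        _ = _ := by ring
    have b2 : |f y₁| ≤ C * (σ ^ (-c) * σ⁻¹) * Real.exp (σ * y₂) := by
      refine ((H σ h0 (by linarith)).1 y₁).trans ?_
      have : σ ^ (-c) ≤ σ ^ (-c) * σ⁻¹ := le_mul_of_one_le_right hσc.le ((one_le_inv₀ h0).2 hσ1.le)
      gcongr
    have b3 := mul_le_mul_of_nonneg_right b2 hy'
    rw [hpow]
    linarith

lemma pow_mul (hf : SubexpGrowth c f) (N : ℕ) : SubexpGrowth (c + N) (fun y => y ^ N * f y) := by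
  induction N with
  | zero => simpa using hf
  | succ N ih =>
    have := ih.id_mul
    simp only [← mul_assoc, ← pow_succ'] at this
    push_cast
    rwa [← add_assoc]

/-- The model function whose transform is a pure power of w. For s > 1 it is locally Lipschitz
across the origin. -/
lemma max_rpow {s : ℝ} (hs : 1 < s) : SubexpGrowth s (fun y => max y 0 ^ s) := by
  obtain ⟨K, hK0, hK⟩ := exists_rpow_mul_exp_neg_le (s := s) (by linarith)
  obtain ⟨K', hK0', hK'⟩ := exists_rpow_mul_exp_neg_le (s := s - 1) (by linarith)
  refine ⟨K + s * K', 1, by positivity, one_pos, le_rfl, 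
    fun σ h0 h1 => ⟨fun y => ?_, fun y₁ y₂ hy => ?_⟩⟩
  · dsimp only
    rcases le_total 0 y with h | h
    · rw [max_eq_left h, abs_of_nonneg (Real.rpow_nonneg h _)]
      refine (hK σ y h0 h).trans ?_
      have : 0 ≤ s * K' := by positivity
      gcongr
      linarith
    · rw [max_eq_right h, Real.zero_rpow (by linarith), abs_zero]
      positivity
  · have hy' : 0 ≤ y₂ - y₁ := by linarith
    have hm : max y₁ 0 ≤ max y₂ 0 := max_le_max_right 0 hy
    have hmd : max y₂ 0 - max y₁ 0 ≤ y₂ - y₁ := by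
      rcases le_total 0 y₁ with h | h
      · rw [max_eq_left h, max_eq_left (h.trans hy)]
      · rw [max_eq_right h]
        rcases le_total 0 y₂ with h' | h'
        · rw [max_eq_left h']; linarith
        · rw [max_eq_right h']; linarith
    have hb : ∀ x ∈ Set.Icc (max y₁ 0) (max y₂ 0), ‖s * x ^ (s - 1)‖ ≤ s * (max y₂ 0) ^ (s - 1) := by
      intro x hx
      have hx0 : 0 ≤ x := (le_max_right _ _).trans hx.1
      rw [Real.norm_of_nonneg (by positivity)]
      have := Real.rpow_le_rpow hx0 hx.2 (show 0 ≤ s - 1 by linarith)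
      gcongr
    have h2 := (convex_Icc (max y₁ 0) (max y₂ 0)).norm_image_sub_le_of_norm_hasDerivWithin_le
      (fun x _ => (Real.hasDerivAt_rpow_const (x := x) (p := s) (Or.inr hs.le)).hasDerivWithinAt) hb
      (Set.left_mem_Icc.2 hm) (Set.right_mem_Icc.2 hm)
    rw [Real.norm_eq_abs, Real.norm_of_nonneg (sub_nonneg.2 hm)] at h2
    refine h2.trans ?_
    have h3 : max y₂ 0 ^ (s - 1) ≤ K' * σ ^ (-s) * Real.exp (σ * y₂) := by
      rcases le_total 0 y₂ with h | h
      · rw [max_eq_left h]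
        refine (hK' σ y₂ h0 h).trans ?_
        have : σ ^ (-(s - 1)) ≤ σ ^ (-s) :=
          Real.rpow_le_rpow_of_exponent_ge h0 h1.le (by linarith)
        gcongr
      · rw [max_eq_right h]
        rw [Real.zero_rpow (by linarith)]
        positivity
    calc s * max y₂ 0 ^ (s - 1) * (max y₂ 0 - max y₁ 0) ≤
          s * (K' * σ ^ (-s) * Real.exp (σ * y₂)) * (y₂ - y₁) := by
          have : 0 ≤ max y₂ 0 - max y₁ 0 := sub_nonneg.2 hm
          gcongr
      _ = s * K' * σ ^ (-s) * Real.exp (σ * y₂) * (y₂ - y₁) := by ring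
      _ ≤ _ := by gcongr; linarith

lemma continuous (hf : SubexpGrowth c f) : Continuous f := by
  obtain ⟨C, r, hC, hr, hr1, H⟩ := hf
  obtain ⟨-, H2⟩ := H (r / 2) (by linarith) (by linarith)
  have hsym : ∀ y y₀, |f y - f y₀| ≤
      C * (r / 2) ^ (-c) * Real.exp (r / 2 * max y y₀) * |y - y₀| := by
    intro y y₀
    rcases le_total y y₀ with h | h
    · rw [abs_sub_comm, max_eq_right h, abs_sub_comm y, abs_of_nonneg (sub_nonneg.2 h)]
      exact H2 y y₀ h
    · rw [max_eq_left h, abs_of_nonneg (sub_nonneg.2 h)]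
      exact H2 y₀ y h
  refine continuous_iff_continuousAt.2 fun y₀ => tendsto_iff_norm_sub_tendsto_zero.2 ?_
  refine squeeze_zero (fun _ => norm_nonneg _) (fun y => hsym y y₀) ?_
  refine Continuous.tendsto' (by fun_prop) _ _ (by simp)

/-- The exponentially damped function is integrable and Lipschitz. -/
lemma damped (hf : SubexpGrowth c f) : ∃ K r : ℝ, 0 < K ∧ 0 < r ∧ r ≤ 1 ∧ ∀ σ, 0 < σ → σ < r →
    Integrable (fun y => Real.exp (-σ * y) * f y) ∧
    ∀ y u, |Real.exp (-σ * y) * f y - Real.exp (-σ * u) * f u| ≤ K * σ ^ (-c) * |y - u| := by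
  have hcont := hf.continuous
  obtain ⟨C, r, hC, hr, hr1, H⟩ := hf
  -- Integrability uses the growth bound with exponent 3σ/2 on the negative and σ/2 on the positive
  -- half-line, so 3σ/2 < r must hold.
  refine ⟨2 * C, r / 2, by positivity, by linarith, by linarith, fun σ h0 h1 => ⟨?_, ?_⟩⟩
  · have hm : AEStronglyMeasurable (fun y => Real.exp (-σ * y) * f y) volume :=
      (Continuous.mul (by fun_prop) hcont).aestronglyMeasurable
    rw [← integrableOn_univ, ← Set.Iic_union_Ioi (a := (0 : ℝ)), integrableOn_union]
    constructor
    · refine (((integrableOn_exp_mul_Iic (show 0 < σ / 2 by linarith) 0)).const_mul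
        (C * (3 / 2 * σ) ^ (-c))).mono' hm.restrict (Eventually.of_forall fun y => ?_)
      rw [norm_mul, Real.norm_of_nonneg (Real.exp_pos _).le, Real.norm_eq_abs]
      calc _ ≤ Real.exp (-σ * y) * (C * (3 / 2 * σ) ^ (-c) * Real.exp (3 / 2 * σ * y)) := by
            gcongr; exact (H (3 / 2 * σ) (by linarith) (by linarith)).1 y
        _ = C * (3 / 2 * σ) ^ (-c) * (Real.exp (-σ * y) * Real.exp (3 / 2 * σ * y)) := by ring
        _ = _ := by rw [← Real.exp_add]; ring_nf
    · refine (((exp_neg_integrableOn_Ioi 0 (show 0 < σ / 2 by linarith))).const_mul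
        (C * (σ / 2) ^ (-c))).mono' hm.restrict (Eventually.of_forall fun y => ?_)
      rw [norm_mul, Real.norm_of_nonneg (Real.exp_pos _).le, Real.norm_eq_abs]
      calc _ ≤ Real.exp (-σ * y) * (C * (σ / 2) ^ (-c) * Real.exp (σ / 2 * y)) := by
            gcongr; exact (H (σ / 2) (by linarith) (by linarith)).1 y
        _ = C * (σ / 2) ^ (-c) * (Real.exp (-σ * y) * Real.exp (σ / 2 * y)) := by ring
        _ = _ := by rw [← Real.exp_add]; ring_nf
  · obtain ⟨H1, H2⟩ := H σ h0 (by linarith)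
    have key : ∀ y₁ y₂, y₁ ≤ y₂ → |Real.exp (-σ * y₂) * f y₂ - Real.exp (-σ * y₁) * f y₁| ≤
        2 * C * σ ^ (-c) * (y₂ - y₁) := by
      intro y₁ y₂ hy
      have hy' : 0 ≤ y₂ - y₁ := by linarith
      rw [show Real.exp (-σ * y₂) * f y₂ - Real.exp (-σ * y₁) * f y₁ =
        Real.exp (-σ * y₂) * (f y₂ - f y₁) - (Real.exp (-σ * y₁) - Real.exp (-σ * y₂)) * f y₁ by ring]
      refine (abs_sub _ _).trans ?_
      rw [abs_mul, abs_mul, abs_of_pos (Real.exp_pos _)]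
      have e0 : Real.exp (-σ * y₂) * Real.exp (σ * y₂) = 1 := by
        rw [← Real.exp_add]; simp
      have e0' : Real.exp (-σ * y₁) * Real.exp (σ * y₁) = 1 := by
        rw [← Real.exp_add]; simp
      have e1 : |Real.exp (-σ * y₁) - Real.exp (-σ * y₂)| ≤ Real.exp (-σ * y₁) * (y₂ - y₁) := by
        have h3 : Real.exp (-σ * y₂) = Real.exp (-σ * y₁) * Real.exp (-(σ * (y₂ - y₁))) := by
          rw [← Real.exp_add]; ring_nf
        have h4 : Real.exp (-σ * y₂) ≤ Real.exp (-σ * y₁) := Real.exp_le_exp.2 (by nlinarith)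
        rw [abs_of_nonneg (by linarith), h3, ← mul_one_sub]
        refine mul_le_mul_of_nonneg_left ?_ (Real.exp_pos _).le
        have := Real.add_one_le_exp (-(σ * (y₂ - y₁)))
        nlinarith
      calc _ ≤ Real.exp (-σ * y₂) * (C * σ ^ (-c) * Real.exp (σ * y₂) * (y₂ - y₁)) +
            Real.exp (-σ * y₁) * (y₂ - y₁) * (C * σ ^ (-c) * Real.exp (σ * y₁)) := by
            gcongr
            · exact H2 y₁ y₂ hy
            · exact H1 y₁
        _ = (Real.exp (-σ * y₂) * Real.exp (σ * y₂)) * (C * σ ^ (-c) * (y₂ - y₁)) +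
            (Real.exp (-σ * y₁) * Real.exp (σ * y₁)) * (C * σ ^ (-c) * (y₂ - y₁)) := by ring
        _ = _ := by rw [e0, e0']; ring
    intro y u
    rcases le_total y u with h | h
    · rw [abs_sub_comm, abs_sub_comm y, abs_of_nonneg (sub_nonneg.2 h)]
      exact key y u h
    · rw [abs_of_nonneg (sub_nonneg.2 h)]
      exact key u y h

end SubexpGrowth

/-- The Laplace transform `∫ f(y) e^{-wy} dy`, as a Mellin transform. -/
noncomputable def logMellin (f : ℝ → ℝ) (w : ℂ) : ℂ :=
  mellin (fun t => (f (-Real.log t) : ℂ)) w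

lemma logMellin_eq_fourier (f : ℝ → ℝ) (σ ξ : ℝ) :
    logMellin f (σ + (2 * Real.pi * ξ : ℝ) * Complex.I) =
      𝓕 (fun y : ℝ => ((Real.exp (-σ * y) * f y : ℝ) : ℂ)) ξ := by
  rw [logMellin, mellin_eq_fourier]
  have e : (((σ : ℂ) + (2 * Real.pi * ξ : ℝ) * Complex.I).im) / (2 * Real.pi) = ξ := by
    have := Real.pi_ne_zero
    simp
  rw [e]
  refine congrArg (fun F : ℝ → ℂ => 𝓕 F ξ) (funext fun u => ?_)
  simp

lemma SubexpGrowth.isBigO {c : ℝ} {f : ℝ → ℝ} (hf : SubexpGrowth c f) :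
    LocallyIntegrableOn (fun t => (f (-Real.log t) : ℂ)) (Set.Ioi 0) ∧
      ∃ r : ℝ, 0 < r ∧ r ≤ 1 ∧
      ∀ σ, 0 < σ → σ < r → (fun t => (f (-Real.log t) : ℂ)) =O[atTop] (fun t : ℝ => t ^ (-σ)) ∧
        (fun t => (f (-Real.log t) : ℂ)) =O[𝓝[>] 0] (fun t : ℝ => t ^ (-σ)) := by
  refine ⟨?_, ?_⟩
  · refine ContinuousOn.locallyIntegrableOn (Complex.continuous_ofReal.comp_continuousOn
      (hf.continuous.comp_continuousOn ?_)) measurableSet_Ioi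
    exact (Real.continuousOn_log.mono fun x hx => ne_of_gt hx).neg
  · obtain ⟨C, r, hC, hr, hr1, H⟩ := hf
    refine ⟨r, hr, hr1, fun σ h0 h1 => ?_⟩
    have key : ∀ t : ℝ, 0 < t → ‖(f (-Real.log t) : ℂ)‖ ≤ C * σ ^ (-c) * ‖t ^ (-σ)‖ := by
      intro t ht
      rw [Complex.norm_real, Real.norm_eq_abs, Real.norm_of_nonneg (by positivity),
        Real.rpow_def_of_pos ht]
      refine ((H σ h0 h1).1 _).trans (le_of_eq ?_)
      ring_nf
    constructor
    · exact Asymptotics.IsBigO.of_bound _ ((eventually_gt_atTop 0).mono key)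
    · exact Asymptotics.IsBigO.of_bound _ (eventually_mem_nhdsWithin.mono key)

lemma SubexpGrowth.hasDerivAt_logMellin {c : ℝ} {f : ℝ → ℝ} (hf : SubexpGrowth c f) :
    ∃ r : ℝ, 0 < r ∧ r ≤ 1 ∧ ∀ w : ℂ, 0 < w.re → w.re < r →
      HasDerivAt (logMellin f) (-logMellin (fun y => y * f y) w) w := by
  obtain ⟨hl, r, hr, hr1, H⟩ := hf.isBigO
  refine ⟨r, hr, hr1, fun w h0 h1 => ?_⟩
  obtain ⟨σ, h3, h4⟩ := exists_between h1
  have := (mellin_hasDerivAt_of_isBigO_rpow hl (H σ (h0.trans h3) h4).1 h3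
    (H (w.re / 2) (by linarith) (by linarith)).2 (by linarith)).2
  refine this.congr_deriv ?_
  rw [logMellin, ← mul_neg_one, mul_comm, ← smul_eq_mul, ← mellin_const_smul]
  congr 1
  funext t
  simp

/-- Differentiating under the integral brings down -y each time; the admissible strip may shrink
with N, but it stays adjacent to Re w = 0. -/
lemma SubexpGrowth.iteratedDeriv_logMellin {c : ℝ} {f : ℝ → ℝ} (hf : SubexpGrowth c f) (N : ℕ) :
    ∃ r : ℝ, 0 < r ∧ r ≤ 1 ∧ ∀ w : ℂ, 0 < w.re → w.re < r →
      (-1) ^ N * iteratedDeriv N (logMellin f) w = logMellin (fun y => y ^ N * f y) w := by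
  induction N with
  | zero => exact ⟨1, one_pos, le_rfl, fun w _ _ => by simp⟩
  | succ N ih =>
    obtain ⟨r, hr, hr1, H⟩ := ih
    obtain ⟨r', hr', hr1', H'⟩ := (hf.pow_mul N).hasDerivAt_logMellin
    refine ⟨min r r', by positivity, (min_le_left _ _).trans hr1, fun w h0 h1 => ?_⟩
    have ho : IsOpen {w : ℂ | 0 < w.re ∧ w.re < r} :=
      (isOpen_lt continuous_const Complex.continuous_re).inter
        (isOpen_lt Complex.continuous_re continuous_const)
    have hev : iteratedDeriv N (logMellin f) =ᶠ[𝓝 w]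
        fun w => (-1) ^ N * logMellin (fun y => y ^ N * f y) w := by
      filter_upwards [ho.mem_nhds ⟨h0, h1.trans_le (min_le_left _ _)⟩] with v hv
      rw [← H v hv.1 hv.2, ← mul_assoc, ← mul_pow]
      simp
    rw [iteratedDeriv_succ, hev.deriv_eq,
      ((H' w h0 (h1.trans_le (min_le_right _ _))).const_mul _).deriv]
    have e1 : (fun y => y * (y ^ N * f y)) = fun y => y ^ (N + 1) * f y := by
      funext y; ring
    have e2 : (-1 : ℂ) ^ N * (-1) ^ N = 1 := by rw [← mul_pow]; simp
    rw [e1, pow_succ]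
    linear_combination logMellin (fun y => y ^ (N + 1) * f y) w * e2

/-- The Laplace transform of a power. -/
lemma logMellin_max_rpow {s : ℝ} (hs : 1 < s) :
    ∃ r : ℝ, 0 < r ∧ r ≤ 1 ∧ ∀ w : ℂ, 0 < w.re → w.re < r →
    logMellin (fun y => max y 0 ^ s) w = Real.Gamma (s + 1) * w ^ (((-(s + 1) : ℝ)) : ℂ) := by
  obtain ⟨r, hr, hr1, H⟩ := (SubexpGrowth.max_rpow hs).hasDerivAt_logMellin
  refine ⟨r, hr, hr1, fun w h0 h1 => ?_⟩
  set U : Set ℂ := {w : ℂ | 0 < w.re ∧ w.re < r}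
  have ho : IsOpen U := (isOpen_lt continuous_const Complex.continuous_re).inter
        (isOpen_lt Complex.continuous_re continuous_const)
  have hpc : IsPreconnected U :=
    ((convex_halfSpace_re_gt 0).inter (convex_halfSpace_re_lt r)).isPreconnected
  -- On the real axis this is Euler's integral for Γ; the identity theorem carries it to the strip.
  have hreal : ∀ σ : ℝ, 0 < σ → logMellin (fun y => max y 0 ^ s) σ =
      Real.Gamma (s + 1) * (σ : ℂ) ^ (((-(s + 1) : ℝ)) : ℂ) := by
    intro σ hσ
    have e := logMellin_eq_fourier (fun y => max y 0 ^ s) σ 0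
    simp only [mul_zero, Complex.ofReal_zero, zero_mul, add_zero] at e
    rw [e, Real.fourier_eq]
    simp only [inner_zero_right, neg_zero, AddChar.map_zero_eq_one, one_smul]
    rw [integral_complex_ofReal, ← Complex.ofReal_cpow hσ.le, ← Complex.ofReal_mul]
    congr 1
    have e2 : (fun y : ℝ => Real.exp (-σ * y) * max y 0 ^ s) =
        (Set.Ioi (0 : ℝ)).indicator fun y => y ^ (s + 1 - 1) * Real.exp (-(σ * y)) := by
      funext y
      by_cases hy : 0 < y
      · rw [Set.indicator_of_mem (show y ∈ Set.Ioi (0 : ℝ) from hy), max_eq_left hy.le,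
          add_sub_cancel_right, neg_mul, mul_comm]
      · rw [Set.indicator_of_notMem (show y ∉ Set.Ioi (0 : ℝ) from hy),
          max_eq_right (not_lt.1 hy), Real.zero_rpow (by linarith), mul_zero]
    rw [e2, integral_indicator measurableSet_Ioi,
      Real.integral_rpow_mul_exp_neg_mul_Ioi (by linarith) hσ, one_div,
      Real.inv_rpow hσ.le, Real.rpow_neg hσ.le, mul_comm]
  have hA : DifferentiableOn ℂ (logMellin fun y => max y 0 ^ s) U := fun v hv =>
    (H v hv.1 hv.2).differentiableAt.differentiableWithinAt
  have hB : DifferentiableOn ℂ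
      (fun w : ℂ => Real.Gamma (s + 1) * w ^ (((-(s + 1) : ℝ)) : ℂ)) U := fun v hv =>
    ((differentiableAt_id.cpow_const (Or.inl hv.1)).const_mul _).differentiableWithinAt
  set z₀ : ℂ := ((r / 2 : ℝ) : ℂ)
  have hz₀ : z₀ ∈ U := by
    change 0 < z₀.re ∧ z₀.re < r
    rw [show z₀.re = r / 2 from Complex.ofReal_re _]
    constructor <;> linarith
  have hfreq : ∃ᶠ v in 𝓝[≠] z₀, logMellin (fun y => max y 0 ^ s) v =
      Real.Gamma (s + 1) * v ^ (((-(s + 1) : ℝ)) : ℂ) := by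
    have ht : Tendsto (fun σ : ℝ => (σ : ℂ)) (𝓝[>] (r / 2)) (𝓝[≠] z₀) := by
      rw [tendsto_nhdsWithin_iff]
      refine ⟨(Complex.continuous_ofReal.tendsto _).mono_left nhdsWithin_le_nhds, ?_⟩
      filter_upwards [self_mem_nhdsWithin] with σ hσ
      have : σ ≠ r / 2 := ne_of_gt hσ
      simpa [z₀] using (by exact_mod_cast this : (σ : ℂ) ≠ ((r / 2 : ℝ) : ℂ))
    refine ht.frequently (Eventually.frequently ?_)
    filter_upwards [self_mem_nhdsWithin] with σ hσ
    exact hreal σ (by have : r / 2 < σ := hσ; linarith)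
  exact (hA.analyticOnNhd ho).eqOn_of_preconnected_of_frequently_eq (hB.analyticOnNhd ho) hpc hz₀
    hfreq ⟨h0, h1⟩

end

end ArithProg

/-! ### A Tauberian theorem from derivatives of the Laplace transform -/

namespace ArithProg

section

open MeasureTheory FourierTransform


lemma norm_cpow_neg_real {w : ℂ} (hw : w ≠ 0) (s : ℝ) : ‖w ^ ((s : ℝ) : ℂ)‖ = ‖w‖ ^ s := by
  rw [Complex.norm_cpow_of_ne_zero hw]
  simp

/-- If the derivatives of the Laplace transform of `f` behave like those of
`Γ(z) G w ^ (-z)`, then `f(u)` behaves like `G u ^ (z - 1)`. -/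
theorem SubexpGrowth.abs_sub_le_of_logMellin {c : ℝ} {f : ℝ → ℝ} (hf : SubexpGrowth c f)
    (hc : 0 ≤ c) {G z E c' r₀ : ℝ} (hE : 0 ≤ E) (hc' : 0 ≤ c') (hr₀ : 0 < r₀)
    (hyp : ∀ N : ℕ, 1 < z + N - 1 → ∃ D, ∀ w : ℂ, 0 < w.re → w.re < r₀ →
      ‖(-1) ^ N * iteratedDeriv N (logMellin f) w -
        ((G * Real.Gamma (z + N) : ℝ) : ℂ) * w ^ ((-(z + N) : ℝ) : ℂ)‖ ≤
      D * (E * ‖w‖ ^ (-(z + N - 1)) + (|w.im| + 2) ^ c')) (A : ℝ) :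
    ∃ C u₀ : ℝ, ∀ u, u₀ ≤ u → |f u - G * u ^ (z - 1)| ≤ C * (E * u ^ (z - 2) + u ^ (-A)) := by
  obtain ⟨K, hK⟩ := exists_integral_rpow_gauss_le hc'
  -- The smoothing scale is u^(-B): small enough that the Lipschitz constant u^(c+N+|z|) times the
  -- scale is at most u^(N-A).
  set B : ℝ := c + |z| + |A| with hB
  have hB0 : 0 ≤ B := by positivity
  -- Large ordinates cost u^(B(c'+1)), independent of N because c' is. So N is taken past B(c'+1) +
  -- |A|; the remaining summands ensure z + N - 1 ≥ 2.
  obtain ⟨N, hN⟩ := exists_nat_ge (B * (c' + 1) + |A| + |z| + 3)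
  have hzl := neg_abs_le z
  have hzu := le_abs_self z
  have hAu := le_abs_self A
  have hA0 := abs_nonneg A
  have hBc : 0 ≤ B * (c' + 1) := by positivity
  set s : ℝ := z + N - 1 with hs
  have hs1 : 2 ≤ s := by linarith
  obtain ⟨D, hD⟩ := hyp N (by linarith)
  obtain ⟨r₁, hr₁, -, h₁⟩ := hf.iteratedDeriv_logMellin N
  obtain ⟨r₂, hr₂, -, h₂⟩ := logMellin_max_rpow (s := s) (by linarith)
  have hF1 : SubexpGrowth (c + N + |z|) (fun y => y ^ N * f y) :=
    (hf.pow_mul N).mono (by linarith [abs_nonneg z])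
  have hF2 : SubexpGrowth (c + N + |z|) (fun y => max y 0 ^ s) :=
    (SubexpGrowth.max_rpow (by linarith)).mono (by linarith)
  obtain ⟨K₁, r₃, hK₁, hr₃, -, h₃⟩ := hF1.damped
  obtain ⟨K₂, r₄, hK₂, hr₄, -, h₄⟩ := hF2.damped
  set r := min (min r₀ r₁) (min (min r₂ r₃) (min r₄ 1)) with hr
  have hr0 : 0 < r := by positivity
  refine ⟨Real.exp 1 * ((K₁ + |G| * K₂) * 2 + (|D| + |D| * |K|)), r⁻¹ + 1, fun u hu => ?_⟩
  have hu0 : 0 < u := by have := inv_pos.2 hr0; linarith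
  -- At Re w = 1/u the damping e^(-σy) equals e^(-1) at y = u, while powers of 1/σ become powers of
  -- u.
  set σ := u⁻¹ with hσ
  have hσ0 : 0 < σ := inv_pos.2 hu0
  have hσr : σ < r := inv_lt_of_inv_lt₀ hr0 (by linarith)
  have hσ₀ : σ < r₀ := hσr.trans_le ((min_le_left _ _).trans (min_le_left _ _))
  have hσ₁ : σ < r₁ := hσr.trans_le ((min_le_left _ _).trans (min_le_right _ _))
  have hσ₂ : σ < r₂ := hσr.trans_le ((min_le_right _ _).trans ((min_le_left _ _).trans
    (min_le_left _ _)))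
  have hσ₃ : σ < r₃ := hσr.trans_le ((min_le_right _ _).trans ((min_le_left _ _).trans
    (min_le_right _ _)))
  have hσ₄ : σ < r₄ := hσr.trans_le ((min_le_right _ _).trans ((min_le_right _ _).trans
    (min_le_left _ _)))
  have hσ₅ : σ < 1 := hσr.trans_le ((min_le_right _ _).trans ((min_le_right _ _).trans
    (min_le_right _ _)))
  have hu1 : 1 < u := by
    have := (one_lt_inv₀ hσ0).2 hσ₅
    rwa [hσ, inv_inv] at this
  obtain ⟨i₃, l₃⟩ := h₃ σ hσ0 hσ₃
  obtain ⟨i₄, l₄⟩ := h₄ σ hσ0 hσ₄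
  set g₁ : ℝ → ℂ := fun y => ((Real.exp (-σ * y) * (y ^ N * f y) : ℝ) : ℂ) with hg₁
  set g₂ : ℝ → ℂ := fun y => ((Real.exp (-σ * y) * (max y 0 ^ s) : ℝ) : ℂ) with hg₂
  have hg₁i : Integrable g₁ := i₃.ofReal
  have hg₂i : Integrable g₂ := i₄.ofReal
  -- The damped difference of y^N f(y) and its expected value G y^(z+N-1).
  set g : ℝ → ℂ := fun y => g₁ y - (G : ℂ) * g₂ y with hg
  have hgi : Integrable g := hg₁i.sub (hg₂i.const_mul _)
  set β : ℝ := u ^ (-B) with hβ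
  have hβ0 : 0 < β := Real.rpow_pos_of_pos hu0 _
  have hβ1 : β ≤ 1 := Real.rpow_le_one_of_one_le_of_nonpos hu1.le (by linarith)
  have hpow : σ ^ (-(c + N + |z|)) = u ^ (c + N + |z|) := by
    rw [hσ, Real.inv_rpow hu0.le, ← Real.rpow_neg hu0.le, neg_neg]
  have hΛ : ∀ y, ‖g y - g u‖ ≤ (K₁ + |G| * K₂) * u ^ (c + N + |z|) * |y - u| := by
    intro y
    have e : g y - g u = (g₁ y - g₁ u) - (G : ℂ) * (g₂ y - g₂ u) := by simp only [hg]; ring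
    rw [e]
    refine (norm_sub_le _ _).trans ?_
    rw [norm_mul]
    have a1 : ‖g₁ y - g₁ u‖ ≤ K₁ * u ^ (c + N + |z|) * |y - u| := by
      simp only [hg₁]
      rw [← Complex.ofReal_sub, Complex.norm_real, Real.norm_eq_abs, ← hpow]
      exact l₃ y u
    have a2 : ‖g₂ y - g₂ u‖ ≤ K₂ * u ^ (c + N + |z|) * |y - u| := by
      simp only [hg₂]
      rw [← Complex.ofReal_sub, Complex.norm_real, Real.norm_eq_abs, ← hpow]
      exact l₄ y u
    rw [Complex.norm_real, Real.norm_eq_abs]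
    have := mul_le_mul_of_nonneg_left a2 (abs_nonneg G)
    linarith
  have hfour : ∀ ξ : ℝ, 𝓕 g ξ = 𝓕 g₁ ξ - (G : ℂ) * 𝓕 g₂ ξ := by
    intro ξ
    simp only [Real.fourier_eq, hg, smul_sub]
    rw [integral_sub, ← smul_eq_mul, ← integral_smul]
    · congr 2
      funext y
      simp only [smul_eq_mul, Circle.smul_def]
      ring
    · exact (Real.fourierIntegral_convergent_iff ξ).2 hg₁i
    · exact (Real.fourierIntegral_convergent_iff ξ).2 (hg₂i.const_mul _)
  set I₁ : ℝ → ℝ := fun ξ => (σ ^ 2 + (2 * Real.pi * ξ) ^ 2)⁻¹ with hI₁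
  set I₂ : ℝ → ℝ := fun ξ => (|2 * Real.pi * ξ| + 2) ^ c' with hI₂
  set V : ℝ → ℝ := fun ξ => |D| * (E * σ ^ (2 - s) * I₁ ξ + I₂ ξ) with hV
  have hVb : ∀ ξ, ‖𝓕 g ξ‖ ≤ V ξ := by
    intro ξ
    set w : ℂ := σ + (2 * Real.pi * ξ : ℝ) * Complex.I with hw
    have hre : w.re = σ := by simp [hw]
    have him : w.im = 2 * Real.pi * ξ := by simp [hw]
    have hw0 : 0 < w.re := by rw [hre]; exact hσ0
    have e1 : 𝓕 g₁ ξ = (-1) ^ N * iteratedDeriv N (logMellin f) w := by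
      rw [h₁ w hw0 (by rw [hre]; exact hσ₁), hw, logMellin_eq_fourier]
    have e2 : 𝓕 g₂ ξ = Real.Gamma (s + 1) * w ^ (((-(s + 1) : ℝ)) : ℂ) := by
      rw [← h₂ w hw0 (by rw [hre]; exact hσ₂), hw, logMellin_eq_fourier]
    have e3 := hD w hw0 (by rw [hre]; exact hσ₀)
    have e4 : s + 1 = z + N := by rw [hs]; ring
    rw [hfour, e1, e2, e4, ← mul_assoc, ← Complex.ofReal_mul]
    refine e3.trans ((mul_le_mul_of_nonneg_right (le_abs_self D) (by positivity)).trans ?_)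
    simp only [hV, hI₁, hI₂]
    refine mul_le_mul_of_nonneg_left ?_ (abs_nonneg D)
    rw [him, mul_assoc E]
    refine add_le_add_left (mul_le_mul_of_nonneg_left ?_ hE) _
    have hnw : ‖w‖ ^ 2 = σ ^ 2 + (2 * Real.pi * ξ) ^ 2 := by
      rw [← Complex.normSq_eq_norm_sq, Complex.normSq_apply, hre, him]; ring
    have hσw : σ ≤ ‖w‖ := by rw [← hre]; exact Complex.re_le_norm w
    have hw1 : 0 < ‖w‖ := hσ0.trans_le hσw
    -- Of the power ‖w‖^(-s) only ‖w‖^(-2) is kept for integrability in ξ; the rest is estimated by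
    -- σ^(2-s). The integral of ‖w‖^(-2) is at most 1/σ, giving u^(s-1) in total.
    rw [← hnw, show -(z + N - 1) = (2 - s) + (-2 : ℝ) by rw [hs]; ring, Real.rpow_add hw1]
    refine mul_le_mul ?_ (le_of_eq ?_) (by positivity) (by positivity)
    · exact Real.rpow_le_rpow_of_nonpos hσ0 hσw (by linarith)
    · rw [Real.rpow_neg hw1.le]; norm_cast
  obtain ⟨j₁, j₂⟩ := integral_inv_sq_add_sq hσ0
  obtain ⟨k₁, k₂⟩ := hK β hβ0 hβ1
  have hexp : ∀ ξ : ℝ, Real.exp (-(Real.pi * β ^ 2) * ξ ^ 2) ≤ 1 := by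
    intro ξ
    rw [Real.exp_le_one_iff]
    have := Real.pi_pos
    have : 0 ≤ Real.pi * β ^ 2 * ξ ^ 2 := by positivity
    linarith
  have hI₁e : Integrable fun ξ => I₁ ξ * Real.exp (-(Real.pi * β ^ 2) * ξ ^ 2) := by
    refine j₁.mono' (j₁.aestronglyMeasurable.mul (by fun_prop)) (Eventually.of_forall fun ξ => ?_)
    have : 0 ≤ I₁ ξ := by simp only [hI₁]; positivity
    rw [Real.norm_of_nonneg (mul_nonneg this (Real.exp_pos _).le)]
    exact mul_le_of_le_one_right this (hexp ξ)
  have hI₁le : ∫ ξ, I₁ ξ * Real.exp (-(Real.pi * β ^ 2) * ξ ^ 2) ≤ u := by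
    refine (integral_mono hI₁e j₁ fun ξ => ?_).trans (j₂.trans_eq (by rw [hσ, inv_inv]))
    have : 0 ≤ I₁ ξ := by simp only [hI₁]; positivity
    exact mul_le_of_le_one_right this (hexp ξ)
  have hVe : ∀ ξ, V ξ * Real.exp (-(Real.pi * β ^ 2) * ξ ^ 2) =
      |D| * (E * σ ^ (2 - s)) * (I₁ ξ * Real.exp (-(Real.pi * β ^ 2) * ξ ^ 2)) +
        |D| * (I₂ ξ * Real.exp (-(Real.pi * β ^ 2) * ξ ^ 2)) := by
    intro ξ; simp only [hV]; ring
  have hVi : Integrable fun ξ => V ξ * Real.exp (-(Real.pi * β ^ 2) * ξ ^ 2) := by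
    simp only [hVe]
    exact (hI₁e.const_mul _).add (k₁.const_mul _)
  have main := norm_le_of_fourier_le hgi hβ0 hΛ hVb hVi
  have hVint : ∫ ξ, V ξ * Real.exp (-(Real.pi * β ^ 2) * ξ ^ 2) ≤
      |D| * (E * u ^ (s - 1)) + |D| * |K| * u ^ (B * (c' + 1)) := by
    simp only [hVe]
    rw [integral_add (hI₁e.const_mul _) (k₁.const_mul _), integral_const_mul, integral_const_mul]
    have q1 : σ ^ (2 - s) * u = u ^ (s - 1) := by
      rw [hσ, Real.inv_rpow hu0.le, ← Real.rpow_neg hu0.le]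
      conv_lhs => rw [← Real.rpow_one u, ← Real.rpow_mul hu0.le, ← Real.rpow_add hu0]
      congr 1; ring
    have q2 : β ^ (-(c' + 1)) = u ^ (B * (c' + 1)) := by
      rw [hβ, ← Real.rpow_mul hu0.le]; congr 1; ring
    have q3 : ∫ ξ, I₂ ξ * Real.exp (-(Real.pi * β ^ 2) * ξ ^ 2) ≤ |K| * u ^ (B * (c' + 1)) := by
      rw [← q2]
      exact k₂.trans (mul_le_mul_of_nonneg_right (le_abs_self K) (by positivity))
    calc _ ≤ |D| * (E * σ ^ (2 - s)) * u + |D| * (|K| * u ^ (B * (c' + 1))) := by gcongr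
      _ = |D| * (E * (σ ^ (2 - s) * u)) + |D| * |K| * u ^ (B * (c' + 1)) := by ring
      _ = _ := by rw [q1]
  have hgu : ‖g u‖ = Real.exp (-1) * (u ^ N * |f u - G * u ^ (z - 1)|) := by
    have e1 : g u = ((Real.exp (-1) * (u ^ N * (f u - G * u ^ (z - 1))) : ℝ) : ℂ) := by
      have e2 : -σ * u = -1 := by rw [hσ]; field_simp
      have e3 : u ^ s = u ^ N * u ^ (z - 1) := by
        rw [← Real.rpow_natCast, ← Real.rpow_add hu0]; congr 1; rw [hs]; ring
      simp only [hg, hg₁, hg₂, e2, max_eq_left hu0.le, e3]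
      push_cast
      ring
    rw [e1, Complex.norm_real, Real.norm_eq_abs, abs_mul, abs_mul, abs_of_pos (Real.exp_pos _),
      abs_of_pos (pow_pos hu0 N)]
  have hpowN : 0 < u ^ (N : ℝ) := Real.rpow_pos_of_pos hu0 _
  have t1 : u ^ (c + N + |z|) * (2 * β) ≤ 2 * (u ^ (N : ℝ) * u ^ (-A)) := by
    rw [hβ, ← Real.rpow_add hu0, mul_left_comm, ← Real.rpow_add hu0]
    have := Real.rpow_le_rpow_of_exponent_le hu1.le
      (show c + N + |z| + -B ≤ N + -A by rw [hB]; linarith)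
    linarith
  have t2 : u ^ (s - 1) = u ^ (N : ℝ) * u ^ (z - 2) := by
    rw [← Real.rpow_add hu0]; congr 1; rw [hs]; ring
  have t3 : u ^ (B * (c' + 1)) ≤ u ^ (N : ℝ) * u ^ (-A) := by
    rw [← Real.rpow_add hu0]
    exact Real.rpow_le_rpow_of_exponent_le hu1.le (by linarith [abs_nonneg z])
  have hE0 : 0 ≤ E * u ^ (z - 2) := by positivity
  have hA1 : 0 < u ^ (-A) := Real.rpow_pos_of_pos hu0 _
  have hM : u ^ (N : ℝ) * (Real.exp (-1) * |f u - G * u ^ (z - 1)|) ≤ u ^ (N : ℝ) *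
      (((K₁ + |G| * K₂) * 2 + (|D| + |D| * |K|)) * (E * u ^ (z - 2) + u ^ (-A))) := by
    rw [Real.rpow_natCast] at *
    calc _ = ‖g u‖ := by rw [hgu]; ring
      _ ≤ _ := main
      _ ≤ (K₁ + |G| * K₂) * (u ^ (c + N + |z|) * (2 * β)) +
          (|D| * (E * u ^ (s - 1)) + |D| * |K| * u ^ (B * (c' + 1))) := by linarith
      _ ≤ (K₁ + |G| * K₂) * (2 * (u ^ N * u ^ (-A))) +
          (|D| * (E * (u ^ N * u ^ (z - 2))) + |D| * |K| * (u ^ N * u ^ (-A))) := by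
          rw [t2]; gcongr
      _ ≤ _ := by
          have p1 : 0 ≤ (K₁ + |G| * K₂) * 2 * (E * u ^ (z - 2)) * u ^ N := by positivity
          have p2 : 0 ≤ |D| * |K| * (E * u ^ (z - 2)) * u ^ N := by positivity
          have p3 : 0 ≤ |D| * u ^ (-A) * u ^ N := by positivity
          linarith
  have hfin := le_of_mul_le_mul_left hM hpowN
  rw [Real.exp_neg, inv_mul_eq_div, div_le_iff₀ (Real.exp_pos 1)] at hfin
  linarith

end

end ArithProg

/-! ### Derivatives of w^(-z) H(w) with a uniform growth exponent -/

namespace ArithProg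

/-- `w / (1 + w)`. -/
noncomputable def moebius (w : ℂ) : ℂ := w / (1 + w)

lemma one_add_ne_zero {w : ℂ} (hw : -1 < w.re) : 1 + w ≠ 0 := by
  intro h
  have := congrArg Complex.re h
  simp at this
  linarith

/-- The reason for using w/(1 + w) in place of w: it has the same simple zero at the origin but is
bounded with all its derivatives on the strip, so multiplying by it does not raise the growth
exponent. -/
lemma polyGrowth_moebius (n : ℕ) : PolyGrowth 0 n moebius := by
  refine PolyGrowth.of_bounded (r := 1 / 4) (C := 3) (by norm_num) le_rfl (fun w hw => ?_)
    (fun w h1 h2 => ?_) n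
  · exact (DifferentiableAt.div differentiableAt_id (differentiableAt_id.const_add 1)
      (one_add_ne_zero (by linarith [hw.1]))).differentiableWithinAt
  · have hne := one_add_ne_zero (w := w) (by linarith)
    have h3 : 3 / 4 ≤ ‖1 + w‖ := le_trans (by simp; linarith) (Complex.re_le_norm _)
    rw [Real.rpow_zero, mul_one, moebius, norm_div, div_le_iff₀ (by linarith)]
    have : ‖w‖ ≤ ‖1 + w‖ + 1 := by
      calc ‖w‖ = ‖(1 + w) - 1‖ := by ring_nf
        _ ≤ _ := (norm_sub_le _ _).trans (by simp)
    linarith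

lemma hasDerivAt_moebius {w : ℂ} (hw : -1 < w.re) :
    HasDerivAt moebius (1 / (1 + w) ^ 2) w := by
  have hne := one_add_ne_zero hw
  refine ((hasDerivAt_id w).div ((hasDerivAt_id w).const_add 1) hne).congr_deriv ?_
  simp

lemma moebius_re_pos {w : ℂ} (hw : 0 < w.re) : 0 < (moebius w).re := by
  have hne := one_add_ne_zero (w := w) (by linarith)
  have e : moebius w = 1 - (1 + w)⁻¹ := by rw [moebius]; field_simp; ring
  rw [e, Complex.sub_re, Complex.one_re, Complex.inv_re, sub_pos, div_lt_one
    (Complex.normSq_pos.2 hne), Complex.normSq_apply]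
  simp
  nlinarith [sq_nonneg w.im]

/-- Both factors lie in the right half-plane, so their arguments add up to less than π in modulus
and the logarithm is additive. -/
lemma cpow_neg_eq_moebius {w : ℂ} (hw : 0 < w.re) (z : ℝ) :
    w ^ ((-z : ℝ) : ℂ) = moebius w ^ ((-z : ℝ) : ℂ) * (1 + w) ^ ((-z : ℝ) : ℂ) := by
  have hne := one_add_ne_zero (w := w) (by linarith)
  have hm := moebius_re_pos hw
  have hm0 : moebius w ≠ 0 := by intro h; rw [h] at hm; simp at hm
  have h1 := abs_lt.1 (Complex.abs_arg_lt_pi_div_two_iff.2 (Or.inl hm))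
  have h2 := abs_lt.1 (Complex.abs_arg_lt_pi_div_two_iff.2
    (Or.inl (show 0 < (1 + w).re by simp; linarith)))
  have e : w = moebius w * (1 + w) := by rw [moebius]; field_simp
  have hlog : Complex.log w = Complex.log (moebius w) + Complex.log (1 + w) := by
    conv_lhs => rw [e]
    exact Complex.log_mul hm0 hne ⟨by linarith, by linarith⟩
  have hw0 : w ≠ 0 := by rintro rfl; simp at hw
  rw [Complex.cpow_def_of_ne_zero hw0, Complex.cpow_def_of_ne_zero hm0,
    Complex.cpow_def_of_ne_zero hne, ← Complex.exp_add, hlog]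
  congr 1; ring

lemma polyGrowth_one_add_cpow (z : ℝ) (n : ℕ) :
    PolyGrowth |z| n (fun w => (1 + w) ^ (z : ℂ)) := by
  refine PolyGrowth.of_bounded (r := 1 / 4) (C := 1 + 2 ^ |z|) (by norm_num) (abs_nonneg z)
    (fun w hw => ?_) (fun w h1 h2 => ?_) n
  · exact ((differentiableAt_id.const_add 1).cpow_const (Or.inl (by
      simp; linarith [hw.1]))).differentiableWithinAt
  · have hne := one_add_ne_zero (w := w) (by linarith)
    have h3 : 1 / 2 ≤ ‖1 + w‖ := le_trans (by simp; linarith) (Complex.re_le_norm _)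
    have h4 : ‖1 + w‖ ≤ |w.im| + 2 := by
      refine (Complex.norm_le_abs_re_add_abs_im _).trans ?_
      simp only [Complex.add_re, Complex.one_re, Complex.add_im, Complex.one_im, zero_add]
      rw [abs_of_nonneg (by linarith : 0 ≤ 1 + w.re)]
      linarith
    rw [norm_cpow_neg_real hne]
    have h5 : 1 ≤ (|w.im| + 2) ^ |z| :=
      Real.one_le_rpow (by linarith [abs_nonneg w.im]) (abs_nonneg z)
    have h6 : (0 : ℝ) < 2 ^ |z| := by positivity
    rcases le_total 0 z with hz | hz
    · rw [abs_of_nonneg hz] at *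
      have := Real.rpow_le_rpow (norm_nonneg _) h4 hz
      nlinarith
    · have h7 : ‖1 + w‖ ^ z ≤ (1 / 2) ^ z :=
        Real.rpow_le_rpow_of_nonpos (by norm_num) h3 hz
      have h8 : (1 / 2 : ℝ) ^ z = 2 ^ |z| := by
        rw [abs_of_nonpos hz, one_div, Real.inv_rpow (by norm_num), Real.rpow_neg (by norm_num)]
      rw [h8] at h7
      nlinarith

/-- The numerators of the derivatives of `w ^ (-z) H(w)`, written with powers of `moebius w`. -/
noncomputable def derivNumerator (z : ℝ) (H : ℂ → ℂ) : ℕ → ℂ → ℂ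
  | 0 => H
  | N + 1 => fun w => moebius w * deriv (derivNumerator z H N) w -
      ((z + N : ℝ) : ℂ) * (deriv moebius w * derivNumerator z H N w)

/-- The exponent c stays the same at every order, which the Tauberian argument requires. -/
lemma PolyGrowth.derivNumerator {c z : ℝ} {H : ℂ → ℂ} (hH : ∀ n, PolyGrowth c n H)
    (N : ℕ) : ∀ n, PolyGrowth c n (derivNumerator z H N) := by
  induction N with
  | zero => exact hH
  | succ N ih =>
    intro n
    have h1 := (polyGrowth_moebius n).mul (PolyGrowth.succ_iff.1 (ih (n + 1))).2
    have h2 := (PolyGrowth.succ_iff.1 (polyGrowth_moebius (n + 1))).2.mul (ih n)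
    have h3 := (PolyGrowth.const (c := 0) (n := n) le_rfl (-((z + N : ℝ) : ℂ))).mul h2
    simp only [zero_add] at h1 h2 h3
    exact (h1.add h3).congr fun w _ => by simp only [ArithProg.derivNumerator]; ring

lemma iteratedDeriv_moebius_cpow_mul {z c : ℝ} {H X : ℂ → ℂ}
    (hH : ∀ n, PolyGrowth c n H)
    (hX : ∀ w ∈ strip, X w = moebius w ^ ((-z : ℝ) : ℂ) * H w) (N : ℕ) :
    ∀ w ∈ strip, iteratedDeriv N X w =
      moebius w ^ ((-(z + N) : ℝ) : ℂ) * derivNumerator z H N w := by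
  induction N with
  | zero => intro w hw; simpa [derivNumerator] using hX w hw
  | succ N ih =>
    intro w hw
    have hev : iteratedDeriv N X =ᶠ[𝓝 w]
        fun w => moebius w ^ ((-(z + N) : ℝ) : ℂ) * derivNumerator z H N w := by
      filter_upwards [isOpen_strip.mem_nhds hw] with v hv
      exact ih v hv
    have hm := moebius_re_pos hw.1
    have hm0 : moebius w ≠ 0 := by intro h; rw [h] at hm; simp at hm
    have hd := hasDerivAt_moebius (w := w) (by linarith [hw.1])
    have h1 := hd.cpow_const (c := ((-(z + N) : ℝ) : ℂ)) (Or.inl hm)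
    have h2 := (((PolyGrowth.derivNumerator (z := z) hH N) 0).diffAt hw).hasDerivAt
    rw [iteratedDeriv_succ, hev.deriv_eq, (h1.fun_mul h2).deriv, derivNumerator]
    dsimp only
    rw [hd.deriv]
    have e1 : moebius w ^ (((-(z + N) : ℝ) : ℂ) - 1) = moebius w ^ ((-(z + (N + 1 : ℕ)) : ℝ) : ℂ) := by
      congr 1; push_cast; ring
    have e2 : moebius w ^ ((-(z + N) : ℝ) : ℂ) =
        moebius w ^ ((-(z + (N + 1 : ℕ)) : ℝ) : ℂ) * moebius w := by
      rw [show ((-(z + N) : ℝ) : ℂ) = ((-(z + (N + 1 : ℕ)) : ℝ) : ℂ) + 1 by push_cast; ring,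
        Complex.cpow_add _ _ hm0, Complex.cpow_one]
    rw [e1, e2]
    push_cast
    ring

/-- At the origin w/(1 + w) tends to 0 with derivative 1, so each step of the recursion only
multiplies the limit by -(z + N). -/
lemma tendsto_derivNumerator {z c : ℝ} {H : ℂ → ℂ} {H₀ : ℂ}
    (hH : ∀ n, PolyGrowth c n H) (hlim : Tendsto (fun σ : ℝ => H σ) (𝓝[>] 0) (𝓝 H₀)) (N : ℕ) :
    Tendsto (fun σ : ℝ => derivNumerator z H N σ) (𝓝[>] 0)
      (𝓝 ((-1) ^ N * (∏ i ∈ Finset.range N, ((z + i : ℝ) : ℂ)) * H₀)) := by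
  induction N with
  | zero => simpa [derivNumerator] using hlim
  | succ N ih =>
    obtain ⟨C, hC⟩ := ((PolyGrowth.derivNumerator (z := z) hH N) 1).2 1 le_rfl
    have hσ : ∀ᶠ σ : ℝ in 𝓝[>] 0, 0 < σ ∧ σ < 1 / 2 := by
      filter_upwards [Ioo_mem_nhdsGT (show (0 : ℝ) < 1 / 2 by norm_num)] with σ h using h
    have h0 : Tendsto (fun σ : ℝ => moebius σ) (𝓝[>] 0) (𝓝 0) := by
      have : ContinuousAt moebius 0 := (hasDerivAt_moebius (by simp)).continuousAt
      have := this.tendsto.comp (tendsto_ofReal_nhdsGT.mono_right nhdsWithin_le_nhds)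
      simpa [moebius, Function.comp_def] using this
    have h1 : Tendsto (fun σ : ℝ => moebius σ * deriv (derivNumerator z H N) σ) (𝓝[>] 0) (𝓝 0) := by
      refine squeeze_zero_norm' (a := fun σ : ℝ => ‖moebius σ‖ * (C * 2 ^ c)) ?_ ?_
      · filter_upwards [hσ] with σ hσ
        rw [norm_mul]
        refine mul_le_mul_of_nonneg_left ?_ (norm_nonneg _)
        have := hC (σ : ℂ) ⟨by simpa using hσ.1, by simpa using hσ.2⟩
        simpa using this
      · simpa using h0.norm.mul_const (C * 2 ^ c)
    have h2 : Tendsto (fun σ : ℝ => deriv moebius (σ : ℂ)) (𝓝[>] 0) (𝓝 1) := by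
      have h3 : ContinuousAt (fun w : ℂ => 1 / (1 + w) ^ 2) 0 := by
        refine continuousAt_const.div (by fun_prop) (by simp)
      have h4 := h3.tendsto.comp (tendsto_ofReal_nhdsGT.mono_right nhdsWithin_le_nhds)
      simp only [add_zero, one_pow, div_one] at h4
      refine h4.congr' ?_
      filter_upwards [hσ] with σ hσ
      exact (hasDerivAt_moebius (by simp; linarith)).deriv.symm
    have h5 := h1.sub ((h2.mul ih).const_mul (((z + N : ℝ) : ℂ)))
    have e : (-1) ^ (N + 1) * (∏ i ∈ Finset.range (N + 1), ((z + i : ℝ) : ℂ)) * H₀ =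
        0 - ((z + N : ℝ) : ℂ) *
          (1 * ((-1) ^ N * (∏ i ∈ Finset.range N, ((z + i : ℝ) : ℂ)) * H₀)) := by
      rw [Finset.prod_range_succ]
      ring
    rw [e]
    exact h5

/-- Mean value inequality between w and a real σ tending to 0, inside the convex part of the strip
of height |Im w|. -/
lemma norm_sub_le_of_polyGrowth {c : ℝ} (hc : 0 ≤ c) {H : ℂ → ℂ} {ℓ : ℂ} (hH : PolyGrowth c 1 H)
    (hlim : Tendsto (fun σ : ℝ => H σ) (𝓝[>] 0) (𝓝 ℓ)) :
    ∃ C, 0 ≤ C ∧ ∀ w ∈ strip, ‖H w - ℓ‖ ≤ C * (|w.im| + 2) ^ c * ‖w‖ := by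
  obtain ⟨C, hC⟩ := hH.2 1 le_rfl
  refine ⟨|C|, abs_nonneg C, fun w hw => ?_⟩
  set S : Set ℂ := {v | 0 < v.re} ∩ {v | v.re < 1 / 2} ∩ (Complex.im ⁻¹' Set.Icc (-|w.im|) |w.im|)
  have hS : Convex ℝ S :=
    ((convex_halfSpace_re_gt 0).inter (convex_halfSpace_re_lt (1 / 2))).inter
      ((convex_Icc (-|w.im|) |w.im|).linear_preimage Complex.imLm)
  have hwS : w ∈ S := ⟨⟨hw.1, hw.2⟩, abs_le.1 le_rfl⟩
  have hb : ∀ σ : ℝ, 0 < σ ∧ σ < 1 / 2 →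
      ‖H w - H σ‖ ≤ |C| * (|w.im| + 2) ^ c * ‖w - σ‖ := by
    intro σ hσ
    have hσS : (σ : ℂ) ∈ S := by
      refine ⟨⟨by simpa using hσ.1, by simpa using hσ.2⟩, ?_⟩
      simp
    refine hS.norm_image_sub_le_of_norm_deriv_le (fun v hv => hH.diffAt ⟨hv.1.1, hv.1.2⟩)
      (fun v hv => ?_) hσS hwS
    have h1 := hC v ⟨hv.1.1, hv.1.2⟩
    rw [iteratedDeriv_one] at h1
    refine h1.trans ?_
    have h2 : |v.im| ≤ |w.im| := abs_le.2 hv.2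
    have h3 := Real.rpow_le_rpow (by positivity) (show |v.im| + 2 ≤ |w.im| + 2 by linarith) hc
    exact mul_le_mul (le_abs_self C) h3 (by positivity) (abs_nonneg C)
  have t1 : Tendsto (fun σ : ℝ => ‖H w - H σ‖) (𝓝[>] 0) (𝓝 ‖H w - ℓ‖) :=
    (hlim.const_sub (H w)).norm
  have t2 : Tendsto (fun σ : ℝ => |C| * (|w.im| + 2) ^ c * ‖w - σ‖) (𝓝[>] 0)
      (𝓝 (|C| * (|w.im| + 2) ^ c * ‖w‖)) := by
    have := ((tendsto_ofReal_nhdsGT.mono_right nhdsWithin_le_nhds).const_sub w).norm.const_mul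
      (|C| * (|w.im| + 2) ^ c)
    simpa using this
  refine le_of_tendsto_of_tendsto t1 t2 ?_
  filter_upwards [Ioo_mem_nhdsGT (show (0 : ℝ) < 1 / 2 by norm_num)] with σ h using hb σ h

/-- The inverse of w/(1 + w) is 1 + 1/w. Comparing the m-th powers of 1 + 1/w and 1/w along θ + 1/w
with 0 ≤ θ ≤ 1 saves one power of 1/‖w‖. -/
lemma norm_moebius_cpow_le {w : ℂ} (hw : 0 < w.re) {m : ℝ} (hm : 1 ≤ m) :
    ‖moebius w ^ ((-m : ℝ) : ℂ)‖ ≤ (1 + ‖w‖⁻¹) ^ m ∧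
      ‖moebius w ^ ((-m : ℝ) : ℂ) - w ^ ((-m : ℝ) : ℂ)‖ ≤ m * (1 + ‖w‖⁻¹) ^ (m - 1) := by
  have hw0 : w ≠ 0 := by rintro rfl; simp at hw
  have hne := one_add_ne_zero (w := w) (by linarith)
  have hmr := moebius_re_pos hw
  have hm0 : moebius w ≠ 0 := by intro h; rw [h] at hmr; simp at hmr
  have hinv : (moebius w)⁻¹ = 1 + w⁻¹ := by rw [moebius]; field_simp; ring
  have hwr : 0 < (w⁻¹).re := by
    rw [Complex.inv_re]; exact div_pos hw (Complex.normSq_pos.2 hw0)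
  have harg : ∀ v : ℂ, 0 < v.re → v ^ ((-m : ℝ) : ℂ) = (v⁻¹) ^ (m : ℂ) := by
    intro v hv
    rw [Complex.inv_cpow _ _ (Complex.slitPlane_arg_ne_pi (Or.inl hv)), Complex.ofReal_neg,
      Complex.cpow_neg]
  rw [harg _ hmr, harg _ hw, hinv]
  have hn : ∀ θ ∈ Set.Icc (0 : ℝ) 1, (θ : ℂ) + w⁻¹ ≠ 0 ∧ 0 < ((θ : ℂ) + w⁻¹).re ∧
      ‖(θ : ℂ) + w⁻¹‖ ≤ 1 + ‖w‖⁻¹ := by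
    intro θ hθ
    have hre : 0 < ((θ : ℂ) + w⁻¹).re := by
      rw [Complex.add_re, Complex.ofReal_re]; linarith [hθ.1]
    refine ⟨fun h => by rw [h] at hre; simp at hre, hre, (norm_add_le _ _).trans ?_⟩
    rw [Complex.norm_real, Real.norm_of_nonneg hθ.1, norm_inv]
    linarith [hθ.2]
  constructor
  · obtain ⟨a1, -, a3⟩ := hn 1 ⟨zero_le_one, le_rfl⟩
    rw [Complex.ofReal_one] at a1 a3
    rw [norm_cpow_neg_real a1]
    exact Real.rpow_le_rpow (norm_nonneg _) a3 (by linarith)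
  · have hd : ∀ θ ∈ Set.Icc (0 : ℝ) 1, HasDerivWithinAt (fun θ : ℝ => ((θ : ℂ) + w⁻¹) ^ (m : ℂ))
        ((m : ℂ) * ((θ : ℂ) + w⁻¹) ^ ((m : ℂ) - 1) * 1) (Set.Icc 0 1) θ := by
      intro θ hθ
      have h1 : HasDerivAt (fun v : ℂ => (v + w⁻¹) ^ (m : ℂ))
          ((m : ℂ) * ((θ : ℂ) + w⁻¹) ^ ((m : ℂ) - 1) * 1) (θ : ℂ) :=
        ((hasDerivAt_id (θ : ℂ)).add_const w⁻¹).cpow_const (Or.inl (hn θ hθ).2.1)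
      exact h1.comp_ofReal.hasDerivWithinAt
    have hb : ∀ θ ∈ Set.Icc (0 : ℝ) 1, ‖(m : ℂ) * ((θ : ℂ) + w⁻¹) ^ ((m : ℂ) - 1) * 1‖ ≤
        m * (1 + ‖w‖⁻¹) ^ (m - 1) := by
      intro θ hθ
      obtain ⟨a1, -, a3⟩ := hn θ hθ
      rw [mul_one, norm_mul, Complex.norm_real, Real.norm_of_nonneg (by linarith),
        show (m : ℂ) - 1 = ((m - 1 : ℝ) : ℂ) by push_cast; rfl, norm_cpow_neg_real a1]
      have := Real.rpow_le_rpow (norm_nonneg _) a3 (show 0 ≤ m - 1 by linarith)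
      gcongr
    have := (convex_Icc (0 : ℝ) 1).norm_image_sub_le_of_norm_hasDerivWithin_le hd hb
      (Set.left_mem_Icc.2 zero_le_one) (Set.right_mem_Icc.2 zero_le_one)
    simpa using this

/-- The derivatives of `w ^ (-z) H(w)`. -/
theorem TameGrowth.exists_iteratedDeriv_sub_le {z : ℝ} {H X : ℂ → ℂ} {H₀ : ℂ} (hH : TameGrowth H)
    (hlim : Tendsto (fun σ : ℝ => H σ) (𝓝[>] 0) (𝓝 H₀))
    (hX : ∀ w ∈ strip, X w = w ^ ((-z : ℝ) : ℂ) * H w) :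
    ∃ c' : ℝ, 0 ≤ c' ∧ ∀ N : ℕ, 1 < z + N - 1 → ∃ D, ∀ w ∈ strip,
      ‖(-1) ^ N * iteratedDeriv N X w -
        ((∏ i ∈ Finset.range N, ((z + i : ℝ) : ℂ)) * H₀) * w ^ ((-(z + N) : ℝ) : ℂ)‖ ≤
      D * (‖w‖ ^ (-(z + N - 1)) + (|w.im| + 2) ^ c') := by
  obtain ⟨c₀, hc₀⟩ := hH
  set c := |c₀| + |z| with hcdef
  have hc : 0 ≤ c := by positivity
  -- The factor (1 + w)^(-z) that turns w into w/(1 + w) grows polynomially and tends to 1 at the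
  -- origin, so it can be absorbed.
  set H₁ : ℂ → ℂ := fun w => (1 + w) ^ ((-z : ℝ) : ℂ) * H w with hH₁
  have hH₁g : ∀ n, PolyGrowth c n H₁ := fun n =>
    ((polyGrowth_one_add_cpow (-z) n).mul ((hc₀ n).mono (le_abs_self c₀) le_rfl)).mono
      (by rw [abs_neg, hcdef, add_comm]) le_rfl
  have hX₁ : ∀ w ∈ strip, X w = moebius w ^ ((-z : ℝ) : ℂ) * H₁ w := fun w hw => by
    rw [hX w hw, cpow_neg_eq_moebius hw.1, hH₁, mul_assoc]
  have hlim₁ : Tendsto (fun σ : ℝ => H₁ σ) (𝓝[>] 0) (𝓝 H₀) := by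
    have h1 : ContinuousAt (fun w : ℂ => (1 + w) ^ ((-z : ℝ) : ℂ)) 0 :=
      ((differentiableAt_id.const_add 1).cpow_const (Or.inl (by simp))).continuousAt
    have h2 := (h1.tendsto.comp (tendsto_ofReal_nhdsGT.mono_right nhdsWithin_le_nhds)).mul hlim
    simpa [hH₁, Function.comp_def] using h2
  refine ⟨c + 1, by linarith, fun N hN => ?_⟩
  set m := z + N with hm
  set ℓ : ℂ := (-1) ^ N * (∏ i ∈ Finset.range N, ((z + i : ℝ) : ℂ)) * H₀ with hℓ
  obtain ⟨C, hC0, hC⟩ := norm_sub_le_of_polyGrowth hc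
    (PolyGrowth.derivNumerator (z := z) hH₁g N 1) (tendsto_derivNumerator (z := z) hH₁g hlim₁ N)
  have hq0 : 0 ≤ m - 1 := by linarith
  refine ⟨(C + ‖ℓ‖ * m) * (2 ^ (m - 1) * 3 ^ (c + 1)), fun w hw => ?_⟩
  have hw0 : w ≠ 0 := by rintro rfl; simpa using hw.1
  have hwn : 0 < ‖w‖ := norm_pos_iff.2 hw0
  obtain ⟨b1, b2⟩ := norm_moebius_cpow_le hw.1 (show 1 ≤ m by linarith)
  rw [iteratedDeriv_moebius_cpow_mul hH₁g hX₁ N w hw]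
  set Y := derivNumerator z H₁ N w
  -- Two sources of error: the numerator differs from its limit by O(‖w‖ T^c), and the power of w/(1
  -- + w) differs from that of w. Each is smaller by a factor ‖w‖ near the origin.
  have e1 : (-1) ^ N * (moebius w ^ ((-m : ℝ) : ℂ) * Y) -
      ((∏ i ∈ Finset.range N, ((z + i : ℝ) : ℂ)) * H₀) * w ^ ((-m : ℝ) : ℂ) =
      (-1) ^ N * (moebius w ^ ((-m : ℝ) : ℂ) * (Y - ℓ) +
        ℓ * (moebius w ^ ((-m : ℝ) : ℂ) - w ^ ((-m : ℝ) : ℂ))) := by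
    have e2 : (-1 : ℂ) ^ N * (-1) ^ N = 1 := by rw [← mul_pow]; simp
    rw [hℓ]
    linear_combination ((∏ i ∈ Finset.range N, ((z + i : ℝ) : ℂ)) * H₀ *
      w ^ ((-m : ℝ) : ℂ)) * e2
  rw [e1, norm_mul]
  have e3 : ‖(-1 : ℂ) ^ N‖ = 1 := by simp
  rw [e3, one_mul]
  set T := |w.im| + 2 with hT
  have hT2 : 2 ≤ T := by linarith [abs_nonneg w.im]
  set q := (1 + ‖w‖⁻¹) ^ (m - 1) with hq
  have hq1 : 0 ≤ q := by positivity
  have hx : 0 < ‖w‖⁻¹ := inv_pos.2 hwn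
  have hstep : ‖moebius w ^ ((-m : ℝ) : ℂ) * (Y - ℓ) +
        ℓ * (moebius w ^ ((-m : ℝ) : ℂ) - w ^ ((-m : ℝ) : ℂ))‖ ≤
      (C + ‖ℓ‖ * m) * (q * T ^ (c + 1)) := by
    refine (norm_add_le _ _).trans ?_
    rw [norm_mul, norm_mul]
    have d1 : (1 + ‖w‖⁻¹) ^ m = q * (1 + ‖w‖⁻¹) := by
      rw [hq]
      conv_rhs => rw [← Real.rpow_one (1 + ‖w‖⁻¹), ← Real.rpow_mul (by positivity),
        ← Real.rpow_add (by positivity)]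
      congr 1; ring
    have d2 : ‖w‖ + 1 ≤ T := by
      have := Complex.norm_le_abs_re_add_abs_im w
      rw [abs_of_pos hw.1] at this
      have := hw.2
      linarith
    have d3 : T ^ (c + 1) = T ^ c * T := by rw [Real.rpow_add (by linarith), Real.rpow_one]
    have d4 : 1 ≤ T ^ (c + 1) := Real.one_le_rpow (by linarith) (by linarith)
    calc _ ≤ (q * (1 + ‖w‖⁻¹)) * (C * T ^ c * ‖w‖) + ‖ℓ‖ * (m * q) := by
          rw [← d1]
          gcongr
          exact hC w hw
      _ = C * q * T ^ c * (‖w‖ + 1) + ‖ℓ‖ * m * q := by field_simp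
      _ ≤ C * q * T ^ c * T + ‖ℓ‖ * m * (q * T ^ (c + 1)) := by
          have : 0 ≤ ‖ℓ‖ * m := mul_nonneg (norm_nonneg ℓ) (by linarith)
          gcongr
          exact le_mul_of_one_le_right hq1 d4
      _ = _ := by rw [d3]; ring
  refine hstep.trans ?_
  rw [mul_assoc]
  have hcoef : 0 ≤ C + ‖ℓ‖ * m := by
    have : 0 ≤ m := by linarith
    have := mul_nonneg (norm_nonneg ℓ) this
    linarith
  refine mul_le_mul_of_nonneg_left ?_ hcoef
  have hpow : ‖w‖ ^ (-(m - 1)) = ‖w‖⁻¹ ^ (m - 1) := by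
    rw [Real.rpow_neg hwn.le, Real.inv_rpow hwn.le]
  rw [hpow]
  have h2q : (0 : ℝ) < 2 ^ (m - 1) := by positivity
  have hTp : 0 < T ^ (c + 1) := by positivity
  have h3c : (1 : ℝ) ≤ 3 ^ (c + 1) := Real.one_le_rpow (by norm_num) (by linarith)
  have hxp : 0 ≤ ‖w‖⁻¹ ^ (m - 1) := by positivity
  -- For ‖w‖ ≥ 1 the polynomial term dominates; for ‖w‖ ≤ 1 the ordinate is bounded and the power of
  -- ‖w‖ dominates. Hence a sum, not a product, of the two.
  rcases le_total ‖w‖⁻¹ 1 with h | h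
  · have k1 : q ≤ 2 ^ (m - 1) := Real.rpow_le_rpow (by positivity) (by linarith) hq0
    calc q * T ^ (c + 1) ≤ 2 ^ (m - 1) * T ^ (c + 1) := by gcongr
      _ ≤ 2 ^ (m - 1) * 3 ^ (c + 1) * T ^ (c + 1) :=
          mul_le_mul_of_nonneg_right (le_mul_of_one_le_right h2q.le h3c) hTp.le
      _ ≤ _ := by
          refine mul_le_mul_of_nonneg_left ?_ (by positivity)
          linarith
  · have k1 : q ≤ 2 ^ (m - 1) * ‖w‖⁻¹ ^ (m - 1) := by
      rw [← Real.mul_rpow (by norm_num) hx.le]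
      exact Real.rpow_le_rpow (by positivity) (by linarith) hq0
    have k2 : T ≤ 3 := by
      have : ‖w‖ ≤ 1 := by
        have := inv_le_one_of_one_le₀ h
        rwa [inv_inv] at this
      linarith [Complex.abs_im_le_norm w]
    have k3 : T ^ (c + 1) ≤ 3 ^ (c + 1) := Real.rpow_le_rpow (by linarith) k2 (by linarith)
    calc q * T ^ (c + 1) ≤ (2 ^ (m - 1) * ‖w‖⁻¹ ^ (m - 1)) * 3 ^ (c + 1) := by gcongr
      _ = 2 ^ (m - 1) * 3 ^ (c + 1) * ‖w‖⁻¹ ^ (m - 1) := by ring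
      _ ≤ _ := by
          refine mul_le_mul_of_nonneg_left ?_ (by positivity)
          linarith

end ArithProg

/-! ### Asymptotics of the twisted average of the kernel -/

namespace ArithProg

section

open MeasureTheory


variable {h : ArithmeticFunction ℝ} {a : ℤ} {k : ℝ}

/-- `∑_d b(d) K(R/d)`, with `b = twist h a` and `K = stepKernel`. -/
noncomputable def twistAvg (h : ArithmeticFunction ℝ) (a : ℤ) (R : ℝ) : ℝ :=
  ∑' d : ℕ, twist h a d * stepKernel (R / d)

lemma exp_div_rpow {d : ℕ} (hd : 0 < d) (y σ : ℝ) :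
    (Real.exp y / d) ^ σ = Real.exp (σ * y) * (d : ℝ) ^ (-σ) := by
  rw [Real.div_rpow (Real.exp_pos y).le (by positivity), ← Real.exp_mul, Real.rpow_neg (by positivity),
    div_eq_mul_inv, mul_comm y]

lemma exists_abs_twist_mul_stepKernel_le (h : ArithmeticFunction ℝ) (a : ℤ) :
    ∃ C, 0 < C ∧ ∀ σ : ℝ, 0 ≤ σ → σ ≤ 3 / 4 →
    (∀ y (d : ℕ), |twist h a d * stepKernel (Real.exp y / d)| ≤
      C * Real.exp (σ * y) * (|twist h a d| * (d : ℝ) ^ (-σ))) ∧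
    ∀ y₁ y₂ (d : ℕ), y₁ ≤ y₂ → |twist h a d * stepKernel (Real.exp y₂ / d) -
      twist h a d * stepKernel (Real.exp y₁ / d)| ≤
      C * Real.exp (σ * y₂) * (y₂ - y₁) * (|twist h a d| * (d : ℝ) ^ (-σ)) := by
  obtain ⟨C₁, hC₁, H₁⟩ := exists_abs_stepKernel_le
  obtain ⟨C₂, hC₂, H₂⟩ := exists_abs_stepKernel_exp_sub_le
  refine ⟨C₁ + C₂, by positivity, fun σ h0 h1 => ⟨fun y d => ?_, fun y₁ y₂ d hy => ?_⟩⟩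
  · rcases Nat.eq_zero_or_pos d with rfl | hd
    · simp
    have hd' : (0 : ℝ) < d := by exact_mod_cast hd
    have := (H₁ (Real.exp y / d) (by positivity) σ h0 h1).1
    rw [exp_div_rpow hd] at this
    rw [abs_mul]
    calc _ ≤ |twist h a d| * (C₁ * (Real.exp (σ * y) * (d : ℝ) ^ (-σ))) := by gcongr
      _ = C₁ * Real.exp (σ * y) * (|twist h a d| * (d : ℝ) ^ (-σ)) := by ring
      _ ≤ _ := by gcongr; linarith
  · rcases Nat.eq_zero_or_pos d with rfl | hd
    · simp
    have hd' : (0 : ℝ) < d := by exact_mod_cast hd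
    have hy' : 0 ≤ y₂ - y₁ := by linarith
    have e : ∀ y, Real.exp y / d = Real.exp (y - Real.log d) := fun y => by
      rw [Real.exp_sub, Real.exp_log hd']
    have := H₂ (y₁ - Real.log d) (y₂ - Real.log d) (by linarith) σ h0 h1
    rw [← e, ← e, show σ * (y₂ - Real.log d) = (y₂ - Real.log d) * σ by ring, Real.exp_mul, ← e,
      exp_div_rpow hd, show y₂ - Real.log d - (y₁ - Real.log d) = y₂ - y₁ by ring] at this
    rw [← mul_sub, abs_mul]
    calc _ ≤ |twist h a d| * (C₂ * (Real.exp (σ * y₂) * (d : ℝ) ^ (-σ)) * (y₂ - y₁)) := by gcongr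
      _ = C₂ * Real.exp (σ * y₂) * (y₂ - y₁) * (|twist h a d| * (d : ℝ) ^ (-σ)) := by ring
      _ ≤ _ := by gcongr; linarith

lemma PrimeHyp.summable_twistAvg (hyp : PrimeHyp h k) (hmult : h.IsMultiplicative)
    (hnonneg : ∀ d, 0 ≤ h d) (ha : a ≠ 0) {R : ℝ} (hR : 0 < R) :
    Summable fun d : ℕ => twist h a d * stepKernel (R / d) := by
  obtain ⟨C, hC, H⟩ := exists_abs_twist_mul_stepKernel_le h a
  have hs := hyp.summable_abs_twist hmult hnonneg ha (show (0 : ℝ) < 1 / 2 by norm_num)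
  refine Summable.of_norm_bounded (hs.mul_left (C * Real.exp (1 / 2 * Real.log R))) fun d => ?_
  have := (H (1 / 2) (by norm_num) (by norm_num)).1 (Real.log R) d
  rwa [Real.exp_log hR] at this

/-- Using the kernel bound u^σ at u = e^y/d leaves ∑ |b(d)| d^(-σ), which is O(σ^(-c)); the
Lipschitz bound is obtained in the same way. -/
lemma PrimeHyp.subexpGrowth_twistAvg (hyp : PrimeHyp h k) (hmult : h.IsMultiplicative)
    (hnonneg : ∀ d, 0 ≤ h d) (ha : a ≠ 0) :
    ∃ c, 0 ≤ c ∧ SubexpGrowth c (fun y => twistAvg h a (Real.exp y)) := by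
  obtain ⟨B, c, hB, hc, HB⟩ := hyp.exists_tsum_abs_twist_le hmult hnonneg ha
  obtain ⟨C, hC, H⟩ := exists_abs_twist_mul_stepKernel_le h a
  refine ⟨c, hc, C * B, 1 / 2, by positivity, by norm_num, by norm_num, fun σ h0 h1 => ?_⟩
  obtain ⟨hs, hle⟩ := HB σ h0 (by linarith)
  obtain ⟨H1, H2⟩ := H σ h0.le (by linarith)
  refine ⟨fun y => ?_, fun y₁ y₂ hy => ?_⟩
  · refine (tsum_of_norm_bounded (f := fun d : ℕ => twist h a d * stepKernel (Real.exp y / d))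
      (hs.mul_left (C * Real.exp (σ * y))).hasSum
      fun d => H1 y d).trans ?_
    rw [tsum_mul_left]
    calc _ ≤ C * Real.exp (σ * y) * (B * σ ^ (-c)) := by gcongr
      _ = _ := by ring
  · have hy' : 0 ≤ y₂ - y₁ := by linarith
    simp only [twistAvg]
    rw [← (hyp.summable_twistAvg hmult hnonneg ha (Real.exp_pos y₂)).tsum_sub
      (hyp.summable_twistAvg hmult hnonneg ha (Real.exp_pos y₁))]
    refine (tsum_of_norm_bounded (f := fun d : ℕ => twist h a d * stepKernel (Real.exp y₂ / d) -
      twist h a d * stepKernel (Real.exp y₁ / d))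
      (hs.mul_left (C * Real.exp (σ * y₂) * (y₂ - y₁))).hasSum
      fun d => H2 y₁ y₂ d hy).trans ?_
    rw [tsum_mul_left]
    calc _ ≤ C * Real.exp (σ * y₂) * (y₂ - y₁) * (B * σ ^ (-c)) := by gcongr
      _ = _ := by ring

/-- A dilation by d multiplies the Mellin transform by d^(-w). Termwise integration is justified by
absolute convergence of ∑ b(d) d^(-w) for Re w > 0. -/
lemma PrimeHyp.logMellin_twistAvg (hyp : PrimeHyp h k) (hmult : h.IsMultiplicative)
    (hnonneg : ∀ d, 0 ≤ h d) (ha : a ≠ 0) {w : ℂ} (hw : w ∈ strip) :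
    logMellin (fun y => twistAvg h a (Real.exp y)) w =
      twistSeries h a w * (1 / (2 * w) + kernelMellinRest w) := by
  obtain ⟨hc, hm⟩ := mellin_mellinKernel hw.1 (by linarith [hw.2])
  set F : ℕ → ℝ → ℂ := fun d t =>
    (t : ℂ) ^ (w - 1) • ((twist h a d : ℂ) * mellinKernel (d * t)) with hF
  have hint : ∀ d, Integrable (F d) (volume.restrict (Set.Ioi 0)) := by
    intro d
    rcases Nat.eq_zero_or_pos d with rfl | hd
    · simp [hF]
    · exact ((MellinConvergent.comp_mul_left (f := mellinKernel)
        (show (0 : ℝ) < d by exact_mod_cast hd)).2 hc).const_smul (twist h a d : ℂ)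
  set Z := ∫ t in Set.Ioi (0 : ℝ), ‖(t : ℂ) ^ (w - 1) • mellinKernel t‖ with hZ
  have hnorm : ∀ d : ℕ, ∫ t in Set.Ioi (0 : ℝ), ‖F d t‖ =
      Z * (|twist h a d| * (d : ℝ) ^ (-w.re)) := by
    intro d
    rcases Nat.eq_zero_or_pos d with rfl | hd
    · simp [hF]
    have hd' : (0 : ℝ) < d := by exact_mod_cast hd
    have e1 : ∀ t ∈ Set.Ioi (0 : ℝ), ‖F d t‖ = |twist h a d| * (d : ℝ) ^ (1 - w.re) *
        ‖((d * t : ℝ) : ℂ) ^ (w - 1) • mellinKernel (d * t)‖ := by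
      intro t ht
      have ht : 0 < t := ht
      simp only [hF, norm_smul, norm_mul, Complex.norm_real, Real.norm_eq_abs]
      rw [Complex.norm_cpow_eq_rpow_re_of_pos ht, Complex.norm_cpow_eq_rpow_re_of_pos (by positivity),
        Real.mul_rpow hd'.le ht.le, Complex.sub_re, Complex.one_re,
        show 1 - w.re = -(w.re - 1) by ring, Real.rpow_neg hd'.le]
      have := (Real.rpow_pos_of_pos hd' (w.re - 1)).ne'
      field_simp
    rw [setIntegral_congr_fun measurableSet_Ioi e1, integral_const_mul,
      integral_comp_mul_left_Ioi (fun t : ℝ => ‖(t : ℂ) ^ (w - 1) • mellinKernel t‖) 0 hd', mul_zero,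
      ← hZ, smul_eq_mul, show 1 - w.re = 1 + -w.re by ring, Real.rpow_add hd', Real.rpow_one]
    field_simp
  have hsum : Summable fun d => ∫ t in Set.Ioi (0 : ℝ), ‖F d t‖ := by
    simp only [hnorm]
    exact (hyp.summable_abs_twist hmult hnonneg ha hw.1).mul_left Z
  have key := hasSum_integral_of_summable_integral_norm hint hsum
  have hterm : ∀ d, ∫ t in Set.Ioi (0 : ℝ), F d t =
      LSeries.term (fun d => (twist h a d : ℂ)) w d * (1 / (2 * w) + kernelMellinRest w) := by
    intro d
    rcases Nat.eq_zero_or_pos d with rfl | hd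
    · simp [hF]
    have hd' : (0 : ℝ) < d := by exact_mod_cast hd
    have e1 : ∀ t ∈ Set.Ioi (0 : ℝ), F d t = (twist h a d : ℂ) *
        ((t : ℂ) ^ (w - 1) • mellinKernel (d * t)) := by
      intro t _; simp only [hF, smul_eq_mul]; ring
    have e2 := mellin_comp_mul_left mellinKernel w hd'
    rw [hm] at e2
    rw [setIntegral_congr_fun measurableSet_Ioi e1, integral_const_mul, ← mellin, e2,
      LSeries.term_of_ne_zero hd.ne', smul_eq_mul, Complex.cpow_neg]
    push_cast
    field_simp
  have e3 : logMellin (fun y => twistAvg h a (Real.exp y)) w =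
      ∫ t in Set.Ioi (0 : ℝ), ∑' d, F d t := by
    rw [logMellin, mellin]
    refine setIntegral_congr_fun measurableSet_Ioi fun t ht => ?_
    have ht : 0 < t := ht
    simp only [hF, twistAvg, smul_eq_mul]
    rw [tsum_mul_left, Complex.ofReal_tsum]
    congr 2
    funext d
    rw [Real.exp_neg, Real.exp_log ht, mellinKernel, mul_inv, div_eq_inv_mul]
    push_cast
    rfl
  rw [e3, ← key.tsum_eq]
  simp only [hterm]
  rw [tsum_mul_right]
  rfl

/-- The asymptotic behaviour of the average of `stepKernel`: the generic case, and the case where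
`1 / Γ(2 - k - ω)` vanishes. -/
theorem PrimeHyp.twistAvg_asymp (hyp : PrimeHyp h k) (hmult : h.IsMultiplicative)
    (hnonneg : ∀ d, 0 ≤ h d) (ha : a ≠ 0) :
    ∃ Q : ℝ, Q ≠ 0 ∧ Tendsto (fun N => regularProd h k a N) atTop (𝓝 Q) ∧
      ((Real.Gamma (2 - k - omegaH h a) ≠ 0 → ∃ C u₀ : ℝ, ∀ u, u₀ ≤ u →
        |twistAvg h a (Real.exp u) - degenerateProd h k a * Q / 2 / Real.Gamma (2 - k - omegaH h a) *
          u ^ (1 - k - omegaH h a)| ≤ C * u ^ (-k - omegaH h a)) ∧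
      (Real.Gamma (2 - k - omegaH h a) = 0 → ∀ A : ℝ, ∃ C u₀ : ℝ, ∀ u, u₀ ≤ u →
        |twistAvg h a (Real.exp u)| ≤ C * u ^ (-A))) := by
  obtain ⟨Q, hQ0, hQ, hlim⟩ := hyp.exists_regularProd_limit hmult hnonneg ha
  refine ⟨Q, hQ0, hQ, ?_⟩
  obtain ⟨c, hc, hf⟩ := hyp.subexpGrowth_twistAvg hmult hnonneg ha
  set z : ℝ := 2 - k - omegaH h a with hz
  set H : ℂ → ℂ := fun w => regularized h a k w * kernelFactor w with hH
  set H₀ : ℝ := degenerateProd h k a * Q / 2 with hH₀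
  have hHt : TameGrowth H := (hyp.tameGrowth_regularized hmult hnonneg ha).mul tameGrowth_kernelFactor
  have hHl : Tendsto (fun σ : ℝ => H σ) (𝓝[>] 0) (𝓝 (H₀ : ℂ)) := by
    have e : (H₀ : ℂ) = ((degenerateProd h k a * Q : ℝ) : ℂ) * (1 / 2) := by
      rw [hH₀]; push_cast; ring
    rw [e]
    exact hlim.mul tendsto_kernelFactor
  have hX : ∀ w ∈ strip, logMellin (fun y => twistAvg h a (Real.exp y)) w =
      w ^ ((-z : ℝ) : ℂ) * H w := by
    intro w hw
    have hw0 : w ≠ 0 := by rintro rfl; simpa using hw.1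
    rw [hyp.logMellin_twistAvg hmult hnonneg ha hw]
    simp only [hH, regularized, kernelFactor]
    have e : w ^ ((-z : ℝ) : ℂ) * w ^ ((1 - k - omegaH h a : ℝ) : ℂ) = w⁻¹ := by
      rw [← Complex.cpow_add _ _ hw0, ← Complex.cpow_neg_one]
      congr 1
      rw [hz]; push_cast; ring
    calc twistSeries h a w * (1 / (2 * w) + kernelMellinRest w) =
          w⁻¹ * twistSeries h a w * (1 / 2 + w * kernelMellinRest w) := by field_simp
      _ = _ := by rw [← e]; ring
  constructor
  · intro hG
    obtain ⟨c', hc', hD⟩ := hHt.exists_iteratedDeriv_sub_le hHl hX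
    -- `Real.Gamma` vanishes exactly at the nonpositive integers, by its default value at the poles.
    have hpole : ∀ m : ℕ, z ≠ -m := fun m hm => hG (by rw [hm]; exact Real.Gamma_neg_nat_eq_zero m)
    have hprod : ∀ N : ℕ, (∏ i ∈ Finset.range N, ((z + i : ℝ) : ℂ)) * (H₀ : ℂ) =
        ((H₀ / Real.Gamma z * Real.Gamma (z + N) : ℝ) : ℂ) := by
      intro N
      have : Real.Gamma (z + N) = (∏ i ∈ Finset.range N, (z + i)) * Real.Gamma z := by
        induction N with
        | zero => simp
        | succ N ih =>
          have hne : z + N ≠ 0 := fun h0 => hpole N (by linarith)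
          rw [Nat.cast_succ, ← add_assoc, Real.Gamma_add_one hne, ih, Finset.prod_range_succ]
          ring
      rw [this]
      have hG' : (Real.Gamma z : ℂ) ≠ 0 := by exact_mod_cast hG
      push_cast
      field_simp
    -- Choosing A = 2 - z makes both error terms equal to u^(z-2).
    obtain ⟨C, u₀, hC⟩ := hf.abs_sub_le_of_logMellin hc (G := H₀ / Real.Gamma z) (z := z) (E := 1)
      (r₀ := 1 / 2) zero_le_one hc' (by norm_num) (fun N hN => by
        obtain ⟨D, hD⟩ := hD N hN
        refine ⟨D, fun w h0 h1 => ?_⟩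
        have := hD w ⟨h0, h1⟩
        rwa [hprod, ← one_mul (‖w‖ ^ _)] at this) (2 - z)
    refine ⟨2 * C, u₀, fun u hu => ?_⟩
    have := hC u hu
    rw [show -(2 - z) = z - 2 by ring] at this
    rw [show 1 - k - (omegaH h a : ℝ) = z - 1 by rw [hz]; ring,
      show -k - (omegaH h a : ℝ) = z - 2 by rw [hz]; ring]
    linarith
  · intro hG A
    obtain ⟨m, hm⟩ : ∃ m : ℕ, z = -m := by
      by_contra hcon
      push Not at hcon
      exact Real.Gamma_ne_zero hcon hG
    -- For z = -m the transform is w^m H(w), without singularity. The Tauberian theorem then applies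
    -- with G = 0 and E = 0, so every power of u is saved.
    have hXt : TameGrowth (logMellin fun y => twistAvg h a (Real.exp y)) := by
      have h1 : ∀ n : ℕ, TameGrowth fun w => w ^ n := by
        intro n
        induction n with
        | zero => simpa using (SlowGrowth.const 1).tame
        | succ n ih => simpa only [pow_succ] using ih.mul ⟨1, polyGrowth_id⟩
      refine ((h1 m).mul hHt).congr fun w hw => ?_
      rw [hX w hw, hm]
      congr 1
      simp
    obtain ⟨c₀, hc₀⟩ := hXt
    obtain ⟨C, u₀, hC⟩ := hf.abs_sub_le_of_logMellin hc (G := 0) (z := z) (E := 0)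
      (r₀ := 1 / 2) (c' := |c₀|) le_rfl (abs_nonneg _) (by norm_num) (fun N _ => by
        obtain ⟨D, hD⟩ := ((hc₀ N).mono (le_abs_self c₀) le_rfl).2 N le_rfl
        refine ⟨D, fun w h0 h1 => ?_⟩
        have := hD w ⟨h0, h1⟩
        simpa using this) A
    exact ⟨C, u₀, fun u hu => by simpa using hC u hu⟩

end

end ArithProg

/-! ### Summatory functions of the density -/

namespace ArithProg

variable {h : ArithmeticFunction ℝ} {a : ℤ} {k : ℝ}

lemma sum_Icc_sum_divisors_mul (b F : ℕ → ℝ) (n : ℕ) :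
    ∑ r ∈ Finset.Icc 1 n, (∑ d ∈ r.divisors, b d) * F r =
      ∑ d ∈ Finset.Icc 1 n, b d * ∑ m ∈ Finset.Icc 1 (n / d), F (d * m) := by
  simp_rw [Finset.sum_mul, Finset.mul_sum]
  rw [Finset.sum_sigma', Finset.sum_sigma']
  refine Finset.sum_bij' (fun x _ => ⟨x.2, x.1 / x.2⟩) (fun y _ => ⟨y.1 * y.2, y.1⟩) ?_ ?_ ?_ ?_ ?_
  · rintro ⟨r, d⟩ hx
    simp only [Finset.mem_sigma, Finset.mem_Icc, Nat.mem_divisors] at hx ⊢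
    have hd : 0 < d := Nat.pos_of_dvd_of_pos hx.2.1 hx.1.1
    have hdr := Nat.le_of_dvd hx.1.1 hx.2.1
    exact ⟨⟨hd, by omega⟩, Nat.div_pos hdr hd, Nat.div_le_div_right hx.1.2⟩
  · rintro ⟨d, m⟩ hx
    simp only [Finset.mem_sigma, Finset.mem_Icc, Nat.mem_divisors] at hx ⊢
    have hd := hx.1.1
    have hm := hx.2.1
    have := Nat.mul_pos hd hm
    refine ⟨⟨this, ?_⟩, dvd_mul_right _ _, this.ne'⟩
    rw [mul_comm]
    exact (Nat.le_div_iff_mul_le hd).1 hx.2.2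
  · rintro ⟨r, d⟩ hx
    simp only [Finset.mem_sigma, Nat.mem_divisors] at hx
    simp [Nat.mul_div_cancel' hx.2.1]
  · rintro ⟨d, m⟩ hx
    simp only [Finset.mem_sigma, Finset.mem_Icc] at hx
    simp [Nat.mul_div_cancel_left _ hx.1.1]
  · rintro ⟨r, d⟩ hx
    simp only [Finset.mem_sigma, Nat.mem_divisors] at hx
    simp [Nat.mul_div_cancel' hx.2.1]

/-- `∑_{q ≤ y} g_a(q)`. -/
noncomputable def densSum (h : ArithmeticFunction ℝ) (a : ℤ) (y : ℝ) : ℝ :=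
  ∑ q ∈ Finset.Icc 1 ⌊y⌋₊, gDens h a q

/-- `∑_{r ≤ R} g_a(r) (1 - r/R)`. -/
noncomputable def densCesaro (h : ArithmeticFunction ℝ) (a : ℤ) (R : ℝ) : ℝ :=
  ∑ r ∈ Finset.Icc 1 ⌊R⌋₊, gDens h a r * (1 - r / R)

/-- `∑_d b(d)/d`. -/
noncomputable def densMean (h : ArithmeticFunction ℝ) (a : ℤ) : ℝ := ∑' d : ℕ, twist h a d / d

/-- `∑_d (b(d)/d) (γ - log d)`. -/
noncomputable def densConst (h : ArithmeticFunction ℝ) (a : ℤ) : ℝ :=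
  ∑' d : ℕ, twist h a d / d * (Real.eulerMascheroniConstant - Real.log d)

lemma hasSum_densSum (hmult : h.IsMultiplicative) {y : ℝ} :
    HasSum (fun d : ℕ => twist h a d / d * harm ⌊y / d⌋₊) (densSum h a y) := by
  have e : densSum h a y = ∑ d ∈ Finset.Icc 1 ⌊y⌋₊, twist h a d / d * harm ⌊y / d⌋₊ := by
    have := sum_Icc_sum_divisors_mul (twist h a) (fun r => 1 / (r : ℝ)) ⌊y⌋₊
    rw [densSum]
    trans ∑ r ∈ Finset.Icc 1 ⌊y⌋₊, (∑ d ∈ r.divisors, twist h a d) * (1 / (r : ℝ))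
    · refine Finset.sum_congr rfl fun r hr => ?_
      have hr0 : r ≠ 0 := by have := (Finset.mem_Icc.1 hr).1; omega
      have hr0' : (r : ℝ) ≠ 0 := by exact_mod_cast hr0
      rw [← mul_gDens_eq_sum hmult hr0]; field_simp
    · rw [this]
      refine Finset.sum_congr rfl fun d hd => ?_
      rw [Nat.floor_div_natCast, harm, div_mul_eq_mul_div, mul_div_assoc, Finset.sum_div]
      congr 1
      refine Finset.sum_congr rfl fun m _ => ?_
      push_cast
      rw [div_div, mul_comm (d : ℝ)]
  rw [e]
  refine hasSum_sum_of_ne_finset_zero fun d hd => ?_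
  rw [Nat.floor_div_natCast]
  rcases Nat.eq_zero_or_pos d with rfl | hd0
  · simp
  · have : ⌊y⌋₊ / d = 0 := Nat.div_eq_of_lt (by
      by_contra hh; exact hd (Finset.mem_Icc.2 ⟨hd0, by omega⟩))
    rw [this]; simp [harm]

lemma hasSum_densCesaro (hmult : h.IsMultiplicative) {R : ℝ} (hR : 0 < R) :
    HasSum (fun d : ℕ => twist h a d / d * stepSum (R / d)) (densCesaro h a R) := by
  have e : densCesaro h a R = ∑ d ∈ Finset.Icc 1 ⌊R⌋₊, twist h a d / d * stepSum (R / d) := by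
    have := sum_Icc_sum_divisors_mul (twist h a) (fun r => 1 / (r : ℝ) - 1 / R) ⌊R⌋₊
    rw [densCesaro]
    trans ∑ r ∈ Finset.Icc 1 ⌊R⌋₊, (∑ d ∈ r.divisors, twist h a d) * (1 / (r : ℝ) - 1 / R)
    · refine Finset.sum_congr rfl fun r hr => ?_
      have hr0 : r ≠ 0 := by have := (Finset.mem_Icc.1 hr).1; omega
      have hr0' : (r : ℝ) ≠ 0 := by exact_mod_cast hr0
      rw [← mul_gDens_eq_sum hmult hr0]; field_simp
    · rw [this]
      refine Finset.sum_congr rfl fun d hd => ?_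
      have hd0 : (0 : ℝ) < d := by exact_mod_cast (Finset.mem_Icc.1 hd).1
      rw [stepSum, Nat.floor_div_natCast, div_mul_eq_mul_div, mul_div_assoc, Finset.sum_div]
      congr 1
      refine Finset.sum_congr rfl fun m hm => ?_
      have hm0 : (0 : ℝ) < m := by exact_mod_cast (Finset.mem_Icc.1 hm).1
      push_cast
      field_simp
  rw [e]
  refine hasSum_sum_of_ne_finset_zero fun d hd => ?_
  rw [stepSum, Nat.floor_div_natCast]
  rcases Nat.eq_zero_or_pos d with rfl | hd0
  · simp
  · have : ⌊R⌋₊ / d = 0 := Nat.div_eq_of_lt (by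
      by_contra hh; exact hd (Finset.mem_Icc.2 ⟨hd0, by omega⟩))
    rw [this]; simp

lemma PrimeHyp.summable_twist_div (hyp : PrimeHyp h k) (hmult : h.IsMultiplicative)
    (hnonneg : ∀ d, 0 ≤ h d) (ha : a ≠ 0) :
    Summable (fun d : ℕ => twist h a d / d) ∧
    Summable (fun d : ℕ => twist h a d / d * (Real.eulerMascheroniConstant - Real.log d)) := by
  have hs := hyp.summable_abs_twist hmult hnonneg ha (show (0 : ℝ) < 1 / 2 by norm_num)
  have key : ∀ d : ℕ, |twist h a d / d| ≤ |twist h a d| * (d : ℝ) ^ (-(1 / 2) : ℝ) ∧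
      |twist h a d / d * (Real.eulerMascheroniConstant - Real.log d)| ≤
        (|Real.eulerMascheroniConstant| + 2) * (|twist h a d| * (d : ℝ) ^ (-(1 / 2) : ℝ)) := by
    intro d
    rcases Nat.eq_zero_or_pos d with rfl | hd
    · simp
    have hd1 : (1 : ℝ) ≤ d := by exact_mod_cast hd
    have hd0 : (0 : ℝ) < d := by linarith
    have hl : Real.log d ≤ 2 * (d : ℝ) ^ (1 / 2 : ℝ) := by
      have := Real.log_natCast_le_rpow_div d (show (0 : ℝ) < 1 / 2 by norm_num)
      linarith
    have hp1 : 1 ≤ (d : ℝ) ^ (1 / 2 : ℝ) := Real.one_le_rpow hd1 (by norm_num)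
    have hinv : (1 : ℝ) / d * (d : ℝ) ^ (1 / 2 : ℝ) = (d : ℝ) ^ (-(1 / 2) : ℝ) := by
      rw [one_div, ← Real.rpow_neg_one, ← Real.rpow_add hd0]; norm_num
    have hab : |twist h a d / d| = |twist h a d| * (1 / d) := by
      rw [abs_div, abs_of_pos hd0]; ring
    refine ⟨?_, ?_⟩
    · rw [hab, ← hinv]
      gcongr
      nlinarith [show (0 : ℝ) < 1 / d by positivity]
    · rw [abs_mul, hab, ← hinv]
      have : |Real.eulerMascheroniConstant - Real.log d| ≤
          (|Real.eulerMascheroniConstant| + 2) * (d : ℝ) ^ (1 / 2 : ℝ) := by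
        refine (abs_sub _ _).trans ?_
        rw [abs_of_nonneg (Real.log_nonneg hd1)]
        nlinarith [abs_nonneg Real.eulerMascheroniConstant]
      calc _ ≤ |twist h a d| * (1 / d) *
            ((|Real.eulerMascheroniConstant| + 2) * (d : ℝ) ^ (1 / 2 : ℝ)) := by gcongr
        _ = _ := by ring
  exact ⟨Summable.of_norm_bounded hs fun d => (key d).1,
    Summable.of_norm_bounded (hs.mul_left _) fun d => (key d).2⟩

/-- Inserting the asymptotics of harmonic numbers at y/d, the error in each term is |b(d)|/d times
(y/d)^(σ-1), and ∑ |b(d)| d^(-σ) converges for every σ > 0. -/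
lemma PrimeHyp.exists_abs_densSum_sub_le (hyp : PrimeHyp h k) (hmult : h.IsMultiplicative)
    (hnonneg : ∀ d, 0 ≤ h d) (ha : a ≠ 0) {σ : ℝ} (h0 : 0 < σ) (h1 : σ ≤ 3 / 4) :
    ∃ C, 0 < C ∧ ∀ y, 0 < y →
      |densSum h a y - (densMean h a * Real.log y + densConst h a)| ≤ C * y ^ (σ - 1) := by
  obtain ⟨C, hC, H⟩ := exists_abs_stepKernel_le
  obtain ⟨s1, s2⟩ := hyp.summable_twist_div hmult hnonneg ha
  have hs := hyp.summable_abs_twist hmult hnonneg ha h0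
  set B := ∑' d : ℕ, |twist h a d| * (d : ℝ) ^ (-σ)
  have hB : 0 ≤ B := tsum_nonneg fun d => by positivity
  refine ⟨C * (B + 1), by positivity, fun y hy => ?_⟩
  have hsum := (hasSum_densSum (a := a) hmult (y := y)).sub
    ((s1.hasSum.mul_right (Real.log y)).add s2.hasSum)
  have hb := tsum_of_norm_bounded (hs.mul_left (C * y ^ (σ - 1))).hasSum (f := fun d : ℕ =>
    twist h a d / d * harm ⌊y / d⌋₊ - (twist h a d / d * Real.log y +
      twist h a d / d * (Real.eulerMascheroniConstant - Real.log d))) (fun d => ?_)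
  · rw [hsum.tsum_eq, tsum_mul_left] at hb
    refine hb.trans ?_
    have : 0 < y ^ (σ - 1) := Real.rpow_pos_of_pos hy _
    calc C * y ^ (σ - 1) * B ≤ C * y ^ (σ - 1) * (B + 1) := by gcongr; linarith
      _ = _ := by ring
  · rcases Nat.eq_zero_or_pos d with rfl | hd
    · simp
    have hd0 : (0 : ℝ) < d := by exact_mod_cast hd
    have hu : 0 < y / d := by positivity
    have h2 := (H (y / d) hu σ h0.le h1).2
    rw [stepKernel_eq hu, add_sub_cancel_right, abs_mul, abs_of_pos hu,
      Real.div_rpow hy.le hd0.le, Real.log_div hy.ne' hd0.ne'] at h2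
    rw [show twist h a d / d * harm ⌊y / d⌋₊ - (twist h a d / d * Real.log y +
      twist h a d / d * (Real.eulerMascheroniConstant - Real.log d)) = twist h a d / d *
      (harm ⌊y / d⌋₊ - (Real.log y - Real.log d) - Real.eulerMascheroniConstant) by ring,
      Real.norm_eq_abs, abs_mul, abs_div, abs_of_pos hd0,
      Real.rpow_sub_one hy.ne', Real.rpow_neg hd0.le]
    have hds : 0 < (d : ℝ) ^ σ := Real.rpow_pos_of_pos hd0 _
    calc _ = |twist h a d| / y * (y / d * |harm ⌊y / d⌋₊ - (Real.log y - Real.log d) -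
          Real.eulerMascheroniConstant|) := by field_simp
      _ ≤ |twist h a d| / y * (C * (y ^ σ / (d : ℝ) ^ σ)) := by gcongr
      _ = _ := by field_simp

/-- Exact, by definition of the kernel: `twistAvg` collects everything beyond the logarithm and the
constant. -/
lemma PrimeHyp.densCesaro_eq (hyp : PrimeHyp h k) (hmult : h.IsMultiplicative)
    (hnonneg : ∀ d, 0 ≤ h d) (ha : a ≠ 0) {R : ℝ} (hR : 0 < R) :
    densCesaro h a R = densMean h a * Real.log R + (densConst h a - densMean h a) +
      twistAvg h a R / R := by
  obtain ⟨s1, s2⟩ := hyp.summable_twist_div hmult hnonneg ha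
  have s3 := hyp.summable_twistAvg hmult hnonneg ha hR
  have key := (((s1.hasSum.mul_right (Real.log R)).add (s2.hasSum.sub s1.hasSum))).add
    (s3.hasSum.div_const R)
  refine (hasSum_densCesaro hmult hR).unique (key.congr_fun fun d => ?_)
  rcases Nat.eq_zero_or_pos d with rfl | hd
  · simp
  have hd0 : (0 : ℝ) < d := by exact_mod_cast hd
  rw [stepKernel, Real.log_div hR.ne' hd0.ne']
  field_simp
  ring

/-- Consecutive values of the summatory function differ by g_a(q), while its smooth approximation
changes by o(1). -/
lemma PrimeHyp.tendsto_gDens (hyp : PrimeHyp h k) (hmult : h.IsMultiplicative)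
    (hnonneg : ∀ d, 0 ≤ h d) (ha : a ≠ 0) : Tendsto (fun q => gDens h a q) atTop (𝓝 0) := by
  obtain ⟨C, hC, H⟩ := hyp.exists_abs_densSum_sub_le hmult hnonneg ha
    (show (0 : ℝ) < 1 / 2 by norm_num) (by norm_num)
  have h1 : Tendsto (fun y : ℝ => densSum h a y - (densMean h a * Real.log y + densConst h a))
      atTop (𝓝 0) := by
    refine squeeze_zero_norm' (a := fun y : ℝ => C * y ^ (-(1 / 2) : ℝ)) ?_ ?_
    · filter_upwards [eventually_gt_atTop 0] with y hy
      have := H y hy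
      norm_num at this ⊢
      exact this
    · simpa using (tendsto_rpow_neg_atTop (show (0 : ℝ) < 1 / 2 by norm_num)).const_mul C
  have h2 := h1.comp (tendsto_natCast_atTop_atTop (R := ℝ))
  have h3 := (h2.comp (tendsto_add_atTop_nat 1)).sub h2
  have h4 : Tendsto (fun q : ℕ => densMean h a * (Real.log ((q : ℝ) + 1) - Real.log q)) atTop
      (𝓝 0) := by
    simpa using (Real.tendsto_log_nat_add_one_sub_log).const_mul (densMean h a)
  have h5 := h3.add h4
  rw [← tendsto_add_atTop_iff_nat 1]
  simp only [sub_zero, add_zero] at h5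
  refine h5.congr fun q => ?_
  simp only [Function.comp, densSum, Nat.floor_natCast]
  rw [Finset.sum_Icc_succ_top (by omega)]
  push_cast
  ring

end ArithProg

/-! ### Consequences of the equidistribution hypothesis -/

namespace ArithProg

variable {h : ArithmeticFunction ℝ} {a : ℤ} {k : ℝ} {α : ℕ → ℝ} {g : ℕ → ℝ} {L : ℝ → ℝ}

lemma PrimeHyp.density_eq (hyp : PrimeHyp h k) {q : ℕ} (hq : q ≠ 0) :
    density h a q = gDens h a q := by
  have h1 : 0 < gammaFun h q := by
    refine Finset.prod_pos fun p hp => ?_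
    have hpp := Nat.prime_of_mem_primeFactors hp
    have hp1 : (1 : ℝ) < p := by exact_mod_cast hpp.one_lt
    have hp0 : (0 : ℝ) < p := by linarith
    refine div_pos (sub_pos.2 ?_) (sub_pos.2 ?_)
    · rwa [div_lt_one hp0]
    · rw [div_lt_one hp0]; exact hyp.lt_self p hpp
  have hq0 : (q : ℝ) ≠ 0 := by exact_mod_cast hq
  rw [density, fDens]
  field_simp

/-- The largest discrepancy `|𝒜(y;q,a) - g(q) 𝒜(y)|` for `y ≤ x`. -/
noncomputable def discrepancy (α g : ℕ → ℝ) (a : ℤ) (x : ℝ) (q : ℕ) : ℝ :=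
  ⨆ y : Set.Icc (0 : ℝ) x, |countAP α (y : ℝ) q a - g q * count α (y : ℝ)|

lemma discrepancy_nonneg (α g : ℕ → ℝ) (a : ℤ) (x : ℝ) (q : ℕ) : 0 ≤ discrepancy α g a x q :=
  Real.iSup_nonneg fun _ => abs_nonneg _

lemma count_nonneg (hα : ∀ n, 1 ≤ n → 0 ≤ α n) (x : ℝ) : 0 ≤ count α x :=
  Finset.sum_nonneg fun n hn => hα n (Finset.mem_Icc.1 hn).1

lemma countAP_nonneg (hα : ∀ n, 1 ≤ n → 0 ≤ α n) (x : ℝ) (q : ℕ) (a : ℤ) : 0 ≤ countAP α x q a :=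
  Finset.sum_nonneg fun n hn => hα n (Finset.mem_Icc.1 (Finset.mem_filter.1 hn).1).1

lemma countAP_le_count (hα : ∀ n, 1 ≤ n → 0 ≤ α n) (x : ℝ) (q : ℕ) (a : ℤ) :
    countAP α x q a ≤ count α x :=
  Finset.sum_le_sum_of_subset_of_nonneg (Finset.filter_subset _ _)
    fun n hn _ => hα n (Finset.mem_Icc.1 hn).1

lemma count_mono (hα : ∀ n, 1 ≤ n → 0 ≤ α n) : Monotone (count α) := fun _ _ hxy =>
  Finset.sum_le_sum_of_subset_of_nonneg (Finset.Icc_subset_Icc le_rfl (Nat.floor_le_floor hxy))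
    fun n hn _ => hα n (Finset.mem_Icc.1 hn).1

/-- The family is bounded by (1 + |g q|) 𝒜(x), so its supremum is genuine and not the default value
0. -/
lemma le_discrepancy (hα : ∀ n, 1 ≤ n → 0 ≤ α n) (g : ℕ → ℝ) (a : ℤ) {x y : ℝ} (h0 : 0 ≤ y)
    (hyx : y ≤ x) (q : ℕ) :
    |countAP α y q a - g q * count α y| ≤ discrepancy α g a x q := by
  refine le_ciSup (f := fun y : Set.Icc (0 : ℝ) x =>
    |countAP α (y : ℝ) q a - g q * count α (y : ℝ)|) ⟨(1 + |g q|) * count α x, ?_⟩ ⟨y, h0, hyx⟩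
  rintro _ ⟨⟨v, hv0, hvx⟩, rfl⟩
  have h1 := count_mono hα hvx
  have h2 := countAP_le_count hα v q a
  have h3 := countAP_nonneg hα v q a
  have h4 := count_nonneg hα v
  calc _ ≤ |countAP α v q a| + |g q * count α v| := abs_sub _ _
    _ = countAP α v q a + |g q| * count α v := by rw [abs_mul, abs_of_nonneg h3, abs_of_nonneg h4]
    _ ≤ count α x + |g q| * count α x := by gcongr; linarith
    _ = _ := by ring

/-- Equidistribution in progressions and regularity of size, with a common saving. -/
structure EquidistBound (α g : ℕ → ℝ) (L : ℝ → ℝ) (a : ℤ) (δ C x₀ : ℝ) : Prop where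
  delta_pos : 0 < δ
  const_pos : 0 < C
  one_le : 1 ≤ x₀
  count_pos : ∀ x ≥ x₀, 0 < count α x
  level : ∀ x ≥ x₀, ∑ q ∈ Finset.Icc 1 ⌊2 * L x⌋₊, discrepancy α g a x q ≤
    C * (count α x / L x ^ (1 + δ))
  size : ∀ x ≥ x₀, ∀ z : ℝ, 1 / (2 * L x) ≤ z → z ≤ 1 →
    |count α (z * x) - z * count α x| ≤ C * (count α x / L x ^ (1 + δ))
  term : ∀ x ≥ x₀, ∀ n : ℕ, 1 ≤ n → (n : ℝ) ≤ x → α n ≤ C * (count α x / L x ^ (1 + δ))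

lemma exists_equidistBound (hα : ∀ n, 1 ≤ n → 0 ≤ α n) (hL_one : ∀ x, 0 ≤ x → 1 ≤ L x)
    (hL_top : Tendsto L atTop atTop) (hyp1 : LevelHyp α h L a) (hyp2 : SizeHyp α L a)
    (hyp3 : PrimeHyp h k) : ∃ δ C x₀, EquidistBound α (gDens h a) L a δ C x₀ := by
  obtain ⟨δ₁, hδ₁, C₁, x₁, H₁⟩ := hyp1
  obtain ⟨⟨δ₂, hδ₂, C₂, x₂, H₂⟩, ⟨δ₃, hδ₃, C₃, x₃, H₃⟩⟩ := hyp2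
  set C := |C₁| + |C₂| + |C₃| + 1
  set δ := min δ₁ (min δ₂ δ₃)
  have hδ : 0 < δ := lt_min hδ₁ (lt_min hδ₂ hδ₃)
  have hcmp : ∀ x, 0 ≤ x → ∀ δ', δ ≤ δ' → ∀ C', C' ≤ C → ∀ B, 0 ≤ B →
      C' * (B / L x ^ (1 + δ')) ≤ C * (B / L x ^ (1 + δ)) := by
    intro x hx δ' hδ' C' hC' B hB
    have hL := hL_one x hx
    have : L x ^ (1 + δ) ≤ L x ^ (1 + δ') := Real.rpow_le_rpow_of_exponent_le hL (by linarith)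
    have : 0 < L x ^ (1 + δ) := Real.rpow_pos_of_pos (by linarith) _
    have : 0 < C := by positivity
    gcongr
  have hC₁ : C₁ ≤ C := by
    have := le_abs_self C₁; simp only [C]; linarith [abs_nonneg C₂, abs_nonneg C₃]
  have hC₂ : C₂ ≤ C := by
    have := le_abs_self C₂; simp only [C]; linarith [abs_nonneg C₁, abs_nonneg C₃]
  have hC₃ : C₃ ≤ C := by
    have := le_abs_self C₃; simp only [C]; linarith [abs_nonneg C₁, abs_nonneg C₂]
  have hδ1 : δ ≤ δ₁ := min_le_left _ _
  have hδ2 : δ ≤ δ₂ := (min_le_right _ _).trans (min_le_left _ _)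
  have hδ3 : δ ≤ δ₃ := (min_le_right _ _).trans (min_le_right _ _)
  obtain ⟨x₄, hx₄⟩ := (hL_top.eventually_gt_atTop C).exists_forall_of_atTop
  set x₀ := max 1 (max x₁ (max x₂ (max x₃ x₄)))
  have k1 : 1 ≤ x₀ := le_max_left _ _
  have k2 : x₁ ≤ x₀ := by simp [x₀]
  have k3 : x₂ ≤ x₀ := by simp [x₀]
  have k4 : x₃ ≤ x₀ := by simp [x₀]
  have k5 : x₄ ≤ x₀ := by simp [x₀]
  -- If 𝒜(x) = 0, the quotient in Hypothesis 2 is 0 by convention, and z = 1 yields 1 ≤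
  -- C/L(x)^(1+δ), impossible once L(x) > C.
  have hpos : ∀ x ≥ x₀, 0 < count α x := by
    intro x hx
    refine lt_of_le_of_ne (count_nonneg hα x) fun h0 => ?_
    have hx0 : 0 < x := by linarith
    have hL := hL_one x hx0.le
    have h1 := H₂ x (by linarith) 1 (by rw [div_le_one (by linarith)]; linarith)
      (by have : 0 ≤ |(a : ℝ)| / x := by positivity
          linarith)
    rw [one_mul, ← h0] at h1
    have h2 := hcmp x hx0.le δ₂ hδ2 C₂ hC₂ 1 (by norm_num)
    have h3 : C * (1 / L x ^ (1 + δ)) < 1 := by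
      have h4 : L x ≤ L x ^ (1 + δ) := by
        conv_lhs => rw [← Real.rpow_one (L x)]
        exact Real.rpow_le_rpow_of_exponent_le hL (by linarith)
      have := hx₄ x (by linarith)
      rw [mul_one_div, div_lt_one (by linarith)]
      linarith
    rw [mul_one_div] at h2
    norm_num at h1
    linarith
  refine ⟨δ, C, x₀, hδ, by positivity, k1, hpos, fun x hx => ?_, fun x hx z hz hz1 => ?_,
    fun x hx n hn hnx => ?_⟩
  · refine le_trans (le_of_eq ?_) ((H₁ x (by linarith)).trans
      (hcmp x (by linarith) δ₁ hδ1 C₁ hC₁ _ (count_nonneg hα x)))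
    refine Finset.sum_congr rfl fun q hq => ?_
    rw [discrepancy, hyp3.density_eq (by have := (Finset.mem_Icc.1 hq).1; omega)]
  · have hx0 : 0 < x := by linarith
    have hA := hpos x hx
    have h1 := H₂ x (by linarith) z hz
      (by have : 0 ≤ |(a : ℝ)| / x := by positivity
          linarith)
    have h2 := mul_le_mul_of_nonneg_right h1 hA.le
    rw [← abs_of_pos hA, ← abs_mul, abs_of_pos hA, sub_mul, div_mul_cancel₀ _ hA.ne'] at h2
    refine h2.trans (le_trans (le_of_eq ?_) (hcmp x hx0.le δ₂ hδ2 C₂ hC₂ _ hA.le))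
    ring
  · exact (H₃ x (by linarith) n hn hnx).trans
      (hcmp x (by linarith) δ₃ hδ3 C₃ hC₃ _ (count_nonneg hα x))

lemma EquidistBound.discrepancy_le {δ C x₀ : ℝ} (H : EquidistBound α g L a δ C x₀) {x : ℝ}
    (hx : x₀ ≤ x) {q : ℕ} (h1 : 1 ≤ q) (h2 : q ≤ 2 * L x) :
    discrepancy α g a x q ≤ C * (count α x / L x ^ (1 + δ)) := by
  refine le_trans (Finset.single_le_sum (f := fun q => discrepancy α g a x q)
    (fun q _ => discrepancy_nonneg α g a x q) (Finset.mem_Icc.2 ⟨h1, Nat.le_floor h2⟩)) (H.level x hx)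

/-- As 𝒜(x; q, a) ≥ 0, equidistribution forces g(q) ≥ -C/L(x)^(1+δ) for all large x. -/
lemma EquidistBound.density_nonneg {δ C x₀ : ℝ} (H : EquidistBound α g L a δ C x₀)
    (hα : ∀ n, 1 ≤ n → 0 ≤ α n) (hL_top : Tendsto L atTop atTop) {q : ℕ} (hq : 1 ≤ q) :
    0 ≤ g q := by
  have h1 : Tendsto (fun x => -(C * (1 / L x ^ (1 + δ)))) atTop (𝓝 0) := by
    have h2 := ((tendsto_rpow_neg_atTop (y := 1 + δ) (by linarith [H.delta_pos])).comp
      hL_top).const_mul (-C)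
    rw [mul_zero] at h2
    refine h2.congr' ?_
    filter_upwards [hL_top.eventually_gt_atTop 0] with x hx
    rw [Function.comp, Real.rpow_neg hx.le]; ring
  refine le_of_tendsto h1 ?_
  filter_upwards [eventually_ge_atTop x₀, hL_top.eventually_ge_atTop (q : ℝ)] with x hx hLx
  have hq0 : (1 : ℝ) ≤ q := by exact_mod_cast hq
  have h2 := H.discrepancy_le hx hq (by linarith)
  have h3 := (le_discrepancy hα g a (by linarith [H.one_le]) le_rfl q).trans h2
  have h4 := countAP_nonneg hα x q a
  have hA := H.count_pos x hx
  have h5 := (abs_le.1 h3).2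
  have h6 : -(C * (1 / L x ^ (1 + δ))) * count α x ≤ g q * count α x := by
    have : C * (1 / L x ^ (1 + δ)) * count α x = C * (count α x / L x ^ (1 + δ)) := by ring
    linarith
  exact le_of_mul_le_mul_right h6 hA

lemma gDens_prime (hmult : h.IsMultiplicative) {p : ℕ} (hp : p.Prime) : gDens h a p = gLocal h a p 1 := by
  rw [gDens, hp.factorization, Finsupp.prod_single_index]
  simp [gLocal, hmult.map_one]

/-- If the coefficient of the logarithm were not positive, the nonnegative g_a(q) would have a
finite sum; but g_a(p) ≥ 1/(2p) for large p, and ∑ 1/p diverges. -/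
lemma PrimeHyp.densMean_pos (hyp : PrimeHyp h k) (hmult : h.IsMultiplicative)
    (hnonneg : ∀ d, 0 ≤ h d) (ha : a ≠ 0) (hg : ∀ q, 1 ≤ q → 0 ≤ gDens h a q) :
    0 < densMean h a := by
  by_contra hneg
  push Not at hneg
  obtain ⟨C, hC, H⟩ := hyp.exists_abs_densSum_sub_le hmult hnonneg ha
    (show (0 : ℝ) < 1 / 2 by norm_num) (by norm_num)
  have hsum : Summable fun q : ℕ => gDens h a (q + 1) := by
    refine summable_of_sum_range_le (c := |densConst h a| + C) (fun q => hg _ (by omega)) fun n => ?_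
    rcases Nat.eq_zero_or_pos n with rfl | hn
    · simp; positivity
    have hn1 : (1 : ℝ) ≤ n := by exact_mod_cast hn
    have h1 := (abs_le.1 (H n (by linarith))).2
    have h2 : (n : ℝ) ^ ((1 / 2 : ℝ) - 1) ≤ 1 := Real.rpow_le_one_of_one_le_of_nonpos hn1 (by norm_num)
    have h3 : densMean h a * Real.log n ≤ 0 :=
      mul_nonpos_of_nonpos_of_nonneg hneg (Real.log_nonneg hn1)
    have h4 : densSum h a n = ∑ i ∈ Finset.range n, gDens h a (i + 1) := by
      rw [densSum, Nat.floor_natCast, Finset.range_eq_Ico, Finset.sum_Ico_add']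
      rfl
    rw [← h4]
    have := le_abs_self (densConst h a)
    nlinarith
  rw [summable_nat_add_iff (f := fun q => gDens h a q) 1] at hsum
  obtain ⟨B, hB⟩ := hyp.growth (1 / 2) (by norm_num)
  refine not_summable_one_div_on_primes (Summable.of_norm_bounded_eventually_nat
    (hsum.mul_left 2) ?_)
  have hlim := (tendsto_rpow_neg_atTop (show (0 : ℝ) < 1 / 2 by norm_num)).const_mul B
  rw [mul_zero] at hlim
  have hev := (hlim.comp (tendsto_natCast_atTop_atTop (R := ℝ))).eventually_le_const
    (show (0 : ℝ) < 1 / 2 by norm_num)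
  filter_upwards [hev, eventually_gt_atTop a.natAbs] with p hp hpa
  by_cases hpp : p.Prime
  swap
  · rw [Set.indicator_of_notMem (by simpa using hpp), norm_zero]
    exact mul_nonneg (by norm_num) (hg p (by omega))
  have hp1 : (1 : ℝ) < p := by exact_mod_cast hpp.one_lt
  have hp0 : (0 : ℝ) < p := by linarith
  rw [Set.indicator_of_mem (by simpa using hpp), Real.norm_of_nonneg (by positivity), gDens_prime hmult hpp]
  have hnd := not_dvd_of_natAbs_lt ha hpa
  have h1 := pow_mul_gLocal_of_lt (h := h) (a := a) (e := 1) hpp (by rw [expo_eq_zero hnd]; norm_num)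
  rw [localDiff_of_not_dvd hmult hnd, pow_one] at h1
  have h2 : h p / p ≤ 1 / 2 := by
    refine le_trans ?_ hp
    have h3 := (le_abs_self _).trans (hB p hpp.one_le)
    calc h p / p ≤ B * (p : ℝ) ^ (1 / 2 : ℝ) / p := by gcongr
      _ = B * ((p : ℝ) ^ (1 / 2 : ℝ) / p) := by ring
      _ = _ := by
        rw [← Real.rpow_sub_one hp0.ne']; norm_num
  have h4 : 1 / 2 ≤ (1 - h p / p) / (1 - 1 / (p : ℝ)) := by
    have : 1 / (p : ℝ) < 1 := by rwa [div_lt_one hp0]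
    have : 0 < 1 / (p : ℝ) := by positivity
    rw [le_div_iff₀ (by linarith)]
    linarith
  rw [← h1] at h4
  rw [div_le_iff₀ hp0]
  linarith

lemma card_filter_modEq_le (N q : ℕ) (hq : 1 ≤ q) (a : ℤ) :
    (((Finset.Icc 1 N).filter (fun n : ℕ => (n : ℤ) ≡ a [ZMOD (q : ℤ)])).card : ℝ) ≤ N / q + 1 := by
  have hq0 : (0 : ℝ) < q := by exact_mod_cast hq
  have h1 : ((Finset.Icc 1 N).filter (fun n : ℕ => (n : ℤ) ≡ a [ZMOD (q : ℤ)])).card ≤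
      ((Finset.Ioc (0 : ℤ) N).filter (fun n => n ≡ a [ZMOD (q : ℤ)])).card := by
    refine Finset.card_le_card_of_injOn (fun n : ℕ => (n : ℤ)) (fun n hn => ?_)
      (fun _ _ _ _ e => by simpa using e)
    simp only [Finset.coe_filter, Finset.mem_Icc, Set.mem_ofPred_eq, Finset.mem_Ioc] at hn ⊢
    exact ⟨⟨by omega, by omega⟩, hn.2⟩
  have h2 := Int.Ioc_filter_modEq_card (0 : ℤ) N (r := q) (by omega) a
  have h3 : (((Finset.Ioc (0 : ℤ) N).filter (fun n => n ≡ a [ZMOD (q : ℤ)])).card : ℝ) ≤ N / q + 1 := by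
    have h4 : (((Finset.Ioc (0 : ℤ) N).filter (fun n => n ≡ a [ZMOD (q : ℤ)])).card : ℝ) =
      ((max (⌊((N : ℤ) - a : ℚ) / (q : ℤ)⌋ - ⌊((0 : ℤ) - a : ℚ) / (q : ℤ)⌋) 0 : ℤ) : ℝ) := by
      rw [← h2]; simp
    rw [h4]
    have h5 := Int.floor_le (((N : ℤ) - a : ℚ) / (q : ℤ))
    have h6 := Int.lt_floor_add_one (((0 : ℤ) - a : ℚ) / (q : ℤ))
    generalize ⌊((N : ℤ) - a : ℚ) / (q : ℤ)⌋ = u at h5 ⊢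
    generalize ⌊((0 : ℤ) - a : ℚ) / (q : ℤ)⌋ = v at h6 ⊢
    push_cast at h5 h6 ⊢
    refine max_le ?_ (by positivity)
    have h7 : (u : ℚ) - v ≤ N / q + 1 := by
      have : ((N : ℚ) - a) / q = N / q + ((0 : ℚ) - a) / q := by ring
      linarith
    have h8 : ((((u : ℚ) - v : ℚ)) : ℝ) ≤ ((N / q + 1 : ℚ) : ℝ) := by exact_mod_cast h7
    push_cast at h8
    exact h8
  exact le_trans (by exact_mod_cast h1) h3

lemma countAP_sub_pred (α : ℕ → ℝ) {n : ℕ} (hn : 1 ≤ n) {q : ℕ} (hna : (n : ℤ) ≡ a [ZMOD (q : ℤ)]) :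
    countAP α n q a - countAP α ((n - 1 : ℕ) : ℝ) q a = α n ∧
      count α n - count α ((n - 1 : ℕ) : ℝ) = α n := by
  obtain ⟨m, rfl⟩ : ∃ m, n = m + 1 := ⟨n - 1, by omega⟩
  simp only [countAP, count, Nat.floor_natCast, Nat.add_sub_cancel]
  constructor
  · rw [Finset.sum_filter, Finset.sum_filter, Finset.sum_Icc_succ_top (by omega), if_pos hna]
    ring
  · rw [Finset.sum_Icc_succ_top (by omega)]
    ring

/-- A single α(n) in the progression is the jump of 𝒜(·; q, a) from n - 1 to n. Comparing with 𝒜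
gives (1 - g(q)) α(n) ≤ 2E, hence α(n) ≤ 3E, and the progression has at most x/q + 1 elements. -/
lemma density_mul_count_le (hα : ∀ n, 1 ≤ n → 0 ≤ α n) {x : ℝ} (hx : 0 ≤ x) {q : ℕ} (hq : 1 ≤ q)
    (hg : g q ≤ 1 / 3) :
    g q * count α x ≤ (3 * x / q + 4) * discrepancy α g a x q := by
  have hq0 : (0 : ℝ) < q := by exact_mod_cast hq
  set E := discrepancy α g a x q with hE
  have hE0 : 0 ≤ E := discrepancy_nonneg α g a x q
  have h1 : ∀ n ∈ (Finset.Icc 1 ⌊x⌋₊).filter (fun n : ℕ => (n : ℤ) ≡ a [ZMOD (q : ℤ)]),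
      α n ≤ 3 * E := by
    intro n hn
    simp only [Finset.mem_filter, Finset.mem_Icc] at hn
    have hnx : (n : ℝ) ≤ x := (Nat.le_floor_iff hx).1 hn.1.2
    have hn' : ((n - 1 : ℕ) : ℝ) ≤ x := le_trans (by exact_mod_cast Nat.sub_le n 1) hnx
    obtain ⟨e1, e2⟩ := countAP_sub_pred α hn.1.1 hn.2
    have b1 := (abs_le.1 (le_discrepancy hα g a (Nat.cast_nonneg n) hnx q)).2
    have b2 := (abs_le.1 (le_discrepancy hα g a (Nat.cast_nonneg (n - 1)) hn' q)).1
    have hαn := hα n hn.1.1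
    have e3 : g q * count α n - g q * count α ((n - 1 : ℕ) : ℝ) = g q * α n := by rw [← e2]; ring
    nlinarith
  have h2 := Finset.sum_le_card_nsmul _ _ _ h1
  have h3 := card_filter_modEq_le ⌊x⌋₊ q hq a
  have h4 : (⌊x⌋₊ : ℝ) / q ≤ x / q := by gcongr; exact Nat.floor_le hx
  have h5 := (abs_le.1 (le_discrepancy hα g a hx le_rfl q)).1
  rw [nsmul_eq_mul] at h2
  have h6 : countAP α x q a ≤ (x / q + 1) * (3 * E) := by
    refine h2.trans ?_
    gcongr
    linarith
  have : (x / q + 1) * (3 * E) + E = (3 * x / q + 4) * E := by ring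
  linarith

lemma sum_Ioc_eq_densSum_sub {y z : ℝ} (hyz : y ≤ z) :
    ∑ q ∈ Finset.Ioc ⌊y⌋₊ ⌊z⌋₊, gDens h a q = densSum h a z - densSum h a y := by
  have h1 := Finset.sum_Ioc_consecutive (fun q => gDens h a q) (Nat.zero_le ⌊y⌋₊)
    (Nat.floor_le_floor hyz)
  have e : ∀ n, Finset.Icc 1 n = Finset.Ioc 0 n := fun n => by ext; simp [Nat.lt_iff_add_one_le]
  rw [densSum, densSum, e, e, ← h1]
  ring

/-- A sequence cannot be too well distributed: progressions to moduli q ∈ (L, 2L] have about x/L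
elements, so each discrepancy is at least of order g(q) 𝒜(x) L/x. The g(q) sum to about c log 2 with
c > 0, and comparing with the level bound limits L to L^(2+δ) ≪ x. -/
lemma EquidistBound.exists_level_rpow_le {δ C x₀ : ℝ}
    (H : EquidistBound α (gDens h a) L a δ C x₀) (hα : ∀ n, 1 ≤ n → 0 ≤ α n)
    (hL_one : ∀ x, 0 ≤ x → 1 ≤ L x) (hL_top : Tendsto L atTop atTop)
    (hyp : PrimeHyp h k) (hmult : h.IsMultiplicative) (hnonneg : ∀ d, 0 ≤ h d) (ha : a ≠ 0) :
    ∃ B, 0 < B ∧ ∀ᶠ x in atTop, L x ^ (2 + δ) ≤ B * x := by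
  have hg : ∀ q, 1 ≤ q → 0 ≤ gDens h a q := fun q hq => H.density_nonneg hα hL_top hq
  have hc := hyp.densMean_pos hmult hnonneg ha hg
  obtain ⟨D, hD, HD⟩ := hyp.exists_abs_densSum_sub_le hmult hnonneg ha
    (show (0 : ℝ) < 1 / 2 by norm_num) (by norm_num)
  obtain ⟨q₀, hq₀⟩ := ((hyp.tendsto_gDens hmult hnonneg ha).eventually_le_const
    (show (0 : ℝ) < 1 / 3 by norm_num)).exists_forall_of_atTop
  set s := densMean h a * Real.log 2 / 2 with hs
  have hs0 : 0 < s := by have := Real.log_pos (show (1 : ℝ) < 2 by norm_num); positivity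
  have hlimD := ((tendsto_rpow_neg_atTop (show (0 : ℝ) < 1 / 2 by norm_num)).comp
    hL_top).const_mul (2 * D)
  rw [mul_zero] at hlimD
  have hC := H.const_pos
  have hδ := H.delta_pos
  refine ⟨6 * C / s, by positivity, ?_⟩
  filter_upwards [eventually_ge_atTop x₀, hL_top.eventually_ge_atTop (q₀ : ℝ),
    hlimD.eventually_le_const hs0, ((tendsto_rpow_atTop (show 0 < 1 + δ by linarith)).comp
      hL_top).eventually_ge_atTop (8 * C / s)] with x hx hLq hDs hLs
  have hx0 : 0 < x := by linarith [H.one_le]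
  have hL := hL_one x hx0.le
  have hL0 : 0 < L x := by linarith
  have hA := H.count_pos x hx
  set E := ∑ q ∈ Finset.Icc 1 ⌊2 * L x⌋₊, discrepancy α (gDens h a) a x q
  have h1 : (∑ q ∈ Finset.Ioc ⌊L x⌋₊ ⌊2 * L x⌋₊, gDens h a q) * count α x ≤
      (3 * x / L x + 4) * E := by
    rw [Finset.sum_mul]
    calc _ ≤ ∑ q ∈ Finset.Ioc ⌊L x⌋₊ ⌊2 * L x⌋₊,
          (3 * x / L x + 4) * discrepancy α (gDens h a) a x q := by
          refine Finset.sum_le_sum fun q hq => ?_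
          rw [Finset.mem_Ioc] at hq
          have hqL : L x < q := (Nat.floor_lt hL0.le).1 hq.1
          have : q₀ ≤ q := by exact_mod_cast hLq.trans hqL.le
          have hq1 : 1 ≤ q := by omega
          refine (density_mul_count_le (a := a) hα hx0.le hq1 (hq₀ q this)).trans ?_
          have := discrepancy_nonneg α (gDens h a) a x q
          gcongr
      _ = (3 * x / L x + 4) * ∑ q ∈ Finset.Ioc ⌊L x⌋₊ ⌊2 * L x⌋₊,
          discrepancy α (gDens h a) a x q := by rw [Finset.mul_sum]
      _ ≤ _ := by
        refine mul_le_mul_of_nonneg_left ?_ (by positivity)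
        refine Finset.sum_le_sum_of_subset_of_nonneg (fun q hq => ?_)
          fun q _ _ => discrepancy_nonneg _ _ _ _ _
        rw [Finset.mem_Ioc] at hq
        exact Finset.mem_Icc.2 ⟨by omega, hq.2⟩
  rw [sum_Ioc_eq_densSum_sub (by linarith)] at h1
  have hS : s ≤ densSum h a (2 * L x) - densSum h a (L x) := by
    have i1 := (abs_le.1 (HD (L x) hL0)).2
    have i2 := (abs_le.1 (HD (2 * L x) (by linarith))).1
    rw [Real.log_mul (by norm_num) hL0.ne'] at i2
    have i3 : (2 * L x) ^ ((1 / 2 : ℝ) - 1) ≤ L x ^ ((1 / 2 : ℝ) - 1) :=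
      Real.rpow_le_rpow_of_nonpos hL0 (by linarith) (by norm_num)
    have i4 : 2 * D * L x ^ ((1 / 2 : ℝ) - 1) ≤ s := by
      norm_num
      simpa using hDs
    have i5 : D * (2 * L x) ^ ((1 / 2 : ℝ) - 1) ≤ D * L x ^ ((1 / 2 : ℝ) - 1) := by gcongr
    have : 2 * s = densMean h a * Real.log 2 := by rw [hs]; ring
    linarith
  set W := L x ^ (1 + δ) with hW
  have hW0 : 0 < W := Real.rpow_pos_of_pos hL0 _
  have h2 : s * count α x ≤ (3 * x / L x + 4) * (C * (count α x / W)) :=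
    (mul_le_mul_of_nonneg_right hS hA.le).trans (h1.trans
      (mul_le_mul_of_nonneg_left (H.level x hx) (by positivity)))
  have h3 : s * W * L x ≤ C * (3 * x + 4 * L x) := by
    have e : (3 * x / L x + 4) * (C * (count α x / W)) * (W * L x) =
        C * (3 * x + 4 * L x) * count α x := by field_simp
    have := mul_le_mul_of_nonneg_right h2 (show 0 ≤ W * L x by positivity)
    rw [e] at this
    refine le_of_mul_le_mul_right (le_trans (le_of_eq ?_) this) hA
    ring
  have h4 : 8 * C ≤ s * W := by
    have := (div_le_iff₀ hs0).1 hLs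
    simp only [Function.comp] at this
    linarith
  have h5 : L x ^ (2 + δ) = W * L x := by
    rw [hW, ← Real.rpow_add_one hL0.ne']; ring_nf
  rw [h5, div_mul_eq_mul_div, le_div_iff₀ hs0]
  nlinarith

end ArithProg

/-! ### Switching divisors -/

namespace ArithProg

variable {h : ArithmeticFunction ℝ} {a : ℤ} {k : ℝ} {α : ℕ → ℝ} {L : ℝ → ℝ}

lemma count_eq_countAP_one (α : ℕ → ℝ) (x : ℝ) (a : ℤ) : count α x = countAP α x 1 a := by
  simp [count, countAP, Int.modEq_one]

lemma countAP_min_sub_countAP_min (α : ℕ → ℝ) (r : ℕ) (a : ℤ) {x v w : ℝ} (hx : 0 ≤ x) (hv : 0 ≤ v)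
    (hvw : v ≤ w) :
    countAP α (min x w) r a - countAP α (min x v) r a =
      ∑ n ∈ (Finset.Icc 1 ⌊x⌋₊).filter
        (fun n : ℕ => (n : ℤ) ≡ a [ZMOD (r : ℤ)] ∧ v < n ∧ (n : ℝ) ≤ w), α n := by
  classical
  have key : ∀ u, 0 ≤ u → countAP α (min x u) r a = ∑ n ∈ Finset.Icc 1 ⌊x⌋₊,
      if (n : ℤ) ≡ a [ZMOD (r : ℤ)] ∧ (n : ℝ) ≤ u then α n else 0 := by
    intro u hu
    rw [countAP, ← Finset.sum_filter]
    congr 1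
    ext n
    simp only [Finset.mem_filter, Finset.mem_Icc, Nat.le_floor_iff hx,
      Nat.le_floor_iff (le_min hx hu), le_min_iff]
    tauto
  rw [key _ hv, key _ (hv.trans hvw), ← Finset.sum_sub_distrib, Finset.sum_filter]
  refine Finset.sum_congr rfl fun n _ => ?_
  by_cases h1 : (n : ℤ) ≡ a [ZMOD (r : ℤ)]
  · by_cases h2 : (n : ℝ) ≤ v
    · simp [h1, h2, h2.trans hvw, not_lt.2 h2]
    · simp [h1, h2, not_le.1 h2]
  · simp [h1]

/-- Short intervals are handled by the pointwise bound for α; this pays for shifting endpoints by a.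
-/
lemma count_sub_count_le {x B : ℝ} (hx : 0 ≤ x) (hB : 0 ≤ B)
    (hαB : ∀ n : ℕ, 1 ≤ n → (n : ℝ) ≤ x → α n ≤ B) {v w : ℝ} (hv : 0 ≤ v) (hvw : v ≤ w) :
    count α (min x w) - count α (min x v) ≤ (w - v + 1) * B := by
  rw [count_eq_countAP_one _ _ 0, count_eq_countAP_one _ _ 0,
    countAP_min_sub_countAP_min α 1 0 hx hv hvw]
  have h1 : ∀ n ∈ (Finset.Icc 1 ⌊x⌋₊).filter
      (fun n : ℕ => (n : ℤ) ≡ 0 [ZMOD ((1 : ℕ) : ℤ)] ∧ v < n ∧ (n : ℝ) ≤ w), α n ≤ B := by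
    intro n hn
    simp only [Finset.mem_filter, Finset.mem_Icc, Nat.le_floor_iff hx] at hn
    exact hαB n hn.1.1 hn.1.2
  refine (Finset.sum_le_card_nsmul _ _ _ h1).trans ?_
  rw [nsmul_eq_mul]
  gcongr
  have h2 : ((Finset.Icc 1 ⌊x⌋₊).filter
      (fun n : ℕ => (n : ℤ) ≡ 0 [ZMOD ((1 : ℕ) : ℤ)] ∧ v < n ∧ (n : ℝ) ≤ w)) ⊆
      Finset.Ioc ⌊v⌋₊ ⌊w⌋₊ := by
    intro n hn
    simp only [Finset.mem_filter] at hn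
    rw [Finset.mem_Ioc, Nat.floor_lt hv, Nat.le_floor_iff (hv.trans hvw)]
    exact hn.2.2
  have h3 := Finset.card_le_card h2
  rw [Nat.card_Ioc] at h3
  have h4 : ((⌊w⌋₊ - ⌊v⌋₊ : ℕ) : ℝ) = (⌊w⌋₊ : ℝ) - ⌊v⌋₊ :=
    Nat.cast_sub (Nat.floor_le_floor hvw)
  have h5 := Nat.floor_le (hv.trans hvw)
  have h6 := Nat.lt_floor_add_one v
  have h7 : ((((Finset.Icc 1 ⌊x⌋₊).filter
      (fun n : ℕ => (n : ℤ) ≡ 0 [ZMOD ((1 : ℕ) : ℤ)] ∧ v < n ∧ (n : ℝ) ≤ w)).card : ℕ) : ℝ) ≤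
      ((⌊w⌋₊ - ⌊v⌋₊ : ℕ) : ℝ) := by exact_mod_cast h3
  linarith

lemma abs_count_sub_count_le (hα : ∀ n, 1 ≤ n → 0 ≤ α n) {x B : ℝ} (hx : 0 ≤ x) (hB : 0 ≤ B)
    (hαB : ∀ n : ℕ, 1 ≤ n → (n : ℝ) ≤ x → α n ≤ B) {v w : ℝ} (hv : 0 ≤ v) (hw : 0 ≤ w) :
    |count α (min x w) - count α (min x v)| ≤ (|w - v| + 1) * B := by
  rcases le_total v w with hvw | hvw
  · rw [abs_of_nonneg (sub_nonneg.2 (count_mono hα (min_le_min_left x hvw))),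
      abs_of_nonneg (sub_nonneg.2 hvw)]
    exact count_sub_count_le hx hB hαB hv hvw
  · rw [abs_sub_comm, abs_sub_comm w,
      abs_of_nonneg (sub_nonneg.2 (count_mono hα (min_le_min_left x hvw))),
      abs_of_nonneg (sub_nonneg.2 hvw)]
    exact count_sub_count_le hx hB hαB hw hvw

lemma countAP_sub_firstTerm (α : ℕ → ℝ) {x : ℝ} {q : ℕ} (ha : |(a : ℝ)| ≤ x) :
    countAP α x q a - firstTerm α a = ∑ n ∈ (Finset.Icc 1 ⌊x⌋₊).filter
      (fun n : ℕ => (n : ℤ) ≡ a [ZMOD (q : ℤ)] ∧ (n : ℤ) ≠ a), α n := by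
  classical
  have hx : 0 ≤ x := (abs_nonneg _).trans ha
  rw [countAP, firstTerm, sub_eq_iff_eq_add]
  split_ifs with hpos
  · have hmem : a.toNat ∈ (Finset.Icc 1 ⌊x⌋₊).filter (fun n : ℕ => (n : ℤ) ≡ a [ZMOD (q : ℤ)]) := by
      rw [Finset.mem_filter, Finset.mem_Icc, Nat.le_floor_iff hx, Int.toNat_of_nonneg hpos.le]
      refine ⟨⟨by omega, ?_⟩, Int.ModEq.refl _⟩
      have : ((a.toNat : ℤ) : ℝ) = a := by rw [Int.toNat_of_nonneg hpos.le]
      rw [Int.cast_natCast] at this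
      rw [this]
      exact (le_abs_self _).trans ha
    rw [← Finset.sum_erase_add _ _ hmem]
    congr 2
    ext n
    simp only [Finset.mem_erase, Finset.mem_filter, Finset.mem_Icc]
    have : n ≠ a.toNat ↔ (n : ℤ) ≠ a := by omega
    rw [this]
    tauto
  · rw [add_zero]
    refine congrArg (fun s => ∑ n ∈ s, α n) (Finset.filter_congr fun n hn => ?_)
    have := (Finset.mem_Icc.1 hn).1
    have : (n : ℤ) ≠ a := by omega
    tauto

/-- The involution (q, n) ↦ ((n - a)/q, n). Because X ≥ |a| + 1 and q > X, a solution n ≠ a cannot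
have n < a, so the cofactor is positive; K bounds it from above. -/
lemma sum_countAP_switch (α : ℕ → ℝ) {x X : ℝ} {K : ℕ} (hx : 0 ≤ x)
    (haX : |(a : ℝ)| + 1 ≤ X) (hK : x + |(a : ℝ)| < X * (K + 1)) :
    ∑ q ∈ Finset.Ioc ⌊X⌋₊ ⌊2 * X⌋₊, ∑ n ∈ (Finset.Icc 1 ⌊x⌋₊).filter
        (fun n : ℕ => (n : ℤ) ≡ a [ZMOD (q : ℤ)] ∧ (n : ℤ) ≠ a), α n =
      ∑ r ∈ Finset.Icc 1 K, ∑ n ∈ (Finset.Icc 1 ⌊x⌋₊).filter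
        (fun n : ℕ => (n : ℤ) ≡ a [ZMOD (r : ℤ)] ∧ a + r * X < n ∧ (n : ℝ) ≤ a + r * (2 * X)),
          α n := by
  have hX : 0 < X := by linarith [abs_nonneg (a : ℝ)]
  rw [Finset.sum_sigma', Finset.sum_sigma']
  have hdiv : ∀ u v : ℕ, 0 < u → ((((u : ℤ) * v) / (u : ℤ)).toNat) = v := fun u v hu => by
    rw [Int.mul_ediv_cancel_left _ (by omega), Int.toNat_natCast]
  have hreal : ∀ n q m : ℕ, (n : ℤ) - a = q * m → (n : ℝ) - a = q * m := fun n q m e => by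
    exact_mod_cast e
  have key1 : ∀ q n : ℕ, X < q → 1 ≤ n → (n : ℤ) ≡ a [ZMOD (q : ℤ)] → (n : ℤ) ≠ a →
      ∃ m : ℕ, 0 < m ∧ (n : ℤ) - a = q * m := by
    intro q n hq hn hna hne
    obtain ⟨m, hm⟩ := hna.symm.dvd
    have hm0 : m ≠ 0 := by rintro rfl; simp at hm; omega
    have hm1 : 0 < m := by
      by_contra hneg
      have hm2 : m ≤ -1 := by omega
      have h1 : (n : ℤ) - a ≤ -q := by rw [hm]; nlinarith [Int.natCast_nonneg q]
      have h2 : (n : ℝ) - a ≤ -q := by exact_mod_cast h1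
      have h3 : (1 : ℝ) ≤ n := by exact_mod_cast hn
      linarith [le_abs_self (a : ℝ)]
    refine ⟨m.toNat, by omega, ?_⟩
    rw [Int.toNat_of_nonneg hm1.le, hm]
  have key2 : ∀ r n : ℕ, 1 ≤ r → (n : ℤ) ≡ a [ZMOD (r : ℤ)] → (a : ℝ) + r * X < n →
      ∃ m : ℕ, 0 < m ∧ (n : ℤ) - a = r * m := by
    intro r n hr hna han
    obtain ⟨m, hm⟩ := hna.symm.dvd
    have hr0 : (0 : ℝ) < r := by exact_mod_cast hr
    have hm' : (n : ℝ) - a = r * m := by exact_mod_cast hm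
    have hm1 : (0 : ℝ) < m := by
      have : 0 < (r : ℝ) * m := by rw [← hm']; nlinarith
      exact pos_of_mul_pos_right this hr0.le
    have hm2 : 0 < m := by exact_mod_cast hm1
    refine ⟨m.toNat, by omega, ?_⟩
    rw [Int.toNat_of_nonneg hm2.le, hm]
  refine Finset.sum_bij' (fun t _ => ⟨(((t.2 : ℤ) - a) / (t.1 : ℤ)).toNat, t.2⟩)
    (fun t _ => ⟨(((t.2 : ℤ) - a) / (t.1 : ℤ)).toNat, t.2⟩) ?_ ?_ ?_ ?_ (fun _ _ => rfl)
  all_goals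
    rintro ⟨q, n⟩ ht
    simp only [Finset.mem_sigma, Finset.mem_filter, Finset.mem_Icc, Finset.mem_Ioc,
      Nat.floor_lt hX.le, Nat.le_floor_iff hx, Nat.le_floor_iff (show 0 ≤ 2 * X by linarith)] at ht ⊢
  · obtain ⟨m, hm0, hm⟩ := key1 q n ht.1.1 ht.2.1.1 ht.2.2.1 ht.2.2.2
    have hq0 : (0 : ℝ) < q := by linarith [ht.1.1]
    have hm' := hreal n q m hm
    have hm1 : (0 : ℝ) < m := by exact_mod_cast hm0
    rw [hm, hdiv q m (by exact_mod_cast hq0)]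
    refine ⟨⟨hm0, ?_⟩, ht.2.1, ?_, ?_, ?_⟩
    · have h1 : X * m < X * (K + 1) := by
        have h2 : X * m ≤ q * m := by gcongr; exact ht.1.1.le
        linarith [ht.2.1.2, neg_abs_le (a : ℝ)]
      have h3 : (m : ℝ) < K + 1 := lt_of_mul_lt_mul_left h1 hX.le
      have : m < K + 1 := by exact_mod_cast h3
      omega
    · exact ((Int.modEq_iff_dvd).2 ⟨q, by rw [hm]; ring⟩).symm
    · nlinarith [ht.1.1]
    · nlinarith [ht.1.2]
  · obtain ⟨m, hm0, hm⟩ := key2 q n ht.1.1 ht.2.2.1 ht.2.2.2.1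
    have hr0 : (0 : ℝ) < q := by exact_mod_cast ht.1.1
    have hm' := hreal n q m hm
    rw [hm, hdiv q m ht.1.1]
    refine ⟨⟨?_, ?_⟩, ht.2.1, ?_, ?_⟩
    · exact lt_of_mul_lt_mul_left (show (q : ℝ) * X < q * m by linarith [ht.2.2.2.1]) hr0.le
    · exact le_of_mul_le_mul_left (show (q : ℝ) * m ≤ q * (2 * X) by linarith [ht.2.2.2.2]) hr0
    · exact ((Int.modEq_iff_dvd).2 ⟨q, by rw [hm]; ring⟩).symm
    · intro e
      have : (n : ℝ) = a := by exact_mod_cast e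
      have := ht.2.2.2.1
      nlinarith
  · obtain ⟨m, hm0, hm⟩ := key1 q n ht.1.1 ht.2.1.1 ht.2.2.1 ht.2.2.2
    have hq0 : (0 : ℝ) < q := by linarith [ht.1.1]
    rw [hm, hdiv q m (by exact_mod_cast hq0), mul_comm (q : ℤ), hdiv m q hm0]
  · obtain ⟨m, hm0, hm⟩ := key2 q n ht.1.1 ht.2.2.1 ht.2.2.2.1
    rw [hm, hdiv q m ht.1.1, mul_comm (q : ℤ), hdiv m q hm0]

/-- For r > M the weight 1 - min(1, r/M) is 0, so both Cesàro sums extend over r ≤ 2M. -/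
lemma sum_min_sub_min_eq {M : ℝ} (hM : 0 < M) :
    ∑ r ∈ Finset.Icc 1 ⌊2 * M⌋₊, gDens h a r * (min 1 (r / M) - min 1 (r / (2 * M))) =
      densCesaro h a (2 * M) - densCesaro h a M := by
  have hsub : Finset.Icc 1 ⌊M⌋₊ ⊆ Finset.Icc 1 ⌊2 * M⌋₊ :=
    Finset.Icc_subset_Icc le_rfl (Nat.floor_le_floor (by linarith))
  have h1 : densCesaro h a M = ∑ r ∈ Finset.Icc 1 ⌊2 * M⌋₊, gDens h a r * (1 - min 1 (r / M)) := by
    rw [densCesaro, ← Finset.sum_subset hsub]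
    · refine Finset.sum_congr rfl fun r hr => ?_
      rw [Finset.mem_Icc, Nat.le_floor_iff hM.le] at hr
      rw [min_eq_right ((div_le_one hM).2 hr.2)]
    · intro r hr hr'
      rw [Finset.mem_Icc] at hr
      rw [Finset.mem_Icc, Nat.le_floor_iff hM.le, not_and, not_le] at hr'
      rw [min_eq_left ((one_le_div hM).2 (hr' hr.1).le)]
      simp
  rw [h1, densCesaro, ← Finset.sum_sub_distrib]
  refine Finset.sum_congr rfl fun r hr => ?_
  rw [Finset.mem_Icc, Nat.le_floor_iff (by linarith)] at hr
  rw [min_eq_right (b := (r : ℝ) / (2 * M)) ((div_le_one (by linarith)).2 hr.2)]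
  ring

/-- After switching, the moduli r ≤ 2M ≤ 2L(x) lie in the range of equidistribution, and the
endpoints a + rX, a + 2rX truncated at x are proportions r/(2M), r/M of x up to the shift by a. -/
lemma EquidistBound.abs_dyadic_sub_le {δ C x₀ : ℝ} (H : EquidistBound α (gDens h a) L a δ C x₀)
    (hα : ∀ n, 1 ≤ n → 0 ≤ α n) (hg : ∀ q, 1 ≤ q → 0 ≤ gDens h a q) {x M : ℝ} (hx : x₀ ≤ x)
    (hM : 1 < M) (hML : M ≤ L x) (haX : |(a : ℝ)| + 1 ≤ x / (2 * M)) :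
    |∑ q ∈ Finset.Ioc ⌊x / (2 * M)⌋₊ ⌊x / M⌋₊,
        (countAP α x q a - firstTerm α a - gDens h a q * count α x) -
      count α x * (densCesaro h a (2 * M) - densCesaro h a M -
        (densSum h a (x / M) - densSum h a (x / (2 * M))))| ≤
    (|(a : ℝ)| + 3 + 2 * (|(a : ℝ)| + 2) * densSum h a (2 * M)) *
      (C * (count α x / L x ^ (1 + δ))) := by
  have hx0 : 0 < x := by linarith [H.one_le]
  have hL0 : 0 < L x := by linarith
  have hA := H.count_pos x hx
  set A := count α x with hAdef
  set B := C * (A / L x ^ (1 + δ)) with hBdef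
  have hB : 0 ≤ B := mul_nonneg H.const_pos.le (div_nonneg hA.le (Real.rpow_nonneg hL0.le _))
  have hαB : ∀ n : ℕ, 1 ≤ n → (n : ℝ) ≤ x → α n ≤ B := H.term x hx
  set X := x / (2 * M) with hX
  have hxX : x = 2 * M * X := by rw [hX]; field_simp
  have hxM : x / M = 2 * X := by rw [hX]; field_simp
  have hX0 : 0 < X := by positivity
  have habs0 := abs_nonneg (a : ℝ)
  have hax : |(a : ℝ)| ≤ x := by nlinarith
  set K := ⌊2 * M⌋₊ with hK
  have hK1 : 2 * M < K + 1 := Nat.lt_floor_add_one _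
  have hK2 : (K : ℝ) ≤ 2 * M := Nat.floor_le (by linarith)
  set T : ℕ → ℝ := fun r => countAP α (min x (a + r * (2 * X))) r a -
    countAP α (min x (a + r * X)) r a with hT
  have hcut : ∀ r : ℕ, 1 ≤ r → 0 ≤ (a : ℝ) + r * X ∧ (a : ℝ) + r * X ≤ a + r * (2 * X) := by
    intro r hr
    have hr1 : (1 : ℝ) ≤ r := by exact_mod_cast hr
    constructor
    · nlinarith [neg_abs_le (a : ℝ)]
    · nlinarith
  -- The shift by a may let r reach K + 1 = ⌊2M⌋ + 1, just outside the range of equidistribution, so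
  -- that term is split off.
  have hswitch : ∑ q ∈ Finset.Ioc ⌊X⌋₊ ⌊2 * X⌋₊, (countAP α x q a - firstTerm α a) =
      ∑ r ∈ Finset.Icc 1 K, T r + T (K + 1) := by
    rw [← Finset.sum_Icc_succ_top (by omega),
      Finset.sum_congr rfl fun q _ => countAP_sub_firstTerm α hax,
      sum_countAP_switch α hx0.le haX (K := K + 1) (by push_cast; nlinarith)]
    refine Finset.sum_congr rfl fun r hr => ?_
    obtain ⟨h1, h2⟩ := hcut r (Finset.mem_Icc.1 hr).1
    rw [hT]
    simp only
    rw [countAP_min_sub_countAP_min α r a hx0.le h1 h2]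
  -- Here n > a + (K + 1)X > x - |a|, so at most |a| + 1 integers are involved.
  have hextra : |T (K + 1)| ≤ (|(a : ℝ)| + 1) * B := by
    obtain ⟨h1, h2⟩ := hcut (K + 1) (by omega)
    have h3 := countAP_min_sub_countAP_min α (K + 1) a hx0.le h1 h2
    have h4 := countAP_min_sub_countAP_min α 1 a hx0.le h1 h2
    rw [← count_eq_countAP_one, ← count_eq_countAP_one] at h4
    have h5 : 0 ≤ T (K + 1) := by
      simp only [hT]
      rw [h3]
      exact Finset.sum_nonneg fun n hn => hα n (Finset.mem_Icc.1 (Finset.mem_filter.1 hn).1).1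
    have h6 : T (K + 1) ≤ count α (min x (a + (K + 1 : ℕ) * (2 * X))) -
        count α (min x (a + (K + 1 : ℕ) * X)) := by
      simp only [hT]
      rw [h3, h4]
      refine Finset.sum_le_sum_of_subset_of_nonneg (fun n hn => ?_)
        fun n hn _ => hα n (Finset.mem_Icc.1 (Finset.mem_filter.1 hn).1).1
      simp only [Finset.mem_filter] at hn ⊢
      exact ⟨hn.1, by simp [Int.modEq_one], hn.2.2⟩
    have h7 : count α (min x (a + (K + 1 : ℕ) * (2 * X))) ≤ count α (min x x) :=
      count_mono hα (by simp)
    have h8 : count α (min x (x - |(a : ℝ)|)) ≤ count α (min x (a + (K + 1 : ℕ) * X)) := by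
      refine count_mono hα (min_le_min_left x ?_)
      push_cast
      nlinarith [neg_abs_le (a : ℝ)]
    have h9 := count_sub_count_le hx0.le hB hαB (v := x - |(a : ℝ)|) (w := x) (by linarith)
      (by linarith)
    rw [abs_of_nonneg h5]
    rw [show x - (x - |(a : ℝ)|) = |(a : ℝ)| by ring] at h9
    linarith
  -- The proportion rc/(2M) is at least 1/(2L(x)), the lower limit allowed in Hypothesis 2; c = 1
  -- and c = 2 give the two endpoints.
  have hcount : ∀ r : ℕ, 1 ≤ r → (r : ℝ) ≤ 2 * M → ∀ c : ℝ, 1 ≤ c →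
      |count α (min x (a + r * (c * X))) - min 1 (r * c / (2 * M)) * A| ≤ (|(a : ℝ)| + 2) * B := by
    intro r hr hrM c hc
    have hr1 : (1 : ℝ) ≤ r := by exact_mod_cast hr
    have hrc : 1 ≤ r * c := by nlinarith
    have h1 := abs_count_sub_count_le hα hx0.le hB hαB (v := r * (c * X)) (w := a + r * (c * X))
      (by positivity) (by nlinarith [neg_abs_le (a : ℝ)])
    rw [add_sub_cancel_right] at h1
    have h2 := H.size x hx (min 1 (r * c / (2 * M))) (le_min ?_ ?_) (min_le_left _ _)
    · have e : min 1 (r * c / (2 * M)) * x = min x (r * (c * X)) := by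
        rw [min_mul_of_nonneg _ _ hx0.le, one_mul]
        congr 1
        rw [hX]; field_simp
      rw [e, ← hAdef, ← hBdef] at h2
      calc _ = |(count α (min x (a + r * (c * X))) - count α (min x (r * (c * X)))) +
            (count α (min x (r * (c * X))) - min 1 (r * c / (2 * M)) * A)| := by ring_nf
        _ ≤ _ := abs_add_le _ _
        _ ≤ (|(a : ℝ)| + 1) * B + B := by gcongr
        _ = _ := by ring
    · rw [div_le_one (by linarith)]; linarith
    · gcongr
  have hterm : ∀ r ∈ Finset.Icc 1 K, |T r - A * (gDens h a r * (min 1 (r / M) - min 1 (r / (2 * M))))| ≤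
      2 * discrepancy α (gDens h a) a x r + 2 * (|(a : ℝ)| + 2) * B * gDens h a r := by
    intro r hr
    rw [Finset.mem_Icc] at hr
    have hrM : (r : ℝ) ≤ 2 * M := le_trans (by exact_mod_cast hr.2) hK2
    obtain ⟨h1, h2⟩ := hcut r hr.1
    have d1 := le_discrepancy hα (gDens h a) a (le_min hx0.le h1) (min_le_left _ _) r
    have d2 := le_discrepancy hα (gDens h a) a (le_min hx0.le (h1.trans h2)) (min_le_left _ _) r
    have c1 := hcount r hr.1 hrM 1 le_rfl
    have c2 := hcount r hr.1 hrM 2 (by norm_num)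
    rw [one_mul, mul_one] at c1
    rw [mul_comm (r : ℝ) 2, mul_div_mul_left _ _ (two_ne_zero)] at c2
    have hgr := hg r hr.1
    set y₁ := min x (a + r * X)
    set y₂ := min x (a + r * (2 * X))
    have e : T r - A * (gDens h a r * (min 1 (r / M) - min 1 (r / (2 * M)))) =
        (countAP α y₂ r a - gDens h a r * count α y₂) - (countAP α y₁ r a - gDens h a r * count α y₁) +
        gDens h a r * ((count α y₂ - min 1 (r / M) * A) - (count α y₁ - min 1 (r / (2 * M)) * A)) := by
      simp only [hT]; ring
    rw [e]
    refine (abs_add_le _ _).trans ?_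
    rw [abs_mul, abs_of_nonneg hgr]
    have f1 := (abs_sub (countAP α y₂ r a - gDens h a r * count α y₂)
      (countAP α y₁ r a - gDens h a r * count α y₁)).trans (add_le_add d2 d1)
    have f2 := (abs_sub (count α y₂ - min 1 (r / M) * A)
      (count α y₁ - min 1 (r / (2 * M)) * A)).trans (add_le_add c2 c1)
    have f3 := mul_le_mul_of_nonneg_left f2 hgr
    linarith
  have hmain : |∑ r ∈ Finset.Icc 1 K, T r - A * (densCesaro h a (2 * M) - densCesaro h a M)| ≤
      2 * B + 2 * (|(a : ℝ)| + 2) * B * densSum h a (2 * M) := by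
    rw [← sum_min_sub_min_eq (by linarith), Finset.mul_sum, ← Finset.sum_sub_distrib]
    refine (Finset.abs_sum_le_sum_abs _ _).trans ((Finset.sum_le_sum hterm).trans ?_)
    rw [Finset.sum_add_distrib, ← Finset.mul_sum, ← Finset.mul_sum, densSum]
    gcongr
    refine le_trans ?_ (H.level x hx)
    exact Finset.sum_le_sum_of_subset_of_nonneg
      (Finset.Icc_subset_Icc le_rfl (Nat.floor_le_floor (by linarith)))
      fun q _ _ => discrepancy_nonneg _ _ _ _ _
  have hlast : ∑ q ∈ Finset.Ioc ⌊X⌋₊ ⌊2 * X⌋₊, gDens h a q * A =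
      A * (densSum h a (2 * X) - densSum h a X) := by
    rw [← Finset.sum_mul, sum_Ioc_eq_densSum_sub (by linarith), mul_comm]
  rw [hxM, Finset.sum_sub_distrib, hswitch, hlast]
  calc _ = |(∑ r ∈ Finset.Icc 1 K, T r - A * (densCesaro h a (2 * M) - densCesaro h a M)) +
        T (K + 1)| := by ring_nf
    _ ≤ _ := abs_add_le _ _
    _ ≤ _ := add_le_add hmain hextra
    _ = _ := by ring

end ArithProg

/-! ### Main term and error of the dyadic sum -/

namespace ArithProg

variable {h : ArithmeticFunction ℝ} {a : ℤ} {k : ℝ} {α : ℕ → ℝ} {L : ℝ → ℝ}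

/-- The main term of the dyadic sum, normalized by `𝒜(x)/(2M)`. -/
noncomputable def dyadicMain (h : ArithmeticFunction ℝ) (a : ℤ) (M : ℝ) : ℝ :=
  twistAvg h a (2 * M) - 2 * twistAvg h a M

lemma PrimeHyp.exists_densSum_le_rpow (hyp : PrimeHyp h k) (hmult : h.IsMultiplicative)
    (hnonneg : ∀ d, 0 ≤ h d) (ha : a ≠ 0) {ε : ℝ} (hε : 0 < ε) :
    ∃ C, 0 < C ∧ ∀ y, 1 ≤ y → densSum h a y ≤ C * y ^ ε := by
  obtain ⟨D, hD, H⟩ := hyp.exists_abs_densSum_sub_le hmult hnonneg ha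
    (show (0 : ℝ) < 1 / 2 by norm_num) (by norm_num)
  refine ⟨|densMean h a| / ε + |densConst h a| + D, by positivity, fun y hy => ?_⟩
  have h1 := (abs_le.1 (H y (by linarith))).2
  have h2 : y ^ ((1 / 2 : ℝ) - 1) ≤ 1 := Real.rpow_le_one_of_one_le_of_nonpos hy (by norm_num)
  have h3 := Real.log_le_rpow_div (show 0 ≤ y by linarith) hε
  have h4 : 1 ≤ y ^ ε := Real.one_le_rpow hy hε.le
  have h5 : densMean h a * Real.log y ≤ |densMean h a| / ε * y ^ ε := by
    calc _ ≤ |densMean h a| * Real.log y := by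
          have := Real.log_nonneg hy
          gcongr
          exact le_abs_self _
      _ ≤ |densMean h a| * (y ^ ε / ε) := by gcongr
      _ = _ := by ring
  have h6 : densConst h a ≤ |densConst h a| * y ^ ε :=
    (le_abs_self _).trans (le_mul_of_one_le_right (abs_nonneg _) h4)
  have h7 : D * y ^ ((1 / 2 : ℝ) - 1) ≤ D * y ^ ε := by gcongr; linarith
  linarith

lemma PrimeHyp.densCesaro_sub_eq (hyp : PrimeHyp h k) (hmult : h.IsMultiplicative)
    (hnonneg : ∀ d, 0 ≤ h d) (ha : a ≠ 0) {M : ℝ} (hM : 0 < M) :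
    densCesaro h a (2 * M) - densCesaro h a M =
      densMean h a * Real.log 2 + dyadicMain h a M / (2 * M) := by
  rw [hyp.densCesaro_eq hmult hnonneg ha (show 0 < 2 * M by linarith),
    hyp.densCesaro_eq hmult hnonneg ha hM, Real.log_mul two_ne_zero hM.ne', dyadicMain]
  field_simp
  ring

/-- The terms c log 2 from the Cesàro sums and from the expected densities cancel. The errors are
C𝒜(x)/L^(1+δ) times a sum of size M^(δ/2), and 𝒜(x) X^(σ-1); both save a power of M over 𝒜(x)/M. -/
lemma EquidistBound.exists_abs_dyadicSum_sub_le {δ C x₀ : ℝ}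
    (H : EquidistBound α (gDens h a) L a δ C x₀) (hα : ∀ n, 1 ≤ n → 0 ≤ α n)
    (hL_one : ∀ x, 0 ≤ x → 1 ≤ L x) (hL_top : Tendsto L atTop atTop)
    (hyp : PrimeHyp h k) (hmult : h.IsMultiplicative) (hnonneg : ∀ d, 0 ≤ h d) (ha : a ≠ 0) :
    ∃ ε > (0 : ℝ), ∃ E, 0 < E ∧ ∀ᶠ x in atTop, ∀ M, 1 < M → M ≤ L x →
      |dyadicSum α h a x M - count α x / (2 * M) * dyadicMain h a M| ≤
        count α x / (2 * M) * (E * M ^ (-ε)) := by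
  have hδ := H.delta_pos
  have hC := H.const_pos
  have hg : ∀ q, 1 ≤ q → 0 ≤ gDens h a q := fun q hq => H.density_nonneg hα hL_top hq
  obtain ⟨B, hB, HB⟩ := H.exists_level_rpow_le hα hL_one hL_top hyp hmult hnonneg ha
  -- Then (M^(1+δ))^(σ-1) = M^(-1-δ/2), which is what X ≥ M^(1+δ)/(2B) turns into a saving of
  -- M^(-δ/2) beyond 1/M.
  set σ := δ / (2 * (1 + δ)) with hσ
  have hσ0 : 0 < σ := by positivity
  have hσ1 : σ ≤ 1 / 2 := by
    rw [hσ, div_le_div_iff₀ (by positivity) (by norm_num)]; linarith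
  have hσ2 : (1 + δ) * (σ - 1) = -1 - δ / 2 := by rw [hσ]; field_simp; ring
  obtain ⟨D, hD, HD⟩ := hyp.exists_abs_densSum_sub_le hmult hnonneg ha hσ0 (by linarith)
  obtain ⟨F, hF, HF⟩ := hyp.exists_densSum_le_rpow hmult hnonneg ha (half_pos hδ)
  set b := |(a : ℝ)| with hb
  have hb0 : 0 ≤ b := abs_nonneg _
  set E₁ := 4 * D * (1 / (2 * B)) ^ (σ - 1)
  set E₂ := 2 * C * (b + 3 + 2 * (b + 2) * (F * 2 ^ (δ / 2)))
  refine ⟨δ / 2, by positivity, E₁ + E₂, by positivity, ?_⟩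
  filter_upwards [eventually_ge_atTop x₀, HB, ((tendsto_rpow_atTop (show 0 < 1 + δ by linarith)).comp
      hL_top).eventually_ge_atTop (2 * B * (b + 1))] with x hx hLB hLx M hM hML
  have hx0 : 0 < x := by linarith [H.one_le]
  have hM0 : 0 < M := by linarith
  have hL0 : 0 < L x := by linarith
  have hA := H.count_pos x hx
  simp only [Function.comp] at hLx
  -- From L^(2+δ) ≤ Bx and M ≤ L; this makes X large both against |a| and against M^(1+δ).
  have hX : L x ^ (1 + δ) / (2 * B) ≤ x / (2 * M) := by
    rw [div_le_div_iff₀ (by positivity) (by positivity)]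
    have h1 : L x ^ (2 + δ) = L x ^ (1 + δ) * L x := by
      rw [← Real.rpow_add_one hL0.ne']; ring_nf
    have h2 : L x ^ (1 + δ) * M ≤ L x ^ (1 + δ) * L x := by gcongr
    linarith
  have haX : b + 1 ≤ x / (2 * M) := by
    refine le_trans ?_ hX
    rw [le_div_iff₀ (by positivity)]
    linarith
  have hMδ : M ^ (1 + δ) ≤ L x ^ (1 + δ) := by gcongr
  have key := H.abs_dyadic_sub_le hα hg hx hM hML haX
  have hds : dyadicSum α h a x M = ∑ q ∈ Finset.Ioc ⌊x / (2 * M)⌋₊ ⌊x / M⌋₊,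
        (countAP α x q a - firstTerm α a - gDens h a q * count α x) := by
    refine Finset.sum_congr rfl fun q hq => ?_
    rw [hyp.density_eq (by have := (Finset.mem_Ioc.1 hq).1; omega)]
  rw [← hds, hyp.densCesaro_sub_eq hmult hnonneg ha hM0, ← hb] at key
  set X := x / (2 * M) with hXdef
  have hX0 : 0 < X := by positivity
  have hxM : x / M = 2 * X := by rw [hXdef]; field_simp
  rw [hxM] at key
  have hXσ : X ^ (σ - 1) ≤ (1 / (2 * B)) ^ (σ - 1) * (M ^ (-(δ / 2)) / M) := by
    have h1 : M ^ (1 + δ) / (2 * B) ≤ X := le_trans (by gcongr) hX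
    refine (Real.rpow_le_rpow_of_nonpos (by positivity) h1 (by linarith)).trans (le_of_eq ?_)
    rw [div_eq_mul_one_div, Real.mul_rpow (by positivity) (by positivity), ← Real.rpow_mul hM0.le,
      hσ2, show -1 - δ / 2 = -(δ / 2) - 1 by ring, Real.rpow_sub_one hM0.ne']
    ring
  have hS : |densSum h a (2 * X) - densSum h a X - densMean h a * Real.log 2| ≤
      E₁ / 2 * (M ^ (-(δ / 2)) / M) := by
    have i1 := HD X hX0
    have i2 := HD (2 * X) (by linarith)
    have i3 : (2 * X) ^ (σ - 1) ≤ X ^ (σ - 1) :=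
      Real.rpow_le_rpow_of_nonpos hX0 (by linarith) (by linarith)
    rw [Real.log_mul two_ne_zero hX0.ne'] at i2
    calc _ = |(densSum h a (2 * X) - (densMean h a * (Real.log 2 + Real.log X) + densConst h a)) -
          (densSum h a X - (densMean h a * Real.log X + densConst h a))| := by ring_nf
      _ ≤ _ := abs_sub _ _
      _ ≤ D * X ^ (σ - 1) + D * X ^ (σ - 1) := by
        refine add_le_add (i2.trans ?_) i1
        gcongr
      _ = 2 * D * X ^ (σ - 1) := by ring
      _ ≤ 2 * D * ((1 / (2 * B)) ^ (σ - 1) * (M ^ (-(δ / 2)) / M)) := by gcongr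
      _ = _ := by simp only [E₁]; ring
  have hR : (b + 3 + 2 * (b + 2) * densSum h a (2 * M)) * (C * (count α x / L x ^ (1 + δ))) ≤
      count α x / (2 * M) * (E₂ * M ^ (-(δ / 2))) := by
    have j1 := HF (2 * M) (by linarith)
    rw [Real.mul_rpow (by norm_num) hM0.le] at j1
    have j2 : 1 ≤ M ^ (δ / 2) := Real.one_le_rpow hM.le (by positivity)
    have j3 : b + 3 + 2 * (b + 2) * densSum h a (2 * M) ≤
        (b + 3 + 2 * (b + 2) * (F * 2 ^ (δ / 2))) * M ^ (δ / 2) := by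
      have : 2 * (b + 2) * densSum h a (2 * M) ≤ 2 * (b + 2) * (F * (2 ^ (δ / 2) * M ^ (δ / 2))) := by
        gcongr
      nlinarith
    have j4 : M ^ (1 + δ) = M * M ^ (δ / 2) * M ^ (δ / 2) := by
      rw [mul_assoc, ← Real.rpow_add hM0, ← Real.rpow_one_add' hM0.le (by linarith)]; ring_nf
    calc _ ≤ ((b + 3 + 2 * (b + 2) * (F * 2 ^ (δ / 2))) * M ^ (δ / 2)) *
          (C * (count α x / M ^ (1 + δ))) := by gcongr
      _ = _ := by
        rw [j4, Real.rpow_neg hM0.le]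
        simp only [E₂]
        field_simp
  have hfin : dyadicSum α h a x M - count α x / (2 * M) * dyadicMain h a M =
      (dyadicSum α h a x M - count α x * (densMean h a * Real.log 2 + dyadicMain h a M / (2 * M) -
        (densSum h a (2 * X) - densSum h a X))) -
      count α x * (densSum h a (2 * X) - densSum h a X - densMean h a * Real.log 2) := by
    field_simp
    ring
  rw [hfin]
  refine (abs_sub _ _).trans ?_
  rw [abs_mul, abs_of_pos hA]
  have h8 := key.trans hR
  have h9 := mul_le_mul_of_nonneg_left hS hA.le
  refine (add_le_add h8 h9).trans (le_of_eq ?_)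
  field_simp
  ring

lemma abs_rpow_sub_rpow_le {u v p : ℝ} (hu : 0 < u) (huv : u ≤ v) (hp : p ≤ 1) :
    |v ^ p - u ^ p| ≤ |p| * u ^ (p - 1) * (v - u) := by
  have := norm_image_sub_le_of_norm_deriv_le_segment' (f := fun t : ℝ => t ^ p)
    (f' := fun t => p * t ^ (p - 1)) (C := |p| * u ^ (p - 1)) (a := u) (b := v)
    (fun t ht => (Real.hasDerivAt_rpow_const (Or.inl (by linarith [ht.1]))).hasDerivWithinAt)
    (fun t ht => ?_) v (Set.right_mem_Icc.2 huv)
  · exact this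
  · have : 0 < t := by linarith [ht.1]
    rw [norm_mul, Real.norm_eq_abs, Real.norm_of_nonneg (Real.rpow_nonneg this.le _)]
    gcongr ?_ * ?_
    exact Real.rpow_le_rpow_of_nonpos hu ht.1 (by linarith)

/-- By continuity on a compact range of log M; needed for M near 1, where the asymptotics say
nothing. -/
lemma PrimeHyp.exists_abs_dyadicMain_le (hyp : PrimeHyp h k) (hmult : h.IsMultiplicative)
    (hnonneg : ∀ d, 0 ≤ h d) (ha : a ≠ 0) (M₀ : ℝ) :
    ∃ B, 0 ≤ B ∧ ∀ M, 1 < M → M ≤ M₀ → |dyadicMain h a M| ≤ B := by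
  obtain ⟨c, hc, hS⟩ := hyp.subexpGrowth_twistAvg hmult hnonneg ha
  have hcont := hS.continuous
  obtain ⟨B, hB⟩ := (isCompact_Icc (a := (0 : ℝ)) (b := Real.log (2 * M₀))).exists_bound_of_continuousOn
    hcont.continuousOn
  refine ⟨|B| + 2 * |B|, by positivity, fun M hM hM0 => ?_⟩
  have h1 := hB (Real.log (2 * M)) ⟨Real.log_nonneg (by linarith),
    Real.log_le_log (by linarith) (by linarith)⟩
  have h2 := hB (Real.log M) ⟨Real.log_nonneg (by linarith),
    Real.log_le_log (by linarith) (by linarith)⟩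
  rw [Real.exp_log (by linarith), Real.norm_eq_abs] at h1 h2
  rw [dyadicMain]
  refine (abs_sub _ _).trans ?_
  rw [abs_mul, abs_two]
  have := le_abs_self B
  linarith

end ArithProg

/-! ### Comparison of the main term with μ -/

namespace ArithProg

variable {h : ArithmeticFunction ℝ} {a : ℤ} {k : ℝ}

/-- On a bounded range of M the error term 1/log^A M is bounded below, so it absorbs any bounded
quantity. -/
lemma inv_rpow_log_ge {A M₀ M : ℝ} (hA : 0 < A) (hM : 1 < M) (hM0 : M ≤ M₀) :
    1 ≤ Real.log M₀ ^ A / Real.log M ^ A := by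
  have h0 := Real.log_pos hM
  rw [one_le_div (Real.rpow_pos_of_pos h0 _)]
  exact Real.rpow_le_rpow h0.le (Real.log_le_log (by linarith) hM0) hA.le

lemma exists_rpow_neg_le_log {ε A : ℝ} (hε : 0 < ε) (hA : 0 < A) :
    ∃ C, 0 < C ∧ ∀ M, 1 < M → M ^ (-ε) ≤ C / Real.log M ^ A := by
  refine ⟨(A / ε) ^ A, by positivity, fun M hM => ?_⟩
  have h0 := Real.log_pos hM
  have hM0 : 0 < M := by linarith
  rw [le_div_iff₀ (Real.rpow_pos_of_pos h0 _), Real.rpow_neg hM0.le, inv_mul_le_iff₀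
    (Real.rpow_pos_of_pos hM0 _)]
  have h1 := Real.log_le_rpow_div hM0.le (show 0 < ε / A by positivity)
  calc Real.log M ^ A ≤ (M ^ (ε / A) / (ε / A)) ^ A := by gcongr
    _ = M ^ ε * (A / ε) ^ A := by
      rw [div_eq_mul_inv, inv_div, Real.mul_rpow (by positivity) (by positivity),
        ← Real.rpow_mul hM0.le, div_mul_cancel₀ _ hA.ne']

lemma PrimeHyp.exists_abs_dyadicMain_sub_mu_le (hyp : PrimeHyp h k) (hmult : h.IsMultiplicative)
    (hnonneg : ∀ d, 0 ≤ h d) (ha : a ≠ 0) :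
    ∃ η : ℝ → ℝ, Tendsto η atTop (𝓝 0) ∧ ∀ A : ℝ, 0 < A → ∃ C, ∀ M, 1 < M →
      |dyadicMain h a M - mu h k a M| ≤ η M * |mu h k a M| + C / Real.log M ^ A := by
  obtain ⟨Q, hQ0, hQ, hgen, hpole⟩ := hyp.twistAvg_asymp hmult hnonneg ha
  have hk := hyp.nonneg
  set κ : ℝ := k + omegaH h a with hκ
  have hκ0 : 0 ≤ κ := by positivity
  rw [show 2 - k - (omegaH h a : ℝ) = 2 - κ by rw [hκ]; ring,
    show 1 - k - (omegaH h a : ℝ) = 1 - κ by rw [hκ]; ring,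
    show -k - (omegaH h a : ℝ) = -κ by rw [hκ]; ring] at hgen
  rw [show 2 - k - (omegaH h a : ℝ) = 2 - κ by rw [hκ]; ring] at hpole
  have hmu : ∀ M, mu h k a M =
      -(degenerateProd h k a * Q / 2 / Real.Gamma (2 - κ) * Real.log M ^ (1 - κ)) := by
    intro M
    rw [mu, hQ.limUnder_eq, show 2 - k - (omegaH h a : ℝ) = 2 - κ by rw [hκ]; ring,
      show 1 - k - (omegaH h a : ℝ) = 1 - κ by rw [hκ]; ring]
    ring
  have hl2 := Real.log_pos (show (1 : ℝ) < 2 by norm_num)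
  have hl2' : Real.log 2 ≤ 1 := by have := Real.log_two_lt_d9; linarith
  have hexp : ∀ M, 1 < M → dyadicMain h a M = twistAvg h a (Real.exp (Real.log M + Real.log 2)) -
      2 * twistAvg h a (Real.exp (Real.log M)) := by
    intro M hM
    rw [Real.exp_add, Real.exp_log (by linarith), Real.exp_log (by norm_num), dyadicMain, mul_comm M]
  by_cases hΓ : Real.Gamma (2 - κ) = 0
  -- When Γ(2 - κ) is at a pole, μ is 0 and the whole main term goes into the error with 1/log^A M.
  · refine ⟨0, tendsto_const_nhds, fun A hA => ?_⟩
    obtain ⟨C, u₀, H⟩ := hpole hΓ A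
    obtain ⟨B, hB0, hB⟩ := hyp.exists_abs_dyadicMain_le hmult hnonneg ha (Real.exp (max u₀ 1))
    refine ⟨3 * |C| + B * (max u₀ 1) ^ A, fun M hM => ?_⟩
    have h0 := Real.log_pos hM
    have hpos : 0 < Real.log M ^ A := Real.rpow_pos_of_pos h0 _
    rw [hmu, hΓ]
    simp only [div_zero, zero_mul, neg_zero, sub_zero, Pi.zero_apply, zero_add]
    rw [add_div]
    have hu1 : 0 < max u₀ 1 := lt_of_lt_of_le one_pos (le_max_right _ _)
    rcases le_total M (Real.exp (max u₀ 1)) with hle | hle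
    · have h1 := inv_rpow_log_ge hA hM hle
      rw [Real.log_exp] at h1
      have h2 : 0 ≤ 3 * |C| / Real.log M ^ A := by positivity
      have h3 : B * 1 ≤ B * (max u₀ 1 ^ A / Real.log M ^ A) := by gcongr
      rw [mul_div_assoc B]
      linarith [hB M hM hle]
    · have hu : max u₀ 1 ≤ Real.log M := (Real.le_log_iff_exp_le (by linarith)).2 hle
      have hu' := (le_max_left u₀ 1).trans hu
      have h1 := H (Real.log M) hu'
      have h2 := H (Real.log M + Real.log 2) (by linarith)
      have h3 : (Real.log M + Real.log 2) ^ (-A) ≤ Real.log M ^ (-A) :=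
        Real.rpow_le_rpow_of_nonpos h0 (by linarith) (by linarith)
      rw [hexp M hM]
      refine (abs_sub _ _).trans ?_
      rw [abs_mul, abs_two]
      have h4 : C * (Real.log M + Real.log 2) ^ (-A) ≤ |C| * Real.log M ^ (-A) := by
        have : 0 ≤ (Real.log M + Real.log 2) ^ (-A) := Real.rpow_nonneg (by linarith) _
        gcongr
        exact le_abs_self C
      have h5 : C * Real.log M ^ (-A) ≤ |C| * Real.log M ^ (-A) := by
        have : 0 ≤ Real.log M ^ (-A) := Real.rpow_nonneg h0.le _
        gcongr
        exact le_abs_self C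
      have h6 : 3 * |C| / Real.log M ^ A = 3 * (|C| * Real.log M ^ (-A)) := by
        rw [Real.rpow_neg h0.le]; ring
      have h7 : 0 ≤ B * max u₀ 1 ^ A / Real.log M ^ A := by positivity
      rw [h6]
      linarith
  · obtain ⟨C, u₀, H⟩ := hgen hΓ
    set G := degenerateProd h k a * Q / 2 / Real.Gamma (2 - κ) with hG
    have hG0 : G ≠ 0 := div_ne_zero (div_ne_zero
      (mul_ne_zero (degenerateProd_ne_zero hmult hnonneg) hQ0) two_ne_zero) hΓ
    have hG1 : 0 < |G| := abs_pos.2 hG0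
    set M₀ := Real.exp (max u₀ 1) with hM₀
    obtain ⟨B, hB0, hB⟩ := hyp.exists_abs_dyadicMain_le hmult hnonneg ha M₀
    set E := 3 * |C| + |G| * |1 - κ| with hE
    have hE0 : 0 ≤ E := by positivity
    have hu1 : 0 < max u₀ 1 := lt_of_lt_of_le one_pos (le_max_right _ _)
    -- Beyond M₀ the error E u^(-κ), with u = log M, is E/(|G| u) times |μ| = |G| u^(1-κ), which
    -- uses G ≠ 0. Below M₀ the value 1 absorbs μ itself and the 1/log^A term absorbs the bounded
    -- main term.
    refine ⟨fun M => if M ≤ M₀ then 1 else E / |G| / Real.log M, ?_, fun A hA =>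
      ⟨B * (max u₀ 1) ^ A, fun M hM => ?_⟩⟩
    · refine (Real.tendsto_log_atTop.const_div_atTop (E / |G|)).congr' ?_
      filter_upwards [eventually_gt_atTop M₀] with M hM
      rw [if_neg (not_le.2 hM)]
    have h0 := Real.log_pos hM
    have hpos : 0 < Real.log M ^ A := Real.rpow_pos_of_pos h0 _
    simp only
    split_ifs with hle
    · have h1 := inv_rpow_log_ge hA hM hle
      rw [hM₀, Real.log_exp] at h1
      have h3 : B * 1 ≤ B * (max u₀ 1 ^ A / Real.log M ^ A) := by gcongr
      rw [mul_div_assoc B]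
      linarith [hB M hM hle, abs_sub (dyadicMain h a M) (mu h k a M)]
    · have hu : max u₀ 1 ≤ Real.log M :=
        (Real.le_log_iff_exp_le (by linarith)).2 (not_le.1 hle).le
      have hu' := (le_max_left u₀ 1).trans hu
      have h7 : 0 ≤ B * max u₀ 1 ^ A / Real.log M ^ A := by positivity
      rw [hmu, hexp M hM]
      set u := Real.log M with hudef
      have h1 := H u hu'
      have h2 := H (u + Real.log 2) (by linarith)
      have h3 : (u + Real.log 2) ^ (-κ) ≤ u ^ (-κ) :=
        Real.rpow_le_rpow_of_nonpos h0 (by linarith) (by linarith)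
      have h4 : C * (u + Real.log 2) ^ (-κ) ≤ |C| * u ^ (-κ) := by
        have : 0 ≤ (u + Real.log 2) ^ (-κ) := Real.rpow_nonneg (by linarith) _
        gcongr
        exact le_abs_self C
      have hun : 0 ≤ u ^ (-κ) := Real.rpow_nonneg h0.le _
      have h5 : C * u ^ (-κ) ≤ |C| * u ^ (-κ) := by
        gcongr
        exact le_abs_self C
      have h6 := abs_rpow_sub_rpow_le h0 (show u ≤ u + Real.log 2 by linarith)
        (show 1 - κ ≤ 1 by linarith)
      rw [show 1 - κ - 1 = -κ by ring, add_sub_cancel_left] at h6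
      have h8 : |1 - κ| * u ^ (-κ) * Real.log 2 ≤ |1 - κ| * u ^ (-κ) :=
        mul_le_of_le_one_right (by positivity) hl2'
      -- With both averages near G u^(1-κ), the combination T(2M) - 2T(M) is near -G u^(1-κ);
      -- replacing u + log 2 by u costs only O(u^(-κ)).
      have e : twistAvg h a (Real.exp (u + Real.log 2)) - 2 * twistAvg h a (Real.exp u) -
          -(G * u ^ (1 - κ)) =
          ((twistAvg h a (Real.exp (u + Real.log 2)) - G * (u + Real.log 2) ^ (1 - κ)) -
            2 * (twistAvg h a (Real.exp u) - G * u ^ (1 - κ))) +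
            G * ((u + Real.log 2) ^ (1 - κ) - u ^ (1 - κ)) := by ring
      have f1 := abs_add_le ((twistAvg h a (Real.exp (u + Real.log 2)) -
          G * (u + Real.log 2) ^ (1 - κ)) - 2 * (twistAvg h a (Real.exp u) - G * u ^ (1 - κ)))
          (G * ((u + Real.log 2) ^ (1 - κ) - u ^ (1 - κ)))
      have f2 := abs_sub (twistAvg h a (Real.exp (u + Real.log 2)) -
          G * (u + Real.log 2) ^ (1 - κ)) (2 * (twistAvg h a (Real.exp u) - G * u ^ (1 - κ)))
      rw [← e, abs_mul G] at f1
      rw [abs_mul 2, abs_two] at f2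
      have f3 := mul_le_mul_of_nonneg_left (h6.trans h8) hG1.le
      have f4 : E / |G| / u * |-(G * u ^ (1 - κ))| = E * u ^ (-κ) := by
        rw [abs_neg, abs_mul, abs_of_nonneg (Real.rpow_nonneg h0.le _), sub_eq_add_neg,
          Real.rpow_add h0, Real.rpow_one]
        field_simp
      rw [f4, hE]
      linarith

end ArithProg

/-! ### Conclusion -/

theorem theorem4
    (α : ℕ → ℝ) (hα : ∀ n : ℕ, 1 ≤ n → 0 ≤ α n)
    (h : ArithmeticFunction ℝ) (hmult : h.IsMultiplicative) (hnonneg : ∀ d : ℕ, 0 ≤ h d)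
    (L : ℝ → ℝ) (hL_smooth : ContDiffOn ℝ (⊤ : ℕ∞) L (Set.Ici 0))
    (hL_mono : MonotoneOn L (Set.Ici 0)) (hL_one : ∀ x : ℝ, 0 ≤ x → 1 ≤ L x)
    (hL_top : Tendsto L atTop atTop)
    (a : ℤ) (ha : a ≠ 0) (k : ℝ)
    (hyp1 : ArithProg.LevelHyp α h L a)
    (hyp2 : ArithProg.SizeHyp α L a)
    (hyp3 : ArithProg.PrimeHyp h k) :
    (∃ P : ℝ, Tendsto (fun N : ℕ => ArithProg.regularProd h k a N) atTop (𝓝 P)) ∧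
    ∃ (η : ℝ → ℝ) (x₀ : ℝ), Tendsto η atTop (𝓝 0) ∧
      ∀ A : ℝ, 0 < A → ∃ C : ℝ, ∀ x : ℝ, x₀ ≤ x → ∀ M : ℝ, 1 < M → M ≤ L x →
        |ArithProg.dyadicSum α h a x M
            - ArithProg.count α x / (2 * M) * ArithProg.mu h k a M|
          ≤ ArithProg.count α x / (2 * M) *
              (η M * |ArithProg.mu h k a M| + C / Real.log M ^ A) := by
  obtain ⟨Q, -, hQ, -⟩ := hyp3.twistAvg_asymp hmult hnonneg ha
  refine ⟨⟨Q, hQ⟩, ?_⟩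
  obtain ⟨δ, C₀, x₁, H⟩ := ArithProg.exists_equidistBound hα hL_one hL_top hyp1 hyp2 hyp3
  obtain ⟨ε, hε, E, hE, hev⟩ :=
    H.exists_abs_dyadicSum_sub_le hα hL_one hL_top hyp3 hmult hnonneg ha
  obtain ⟨η, hη, hmain⟩ := hyp3.exists_abs_dyadicMain_sub_mu_le hmult hnonneg ha
  obtain ⟨x₀, hx₀⟩ := hev.exists_forall_of_atTop
  refine ⟨η, x₀, hη, fun A hA => ?_⟩
  obtain ⟨C₁, hC₁⟩ := hmain A hA
  obtain ⟨C₂, hC₂, hlog⟩ := ArithProg.exists_rpow_neg_le_log hε hA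
  refine ⟨C₁ + E * C₂, fun x hx M hM hML => ?_⟩
  have hscale : 0 ≤ ArithProg.count α x / (2 * M) :=
    div_nonneg (ArithProg.count_nonneg hα x) (by linarith)
  have h1 := hx₀ x hx M hM hML
  have h2 := mul_le_mul_of_nonneg_left (hC₁ M hM) hscale
  have h3 := mul_le_mul_of_nonneg_left (mul_le_mul_of_nonneg_left (hlog M hM) hE.le) hscale
  calc _ = |(ArithProg.dyadicSum α h a x M
          - ArithProg.count α x / (2 * M) * ArithProg.dyadicMain h a M)
          + ArithProg.count α x / (2 * M) *
            (ArithProg.dyadicMain h a M - ArithProg.mu h k a M)| := by ring_nf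
    _ ≤ _ := abs_add_le _ _
    _ ≤ ArithProg.count α x / (2 * M) * (E * (C₂ / Real.log M ^ A))
        + ArithProg.count α x / (2 * M) *
          (η M * |ArithProg.mu h k a M| + C₁ / Real.log M ^ A) := by
      refine add_le_add (h1.trans h3) ?_
      rw [abs_mul, abs_of_nonneg hscale]
      exact h2
    _ = _ := by ring
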